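/- **Notation.** Let $\overline N(m,n)$ be the number of overpartitions of $n$ (partitions in which the first occurrence of each part size may be overlined) with rank $m$, where the rank is the largest part minus the number of parts. For $|u|=1$, $|q|<1$ put $\mathcal O(u;q):=1+\sum_{n\ge1}\sum_{m\in\mathbb Z}\overline N(m,n)u^mq^n$, and $\mathcal O\left(\frac ac;q\right):=\mathcal O(e^{2\pi i a/c};q)$. Let $0<a<c$ be coprime integers with $c>2$, let $k\ge1$, and let $h,h'$ be integers with $hh'\equiv-1\pmod k$; if $k$ is odd, $h'$ is chosen even. Let $w\in\mathbb C$ with $\mathrm{Re}(w)>0$ (powers of $w$ are principal), and $$z=\tfrac1k(h+iw),\quad z_1=\tfrac1k\left(h'+\tfrac iw\right),\quad q=e^{2\pi i z}=e^{\frac{2\pi i}{k}(h+iw)},\quad q_1=e^{2\pi i z_1}=e^{\frac{2\pi i}{k}\left(h'+\frac iw\right)}.$$ Fractional powers of $q_1$ mean $q_1^r=e^{2\pi i r z_1}$. Put $k_1=\frac{k}{(k,c)}$, $c_1=\frac{c}{(c,k)}$, let $0\le l<c_1$ with $l\equiv ak_1\pmod{c_1}$, and let $\widetilde k\in\{0,1\}$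 with $\widetilde k\equiv k\pmod 2$. Let $$\omega_{h,k}=\exp\Big(\pi i\sum_{\mu \bmod k}\left(\left(\tfrac\mu k\right)\right)\left(\left(\tfrac{h\mu}k\right)\right)\Big),\qquad ((x))=x-\lfloor x\rfloor-\tfrac12\ (x\notin\mathbb Z),\quad ((x))=0\ (x\in\mathbb Z),$$ and let $\eta(z)=q^{1/24}\prod_{n\ge1}(1-q^n)$. For $0<\frac bc<1$ let $s=s(b,c)=0,1,2$ according as $\frac bc\le\frac14$, $\frac14<\frac bc\le\frac34$, $\frac bc>\frac34$, and $t=t(b,c)=1,3$ according as $\frac bc<\frac12$, $\frac bc>\frac12$. For an integer $a$, with $q=e^{2\pi iz}$, $\mathrm{Im}(z)>0$, and $q^r=e^{2\pi i rz}$, define $$\mathcal U\left(\tfrac ac;q\right)=\sin\left(\tfrac{\pi a}c\right)\frac{\eta(z/2)}{\eta^2(z)}\sum_{n\in\mathbb Z}\frac{(1+q^n)q^{n^2+\frac n2}}{1-2q^n\cos\left(\frac{2\pi a}c\right)+q^{2n}},$$ $$\mathcal U(a,b,c;q)=\frac{\eta(z/2)}{\eta^2(z)}e^{\frac{\pi ia}c\left(\frac{4b}c-1-2s\right)}q^{\frac{sb}c+\frac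 b{2c}-\frac{b^2}{c^2}}\sum_{m\in\mathbb Z}\frac{q^{\frac m2(2m+1)+ms}}{1-e^{-\frac{2\pi ia}c}q^{m+\frac bc}},$$ $$\mathcal V(a,b,c;q)=\frac{\eta(z/2)}{\eta^2(z)}e^{\frac{\pi ia}c\left(\frac{4b}c-1-2s\right)}q^{\frac{sb}c+\frac b{2c}-\frac{b^2}{c^2}}\sum_{m\in\mathbb Z}\frac{q^{\frac m2(2m+1)+ms}\left(1+e^{-\frac{2\pi ia}c}q^{m+\frac bc}\right)}{1-e^{-\frac{2\pi ia}c}q^{m+\frac bc}},$$ $$\mathcal O(a,b,c;q)=\frac{\eta(2z)}{\eta^2(z)}e^{\frac{\pi ia}c\left(\frac{4b}c-1-t\right)}q^{\frac{tb}{2c}+\frac b{2c}-\frac{b^2}{c^2}}\sum_{m\in\mathbb Z}(-1)^m\frac{q^{\frac m2(2m+1)+\frac{mt}2}}{1-e^{-\frac{2\pi ia}c}q^{m+\frac bc}},$$ $$\mathcal V\left(\tfrac ac;q\right)=\frac{\eta(2z)}{\eta^2(z)}q^{\frac14}\sum_{m\in\mathbb Z}\frac{(-1)^mq^{m^2+m}\left(1+e^{-\frac{2\pi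 ia}c}q^{m+\frac12}\right)}{1-e^{-\frac{2\pi ia}c}q^{m+\frac12}}.$$ Finally, with $H_{a,c}(x)=\frac{e^x}{1-2\cos\left(\frac{2\pi a}c\right)e^x+e^{2x}}$, for $\nu\in\mathbb Z$ let $$I_{a,c,k,\nu}(w)=\int_{\mathbb R}e^{-\frac{2\pi wx^2}k}H_{a,c}\left(\tfrac{2\pi i\nu}k-\tfrac{2\pi wx}k-\tfrac{\widetilde k\pi i}{2k}\right)dx,$$ where, if the integrand has a pole on the real line (this is possible only at $x=0$), the principal value is taken. **Theorem 2.1.** The integrals $I_{a,c,k,\nu}(w)$ exist (in the above sense). For $k$ even put $$M_0=\frac{4\sin^2\left(\frac{\pi a}c\right)\omega_{h,k}^2}{\omega_{h,k/2}\,k}\,w^{\frac12}\sum_{\nu=0}^{k-1}(-1)^\nu e^{-\frac{2\pi ih'\nu^2}k}I_{a,c,k,\nu}(w),$$ and for $k$ odd put $$M_1=\frac{4\sqrt2\sin^2\left(\frac{\pi a}c\right)\omega_{h,k}^2}{\omega_{2h,k}\,k}\,w^{\frac12}\sum_{\nu=0}^{k-1}e^{-\frac{\pi ih'}k(2\nu^2-\nu)}I_{a,c,k,\nu}(w).$$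 Then the following hold. 1. If $c\mid k$ and $k$ is even, then $$\mathcal O\left(\tfrac ac;q\right)=-(-1)^{k_1}i\,e^{-\frac{2\pi ia^2h'k_1}c}\tan\left(\tfrac{\pi a}c\right)\cot\left(\tfrac{\pi ah'}c\right)\frac{\omega_{h,k}^2}{\omega_{h,k/2}}w^{-\frac12}\,\mathcal O\left(\tfrac{ah'}c;q_1\right)+M_0.$$ 2. If $c\mid k$ and $k$ is odd, then $$\mathcal O\left(\tfrac ac;q\right)=-\sqrt2\,i\,e^{\frac{\pi ih'}{8k}-\frac{2\pi ia^2h'k_1}c}\tan\left(\tfrac{\pi a}c\right)\frac{\omega_{h,k}^2}{\omega_{2h,k}}w^{-\frac12}\,\mathcal U\left(\tfrac{ah'}c;q_1\right)+M_1.$$ 3. If $c\nmid k$, $k$ is even and $c_1\ne2$, then $$\mathcal O\left(\tfrac ac;q\right)=2(-1)^{\frac{l-ak_1}{c_1}}e^{-\frac{2\pi ia^2h'k_1}{c_1c}}\tan\left(\tfrac{\pi a}c\right)\frac{\omega_{h,k}^2}{\omega_{h,k/2}}w^{-\frac12}\,\mathcal O\left(ah',\tfrac{lc}{c_1},c;q_1\right)+M_0.$$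 4. If $c\nmid k$, $k$ is even and $c_1=2$, then $$\mathcal O\left(\tfrac ac;q\right)=(-1)^{\frac{l-ak_1}{c_1}}e^{-\frac{\pi ia^2h'k_1}{c}}\tan\left(\tfrac{\pi a}c\right)\frac{\omega_{h,k}^2}{\omega_{h,k/2}}w^{-\frac12}\,\mathcal V\left(\tfrac{ah'}c;q_1\right)+M_0.$$ 5. If $c\nmid k$, $k$ is odd and $c_1\ne4$, then $$\mathcal O\left(\tfrac ac;q\right)=\sqrt2\,e^{\frac{\pi ih'}{8k}-\frac{2\pi ih'a^2k_1}{cc_1}}\tan\left(\tfrac{\pi a}c\right)\frac{\omega_{h,k}^2}{\omega_{2h,k}}w^{-\frac12}\,\mathcal U\left(ah',\tfrac{lc}{c_1},c;q_1\right)+M_1.$$ 6. If $c\nmid k$, $k$ is odd and $c_1=4$, then $$\mathcal O\left(\tfrac ac;q\right)=e^{\frac{\pi ih'}{8k}-\frac{2\pi ih'a^2k_1}{cc_1}}\tan\left(\tfrac{\pi a}c\right)\frac{\omega_{h,k}^2}{\sqrt2\,\omega_{2h,k}}w^{-\frac12}\,\mathcal V\left(ah',\tfrac{lc}{c_1},c;q_1\right)+M_1.$$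 -/

import Mathlib

open Complex MeasureTheory Filter Topology
open scoped Real

noncomputable section

namespace OverpartitionRank

/-- An overpartition of `n`: a partition of `n` together with the set of those part sizes
whose first occurrence is overlined. -/
structure Overpartition (n : ℕ) where
  /-- the underlying partition -/
  toPartition : n.Partition
  /-- the part sizes whose first occurrence is overlined -/
  overlined : Finset ℕ
  overlined_subset : overlined ⊆ toPartition.parts.toFinset

/-- Dyson's rank: the largest part minus the number of parts. -/
def Overpartition.rank {n : ℕ} (p : Overpartition n) : ℤ :=
  (p.toPartition.parts.sup : ℤ) - (Multiset.card p.toPartition.parts : ℤ)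

/-- `overN m n` is the number of overpartitions of `n` with rank `m`. -/
def overN (m : ℤ) (n : ℕ) : ℕ :=
  Nat.card {p : Overpartition n // p.rank = m}

/-- The rank generating function `𝒪(u; q) = 1 + ∑_{n ≥ 1} ∑_m N(m, n) u^m q^n`;
for each `n` only finitely many `m` contribute. -/
def rankGen (u q : ℂ) : ℂ :=
  1 + ∑' n : ℕ, (∑ᶠ m : ℤ, (overN m (n + 1) : ℂ) * u ^ m) * q ^ (n + 1)

/-- `q ^ r` for `q = e^{2 π i z}`, that is `e^{2 π i r z}`. -/
def qpow (z r : ℂ) : ℂ := cexp (2 * π * I * r * z)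

/-- `𝒪(a/c; q) = 𝒪(ζ_c^a; q)` with `ζ_c = e^{2 π i / c}` and `q = e^{2 π i z}`. -/
def rankO (a : ℤ) (c : ℕ) (z : ℂ) : ℂ :=
  rankGen (cexp (2 * π * I * a / c)) (cexp (2 * π * I * z))

/-- The sawtooth function `((x))`. -/
def sawtooth (x : ℝ) : ℝ := if Int.fract x = 0 then 0 else x - ⌊x⌋ - 1 / 2

/-- The multiplier `ω_{h,k}`. -/
def omega (h : ℤ) (k : ℕ) : ℂ :=
  cexp (π * I *
    ((∑ μ ∈ Finset.range k, sawtooth ((μ : ℝ) / k) * sawtooth ((h * μ : ℝ) / k) : ℝ) : ℂ))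

/-- `s(b,c)` for `0 < b/c < 1`: it is `0`, `1`, `2` according as `b/c ≤ 1/4`,
`1/4 < b/c ≤ 3/4`, `3/4 < b/c`. -/
def sIdx (b c : ℕ) : ℕ := if 4 * b ≤ c then 0 else if 4 * b ≤ 3 * c then 1 else 2

/-- `t(b,c)` for `0 < b/c < 1`, `b/c ≠ 1/2`: it is `1` if `b/c < 1/2` and `3` if `b/c > 1/2`. -/
def tIdx (b c : ℕ) : ℕ := if 2 * b < c then 1 else 3

/-- `𝒰(a/c; z)`. -/
def compU (a : ℤ) (c : ℕ) (z : ℂ) : ℂ :=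
  Complex.sin (π * a / c) * (ModularForm.eta (z / 2) / ModularForm.eta z ^ 2) *
    ∑' n : ℤ, (1 + qpow z n) * qpow z ((n : ℂ) ^ 2 + n / 2) /
      (1 - 2 * qpow z n * Complex.cos (2 * π * a / c) + qpow z (2 * n))

/-- `𝒰(a, b, c; z)`. -/
def compUabc (a : ℤ) (b c : ℕ) (z : ℂ) : ℂ :=
  ModularForm.eta (z / 2) / ModularForm.eta z ^ 2 *
    cexp (π * I * a / c * (4 * b / c - 1 - 2 * sIdx b c)) *
    qpow z (sIdx b c * b / c + b / (2 * c) - (b : ℂ) ^ 2 / (c : ℂ) ^ 2) *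
    ∑' m : ℤ, qpow z ((m : ℂ) / 2 * (2 * m + 1) + m * sIdx b c) /
      (1 - cexp (-(2 * π * I * a / c)) * qpow z (m + b / c))

/-- `𝒱(a, b, c; z)`. -/
def compVabc (a : ℤ) (b c : ℕ) (z : ℂ) : ℂ :=
  ModularForm.eta (z / 2) / ModularForm.eta z ^ 2 *
    cexp (π * I * a / c * (4 * b / c - 1 - 2 * sIdx b c)) *
    qpow z (sIdx b c * b / c + b / (2 * c) - (b : ℂ) ^ 2 / (c : ℂ) ^ 2) *
    ∑' m : ℤ, qpow z ((m : ℂ) / 2 * (2 * m + 1) + m * sIdx b c) *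
        (1 + cexp (-(2 * π * I * a / c)) * qpow z (m + b / c)) /
      (1 - cexp (-(2 * π * I * a / c)) * qpow z (m + b / c))

/-- `𝒪(a, b, c; z)`. -/
def compOabc (a : ℤ) (b c : ℕ) (z : ℂ) : ℂ :=
  ModularForm.eta (2 * z) / ModularForm.eta z ^ 2 *
    cexp (π * I * a / c * (4 * b / c - 1 - tIdx b c)) *
    qpow z (tIdx b c * b / (2 * c) + b / (2 * c) - (b : ℂ) ^ 2 / (c : ℂ) ^ 2) *
    ∑' m : ℤ, (-1 : ℂ) ^ m * qpow z ((m : ℂ) / 2 * (2 * m + 1) + m * tIdx b c / 2) /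
      (1 - cexp (-(2 * π * I * a / c)) * qpow z (m + b / c))

/-- `𝒱(a/c; z)`. -/
def compV (a : ℤ) (c : ℕ) (z : ℂ) : ℂ :=
  ModularForm.eta (2 * z) / ModularForm.eta z ^ 2 * qpow z (1 / 4) *
    ∑' m : ℤ, (-1 : ℂ) ^ m * qpow z ((m : ℂ) ^ 2 + m) *
        (1 + cexp (-(2 * π * I * a / c)) * qpow z (m + 1 / 2)) /
      (1 - cexp (-(2 * π * I * a / c)) * qpow z (m + 1 / 2))

/-- `H_{a,c}(x) = e^x / (1 - 2 cos(2 π a / c) e^x + e^{2x})`. -/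
def fnH (a c : ℕ) (x : ℂ) : ℂ :=
  cexp x / (1 - 2 * Complex.cos (2 * π * a / c) * cexp x + cexp (2 * x))

/-- The integrand of the Mordell type integral `I_{a,c,k,ν}(w)`; here `k % 2` is the number that
is `0` for even and `1` for odd `k`. -/
def mordellIntegrand (a c k : ℕ) (ν : ℤ) (w : ℂ) (x : ℝ) : ℂ :=
  cexp (-(2 * π * w * (x : ℂ) ^ 2 / k)) *
    fnH a c (2 * π * I * ν / k - 2 * π * w * x / k - ((k % 2 : ℕ) : ℂ) * π * I / (2 * k))

/-- The Mordell type integral `I_{a,c,k,ν}(w)`, as a principal value at `x = 0`, the only real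
point at which the integrand can have a pole (if there is none, this is the usual integral). -/
def mordellI (a c k : ℕ) (ν : ℤ) (w : ℂ) : ℂ :=
  limUnder (𝓝[>] (0 : ℝ)) fun ε => ∫ x in {x : ℝ | ε < |x|}, mordellIntegrand a c k ν w x

end OverpartitionRank

end

/-!
Write `α = a / c`, and let `u = e^{2π i α}` throughout.

**The rank generating function as a cotangent sum.** Sorting overpartitions by their largest part
turns `𝒪(u; q)` into a basic hypergeometric series (`rankGen_eq`), which the Rogers–Fine identity
(`hasSum_finePre`) makes symmetric in `u` and `u⁻¹`. Partial fractions in `u + u⁻¹`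
(`rankGen_eq_tsum_quadFactor`) and Gauss's identity `∏ (1 + q^n) / (1 - q^n) = (∑ (-1)^n q^{n²})⁻¹`
(`fineSum_mul_altTheta`) then give
`𝒪(u; q) = tan (π α) · η(2z) / η(z)² · ∑ (-1)^n q^{n²} cot π(α - n z)`
(`rankO_eq_fineSum_mul`, `fineSum_eq_eta`). The two factors are transformed separately.

**The eta quotient.** The transformation of `η` at the cusp `h / k` (`etaCusp_inv`) is proved along
the Euclidean algorithm; the multipliers match by the reciprocity law for Dedekind sums
(`dedekindSum_add_dedekindSum`). It produces `ω_{h,k}² / ω_{h,k/2}` or `ω_{h,k}² / ω_{2h,k}`.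

**The cotangent sum.** The sum is split into classes modulo `k`, and Poisson summation is applied to
each of them (`tsum_cotGauss_eq`). This leaves integrals of a Gaussian, with a linear phase of
frequency `r - κ`, against a cotangent. Each line of integration is moved to the saddle point of the
Gaussian (`integral_cotGauss_eq`). The integrals over the shifted lines depend on `r` only through a
Gaussian factor, so that they combine to a theta series times finitely many Mordell type integrals
(`sum_saddleTerm`). The theta series is the reciprocal of the transformed eta quotient, which is why
it is absent from the result. The residue of a given pole is picked up at all frequencies beyond
twice its position; the sum over these frequencies is a geometric series (`tsum_resTerm`), and the
sum over the poles is an Appell–Lerch sum in `q₁` (`tsum_resSum`). Which frequencies count is decided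
by the integer part of `2 k α + κ`: this is the origin of the shifts `s(b, c)` and `t(b, c)`.

**Exceptional positions.** The argument needs `α` generic: no pole on the real line or on a shifted
line. Both sides have one-sided limits as `α` tends to `a / c`, and `tsum_cotTerm_eq_mean` takes
their mean. The mean of the integrals along two lines on either side of a pole is the principal value
(`tendsto_principalValue`, `mordellI_eq`). If `2 k a / c + κ` is an integer, the two Appell–Lerch sums
differ in one frequency, and their sum has the numerator `1 + X` over `1 - X` (`tsum_resSum_add`):
this is the origin of `𝒱` and, when `c` divides the even number `k`, of the cotangent sum that leads
back to `𝒪`.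
-/

noncomputable section

namespace OverpartitionRank

/-! ### Integrals along horizontal lines -/

lemma norm_le_div_one_add_sq_of_continuous {f : ℝ → ℂ} (hf : Continuous f)
    (hd : ∃ B R : ℝ, ∀ x : ℝ, R ≤ |x| → ‖f x‖ ≤ B / (1 + x ^ 2)) :
    ∃ B : ℝ, ∀ x : ℝ, ‖f x‖ ≤ B / (1 + x ^ 2) := by
  obtain ⟨B, R, h⟩ := hd
  have hc : ContinuousOn (fun x : ℝ => ‖f x‖ * (1 + x ^ 2)) (Set.Icc (-R) R) := by fun_prop
  obtain ⟨B', hB'⟩ := isCompact_Icc.exists_bound_of_continuousOn hc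
  refine ⟨max B B', fun x => ?_⟩
  have hx : 0 < 1 + x ^ 2 := by positivity
  rw [le_div_iff₀ hx]
  rcases le_total R |x| with h1 | h1
  · exact ((le_div_iff₀ hx).1 (h x h1)).trans (le_max_left _ _)
  · refine (le_trans ?_ (hB' x (abs_le.1 h1))).trans (le_max_right _ _)
    exact le_abs_self _

lemma integrable_of_continuous_of_decay {f : ℝ → ℂ} (hf : Continuous f)
    (hd : ∃ B R : ℝ, ∀ x : ℝ, R ≤ |x| → ‖f x‖ ≤ B / (1 + x ^ 2)) : Integrable f := by
  obtain ⟨B, h⟩ := norm_le_div_one_add_sq_of_continuous hf hd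
  refine Integrable.mono' (integrable_inv_one_add_sq.const_mul B) hf.aestronglyMeasurable
    (Eventually.of_forall fun x => ?_)
  simpa [div_eq_mul_inv] using h x

/-- Quadratic decay of `f` towards both ends of the strip `a ≤ im z ≤ b`. -/
def StripDecay (f : ℂ → ℂ) (a b : ℝ) : Prop :=
  ∃ B R : ℝ, ∀ z : ℂ, a ≤ z.im → z.im ≤ b → R ≤ |z.re| → ‖f z‖ ≤ B / (1 + z.re ^ 2)

lemma StripDecay.line {f : ℂ → ℂ} {a b : ℝ} (h : StripDecay f a b) {y : ℝ} (ha : a ≤ y)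
    (hb : y ≤ b) : ∃ B R : ℝ, ∀ x : ℝ, R ≤ |x| → ‖f (x + y * I)‖ ≤ B / (1 + x ^ 2) := by
  obtain ⟨B, R, h⟩ := h
  refine ⟨B, R, fun x hx => ?_⟩
  simpa using h (x + y * I) (by simpa) (by simpa) (by simpa)

lemma StripDecay.add {f g : ℂ → ℂ} {a b : ℝ} (hf : StripDecay f a b) (hg : StripDecay g a b) :
    StripDecay (fun z => f z + g z) a b := by
  obtain ⟨B, R, h⟩ := hf
  obtain ⟨B', R', h'⟩ := hg
  refine ⟨B + B', max R R', fun z h1 h2 h3 => (norm_add_le _ _).trans ?_⟩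
  rw [add_div]
  exact add_le_add (h z h1 h2 ((le_max_left _ _).trans h3))
    (h' z h1 h2 ((le_max_right _ _).trans h3))

lemma StripDecay.const_mul {f : ℂ → ℂ} {a b : ℝ} (hf : StripDecay f a b) (c : ℂ) :
    StripDecay (fun z => c * f z) a b := by
  obtain ⟨B, R, h⟩ := hf
  refine ⟨‖c‖ * B, R, fun z h1 h2 h3 => ?_⟩
  rw [norm_mul, mul_div_assoc]
  exact mul_le_mul_of_nonneg_left (h z h1 h2 h3) (norm_nonneg _)

lemma StripDecay.congr {f g : ℂ → ℂ} {a b : ℝ} (hf : StripDecay f a b) (R' : ℝ)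
    (hfg : ∀ z : ℂ, R' ≤ |z.re| → g z = f z) : StripDecay g a b := by
  obtain ⟨B, R, h⟩ := hf
  refine ⟨B, max R R', fun z h1 h2 h3 => ?_⟩
  rw [hfg z ((le_max_right _ _).trans h3)]
  exact h z h1 h2 ((le_max_left _ _).trans h3)

lemma StripDecay.mono {f : ℂ → ℂ} {a b a' b' : ℝ} (hf : StripDecay f a b) (ha : a ≤ a')
    (hb : b' ≤ b) : StripDecay f a' b' := by
  obtain ⟨B, R, h⟩ := hf
  exact ⟨B, R, fun z h1 h2 h3 => h z (ha.trans h1) (h2.trans hb) h3⟩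

lemma integrable_line {f : ℂ → ℂ} {a b y : ℝ} (ha : a ≤ y) (hb : y ≤ b)
    (hd : ∀ z : ℂ, z.im = y → DifferentiableAt ℂ f z) (hdec : StripDecay f a b) :
    Integrable fun x : ℝ => f (x + y * I) := by
  refine integrable_of_continuous_of_decay ?_ (hdec.line ha hb)
  refine continuous_iff_continuousAt.2 fun x => ?_
  have h1 : ContinuousAt f ((fun x : ℝ => (x : ℂ) + y * I) x) :=
    (hd _ (by simp)).continuousAt
  exact ContinuousAt.comp (f := fun x : ℝ => (x : ℂ) + y * I) h1 (by fun_prop)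

/-- Shifting the line of integration through a strip without poles. -/
lemma integral_line_eq_of_differentiable {f : ℂ → ℂ} {a b : ℝ} (hab : a ≤ b)
    (hd : ∀ z : ℂ, a ≤ z.im → z.im ≤ b → DifferentiableAt ℂ f z) (hdec : StripDecay f a b) :
    ∫ x : ℝ, f (x + a * I) = ∫ x : ℝ, f (x + b * I) := by
  have hia := integrable_line le_rfl hab (fun z hz => hd z hz.ge (hz.le.trans hab)) hdec
  have hib := integrable_line hab le_rfl (fun z hz => hd z (hab.trans hz.ge) hz.le) hdec
  have ta := intervalIntegral_tendsto_integral hia tendsto_neg_atTop_atBot tendsto_id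
  have tb := intervalIntegral_tendsto_integral hib tendsto_neg_atTop_atBot tendsto_id
  have hrect : ∀ T : ℝ, 0 ≤ T → (∫ x in (-T)..T, f (x + a * I)) - (∫ x in (-T)..T, f (x + b * I)) =
      I * (∫ y in a..b, f ((-T : ℝ) + y * I)) - I * ∫ y in a..b, f (T + y * I) := by
    intro T hT
    have := integral_boundary_rect_eq_zero_of_differentiableOn f ⟨-T, a⟩ ⟨T, b⟩ (by
      intro z hz
      have hz2 := hz.2
      simp only [Set.uIcc_of_le hab, Set.mem_preimage, Set.mem_Icc] at hz2
      exact (hd z hz2.1 hz2.2).differentiableWithinAt)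
    simp only [smul_eq_mul] at this
    linear_combination this
  obtain ⟨B, R, hB⟩ := hdec
  have hside : ∀ s : ℝ → ℝ, (∀ T, |s T| = |T|) →
      Tendsto (fun T : ℝ => ∫ y in a..b, f ((s T : ℝ) + y * I)) atTop (𝓝 0) := by
    intro s hs
    have hlim : Tendsto (fun T : ℝ => B * (1 + T ^ 2)⁻¹ * |b - a|) atTop (𝓝 0) := by
      have : Tendsto (fun T : ℝ => 1 + T ^ 2) atTop atTop :=
        tendsto_atTop_add_const_left _ _ (tendsto_pow_atTop two_ne_zero)
      simpa using (this.inv_tendsto_atTop.const_mul B).mul_const |b - a|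
    refine squeeze_zero_norm' ?_ hlim
    filter_upwards [eventually_ge_atTop R, eventually_ge_atTop 0] with T hT hT0
    refine intervalIntegral.norm_integral_le_of_norm_le_const fun y hy => ?_
    rw [Set.uIoc_of_le hab] at hy
    have := hB ((s T : ℝ) + y * I) (by simpa using hy.1.le) (by simpa using hy.2)
      (by simpa [hs, abs_of_nonneg hT0] using hT)
    have h2 : (s T) ^ 2 = T ^ 2 := by rw [← sq_abs, hs, sq_abs]
    simpa [div_eq_mul_inv, h2] using this
  have h1 := hside (fun T => -T) (fun T => abs_neg T)
  have h2 := hside (fun T => T) (fun T => rfl)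
  have h3 := (h1.const_mul I).sub (h2.const_mul I)
  have h4 := (ta.sub tb).congr' (by
    filter_upwards [eventually_ge_atTop 0] with T hT
    exact hrect T hT)
  have h5 := tendsto_nhds_unique h4 h3
  simp only [mul_zero, sub_zero] at h5
  exact sub_eq_zero.1 h5

/-- A function with a simple pole at `p` minus a multiple of a function with the same simple pole
extends holomorphically over `p`. -/
lemma exists_differentiableAt_extension {f φ : ℂ → ℂ} {p c : ℂ}
    (hf : ∀ᶠ z in 𝓝[≠] p, DifferentiableAt ℂ f z)
    (hφ : ∀ᶠ z in 𝓝[≠] p, DifferentiableAt ℂ φ z)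
    (hres : Tendsto (fun z => (z - p) * f z) (𝓝[≠] p) (𝓝 c))
    (hφres : Tendsto (fun z => (z - p) * φ z) (𝓝[≠] p) (𝓝 1)) :
    ∃ g : ℂ → ℂ, (∀ z, z ≠ p → g z = f z - c * φ z) ∧ DifferentiableAt ℂ g p := by
  set F : ℂ → ℂ := fun z => f z - c * φ z with hF
  refine ⟨Function.update F p ((𝓝[≠] p).limUnder F),
    fun z hz => by rw [Function.update_of_ne hz], ?_⟩
  obtain ⟨s, hs, hs'⟩ := (eventually_nhdsWithin_iff.1 (hf.and hφ)).exists_mem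
  have key := differentiableOn_update_limUnder_of_isLittleO (f := F) (c := p) hs
    (fun z hz => ((hs' z hz.1 hz.2).1.sub ((hs' z hz.1 hz.2).2.const_mul c)).differentiableWithinAt)
    (by
      rw [Asymptotics.isLittleO_iff_tendsto']
      · have h1 : Tendsto (fun z => z - p) (𝓝[≠] p) (𝓝 0) := by
          have : Tendsto (fun z => z - p) (𝓝 p) (𝓝 (p - p)) := by
            exact (continuous_id.sub continuous_const).tendsto p
          rw [sub_self] at this
          exact this.mono_left nhdsWithin_le_nhds
        have h2 := (hres.sub (hφres.const_mul c)).sub (h1.mul_const (F p))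
        simp only [mul_one, sub_self, zero_mul] at h2
        refine h2.congr fun z => ?_
        simp only [hF, div_inv_eq_mul]
        ring
      · filter_upwards [self_mem_nhdsWithin] with z hz h0
        exact absurd (sub_eq_zero.1 (inv_eq_zero.1 h0)) hz)
  exact key.differentiableAt hs

lemma integral_im_part_lorentz {A : ℝ} (hA : 0 < A) : ∫ u : ℝ, A / (u ^ 2 + A ^ 2) = π := by
  have h2 : ∫ x : ℝ, (1 + (x / A) ^ 2)⁻¹ = |A| • ∫ x : ℝ, (1 + x ^ 2)⁻¹ :=
    Measure.integral_comp_div (fun x : ℝ => (1 + x ^ 2)⁻¹) A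
  rw [integral_univ_inv_one_add_sq, abs_of_pos hA, smul_eq_mul] at h2
  have h3 : ∀ u : ℝ, A / (u ^ 2 + A ^ 2) = A⁻¹ * (1 + (u / A) ^ 2)⁻¹ := by
    intro u
    have : u ^ 2 + A ^ 2 ≠ 0 := by positivity
    field_simp
    rw [add_comm]
  simp_rw [h3]
  rw [integral_const_mul, h2]
  field_simp

lemma integrable_lorentz {A : ℝ} (hA : 0 < A) : Integrable fun u : ℝ => A / (u ^ 2 + A ^ 2) := by
  by_contra h
  have := integral_undef h
  rw [integral_im_part_lorentz hA] at this
  exact Real.pi_ne_zero this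

/-- The function `1 / (z - p) - 1 / (z - p')`, where `p'` is the reflection of `p` in the line
`im z = a`. -/
def poleKernel (p : ℂ) (a : ℝ) (z : ℂ) : ℂ :=
  1 / (z - p) - 1 / (z - (p - 2 * (p.im - a : ℝ) * I))

lemma differentiableAt_poleKernel {p z : ℂ} {a : ℝ} (ha : a < p.im) (hz : a ≤ z.im) (hzp : z ≠ p) :
    DifferentiableAt ℂ (poleKernel p a) z := by
  have h2 : z - (p - 2 * (p.im - a : ℝ) * I) ≠ 0 := by
    intro h
    have := congrArg Complex.im h
    simp at this
    linarith
  have h1 : z - p ≠ 0 := sub_ne_zero.2 hzp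
  unfold poleKernel
  fun_prop (disch := assumption)

lemma tendsto_poleKernel {p : ℂ} {a : ℝ} (ha : a < p.im) :
    Tendsto (fun z => (z - p) * poleKernel p a z) (𝓝[≠] p) (𝓝 1) := by
  have hp' : p - (p - 2 * (p.im - a : ℝ) * I) ≠ 0 := by
    intro h
    have := congrArg Complex.im h
    simp at this
    linarith
  have h1 : ContinuousAt (fun z => 1 - (z - p) / (z - (p - 2 * (p.im - a : ℝ) * I))) p := by
    fun_prop (disch := assumption)
  have h2 : Tendsto (fun z => 1 - (z - p) / (z - (p - 2 * (p.im - a : ℝ) * I))) (𝓝[≠] p) (𝓝 1) := by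
    have := h1.tendsto.mono_left (nhdsWithin_le_nhds (s := {p}ᶜ))
    simpa using this
  refine h2.congr' ?_
  filter_upwards [self_mem_nhdsWithin] with z hz
  have : z - p ≠ 0 := sub_ne_zero.2 hz
  unfold poleKernel
  field_simp

lemma stripDecay_poleKernel (p : ℂ) (a c d : ℝ) : StripDecay (poleKernel p a) c d := by
  set p' := p - 2 * (p.im - a : ℝ) * I with hp'
  have hre : p'.re = p.re := by simp [hp']
  refine ⟨8 * ‖p - p'‖, 2 * |p.re| + 1, fun z _ _ hz => ?_⟩
  have h0 : |z.re| / 2 ≤ |z.re - p.re| := by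
    have := abs_sub_abs_le_abs_sub z.re p.re
    linarith [abs_nonneg p.re]
  have hz1 : 1 ≤ |z.re| := by linarith [abs_nonneg p.re]
  have h1 : |z.re| / 2 ≤ ‖z - p‖ := h0.trans (by simpa using Complex.abs_re_le_norm (z - p))
  have h2 : |z.re| / 2 ≤ ‖z - p'‖ :=
    h0.trans (by simpa [hre] using Complex.abs_re_le_norm (z - p'))
  have n1 : z - p ≠ 0 := norm_pos_iff.1 (by linarith)
  have n2 : z - p' ≠ 0 := norm_pos_iff.1 (by linarith)
  have e : poleKernel p a z = (p - p') / ((z - p) * (z - p')) := by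
    unfold poleKernel
    rw [← hp', div_sub_div _ _ n1 n2]
    ring
  rw [e, norm_div, norm_mul]
  have h3 : |z.re| / 2 * (|z.re| / 2) ≤ ‖z - p‖ * ‖z - p'‖ :=
    mul_le_mul h1 h2 (by positivity) (norm_nonneg _)
  have h4 : (1 + z.re ^ 2) / 8 ≤ ‖z - p‖ * ‖z - p'‖ := by
    refine le_trans ?_ h3
    have : 1 ≤ |z.re| * |z.re| := by nlinarith
    rw [← sq_abs]
    nlinarith
  rw [div_le_div_iff₀ (lt_of_lt_of_le (by positivity) h4) (by positivity)]
  nlinarith [norm_nonneg (p - p')]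

lemma integral_poleKernel_below {p : ℂ} {a : ℝ} (ha : a < p.im) :
    ∫ x : ℝ, poleKernel p a (x + a * I) = 2 * π * I := by
  have hA : 0 < p.im - a := by linarith
  have h : ∀ x : ℝ, poleKernel p a (x + a * I) =
      ((fun u : ℝ => 2 * I * (((p.im - a) / (u ^ 2 + (p.im - a) ^ 2) : ℝ) : ℂ)) (x - p.re)) := by
    intro x
    set u : ℝ := x - p.re
    set A : ℝ := p.im - a
    have e1 : (x : ℂ) + a * I - p = u - A * I := by
      apply Complex.ext <;> simp [u, A]
    have e2 : (x : ℂ) + a * I - (p - 2 * (A : ℝ) * I) = u + A * I := by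
      apply Complex.ext <;> simp [u, A]
      ring
    have n1 : (u : ℂ) - A * I ≠ 0 := by
      intro h; have := congrArg Complex.im h; simp at this; exact hA.ne' this
    have n2 : (u : ℂ) + A * I ≠ 0 := by
      intro h; have := congrArg Complex.im h; simp at this; exact hA.ne' this
    have n3 : (u : ℂ) ^ 2 + A ^ 2 ≠ 0 := by
      have : (u : ℂ) ^ 2 + A ^ 2 = (u - A * I) * (u + A * I) := by
        ring_nf; rw [I_sq]; ring
      rw [this]; exact mul_ne_zero n1 n2
    unfold poleKernel
    rw [e1, e2]
    push_cast
    rw [div_sub_div _ _ n1 n2, mul_div_assoc', div_eq_div_iff (mul_ne_zero n1 n2) n3]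
    ring_nf
    rw [show I ^ 3 = I ^ 2 * I by ring, I_sq]
    ring
  simp_rw [h]
  rw [integral_sub_right_eq_self (fun u : ℝ =>
    2 * I * (((p.im - a) / (u ^ 2 + (p.im - a) ^ 2) : ℝ) : ℂ)) p.re, integral_const_mul,
    integral_complex_ofReal, integral_im_part_lorentz hA]
  ring

lemma integral_poleKernel_above {p : ℂ} {a b : ℝ} (ha : a < p.im) (hb : p.im < b) :
    ∫ x : ℝ, poleKernel p a (x + b * I) = 0 := by
  have hA : 0 < b - p.im := by linarith
  have hB : 0 < b + p.im - 2 * a := by linarith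
  set A : ℝ := b - p.im
  set B : ℝ := b + p.im - 2 * a
  set g : ℝ → ℂ := fun u => 1 / (u + A * I) - 1 / (u + B * I) with hg
  have h : ∀ x : ℝ, poleKernel p a (x + b * I) = g (x - p.re) := by
    intro x
    have e1 : (x : ℂ) + b * I - p = ((x - p.re : ℝ) : ℂ) + A * I := by
      apply Complex.ext <;> simp [A]
    have e2 : (x : ℂ) + b * I - (p - 2 * (p.im - a : ℝ) * I) = ((x - p.re : ℝ) : ℂ) + B * I := by
      apply Complex.ext <;> simp [B]
      ring
    unfold poleKernel
    rw [e1, e2]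
  have hint : Integrable fun x : ℝ => poleKernel p a (x + b * I) := by
    refine integrable_line (a := b) (b := b) le_rfl le_rfl (fun z hz => ?_)
      (stripDecay_poleKernel _ _ _ _)
    exact differentiableAt_poleKernel ha (by linarith) (fun h => by rw [h] at hz; linarith)
  have hgi : Integrable g := by
    have := hint.comp_add_right p.re
    simp_rw [h] at this
    simpa using this
  simp_rw [h]
  rw [integral_sub_right_eq_self g p.re]
  have h2 : ∫ u, g u + g (-u) = 2 * ∫ u, g u := by
    rw [integral_add hgi hgi.comp_neg, integral_neg_eq_self]
    ring
  have key : ∀ {A : ℝ}, 0 < A → ∀ u : ℝ, 1 / ((u : ℂ) + A * I) + 1 / (((-u : ℝ) : ℂ) + A * I) =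
      -2 * I * ((A / (u ^ 2 + A ^ 2) : ℝ) : ℂ) := by
    intro A hA u
    have n1 : (u : ℂ) + A * I ≠ 0 := by
      intro h; have := congrArg Complex.im h; simp at this; exact hA.ne' this
    have n2 : ((-u : ℝ) : ℂ) + A * I ≠ 0 := by
      intro h; have := congrArg Complex.im h; simp at this; exact hA.ne' this
    have n3 : (u : ℂ) ^ 2 + A ^ 2 ≠ 0 := by
      have : (u : ℂ) ^ 2 + A ^ 2 = -((u + A * I) * (((-u : ℝ) : ℂ) + A * I)) := by
        push_cast
        ring_nf; rw [I_sq]; ring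
      rw [this]; exact neg_ne_zero.2 (mul_ne_zero n1 n2)
    rw [div_add_div _ _ n1 n2]
    push_cast at n2 ⊢
    rw [mul_div_assoc', div_eq_div_iff (mul_ne_zero n1 n2) n3]
    ring_nf
    rw [show I ^ 3 = I ^ 2 * I by ring, I_sq]
    ring
  have h3 : ∀ u, g u + g (-u) = -2 * I * ((A / (u ^ 2 + A ^ 2) : ℝ) : ℂ) -
      -2 * I * ((B / (u ^ 2 + B ^ 2) : ℝ) : ℂ) := by
    intro u
    rw [← key hA u, ← key hB u]
    simp only [hg]
    ring
  simp_rw [h3] at h2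
  rw [integral_sub ((integrable_lorentz hA).ofReal.const_mul _)
    ((integrable_lorentz hB).ofReal.const_mul _), integral_const_mul, integral_const_mul,
    integral_complex_ofReal, integral_complex_ofReal, integral_im_part_lorentz hA, integral_im_part_lorentz hB,
    sub_self] at h2
  simpa using h2.symm

/-- The residue theorem for a horizontal strip, for functions with finitely many poles, all of them
simple. -/
theorem integral_line_sub_integral_line {ι : Type*} [DecidableEq ι] {a b : ℝ} (hab : a ≤ b)
    (S : Finset ι) (p c : ι → ℂ) (hpS : ∀ i ∈ S, a < (p i).im ∧ (p i).im < b) (hinj : Set.InjOn p S)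
    {f : ℂ → ℂ}
    (hd : ∀ z : ℂ, a ≤ z.im → z.im ≤ b → (∀ i ∈ S, z ≠ p i) → DifferentiableAt ℂ f z)
    (hres : ∀ i ∈ S, Tendsto (fun z => (z - p i) * f z) (𝓝[≠] p i) (𝓝 (c i)))
    (hdec : StripDecay f a b) :
    (∫ x : ℝ, f (x + a * I)) - ∫ x : ℝ, f (x + b * I) = 2 * π * I * ∑ i ∈ S, c i := by
  induction S using Finset.induction_on generalizing f with
  | empty =>
    simpa [sub_eq_zero] using
      integral_line_eq_of_differentiable hab (fun z h1 h2 => hd z h1 h2 (by simp)) hdec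
  | insert i S hi ih =>
    have hpi := hpS i (Finset.mem_insert_self i S)
    have hne : ∀ j ∈ S, p j ≠ p i := fun j hj h => by
      have := hinj (Finset.mem_insert_of_mem hj) (Finset.mem_insert_self i S) h
      exact hi (this ▸ hj)
    -- away from the finitely many other poles, `f` is differentiable near `p i`
    have hfnear : ∀ᶠ z in 𝓝[≠] p i, DifferentiableAt ℂ f z := by
      have e1 : ∀ᶠ z in 𝓝 (p i), a < z.im ∧ z.im < b :=
        (continuous_im.tendsto (p i)).eventually (Ioo_mem_nhds hpi.1 hpi.2)
      have e2 : ∀ᶠ z in 𝓝 (p i), ∀ j ∈ S, z ≠ p j := by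
        rw [Filter.eventually_all_finset]
        exact fun j hj => isOpen_ne.mem_nhds (hne j hj).symm
      filter_upwards [nhdsWithin_le_nhds e1, nhdsWithin_le_nhds e2, self_mem_nhdsWithin]
        with z h1 h2 h3
      refine hd z h1.1.le h1.2.le fun j hj => ?_
      rcases Finset.mem_insert.1 hj with rfl | hj
      · exact h3
      · exact h2 j hj
    have hφnear : ∀ᶠ z in 𝓝[≠] p i, DifferentiableAt ℂ (poleKernel (p i) a) z := by
      have e1 : ∀ᶠ z in 𝓝 (p i), a < z.im ∧ z.im < b :=
        (continuous_im.tendsto (p i)).eventually (Ioo_mem_nhds hpi.1 hpi.2)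
      filter_upwards [nhdsWithin_le_nhds e1, self_mem_nhdsWithin] with z h1 h3
      exact differentiableAt_poleKernel hpi.1 h1.1.le h3
    obtain ⟨g, hg, hgd⟩ := exists_differentiableAt_extension hfnear hφnear
      (hres i (Finset.mem_insert_self i S)) (tendsto_poleKernel hpi.1)
    have hgeq : ∀ z, z ≠ p i → g =ᶠ[𝓝 z] fun z => f z - c i * poleKernel (p i) a z := by
      intro z hz
      filter_upwards [isOpen_ne.mem_nhds hz] with y hy using hg y hy
    have hgdec : StripDecay g a b := by
      have h1 := hdec.add ((stripDecay_poleKernel (p i) a a b).const_mul (-c i))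
      refine h1.congr (|(p i).re| + 1) fun z hz => ?_
      rw [hg z (fun h => by rw [h] at hz; linarith)]
      ring
    have hgd' : ∀ z : ℂ, a ≤ z.im → z.im ≤ b → (∀ j ∈ S, z ≠ p j) → DifferentiableAt ℂ g z := by
      intro z h1 h2 h3
      by_cases hz : z = p i
      · rw [hz]; exact hgd
      · refine DifferentiableAt.congr_of_eventuallyEq ?_ (hgeq z hz)
        refine (hd z h1 h2 fun j hj => ?_).sub
          ((differentiableAt_poleKernel hpi.1 h1 hz).const_mul _)
        rcases Finset.mem_insert.1 hj with rfl | hj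
        · exact hz
        · exact h3 j hj
    have hgres : ∀ j ∈ S, Tendsto (fun z => (z - p j) * g z) (𝓝[≠] p j) (𝓝 (c j)) := by
      intro j hj
      have h1 := hres j (Finset.mem_insert_of_mem hj)
      have h2 : Tendsto (fun z => (z - p j) * (c i * poleKernel (p i) a z)) (𝓝[≠] p j) (𝓝 0) := by
        have hpj := hpS j (Finset.mem_insert_of_mem hj)
        have : ContinuousAt (fun z => (z - p j) * (c i * poleKernel (p i) a z)) (p j) :=
          (continuousAt_id.sub continuousAt_const).mul (continuousAt_const.mul
            (differentiableAt_poleKernel hpi.1 hpj.1.le (hne j hj)).continuousAt)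
        have h3 := this.tendsto.mono_left (nhdsWithin_le_nhds (s := {p j}ᶜ))
        simpa using h3
      have h3 := h1.sub h2
      rw [sub_zero] at h3
      refine h3.congr' ?_
      filter_upwards [nhdsWithin_le_nhds (hgeq (p j) (hne j hj))] with z hz
      rw [hz]
      ring
    have key := ih (fun j hj => hpS j (Finset.mem_insert_of_mem hj))
      (hinj.mono (by intro j hj; exact Finset.mem_insert_of_mem hj)) hgd' hgres hgdec
    have hline : ∀ y : ℝ, a ≤ y → y ≤ b → y ≠ (p i).im → (∀ j ∈ S, y ≠ (p j).im) →
        ∫ x : ℝ, g (x + y * I) = (∫ x : ℝ, f (x + y * I)) -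
          c i * ∫ x : ℝ, poleKernel (p i) a (x + y * I) := by
      intro y hya hyb hyi hyj
      have hfi : Integrable fun x : ℝ => f (x + y * I) :=
        integrable_line hya hyb (fun z hz => hd z (hz ▸ hya) (hz ▸ hyb) (fun j hj h => by
          rcases Finset.mem_insert.1 hj with rfl | hj
          · exact hyi (by rw [← hz, h])
          · exact hyj j hj (by rw [← hz, h]))) hdec
      have hpi' : Integrable fun x : ℝ => poleKernel (p i) a (x + y * I) :=
        integrable_line hya hyb (fun z hz => differentiableAt_poleKernel hpi.1 (hz ▸ hya)
          (fun h => hyi (by rw [← hz, h]))) (stripDecay_poleKernel (p i) a a b)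
      rw [← integral_const_mul, ← integral_sub hfi (hpi'.const_mul _)]
      refine integral_congr_ae (Eventually.of_forall fun x => ?_)
      exact hg _ fun h => hyi (by rw [← h]; simp)
    rw [hline a le_rfl hab hpi.1.ne (fun j hj => (hpS j (Finset.mem_insert_of_mem hj)).1.ne),
      hline b hab le_rfl hpi.2.ne' (fun j hj => (hpS j (Finset.mem_insert_of_mem hj)).2.ne'),
      integral_poleKernel_below hpi.1, integral_poleKernel_above hpi.1 hpi.2] at key
    rw [Finset.sum_insert hi]
    linear_combination key

/-! ### Principal values -/

/-- An odd function with a simple pole at `0` with residue `1`, and no other pole in the strip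
`|im z| < 1`. -/
def oddKernel (z : ℂ) : ℂ := 1 / (z * (z ^ 2 + 1))

lemma oddKernel_neg (z : ℂ) : oddKernel (-z) = -oddKernel z := by
  unfold oddKernel
  rw [neg_sq, neg_mul, div_neg]

lemma sq_add_one_ne_zero {z : ℂ} (hz : |z.im| < 1) : z ^ 2 + 1 ≠ 0 := by
  intro h
  have h1 : (z - I) * (z + I) = 0 := by linear_combination h - I_sq
  rcases mul_eq_zero.1 h1 with h2 | h2
  · rw [sub_eq_zero.1 h2] at hz; simp at hz
  · rw [eq_neg_of_add_eq_zero_left h2] at hz; simp at hz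

lemma differentiableAt_oddKernel {z : ℂ} (h0 : z ≠ 0) (hz : |z.im| < 1) :
    DifferentiableAt ℂ oddKernel z := by
  have := mul_ne_zero h0 (sq_add_one_ne_zero hz)
  unfold oddKernel
  fun_prop (disch := assumption)

lemma tendsto_oddKernel : Tendsto (fun z => (z - 0) * oddKernel z) (𝓝[≠] 0) (𝓝 1) := by
  have h1 : ContinuousAt (fun z : ℂ => 1 / (z ^ 2 + 1)) 0 := by
    have : (0 : ℂ) ^ 2 + 1 ≠ 0 := by simp
    fun_prop (disch := assumption)
  have h2 := h1.tendsto.mono_left (nhdsWithin_le_nhds (s := {(0 : ℂ)}ᶜ))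
  simp only [ne_eq, OfNat.ofNat_ne_zero, not_false_eq_true, zero_pow, zero_add, div_one] at h2
  refine h2.congr' ?_
  filter_upwards [self_mem_nhdsWithin] with z hz
  unfold oddKernel
  have : z ≠ 0 := hz
  by_cases h : z ^ 2 + 1 = 0
  · simp [h]
  · field_simp
    simp

lemma stripDecay_oddKernel (c d : ℝ) (hc : -1 < c) (hd : d < 1) : StripDecay oddKernel c d := by
  refine ⟨2, 2, fun z h1 h2 h3 => ?_⟩
  have hz : 2 ≤ ‖z‖ := h3.trans (Complex.abs_re_le_norm z)
  have him : |z.im| < 1 := abs_lt.2 ⟨by linarith, by linarith⟩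
  have h4 : ‖z‖ ^ 2 - 1 ≤ ‖z ^ 2 + 1‖ := by
    have := norm_sub_le (z ^ 2 + 1) 1
    rw [add_sub_cancel_right, norm_pow, norm_one] at this
    linarith
  have h5 : z.re ^ 2 ≤ ‖z‖ ^ 2 := by
    rw [← sq_abs]
    exact pow_le_pow_left₀ (abs_nonneg _) (Complex.abs_re_le_norm z) 2
  unfold oddKernel
  rw [norm_div, norm_one, norm_mul]
  have h6 : (1 + z.re ^ 2) / 2 ≤ ‖z‖ * ‖z ^ 2 + 1‖ := by
    have : 0 ≤ ‖z ^ 2 + 1‖ := norm_nonneg _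
    nlinarith
  rw [div_le_div_iff₀ (lt_of_lt_of_le (by positivity) h6) (by positivity)]
  linarith

/-- The principal value at a simple pole is the mean of the integrals along the two lines passing
above and below the pole. -/
theorem tendsto_principalValue {F : ℂ → ℂ} {δ : ℝ} {c : ℂ} (hδ : 0 < δ) (hδ1 : δ < 1)
    (hd : ∀ z : ℂ, |z.im| ≤ δ → z ≠ 0 → DifferentiableAt ℂ F z)
    (hres : Tendsto (fun z => z * F z) (𝓝[≠] 0) (𝓝 c)) (hdec : StripDecay F (-δ) δ) :
    (∀ ε : ℝ, 0 < ε → IntegrableOn (fun x : ℝ => F x) {x : ℝ | ε < |x|}) ∧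
    Tendsto (fun ε : ℝ => ∫ x in {x : ℝ | ε < |x|}, F x) (𝓝[>] 0)
      (𝓝 (((∫ x : ℝ, F (x + δ * I)) + ∫ x : ℝ, F (x + (-δ : ℝ) * I)) / 2)) := by
  have hnear : ∀ᶠ z : ℂ in 𝓝[≠] 0, |z.im| < δ := by
    have : Tendsto (fun z : ℂ => |z.im|) (𝓝 0) (𝓝 |(0 : ℂ).im|) :=
      (continuous_abs.comp continuous_im).tendsto 0
    rw [zero_im, abs_zero] at this
    exact nhdsWithin_le_nhds (this.eventually (gt_mem_nhds hδ))
  obtain ⟨G, hG, hGd⟩ := exists_differentiableAt_extension (f := F) (φ := oddKernel) (p := 0) (c := c)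
    (by filter_upwards [hnear, self_mem_nhdsWithin] with z hz h0 using hd z hz.le h0)
    (by filter_upwards [hnear, self_mem_nhdsWithin] with z hz h0 using
          differentiableAt_oddKernel h0 (hz.trans hδ1))
    (by simpa using hres) tendsto_oddKernel
  have hGeq : ∀ z, z ≠ 0 → G =ᶠ[𝓝 z] fun z => F z - c * oddKernel z := by
    intro z hz
    filter_upwards [isOpen_ne.mem_nhds hz] with y hy using hG y hy
  have hG' : ∀ z : ℂ, -δ ≤ z.im → z.im ≤ δ → DifferentiableAt ℂ G z := by
    intro z h1 h2
    have him : |z.im| ≤ δ := abs_le.2 ⟨h1, h2⟩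
    by_cases hz : z = 0
    · rw [hz]; exact hGd
    · exact ((hd z him hz).sub ((differentiableAt_oddKernel hz (him.trans_lt hδ1)).const_mul
        _)).congr_of_eventuallyEq (hGeq z hz)
  have hodec := stripDecay_oddKernel (-δ) δ (by linarith) hδ1
  have hGdec : StripDecay G (-δ) δ := by
    refine (hdec.add (hodec.const_mul (-c))).congr 1 fun z hz => ?_
    rw [hG z (fun h => by rw [h] at hz; simp at hz; linarith)]
    ring
  have hGint : Integrable fun x : ℝ => G x := by
    have := integrable_line (y := 0) (by linarith) hδ.le
      (fun z hz => hG' z (by linarith) (by linarith)) hGdec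
    simpa using this
  have hup : ∫ x : ℝ, G x = ∫ x : ℝ, G (x + δ * I) := by
    have := integral_line_eq_of_differentiable (a := 0) hδ.le
      (fun z h1 h2 => hG' z (by linarith) h2) (hGdec.mono (by linarith) le_rfl)
    simpa using this
  have hdown : ∫ x : ℝ, G x = ∫ x : ℝ, G (x + (-δ : ℝ) * I) := by
    have := integral_line_eq_of_differentiable (a := -δ) (b := 0) (by linarith)
      (fun z h1 h2 => hG' z h1 (by linarith)) (hGdec.mono le_rfl hδ.le)
    simpa using this.symm
  have hline : ∀ y : ℝ, |y| = δ → ∫ x : ℝ, G (x + y * I) =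
      (∫ x : ℝ, F (x + y * I)) - c * ∫ x : ℝ, oddKernel (x + y * I) := by
    intro y hy
    have hy' := abs_le.1 hy.le
    have hne : ∀ z : ℂ, z.im = y → z ≠ 0 := fun z hz h => by
      rw [h] at hz; rw [← hz] at hy; simp at hy; linarith
    have i1 : Integrable fun x : ℝ => F (x + y * I) :=
      integrable_line hy'.1 hy'.2 (fun z hz => hd z (by rw [hz, hy]) (hne z hz)) hdec
    have i2 : Integrable fun x : ℝ => oddKernel (x + y * I) :=
      integrable_line hy'.1 hy'.2 (fun z hz => differentiableAt_oddKernel (hne z hz)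
        (by rw [hz, hy]; exact hδ1)) hodec
    rw [← integral_const_mul, ← integral_sub i1 (i2.const_mul _)]
    exact integral_congr_ae (Eventually.of_forall fun x => hG _ (hne _ (by simp)))
  have hodd : ∫ x : ℝ, oddKernel (x + (-δ : ℝ) * I) = -∫ x : ℝ, oddKernel (x + δ * I) := by
    rw [← integral_neg_eq_self, ← integral_neg]
    congr 1
    ext x
    rw [← oddKernel_neg]
    congr 1
    push_cast
    ring
  have hval : ((∫ x : ℝ, F (x + δ * I)) + ∫ x : ℝ, F (x + (-δ : ℝ) * I)) / 2 = ∫ x : ℝ, G x := by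
    have e1 := hline δ (abs_of_pos hδ)
    have e2 := hline (-δ) (by rw [abs_neg, abs_of_pos hδ])
    rw [hodd] at e2
    rw [← hup] at e1
    rw [← hdown] at e2
    linear_combination (-1 / 2 : ℂ) * e1 + (-1 / 2 : ℂ) * e2
  have hmeas : ∀ ε : ℝ, MeasurableSet {x : ℝ | ε < |x|} := fun ε =>
    measurableSet_lt measurable_const continuous_abs.measurable
  have hoint : ∀ ε : ℝ, 0 < ε → IntegrableOn (fun x : ℝ => oddKernel x) {x : ℝ | ε < |x|} := by
    intro ε hε
    refine Integrable.mono' ((integrable_inv_one_add_sq.const_mul (1 / ε)).integrableOn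
      (s := {x : ℝ | ε < |x|})) ?_ ?_
    · unfold oddKernel
      exact (by fun_prop : Measurable fun x : ℝ => 1 / ((x : ℂ) * ((x : ℂ) ^ 2 + 1))).aestronglyMeasurable
    · refine (ae_restrict_iff' (hmeas ε)).2 (Eventually.of_forall fun x hx => ?_)
      have hx' : ε < |x| := hx
      have : oddKernel x = ((1 / (x * (x ^ 2 + 1)) : ℝ) : ℂ) := by
        unfold oddKernel; push_cast; rfl
      rw [this, norm_real, Real.norm_eq_abs, abs_div, abs_one, abs_mul,
        abs_of_pos (by positivity : 0 < x ^ 2 + 1), one_div_mul_eq_div, ← one_div, div_div, add_comm 1]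
      exact one_div_le_one_div_of_le (by positivity) (by nlinarith [sq_nonneg x])
  have hFG : ∀ ε : ℝ, 0 < ε → Set.EqOn (fun x : ℝ => F x)
      (fun x : ℝ => G x + c * oddKernel x) {x : ℝ | ε < |x|} := by
    intro ε hε x hx
    have hx' : ε < |x| := hx
    have : (x : ℂ) ≠ 0 := by
      rw [Ne, ofReal_eq_zero]
      rintro rfl
      rw [abs_zero] at hx'
      linarith
    simp [hG x this]
  have hFint : ∀ ε : ℝ, 0 < ε → IntegrableOn (fun x : ℝ => F x) {x : ℝ | ε < |x|} := by
    intro ε hε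
    exact (hGint.integrableOn.add ((hoint ε hε).const_mul c)).congr_fun (hFG ε hε).symm (hmeas ε)
  refine ⟨hFint, ?_⟩
  have hset : ∀ ε : ℝ, 0 < ε → ∫ x in {x : ℝ | ε < |x|}, F x = ∫ x in {x : ℝ | ε < |x|}, G x := by
    intro ε hε
    rw [setIntegral_congr_fun (hmeas ε) (hFG ε hε), integral_add hGint.integrableOn
      ((hoint ε hε).const_mul c), integral_const_mul]
    have : ∫ x in {x : ℝ | ε < |x|}, oddKernel x = -∫ x in {x : ℝ | ε < |x|}, oddKernel x := by
      rw [← integral_indicator (hmeas ε)]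
      nth_rw 1 [← integral_neg_eq_self]
      rw [← integral_neg]
      congr 1
      ext x
      simp only [Set.indicator_apply, Set.mem_ofPred_eq, abs_neg]
      split_ifs
      · push_cast; exact oddKernel_neg _
      · simp
    have h0 : ∫ x in {x : ℝ | ε < |x|}, oddKernel x = 0 := by
      linear_combination (1 / 2 : ℂ) * this
    rw [h0, mul_zero, add_zero]
  rw [hval]
  have hlim : Tendsto (fun ε : ℝ => ∫ x, Set.indicator {x : ℝ | ε < |x|} (fun x : ℝ => G x) x)
      (𝓝[>] 0) (𝓝 (∫ x : ℝ, G x)) := by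
    refine tendsto_integral_filter_of_dominated_convergence (fun x => ‖G x‖) ?_ ?_ hGint.norm ?_
    · exact Eventually.of_forall fun ε => hGint.aestronglyMeasurable.indicator (hmeas ε)
    · exact Eventually.of_forall fun ε => Eventually.of_forall fun x => norm_indicator_le_norm_self _ _
    · have : ∀ᵐ x : ℝ, x ≠ 0 := by simp [ae_iff, measure_singleton]
      filter_upwards [this] with x hx
      refine tendsto_const_nhds.congr' ?_
      have : ∀ᶠ ε in 𝓝 (0 : ℝ), ε < |x| := gt_mem_nhds (abs_pos.2 hx)
      filter_upwards [nhdsWithin_le_nhds this] with ε hε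
      rw [Set.indicator_of_mem]
      exact hε
  refine hlim.congr' ?_
  filter_upwards [self_mem_nhdsWithin] with ε hε
  rw [hset ε hε, integral_indicator (hmeas ε)]

/-! ### Gaussian integrals against a cotangent -/

lemma norm_cot_le {z : ℂ} {η : ℝ} (hη : 0 < η) (hz : η ≤ |z.im|) :
    ‖Complex.cot z‖ ≤ 2 / (1 - Real.exp (-2 * η)) := by
  set y := z.im with hy
  have e1 : ‖cexp (z * I)‖ = Real.exp (-y) := by rw [norm_exp]; simp [hy]
  have e2 : ‖cexp (-z * I)‖ = Real.exp y := by rw [norm_exp]; simp [hy]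
  have hc : ‖Complex.cos z‖ ≤ (Real.exp y + Real.exp (-y)) / 2 := by
    rw [Complex.cos, norm_div, Complex.norm_two]
    gcongr
    refine (norm_add_le _ _).trans ?_
    rw [e1, e2, add_comm]
  have hs : |Real.exp y - Real.exp (-y)| / 2 ≤ ‖Complex.sin z‖ := by
    rw [Complex.sin, norm_div, norm_mul, norm_I, mul_one, Complex.norm_two]
    gcongr
    have := abs_norm_sub_norm_le (cexp (-z * I)) (cexp (z * I))
    rwa [e1, e2] at this
  have hη1 : 0 < 1 - Real.exp (-2 * η) := by
    rw [sub_pos, Real.exp_lt_one_iff]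
    linarith
  have key : (Real.exp y + Real.exp (-y)) * (1 - Real.exp (-2 * η)) ≤
      2 * |Real.exp y - Real.exp (-y)| := by
    have aux : ∀ t : ℝ, η ≤ t → (Real.exp t + Real.exp (-t)) * (1 - Real.exp (-2 * η)) ≤
        2 * (Real.exp t - Real.exp (-t)) := by
      intro t ht
      have h1 : Real.exp (-t) ≤ Real.exp (-2 * η) * Real.exp t := by
        rw [← Real.exp_add]
        exact Real.exp_le_exp.2 (by linarith)
      have h2 : Real.exp (-t) ≤ Real.exp t := Real.exp_le_exp.2 (by linarith)
      nlinarith [Real.exp_pos t, Real.exp_pos (-t)]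
    rcases le_abs.1 hz with h | h
    · exact (aux y h).trans (by gcongr; exact le_abs_self _)
    · have h1 := aux (-y) h
      rw [neg_neg, add_comm] at h1
      have h2 := neg_abs_le (Real.exp y - Real.exp (-y))
      linarith
  have hpos : 0 < Real.exp y + Real.exp (-y) := by positivity
  have habs : 0 < |Real.exp y - Real.exp (-y)| := by nlinarith
  rw [Complex.cot_eq_cos_div_sin, norm_div, div_le_div_iff₀ (by linarith) hη1]
  nlinarith

lemma norm_cot_le_three {z : ℂ} (hz : 1 ≤ |z.im|) : ‖Complex.cot z‖ ≤ 3 := by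
  refine (norm_cot_le (η := 1) (by norm_num) hz).trans ?_
  have h1 : 3 ≤ Real.exp 2 := by
    have := Real.add_one_le_exp (2 : ℝ)
    linarith
  rw [mul_one]
  have h2 : Real.exp (-2) ≤ 1 / 3 := by
    rw [Real.exp_neg, ← one_div]
    exact one_div_le_one_div_of_le (by norm_num) h1
  rw [div_le_iff₀ (by linarith)]
  linarith

lemma cot_add_int_mul_pi (z : ℂ) (n : ℤ) : Complex.cot (z + n * π) = Complex.cot z := by
  have h : Function.Periodic Complex.cot π := fun z => by
    rw [Complex.cot_eq_cos_div_sin, Complex.cot_eq_cos_div_sin, Complex.cos_add_pi,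
      Complex.sin_add_pi, neg_div_neg_eq]
  exact h.int_mul n z

lemma cot_neg' (z : ℂ) : Complex.cot (-z) = -Complex.cot z := by
  rw [Complex.cot_eq_cos_div_sin, Complex.cot_eq_cos_div_sin, Complex.cos_neg, Complex.sin_neg,
    div_neg]

lemma sin_pi_mul_eq_zero {s : ℂ} (h : Complex.sin (π * s) = 0) : ∃ m : ℤ, s = m := by
  obtain ⟨m, hm⟩ := Complex.sin_eq_zero_iff.1 h
  refine ⟨m, ?_⟩
  have : (π : ℂ) ≠ 0 := by exact_mod_cast Real.pi_ne_zero
  rw [mul_comm] at hm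
  exact mul_right_cancel₀ this hm

/-- The cotangent is bounded on the union of all the lines in direction `i v` whose distance from
the poles is at least `η`. -/
lemma exists_cot_bound {v : ℂ} (hv : 0 < v.re) {η : ℝ} (hη : 0 < η) :
    ∃ M : ℝ, 0 ≤ M ∧ ∀ t x : ℝ, (∃ n : ℤ, n + η ≤ t ∧ t ≤ n + 1 - η) →
      ‖Complex.cot (π * (t - I * v * x))‖ ≤ M := by
  have hK : IsCompact (Set.Icc η (1 - η) ×ˢ Set.Icc (-(1 / v.re)) (1 / v.re)) :=
    isCompact_Icc.prod isCompact_Icc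
  have hcont : ContinuousOn (fun q : ℝ × ℝ => Complex.cot (π * (q.1 - I * v * q.2)))
      (Set.Icc η (1 - η) ×ˢ Set.Icc (-(1 / v.re)) (1 / v.re)) := by
    have hne : ∀ q ∈ Set.Icc η (1 - η) ×ˢ Set.Icc (-(1 / v.re)) (1 / v.re),
        Complex.sin (π * ((q.1 : ℝ) - I * v * (q.2 : ℝ))) ≠ 0 := by
      rintro ⟨t, x⟩ ⟨ht, -⟩ h0
      obtain ⟨m, hm⟩ := sin_pi_mul_eq_zero h0
      have him := congrArg Complex.im hm
      have hre := congrArg Complex.re hm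
      simp at him hre
      have hx : x = 0 := by
        rcases him with h | h
        · linarith
        · exact h
      simp only [hx, mul_zero, add_zero] at hre
      simp only [Set.mem_Icc] at ht
      have h1 : (0 : ℝ) < m := by linarith
      have h2 : (m : ℝ) < 1 := by linarith
      have h3 : (0 : ℤ) < m := by exact_mod_cast h1
      have h4 : m < (1 : ℤ) := by exact_mod_cast h2
      omega
    simp only [Complex.cot_eq_cos_div_sin]
    refine ContinuousOn.div ?_ ?_ hne
    · exact (Complex.continuous_cos.comp (by fun_prop)).continuousOn
    · exact (Complex.continuous_sin.comp (by fun_prop)).continuousOn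
  obtain ⟨M, hM⟩ := hK.exists_bound_of_continuousOn hcont
  refine ⟨max M 3, le_trans (by norm_num) (le_max_right _ _), ?_⟩
  rintro t x ⟨n, h1, h2⟩
  have hper : Complex.cot (π * (t - I * v * x)) =
      Complex.cot (π * (((t - n : ℝ) : ℂ) - I * v * x)) := by
    rw [← cot_add_int_mul_pi (π * (((t - n : ℝ) : ℂ) - I * v * x)) n]
    congr 1
    push_cast
    ring
  rw [hper]
  by_cases hx : |x| ≤ 1 / v.re
  · exact (hM (t - n, x) ⟨⟨by simp only; linarith, by simp only; linarith⟩, abs_le.1 hx⟩).trans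
      (le_max_left _ _)
  · refine (norm_cot_le_three ?_).trans (le_max_right _ _)
    have hx' : 1 < v.re * |x| := by
      rw [not_le, div_lt_iff₀ hv] at hx
      linarith
    have : (π * (((t - n : ℝ) : ℂ) - I * v * x)).im = -(π * (v.re * x)) := by simp
    rw [this, abs_neg, abs_mul, abs_mul, abs_of_pos hv, abs_of_pos Real.pi_pos]
    nlinarith [Real.pi_gt_three]

lemma exists_gaussian_strip_bound {β γ : ℂ} (hβ : 0 < β.re) (Y : ℝ) :
    ∃ B : ℝ, 0 ≤ B ∧ ∀ z : ℂ, |z.im| ≤ Y → ‖cexp (-(β * z ^ 2) + γ * z)‖ ≤ B / (1 + z.re ^ 2) := by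
  set A := β.re
  set C := 2 * |β.im| * Y + |γ.re|
  set D := A * Y ^ 2 + |γ.im| * Y
  set E := C ^ 2 / (2 * A) + D
  refine ⟨Real.exp E * max 1 (2 / A), by positivity, fun z hz => ?_⟩
  have hY : 0 ≤ Y := (abs_nonneg _).trans hz
  rw [norm_exp]
  have hre : (-(β * z ^ 2) + γ * z).re =
      -A * z.re ^ 2 + A * z.im ^ 2 + 2 * β.im * z.im * z.re + γ.re * z.re - γ.im * z.im := by
    simp [sq, A]
    ring
  have h1 : A * z.im ^ 2 ≤ A * Y ^ 2 := by
    have : z.im ^ 2 ≤ Y ^ 2 := by rw [← sq_abs]; exact pow_le_pow_left₀ (abs_nonneg _) hz 2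
    exact mul_le_mul_of_nonneg_left this hβ.le
  have h2 : 2 * β.im * z.im * z.re ≤ 2 * |β.im| * Y * |z.re| := by
    refine (le_abs_self _).trans ?_
    rw [abs_mul, abs_mul, abs_mul, abs_two]
    gcongr
  have h3 : γ.re * z.re ≤ |γ.re| * |z.re| := (le_abs_self _).trans (abs_mul _ _).le
  have h4 : -(γ.im * z.im) ≤ |γ.im| * Y := by
    refine (neg_le_abs _).trans ?_
    rw [abs_mul]
    gcongr
  have h5 : C * |z.re| ≤ A / 2 * z.re ^ 2 + C ^ 2 / (2 * A) := by
    have : 0 ≤ (A * |z.re| - C) ^ 2 / (2 * A) := by positivity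
    have e : (A * |z.re| - C) ^ 2 / (2 * A) =
        A / 2 * |z.re| ^ 2 - C * |z.re| + C ^ 2 / (2 * A) := by
      field_simp
      ring
    rw [e, sq_abs] at this
    linarith
  have h6 : (-(β * z ^ 2) + γ * z).re ≤ E - A / 2 * z.re ^ 2 := by
    rw [hre]
    simp only [C, D, E] at h5 ⊢
    nlinarith
  refine (Real.exp_le_exp.2 h6).trans ?_
  rw [sub_eq_add_neg, Real.exp_add, mul_div_assoc]
  refine mul_le_mul_of_nonneg_left ?_ (Real.exp_pos _).le
  rw [Real.exp_neg, ← one_div]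
  have h7 : 1 + A / 2 * z.re ^ 2 ≤ Real.exp (A / 2 * z.re ^ 2) := by
    have := Real.add_one_le_exp (A / 2 * z.re ^ 2)
    linarith
  rw [div_le_div_iff₀ (Real.exp_pos _) (by positivity)]
  have h8 : 1 + z.re ^ 2 ≤ max 1 (2 / A) * (1 + A / 2 * z.re ^ 2) := by
    have m1 : 1 ≤ max 1 (2 / A) := le_max_left _ _
    have m2 : 2 / A ≤ max 1 (2 / A) := le_max_right _ _
    have m3 : 2 / A * (A / 2 * z.re ^ 2) = z.re ^ 2 := by field_simp
    have m4 : 0 ≤ A / 2 * z.re ^ 2 := by positivity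
    nlinarith
  rw [one_mul]
  exact h8.trans (mul_le_mul_of_nonneg_left h7 (by positivity))

/-- The integrand `e^{-2π w x²/k - 2π i ρ x/k} cot π(α - (μ + i w x)/k)`. -/
def cotGauss (α : ℝ) (k : ℕ) (w : ℂ) (μ ρ : ℝ) (x : ℂ) : ℂ :=
  cexp (-(2 * π * w / k * x ^ 2) + -(2 * π * I * ρ / k) * x) *
    Complex.cot (π * (α - (μ + I * w * x) / k))

/-- The poles of `cotGauss`. -/
def cotPole (α : ℝ) (k : ℕ) (w : ℂ) (μ : ℝ) (m : ℤ) : ℂ := -I * (k * (α + m) - μ : ℝ) / w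

variable {α : ℝ} {k : ℕ} {w : ℂ} {μ ρ : ℝ}

lemma ne_zero_of_re_pos (hw : 0 < w.re) : w ≠ 0 := by
  rintro rfl
  simp at hw

lemma inv_re_pos (hw : 0 < w.re) : 0 < (w⁻¹).re := by
  rw [inv_re]
  exact div_pos hw (normSq_pos.2 (ne_zero_of_re_pos hw))

lemma cotPole_im (m : ℤ) : (cotPole α k w μ m).im = -((k * (α + m) - μ) * (w⁻¹).re) := by
  rw [cotPole, div_eq_mul_inv, mul_assoc, neg_mul, neg_im, I_mul_im, re_ofReal_mul]

lemma differentiableAt_cotGauss (hk : 0 < k) (hw : w ≠ 0) {x : ℂ}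
    (hx : ∀ m : ℤ, x ≠ cotPole α k w μ m) : DifferentiableAt ℂ (cotGauss α k w μ ρ) x := by
  have hk' : (k : ℂ) ≠ 0 := by exact_mod_cast hk.ne'
  have hsin : Complex.sin (π * (α - (μ + I * w * x) / k)) ≠ 0 := by
    intro h0
    obtain ⟨m, hm⟩ := sin_pi_mul_eq_zero h0
    apply hx (-m)
    rw [cotPole]
    field_simp at hm ⊢
    push_cast
    linear_combination I * hm + x * w * I_sq
  unfold cotGauss
  simp only [Complex.cot_eq_cos_div_sin]
  fun_prop (disch := assumption)

lemma tendsto_cotGauss_pole (hk : 0 < k) (hw : w ≠ 0) (m : ℤ) :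
    Tendsto (fun z => (z - cotPole α k w μ m) * cotGauss α k w μ ρ z) (𝓝[≠] cotPole α k w μ m)
      (𝓝 (I * k / (π * w) * cexp (2 * π * ((k * (α + m) - μ : ℝ) ^ 2 -
        ρ * (k * (α + m) - μ : ℝ)) / (w * k)))) := by
  have hk' : (k : ℂ) ≠ 0 := by exact_mod_cast hk.ne'
  have hpi : (π : ℂ) ≠ 0 := by exact_mod_cast Real.pi_ne_zero
  set p := cotPole α k w μ m with hp
  set s : ℂ → ℂ := fun z => π * (α - (μ + I * w * z) / k) with hs
  have hsp : s p = ((-m : ℤ) : ℂ) * π := by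
    simp only [hs, hp, cotPole]
    field_simp
    push_cast
    linear_combination ((k : ℂ) * (α + m) - μ) * I_sq
  have hsin : Complex.sin (s p) = 0 := by rw [hsp, Complex.sin_int_mul_pi]
  have hcos : Complex.cos (s p) ≠ 0 := by
    intro h
    have := Complex.sin_sq_add_cos_sq (s p)
    rw [hsin, h] at this
    simp at this
  have hder : HasDerivAt (fun z => Complex.sin (s z)) (Complex.cos (s p) * (-(π * I * w / k))) p := by
    have h1 : HasDerivAt s (-(π * I * w / k)) p := by
      have := ((((hasDerivAt_id p).const_mul (I * w)).const_add (μ : ℂ)).div_const (k : ℂ)).const_sub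
        (α : ℂ) |>.const_mul (π : ℂ)
      refine this.congr_deriv ?_
      ring
    exact (Complex.hasDerivAt_sin (s p)).comp p h1
  have hne : Complex.cos (s p) * (-(π * I * w / k)) ≠ 0 := by
    refine mul_ne_zero hcos (neg_ne_zero.2 ?_)
    exact div_ne_zero (mul_ne_zero (mul_ne_zero hpi I_ne_zero) hw) hk'
  have h1 := hder.tendsto_slope.inv₀ hne
  have h2 : ContinuousAt (fun z => cexp (-(2 * π * w / k * z ^ 2) + -(2 * π * I * ρ / k) * z) *
      Complex.cos (s z)) p := by
    simp only [hs]
    fun_prop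
  have h3 := (h2.tendsto.mono_left (nhdsWithin_le_nhds (s := {p}ᶜ))).mul h1
  have hval : cexp (-(2 * π * w / k * p ^ 2) + -(2 * π * I * ρ / k) * p) * Complex.cos (s p) *
      (Complex.cos (s p) * (-(π * I * w / k)))⁻¹ = I * k / (π * w) *
      cexp (2 * π * ((k * (α + m) - μ : ℝ) ^ 2 - ρ * (k * (α + m) - μ : ℝ)) / (w * k)) := by
    have e : -(2 * π * w / k * p ^ 2) + -(2 * π * I * ρ / k) * p =
        2 * π * ((k * (α + m) - μ : ℝ) ^ 2 - ρ * (k * (α + m) - μ : ℝ)) / (w * k) := by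
      simp only [hp, cotPole]
      generalize ((k * (α + m) - μ : ℝ) : ℂ) = d
      field_simp
      ring_nf
      rw [I_sq]
      ring
    rw [e]
    field_simp
    rw [I_sq]
  rw [hval] at h3
  refine h3.congr' ?_
  filter_upwards [self_mem_nhdsWithin] with z hz
  have hz' : z - p ≠ 0 := sub_ne_zero.2 hz
  rw [slope_def_field, hsin, sub_zero, inv_div, cotGauss, Complex.cot_eq_cos_div_sin]
  simp only [hs]
  ring

lemma stripDecay_cotGauss (hk : 0 < k) (hw : 0 < w.re) (a b : ℝ) :
    StripDecay (cotGauss α k w μ ρ) a b := by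
  have hk' : (0 : ℝ) < k := by exact_mod_cast hk
  have hβ : 0 < (2 * π * w / k).re := by
    have : (2 * π * w / k).re = 2 * π / k * w.re := by
      rw [show 2 * π * w / k = ((2 * π / k : ℝ) : ℂ) * w by push_cast; ring, re_ofReal_mul]
    rw [this]
    positivity
  set Y := max |a| |b|
  obtain ⟨B, hB0, hB⟩ := exists_gaussian_strip_bound (γ := -(2 * π * I * ρ / k)) hβ Y
  refine ⟨B * 3, (k + |w.im| * Y) / w.re, fun z h1 h2 h3 => ?_⟩
  have hz : |z.im| ≤ Y := by
    rcases abs_cases z.im with ⟨h, _⟩ | ⟨h, _⟩ <;> rw [h]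
    · exact (h2.trans (le_abs_self b)).trans (le_max_right _ _)
    · exact ((neg_le_neg h1).trans (neg_le_abs a)).trans (le_max_left _ _)
  rw [cotGauss, norm_mul, mul_div_right_comm B]
  refine mul_le_mul (hB z hz) (norm_cot_le_three ?_) (norm_nonneg _) (by positivity)
  have e : (π * (α - (μ + I * w * z) / k) : ℂ) =
      ((π * (α - μ / k) : ℝ) : ℂ) - ((π / k : ℝ) : ℂ) * (I * (w * z)) := by
    push_cast
    ring
  rw [e, sub_im, ofReal_im, im_ofReal_mul, zero_sub, abs_neg, I_mul_im, mul_re, abs_mul,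
    abs_of_pos (by positivity)]
  rw [div_le_iff₀ hw] at h3
  have h4 : (k : ℝ) ≤ |w.re * z.re - w.im * z.im| := by
    have g1 := abs_sub_abs_le_abs_sub (w.re * z.re) (w.im * z.im)
    rw [abs_mul, abs_mul, abs_of_pos hw] at g1
    have g2 : |w.im| * |z.im| ≤ |w.im| * Y := mul_le_mul_of_nonneg_left hz (abs_nonneg _)
    linarith
  have h5 : (1 : ℝ) ≤ π / k * k := by
    rw [div_mul_cancel₀ _ hk'.ne']
    linarith [Real.pi_gt_three]
  exact h5.trans (mul_le_mul_of_nonneg_left h4 (by positivity))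

/-- The sign with which a pole at position `d` counts when the line of integration is moved from
position `0` to position `ρ / 2`. -/
def stepSign (ρ d : ℝ) : ℂ := if 0 < d ∧ d < ρ / 2 then 1 else if ρ / 2 < d ∧ d < 0 then -1 else 0

/-- The value of the Gaussian factor of `cotGauss` at the pole in position `d`. -/
def poleGauss (k : ℕ) (w : ℂ) (ρ d : ℝ) : ℂ := cexp (2 * π * ((d : ℂ) ^ 2 - ρ * d) / (w * k))

lemma finite_int_between (hk : 0 < k) (u v : ℝ) :
    {m : ℤ | u < k * (α + m) - μ ∧ k * (α + m) - μ < v}.Finite := by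
  have hk' : (0 : ℝ) < k := by exact_mod_cast hk
  refine (Set.finite_Icc ⌊(u + μ) / k - α⌋ ⌈(v + μ) / k - α⌉).subset fun m hm => ?_
  obtain ⟨h1, h2⟩ := hm
  constructor
  · have : (u + μ) / k - α ≤ m := by
      rw [sub_le_iff_le_add, div_le_iff₀ hk']
      linarith
    exact_mod_cast (Int.floor_le _).trans this
  · have : (m : ℝ) ≤ (v + μ) / k - α := by
      rw [le_sub_iff_add_le, le_div_iff₀ hk']
      linarith
    exact_mod_cast this.trans (Int.le_ceil _)

lemma cotPole_injective (hk : 0 < k) (hw : w ≠ 0) : Function.Injective (cotPole α k w μ) := by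
  have hk' : (k : ℝ) ≠ 0 := by exact_mod_cast hk.ne'
  intro m n h
  unfold cotPole at h
  rw [div_left_inj' hw] at h
  have h2 := mul_left_cancel₀ (neg_ne_zero.2 I_ne_zero) h
  have h3 : k * (α + m) - μ = k * (α + n) - μ := by exact_mod_cast h2
  have h4 : (m : ℝ) = n := by
    have := mul_left_cancel₀ hk' (sub_left_injective h3)
    linarith
  exact_mod_cast h4

/-- Moving the line of integration to the saddle point of the Gaussian; the poles that are passed
contribute the residues. -/
theorem integral_cotGauss_eq (hk : 0 < k) (hw : 0 < w.re)
    (h0 : ∀ m : ℤ, k * (α + m) - μ ≠ 0) (h1 : ∀ m : ℤ, k * (α + m) - μ ≠ ρ / 2) :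
    ∫ x : ℝ, cotGauss α k w μ ρ x =
      cexp (-(π * ρ ^ 2 / (2 * w * k))) * (∫ x : ℝ, cotGauss α k w (μ + ρ / 2) 0 x) +
      2 * k / w * ∑' m : ℤ, stepSign ρ (k * (α + m) - μ) * poleGauss k w ρ (k * (α + m) - μ) := by
  have hw0 := ne_zero_of_re_pos hw
  have hk' : (k : ℂ) ≠ 0 := by exact_mod_cast hk.ne'
  have hpi : (π : ℂ) ≠ 0 := by exact_mod_cast Real.pi_ne_zero
  have hP := inv_re_pos hw
  -- the shifted line, up to a real translation
  have hshift : ∫ x : ℝ, cotGauss α k w μ ρ (x + (-(ρ / 2 * (w⁻¹).re) : ℝ) * I) =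
      cexp (-(π * ρ ^ 2 / (2 * w * k))) * (∫ x : ℝ, cotGauss α k w (μ + ρ / 2) 0 x) := by
    rw [← integral_const_mul, ← integral_add_right_eq_self _ (ρ / 2 * (w⁻¹).im)]
    congr 1
    ext x
    have e : (((x + ρ / 2 * (w⁻¹).im : ℝ) : ℂ) + (-(ρ / 2 * (w⁻¹).re) : ℝ) * I) =
        x - I * ρ / (2 * w) := by
      have : I * ρ / (2 * w) = ((ρ / 2 : ℝ) : ℂ) * (I * w⁻¹) := by
        push_cast
        field_simp
      rw [this]
      apply Complex.ext <;> simp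
    rw [e]
    unfold cotGauss
    rw [← mul_assoc, ← Complex.exp_add]
    congr 2
    · field_simp
      ring_nf
      rw [I_sq]
      push_cast
      ring
    · congr 1
      field_simp
      push_cast
      ring_nf
      rw [I_sq]
      ring
  -- the saddle point lies above the real axis for negative and below it for positive `ρ`
  have hpoleGauss : ∀ m : ℤ, cexp (2 * π * ((k * (α + m) - μ : ℝ) ^ 2 -
        ρ * (k * (α + m) - μ : ℝ)) / (w * k)) = poleGauss k w ρ (k * (α + m) - μ) := fun m => rfl
  rcases lt_trichotomy ρ 0 with hρ | hρ | hρ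
  · -- the line moves upwards
    set S := (finite_int_between (α := α) (μ := μ) hk (ρ / 2) 0).toFinset with hS
    have hmem : ∀ m : ℤ, m ∈ S ↔ ρ / 2 < k * (α + m) - μ ∧ k * (α + m) - μ < 0 := by
      intro m; rw [hS, Set.Finite.mem_toFinset]; rfl
    have key := integral_line_sub_integral_line (a := 0) (b := -(ρ / 2 * (w⁻¹).re))
      (by nlinarith) S (cotPole α k w μ) _ (fun m hm => by
        rw [cotPole_im]
        obtain ⟨g1, g2⟩ := (hmem m).1 hm
        constructor <;> nlinarith) (cotPole_injective hk hw0).injOn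
      (f := cotGauss α k w μ ρ) (fun z z1 z2 z3 => differentiableAt_cotGauss hk hw0 fun m hm => by
        have him : z.im = _ := (congrArg Complex.im hm).trans (cotPole_im m)
        refine z3 m ((hmem m).2 ⟨?_, ?_⟩) hm
        · refine lt_of_le_of_ne ?_ (h1 m).symm
          rw [him] at z2
          by_contra hcon
          nlinarith
        · refine lt_of_le_of_ne ?_ (h0 m)
          rw [him] at z1
          by_contra hcon
          nlinarith) (fun m _ => tendsto_cotGauss_pole hk hw0 m) (stripDecay_cotGauss hk hw _ _)
    rw [hshift] at key
    simp only [ofReal_zero, zero_mul, add_zero] at key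
    have hsum : ∑' m : ℤ, stepSign ρ (k * (α + m) - μ) * poleGauss k w ρ (k * (α + m) - μ) =
        ∑ m ∈ S, -poleGauss k w ρ (k * (α + m) - μ) := by
      rw [tsum_eq_sum (s := S)]
      · refine Finset.sum_congr rfl fun m hm => ?_
        have := (hmem m).1 hm
        rw [stepSign, if_neg (by rintro ⟨g1, g2⟩; linarith), if_pos this]
        ring
      · intro m hm
        rw [hmem] at hm
        rw [stepSign, if_neg (by rintro ⟨g1, g2⟩; linarith), if_neg hm, zero_mul]
    rw [hsum, Finset.sum_neg_distrib]
    rw [← Finset.mul_sum] at key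
    simp only [hpoleGauss] at key
    rw [sub_eq_iff_eq_add] at key
    rw [key]
    field_simp
    rw [I_sq]
    ring
  · have hsum : ∑' m : ℤ, stepSign ρ (k * (α + m) - μ) * poleGauss k w ρ (k * (α + m) - μ) = 0 := by
      convert tsum_zero with m
      rw [stepSign, if_neg (by rintro ⟨g1, g2⟩; linarith), if_neg (by rintro ⟨g1, g2⟩; linarith),
        zero_mul]
    rw [hsum]
    simp [hρ]
  · set S := (finite_int_between (α := α) (μ := μ) hk 0 (ρ / 2)).toFinset with hS
    have hmem : ∀ m : ℤ, m ∈ S ↔ 0 < k * (α + m) - μ ∧ k * (α + m) - μ < ρ / 2 := by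
      intro m; rw [hS, Set.Finite.mem_toFinset]; rfl
    have key := integral_line_sub_integral_line (a := -(ρ / 2 * (w⁻¹).re)) (b := 0)
      (by nlinarith) S (cotPole α k w μ) _ (fun m hm => by
        rw [cotPole_im]
        obtain ⟨g1, g2⟩ := (hmem m).1 hm
        constructor <;> nlinarith) (cotPole_injective hk hw0).injOn
      (f := cotGauss α k w μ ρ) (fun z z1 z2 z3 => differentiableAt_cotGauss hk hw0 fun m hm => by
        have him : z.im = _ := (congrArg Complex.im hm).trans (cotPole_im m)
        refine z3 m ((hmem m).2 ⟨?_, ?_⟩) hm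
        · refine lt_of_le_of_ne ?_ (h0 m).symm
          rw [him] at z2
          by_contra hcon
          nlinarith
        · refine lt_of_le_of_ne ?_ (h1 m)
          rw [him] at z1
          by_contra hcon
          nlinarith) (fun m _ => tendsto_cotGauss_pole hk hw0 m) (stripDecay_cotGauss hk hw _ _)
    rw [hshift] at key
    simp only [ofReal_zero, zero_mul, add_zero] at key
    have hsum : ∑' m : ℤ, stepSign ρ (k * (α + m) - μ) * poleGauss k w ρ (k * (α + m) - μ) =
        ∑ m ∈ S, poleGauss k w ρ (k * (α + m) - μ) := by
      rw [tsum_eq_sum (s := S)]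
      · refine Finset.sum_congr rfl fun m hm => ?_
        have := (hmem m).1 hm
        rw [stepSign, if_pos this]
        ring
      · intro m hm
        rw [hmem] at hm
        rw [stepSign, if_neg hm, if_neg (by rintro ⟨g1, g2⟩; linarith), zero_mul]
    rw [hsum]
    rw [← Finset.mul_sum] at key
    simp only [hpoleGauss] at key
    rw [sub_eq_iff_eq_add] at key
    rw [key]
    field_simp
    rw [I_sq]
    ring

/-! ### Sums over residue classes -/

lemma sum_range_eq_sum_zmod {k : ℕ} [NeZero k] {g : ℤ → ℂ} :
    ∑ s ∈ Finset.range k, g s = ∑ x : ZMod k, g (x.val : ℤ) := by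
  refine Finset.sum_bij' (fun s _ => (s : ZMod k)) (fun x _ => x.val) (fun _ _ => Finset.mem_univ _)
    (fun x _ => Finset.mem_range.2 (ZMod.val_lt x)) ?_ ?_ ?_
  · intro s hs
    exact ZMod.val_cast_of_lt (Finset.mem_range.1 hs)
  · intro x _
    exact ZMod.natCast_zmod_val x
  · intro s hs
    rw [ZMod.val_cast_of_lt (Finset.mem_range.1 hs)]

lemma periodic_eq_val {k : ℕ} [NeZero k] {g : ℤ → ℂ} (hg : Function.Periodic g (k : ℤ)) (n : ℤ) :
    g n = g (((n : ZMod k).val : ℕ) : ℤ) := by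
  rw [ZMod.val_intCast]
  conv_lhs => rw [← Int.emod_add_mul_ediv n k]
  have := hg.int_mul (n / k) (n % k)
  rw [mul_comm]
  simpa using this

/-- A sum of a `k`-periodic function over a complete system of residues may be reindexed by a
residue prime to `k`. -/
lemma sum_range_mul {k : ℕ} (hk : 0 < k) {g : ℤ → ℂ} (hg : Function.Periodic g (k : ℤ)) {h h' : ℤ}
    (hh : h * h' ≡ -1 [ZMOD k]) :
    ∑ s ∈ Finset.range k, g (h * s) = ∑ s ∈ Finset.range k, g s := by
  have : NeZero k := ⟨hk.ne'⟩
  have hu : (h : ZMod k) * (-h' : ℤ) = 1 := by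
    have := (ZMod.intCast_eq_intCast_iff _ _ _).2 hh
    push_cast at this ⊢
    rw [mul_neg, this, neg_neg]
  rw [sum_range_eq_sum_zmod (g := fun s => g (h * s)), sum_range_eq_sum_zmod]
  refine Finset.sum_bij' (fun x _ => (h : ZMod k) * x) (fun x _ => ((-h' : ℤ) : ZMod k) * x)
    (fun _ _ => Finset.mem_univ _) (fun _ _ => Finset.mem_univ _) ?_ ?_ ?_
  · intro x _
    rw [← mul_assoc, mul_comm _ (h : ZMod k), hu, one_mul]
  · intro x _
    rw [← mul_assoc, hu, one_mul]
  · intro x _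
    rw [periodic_eq_val hg]
    congr 3
    push_cast
    rw [ZMod.natCast_zmod_val]

lemma sum_range_add {k : ℕ} (hk : 0 < k) {g : ℤ → ℂ} (hg : Function.Periodic g (k : ℤ)) (n : ℤ) :
    ∑ s ∈ Finset.range k, g (s + n) = ∑ s ∈ Finset.range k, g s := by
  have : NeZero k := ⟨hk.ne'⟩
  rw [sum_range_eq_sum_zmod (g := fun s => g (s + n)), sum_range_eq_sum_zmod]
  refine Fintype.sum_equiv (Equiv.addRight (n : ZMod k)) _ _ fun x => ?_
  rw [periodic_eq_val hg]
  congr 3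
  push_cast
  rw [ZMod.natCast_zmod_val]
  rfl

/-- Splitting a sum over the integers into residue classes. -/
lemma tsum_eq_sum_range_tsum {k : ℕ} (hk : 0 < k) {U : ℤ → ℂ} (hU : Summable U) :
    ∑' n, U n = ∑ s ∈ Finset.range k, ∑' j : ℤ, U (k * j + s) := by
  have : NeZero k := ⟨hk.ne'⟩
  have e : ∀ p : ℤ × Fin k, U ((Int.divModEquiv k).symm p) = U (k * p.1 + (p.2 : ℕ)) := by
    rintro ⟨j, s⟩
    rw [Int.divModEquiv_symm_apply]
    congr 1
    simp
    ring
  rw [← (Int.divModEquiv k).symm.tsum_eq]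
  simp_rw [e]
  have hs : Summable fun p : ℤ × Fin k => U (k * p.1 + (p.2 : ℕ)) := by
    simp_rw [← e]
    exact (Int.divModEquiv k).symm.summable_iff.2 hU
  rw [← (Equiv.prodComm (Fin k) ℤ).tsum_eq]
  have hs' := (Equiv.prodComm (Fin k) ℤ).summable_iff.2 hs
  refine hs'.tsum_prod.trans ?_
  rw [tsum_fintype, ← Fin.sum_univ_eq_sum_range
    (fun s : ℕ => ∑' j : ℤ, U (k * j + s)) k]
  rfl

lemma summable_residue {E : Type*} [NormedAddCommGroup E] [CompleteSpace E] {k : ℕ} (hk : 0 < k)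
    {U : ℤ → E} (hU : Summable U) (s : ℤ) :
    Summable fun j : ℤ => U (k * j + s) := by
  refine hU.comp_injective fun a b hab => ?_
  have : (k : ℤ) ≠ 0 := by exact_mod_cast hk.ne'
  have h2 : (k : ℤ) * a = k * b := add_right_cancel hab
  exact mul_left_cancel₀ this h2

lemma summable_exp_neg_abs_int {c : ℝ} (hc : 0 < c) (x₀ : ℝ) :
    Summable fun n : ℤ => Real.exp (-(c * |n - x₀|)) := by
  have h0 : Summable fun n : ℤ => Real.exp (-(c * |(n : ℝ)|)) := by
    have hg : Summable fun n : ℕ => Real.exp (-c) ^ n :=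
      summable_geometric_of_lt_one (Real.exp_pos _).le (Real.exp_lt_one_iff.2 (by linarith))
    refine Summable.of_nat_of_neg ?_ ?_
    · refine hg.congr fun n => ?_
      rw [← Real.exp_nat_mul]
      simp
      ring
    · refine hg.congr fun n => ?_
      rw [← Real.exp_nat_mul]
      simp
      ring
  refine Summable.of_nonneg_of_le (fun n => (Real.exp_pos _).le) (fun n => ?_)
    (h0.mul_left (Real.exp (c * |x₀|)))
  rw [← Real.exp_add]
  refine Real.exp_le_exp.2 ?_
  have := abs_sub_abs_le_abs_sub (n : ℝ) x₀
  nlinarith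

/-! ### Poisson summation for the cotangent sums -/

section
variable {α : ℝ} {k : ℕ} {w : ℂ} {μ ρ : ℝ}

lemma cotPole_ne_ofReal (hw : 0 < w.re) {m : ℤ} (h0 : k * (α + m) - μ ≠ 0) (x : ℝ) :
    (x : ℂ) ≠ cotPole α k w μ m := by
  intro h
  have := congrArg Complex.im h
  rw [cotPole_im, ofReal_im] at this
  have h2 := (inv_re_pos hw).ne'
  rcases mul_eq_zero.1 (neg_eq_zero.1 this.symm) with h3 | h3
  · exact h0 h3
  · exact h2 h3

lemma continuous_cotGauss (hk : 0 < k) (hw : 0 < w.re) (h0 : ∀ m : ℤ, k * (α + m) - μ ≠ 0) :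
    Continuous fun x : ℝ => cotGauss α k w μ ρ x := by
  refine continuous_iff_continuousAt.2 fun x => ?_
  have h1 : ContinuousAt (cotGauss α k w μ ρ) ((fun x : ℝ => (x : ℂ)) x) :=
    (differentiableAt_cotGauss hk (ne_zero_of_re_pos hw)
      fun m => cotPole_ne_ofReal hw (h0 m) x).continuousAt
  exact ContinuousAt.comp (f := fun x : ℝ => (x : ℂ)) h1 continuous_ofReal.continuousAt

lemma cotGauss_decay (hk : 0 < k) (hw : 0 < w.re) (h0 : ∀ m : ℤ, k * (α + m) - μ ≠ 0) :
    ∃ B : ℝ, ∀ x : ℝ, ‖cotGauss α k w μ ρ x‖ ≤ B / (1 + x ^ 2) := by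
  refine norm_le_div_one_add_sq_of_continuous (continuous_cotGauss hk hw h0) ?_
  simpa using (stripDecay_cotGauss (α := α) (μ := μ) (ρ := ρ) hk hw 0 0).line le_rfl le_rfl

lemma cotGauss_zero_mul (x b : ℂ) :
    cotGauss α k w μ 0 x * cexp (-(2 * π * I * ρ * (x - b) / k)) =
      cexp (2 * π * I * ρ * b / k) * cotGauss α k w μ ρ x := by
  unfold cotGauss
  rw [mul_right_comm, ← mul_assoc, ← Complex.exp_add, ← Complex.exp_add]
  congr 2
  push_cast
  ring

/-- Poisson summation over a progression modulo `k`. The character `e^{2π i κ j}` shifts the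
frequencies from `r` to `r - κ`. -/
theorem tsum_cotGauss_eq (hk : 0 < k) (hw : 0 < w.re) (h0 : ∀ m : ℤ, k * (α + m) - μ ≠ 0)
    (κ : ℝ) (b : ℝ)
    (hsum : Summable fun r : ℤ => cexp (2 * π * I * (r - κ : ℝ) * b / k) *
      ∫ x : ℝ, cotGauss α k w μ (r - κ) x) :
    ∑' j : ℤ, cexp (2 * π * I * κ * j) * cotGauss α k w μ 0 (k * j + b) =
      1 / k * ∑' r : ℤ, cexp (2 * π * I * (r - κ : ℝ) * b / k) *
        ∫ x : ℝ, cotGauss α k w μ (r - κ) x := by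
  have hk' : (k : ℂ) ≠ 0 := by exact_mod_cast hk.ne'
  have hkr : (0 : ℝ) < k := by exact_mod_cast hk
  set f : ℝ → ℂ := fun t => cexp (2 * π * I * κ * t) *
    cotGauss α k w μ 0 ((k * t + b : ℝ) : ℂ) with hf
  have hcont : Continuous f := by
    have := (continuous_cotGauss (ρ := 0) hk hw h0).comp
      (by fun_prop : Continuous fun t : ℝ => k * t + b)
    exact Continuous.mul (by fun_prop) this
  have hfour : ∀ r : ℤ, FourierTransform.fourier f (r : ℝ) =
      1 / k * (cexp (2 * π * I * (r - κ : ℝ) * b / k) * ∫ x : ℝ, cotGauss α k w μ (r - κ) x) := by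
    intro r
    rw [Real.fourier_real_eq_integral_exp_smul]
    have e : ∀ t : ℝ, cexp (↑(-2 * π * t * r) * I) • f t =
        (fun y : ℝ => (fun x : ℝ => cexp (2 * π * I * (r - κ : ℝ) * b / k) *
          cotGauss α k w μ (r - κ) x) (y + b)) (k * t) := by
      intro t
      simp only [smul_eq_mul, hf]
      rw [← cotGauss_zero_mul, ← mul_assoc, ← Complex.exp_add, mul_comm]
      push_cast
      congr 2
      field_simp
      ring
    simp_rw [e]
    rw [Measure.integral_comp_mul_left (fun y : ℝ => (fun x : ℝ => cexp (2 * π * I * (r - κ : ℝ) *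
      b / k) * cotGauss α k w μ (r - κ) x) (y + b)) (k : ℝ), integral_add_right_eq_self
      (fun x : ℝ => cexp (2 * π * I * (r - κ : ℝ) * b / k) * cotGauss α k w μ (r - κ) x) b,
      integral_const_mul, abs_of_pos (by positivity), real_smul]
    push_cast
    rw [one_div]
  have hO : f =O[cocompact ℝ] fun x => |x| ^ (-(2 : ℝ)) := by
    obtain ⟨B, hB⟩ := cotGauss_decay (α := α) (μ := μ) (ρ := 0) hk hw h0
    have hB0 : 0 ≤ B := by
      have := (norm_nonneg _).trans (hB 0)
      simpa using this
    refine Asymptotics.IsBigO.of_bound (4 * B) ?_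
    have hev : ∀ᶠ t : ℝ in cocompact ℝ, max 1 (2 * |b|) ≤ ‖t‖ :=
      (tendsto_norm_cocompact_atTop (E := ℝ)).eventually (eventually_ge_atTop _)
    filter_upwards [hev] with t ht
    rw [Real.norm_eq_abs] at ht
    have ht1 : 1 ≤ |t| := (le_max_left _ _).trans ht
    have ht2 : 2 * |b| ≤ |t| := (le_max_right _ _).trans ht
    have n1 : ‖cexp (2 * π * I * κ * t)‖ = 1 := by
      rw [norm_exp]
      simp
    have hk1 : (1 : ℝ) ≤ k := by exact_mod_cast hk
    have h1 : |t| / 2 ≤ |k * t + b| := by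
      have := abs_sub_abs_le_abs_sub (k * t) (-b)
      rw [abs_neg, sub_neg_eq_add, abs_mul, abs_of_pos hkr] at this
      nlinarith
    simp only [hf]
    rw [norm_mul, n1, one_mul, Real.norm_of_nonneg (by positivity), Real.rpow_neg (abs_nonneg _),
      Real.rpow_two, ← div_eq_mul_inv]
    refine (hB _).trans ?_
    rw [div_le_div_iff₀ (by positivity) (by positivity)]
    have h2 : |t| ^ 2 / 4 ≤ (k * t + b) ^ 2 := by
      rw [← sq_abs (k * t + b)]
      nlinarith [abs_nonneg t]
    nlinarith
  have hS : Summable fun r : ℤ => FourierTransform.fourier f (r : ℝ) := by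
    simp_rw [hfour]
    exact hsum.mul_left _
  have key := Real.tsum_eq_tsum_fourier_of_rpow_decay_of_summable hcont (by norm_num) hO hS 0
  simp only [zero_add, QuotientAddGroup.mk_zero, fourier_eval_zero, mul_one] at key
  simp_rw [hfour] at key
  rw [tsum_mul_left] at key
  rw [← key]
  refine tsum_congr fun j => ?_
  simp only [hf]
  push_cast
  rfl

end

/-! ### The cotangent sum in terms of Gaussian integrals and residues -/

/-- The shift `κ` of the frequencies: `0` for even and `1/2` for odd `k`. -/
def freqShift (k : ℕ) : ℝ := ((k % 2 : ℕ) : ℝ) / 2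

/-- The weight `(-1)^{(k+1)n} e^{-2π i h' n² / k}`, a `k`-periodic function of `n`. -/
def gaussWeight (k : ℕ) (h' : ℤ) (n : ℤ) : ℂ :=
  (-1) ^ (((k : ℤ) + 1) * n) * cexp (-(2 * π * I * h' * n ^ 2 / k))

/-- The phase `e^{-2π i ρ h' n / k}`. -/
def linPhase (k : ℕ) (h' : ℤ) (ρ : ℝ) (n : ℤ) : ℂ := cexp (-(2 * π * I * ρ * h' * n / k))

/-- The contribution of the pole at position `k α - n` to the integral with frequency `r - κ`. -/
def resTerm (α : ℝ) (k : ℕ) (h' : ℤ) (w : ℂ) (n r : ℤ) : ℂ :=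
  gaussWeight k h' n * linPhase k h' (r - freqShift k) n *
    (stepSign (r - freqShift k) (k * α - n) * poleGauss k w (r - freqShift k) (k * α - n))

section
variable {α : ℝ} {k : ℕ} {w : ℂ} {h h' : ℤ}

lemma cexp_two_pi_int (n : ℤ) : cexp (2 * π * I * n) = 1 := by
  rw [mul_comm]
  exact Complex.exp_int_mul_two_pi_mul_I n

lemma cexp_eq_of_sub {x y : ℂ} (n : ℤ) (h : x = y + 2 * π * I * n) : cexp x = cexp y := by
  rw [h, Complex.exp_add, cexp_two_pi_int, mul_one]

lemma neg_one_zpow_eq_cexp (n : ℤ) : (-1 : ℂ) ^ n = cexp (π * I * n) := by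
  rw [mul_comm, Complex.exp_int_mul, Complex.exp_pi_mul_I]

lemma exists_int_freq_mul (hpar : Odd k → Even h') (r : ℤ) :
    ∃ N : ℤ, ((r - freqShift k : ℝ) : ℂ) * h' = N := by
  rcases Nat.even_or_odd k with hk | hk
  · refine ⟨r * h', ?_⟩
    simp [freqShift, Nat.even_iff.1 hk]
  · obtain ⟨t, ht⟩ := hpar hk
    refine ⟨r * h' - t, ?_⟩
    simp [freqShift, Nat.odd_iff.1 hk, ht]
    ring

lemma gaussWeight_periodic (hk : 0 < k) : Function.Periodic (gaussWeight k h') (k : ℤ) := by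
  intro n
  have hk' : (k : ℂ) ≠ 0 := by exact_mod_cast hk.ne'
  unfold gaussWeight
  congr 1
  · rw [mul_add, zpow_add₀ (by norm_num), mul_right_eq_self₀]
    left
    refine Even.neg_one_zpow ?_
    rw [mul_comm]
    exact Int.even_mul_succ_self k
  · refine cexp_eq_of_sub (-(h' * (2 * n + k))) ?_
    push_cast
    field_simp
    ring

lemma linPhase_periodic (hk : 0 < k) (hpar : Odd k → Even h') (r : ℤ) :
    Function.Periodic (linPhase k h' (r - freqShift k)) (k : ℤ) := by
  intro n
  have hk' : (k : ℂ) ≠ 0 := by exact_mod_cast hk.ne'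
  obtain ⟨N, hN⟩ := exists_int_freq_mul hpar r
  refine cexp_eq_of_sub (-N) ?_
  push_cast at hN ⊢
  rw [← hN]
  field_simp
  ring

lemma cotGauss_add_k (hk : 0 < k) (μ ρ : ℝ) (x : ℂ) :
    cotGauss α k w (μ + k) ρ x = cotGauss α k w μ ρ x := by
  have hk' : (k : ℂ) ≠ 0 := by exact_mod_cast hk.ne'
  unfold cotGauss
  congr 1
  rw [← cot_add_int_mul_pi _ 1]
  congr 1
  push_cast
  field_simp
  ring

lemma norm_gaussWeight (n : ℤ) : ‖gaussWeight k h' n‖ = 1 := by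
  unfold gaussWeight
  rw [norm_mul, norm_zpow, norm_neg, norm_one, one_zpow, one_mul, norm_exp]
  have : -(2 * π * I * h' * n ^ 2 / k : ℂ) = ((-(2 * π * h' * n ^ 2 / k) : ℝ) : ℂ) * I := by
    push_cast; ring
  rw [this, re_ofReal_mul, I_re, mul_zero, Real.exp_zero]

lemma norm_linPhase (ρ : ℝ) (n : ℤ) : ‖linPhase k h' ρ n‖ = 1 := by
  unfold linPhase
  rw [norm_exp]
  have : -(2 * π * I * ρ * h' * n / k : ℂ) = ((-(2 * π * ρ * h' * n / k) : ℝ) : ℂ) * I := by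
    push_cast; ring
  rw [this, re_ofReal_mul, I_re, mul_zero, Real.exp_zero]

lemma norm_poleGauss (ρ d : ℝ) :
    ‖poleGauss k w ρ d‖ = Real.exp (-(2 * π * (w⁻¹).re / k * (ρ * d - d ^ 2))) := by
  unfold poleGauss
  rw [norm_exp]
  have : (2 * π * ((d : ℂ) ^ 2 - ρ * d) / (w * k) : ℂ) =
      ((-(2 * π / k * (ρ * d - d ^ 2)) : ℝ) : ℂ) * w⁻¹ := by
    push_cast
    rw [div_eq_mul_inv, mul_inv]
    ring
  rw [this, re_ofReal_mul]
  congr 1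
  ring

lemma norm_stepSign_mul_le {K d₀ ρ d : ℝ} (hK : 0 < K) (hd : d₀ ≤ |d|) :
    ‖stepSign ρ d‖ * Real.exp (-(K * (ρ * d - d ^ 2))) ≤
      Real.exp (-(K * d₀ / 4 * |ρ|)) * Real.exp (-(K * d₀ / 2 * |d|)) := by
  have key : ∀ ρ d : ℝ, d₀ ≤ d → 0 < d → 2 * d < ρ →
      -(K * (ρ * d - d ^ 2)) ≤ -(K * d₀ / 4 * ρ) + -(K * d₀ / 2 * d) := by
    intro ρ d h1 h2 h3
    have e1 : d₀ / 4 * ρ + d₀ / 2 * d ≤ ρ * d - d ^ 2 := by nlinarith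
    nlinarith
  rw [← Real.exp_add]
  unfold stepSign
  split_ifs with h1 h2
  · rw [norm_one, one_mul, Real.exp_le_exp, abs_of_pos h1.1, abs_of_pos (by linarith : 0 < ρ)]
    rw [abs_of_pos h1.1] at hd
    exact key ρ d hd h1.1 (by linarith)
  · rw [norm_neg, norm_one, one_mul, Real.exp_le_exp, abs_of_neg h2.2,
      abs_of_neg (by linarith : ρ < 0)]
    rw [abs_of_neg h2.2] at hd
    have := key (-ρ) (-d) hd (by linarith) (by linarith)
    nlinarith
  · rw [norm_zero, zero_mul]
    positivity

lemma exists_dist_int {x : ℝ} (hx : ∀ n : ℤ, x ≠ n) : ∃ d : ℝ, 0 < d ∧ ∀ n : ℤ, d ≤ |x - n| :=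
  ⟨|x - round x|, abs_pos.2 (sub_ne_zero.2 (hx _)), fun n => round_le x n⟩

/-- The residues decay exponentially in the position of the pole and in the frequency `ρ`, since the
positions of the poles keep a distance from `0` and a pole is passed only if `|ρ|` exceeds twice the
absolute value of its position. -/
lemma summable_resTerm (hk : 0 < k) (hw : 0 < w.re) (hα : ∀ n : ℤ, k * α ≠ n) :
    Summable fun p : ℤ × ℤ => resTerm α k h' w p.1 p.2 := by
  have hkr : (0 : ℝ) < k := by exact_mod_cast hk
  obtain ⟨d₀, hd₀, hd⟩ := exists_dist_int hα
  have hP := inv_re_pos hw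
  set K := 2 * π * (w⁻¹).re / k with hKdef
  have hK : 0 < K := by positivity
  have s1 := summable_exp_neg_abs_int (c := K * d₀ / 4) (by positivity) (freqShift k)
  have s2 := summable_exp_neg_abs_int (c := K * d₀ / 2) (by positivity) (k * α)
  refine Summable.of_norm_bounded (s2.mul_of_nonneg s1 (fun _ => (Real.exp_pos _).le)
    (fun _ => (Real.exp_pos _).le)) ?_
  rintro ⟨n, r⟩
  unfold resTerm
  simp only [norm_mul, norm_gaussWeight, norm_linPhase, norm_poleGauss, one_mul]
  refine (norm_stepSign_mul_le hK (hd n)).trans ?_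
  rw [mul_comm, abs_sub_comm (k * α) (n : ℝ)]

/-- Away from the poles, the saddle point integrals are uniformly bounded. -/
lemma exists_integral_cotGauss_bound (hk : 0 < k) (hw : 0 < w.re) {d : ℝ} (hd : 0 < d) :
    ∃ C : ℝ, ∀ μ : ℝ, (∀ n : ℤ, d ≤ |k * α - μ - k * n|) →
      ‖∫ x : ℝ, cotGauss α k w μ 0 x‖ ≤ C := by
  have hkr : (0 : ℝ) < k := by exact_mod_cast hk
  have hk' : (k : ℂ) ≠ 0 := by exact_mod_cast hk.ne'
  have hv : 0 < (w / k).re := by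
    rw [div_natCast_re]
    positivity
  have hβ : 0 < (2 * π * w / k).re := by
    have : (2 * π * w / k).re = 2 * π * (w / k).re := by
      rw [show 2 * π * w / k = ((2 * π : ℝ) : ℂ) * (w / k) by push_cast; ring, re_ofReal_mul]
    rw [this]
    positivity
  obtain ⟨M, hM0, hM⟩ := exists_cot_bound hv (η := d / k) (by positivity)
  obtain ⟨B, hB0, hB⟩ := exists_gaussian_strip_bound (γ := 0) hβ 0
  refine ⟨∫ x : ℝ, B * M * (1 + x ^ 2)⁻¹, fun μ hμ => ?_⟩
  refine norm_integral_le_of_norm_le (integrable_inv_one_add_sq.const_mul _)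
    (Eventually.of_forall fun x => ?_)
  have h1 := hB (x : ℂ) (by simp)
  have h2 : ‖Complex.cot (π * (α - (μ + I * w * x) / k))‖ ≤ M := by
    have hdist : ∀ n : ℤ, d / k ≤ |(α - μ / k) - n| := by
      intro n
      have h3 := hμ n
      have e : k * α - μ - k * n = (α - μ / k - n) * k := by field_simp
      rw [e, abs_mul, abs_of_pos hkr] at h3
      rwa [div_le_iff₀ hkr]
    have := hM (α - μ / k) x ⟨⌊α - μ / k⌋, ?_, ?_⟩
    · convert this using 3
      push_cast
      ring
    · have h3 := hdist ⌊α - μ / k⌋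
      rw [abs_of_nonneg (by linarith [Int.floor_le (α - μ / k)])] at h3
      linarith
    · have h3 := hdist (⌊α - μ / k⌋ + 1)
      rw [abs_of_nonpos (by push_cast; linarith [Int.lt_floor_add_one (α - μ / k)])] at h3
      push_cast at h3
      linarith
  have e : cotGauss α k w μ 0 x = cexp (-(2 * π * w / k * (x : ℂ) ^ 2) + 0 * x) *
      Complex.cot (π * (α - (μ + I * w * x) / k)) := by
    unfold cotGauss
    simp
  rw [e, norm_mul]
  simp only [ofReal_re] at h1
  calc _ ≤ B / (1 + x ^ 2) * M := mul_le_mul h1 h2 (norm_nonneg _) (by positivity)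
    _ = _ := by ring

/-- The contribution of the saddle point integral with frequency `r - κ`. -/
def saddleTerm (α : ℝ) (k : ℕ) (h' : ℤ) (w : ℂ) (n r : ℤ) : ℂ :=
  gaussWeight k h' n * linPhase k h' (r - freqShift k) n *
    (cexp (-(π * (r - freqShift k : ℝ) ^ 2 / (2 * w * k))) *
      ∫ x : ℝ, cotGauss α k w (n + (r - freqShift k) / 2) 0 x)

lemma summable_cexp_neg_sq (hk : 0 < k) (hw : 0 < w.re) (κ : ℝ) :
    Summable fun r : ℤ => ‖cexp (-(π * (r - κ : ℝ) ^ 2 / (2 * w * k)))‖ := by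
  have hkr : (0 : ℝ) < k := by exact_mod_cast hk
  have hP := inv_re_pos hw
  set K := π * (w⁻¹).re / (2 * k) with hKdef
  have hK : 0 < K := by positivity
  have s1 := (summable_exp_neg_abs_int (c := K * 2) (by positivity) κ).mul_left (Real.exp K)
  refine Summable.of_nonneg_of_le (fun _ => norm_nonneg _) (fun r => ?_) s1
  rw [norm_exp, ← Real.exp_add, Real.exp_le_exp]
  have : (-(π * (r - κ : ℝ) ^ 2 / (2 * w * k)) : ℂ) =
      ((-(π / (2 * k) * (r - κ) ^ 2) : ℝ) : ℂ) * w⁻¹ := by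
    push_cast
    rw [div_eq_mul_inv, mul_inv, mul_inv]
    ring
  rw [this, re_ofReal_mul]
  have h1 : 0 ≤ (|r - κ| - 1) ^ 2 := sq_nonneg _
  have h2 : |r - κ| ^ 2 = (r - κ) ^ 2 := sq_abs _
  have h3 : -(π / (2 * k) * (r - κ) ^ 2) * (w⁻¹).re = -(K * (r - κ) ^ 2) := by
    rw [hKdef]; ring
  rw [h3]
  nlinarith

lemma summable_saddleTerm (hk : 0 < k) (hw : 0 < w.re)
    (hα : ∀ n : ℤ, 2 * (k * α) + freqShift k ≠ n) (n : ℤ) :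
    Summable fun r : ℤ => saddleTerm α k h' w n r := by
  obtain ⟨d, hd, hdist⟩ := exists_dist_int hα
  obtain ⟨C, hC⟩ := exists_integral_cotGauss_bound (α := α) hk hw (half_pos hd)
  refine Summable.of_norm_bounded ((summable_cexp_neg_sq hk hw (freqShift k)).mul_right C) ?_
  intro r
  unfold saddleTerm
  rw [norm_mul, norm_mul, norm_mul, norm_gaussWeight, norm_linPhase, one_mul, one_mul]
  refine mul_le_mul_of_nonneg_left (hC _ fun m => ?_) (norm_nonneg _)
  have := hdist (2 * n + r + 2 * k * m)
  have e : k * α - (n + (r - freqShift k) / 2) - k * m =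
      (2 * (k * α) + freqShift k - ((2 * n + r + 2 * k * m : ℤ) : ℝ)) / 2 := by
    push_cast
    ring
  rw [e, abs_div, abs_two]
  linarith

/-- The substitution `n = h s` turns the weights, which involve `h'`, into the weights of the class of
`s` modulo `k` in the original sum, which involve `h`. -/
lemma weight_mul (hk : 0 < k) (hh : h * h' ≡ -1 [ZMOD k]) (hpar : Odd k → Even h') (s r : ℤ) :
    gaussWeight k h' (h * s) * linPhase k h' (r - freqShift k) (h * s) =
      (-1) ^ s * cexp (2 * π * I * h * s ^ 2 / k) *
        cexp (2 * π * I * (r - freqShift k : ℝ) * s / k) := by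
  have hk' : (k : ℂ) ≠ 0 := by exact_mod_cast hk.ne'
  obtain ⟨t, ht⟩ : ∃ t : ℤ, h * h' = -1 + k * t := by
    obtain ⟨t, ht⟩ := (Int.modEq_iff_dvd.1 hh.symm)
    exact ⟨t, by linarith⟩
  have htc : (h : ℂ) * h' = -1 + k * t := by exact_mod_cast ht
  unfold gaussWeight linPhase
  rw [neg_one_zpow_eq_cexp, neg_one_zpow_eq_cexp, ← Complex.exp_add, ← Complex.exp_add,
    ← Complex.exp_add, ← Complex.exp_add]
  have e1 : (-(2 * π * I * h' * ((h * s : ℤ) : ℂ) ^ 2 / k) : ℂ) =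
      2 * π * I * h * s ^ 2 / k - 2 * π * I * (t * h * s ^ 2) := by
    push_cast
    field_simp
    linear_combination (-(h : ℂ) * s ^ 2) * htc
  have e2 : (-(2 * π * I * (r - freqShift k : ℝ) * h' * ((h * s : ℤ) : ℂ) / k) : ℂ) =
      2 * π * I * (r - freqShift k : ℝ) * s / k - 2 * π * I * ((r - freqShift k : ℝ) * t * s) := by
    push_cast
    field_simp
    linear_combination (-((r : ℂ) - freqShift k) * s) * htc
  rw [e1, e2]
  rcases Nat.even_or_odd k with hke | hko
  · obtain ⟨j, hj⟩ := hke
    have hho : Odd h := by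
      rw [← Int.not_even_iff_odd]
      rintro ⟨u, hu⟩
      rw [hu, hj] at ht
      push_cast at ht
      have : (2 : ℤ) * (u * h' - j * t) = -1 := by linarith
      omega
    obtain ⟨u, hu⟩ := hho
    refine cexp_eq_of_sub (j * h * s + u * s - t * h * s ^ 2 - r * t * s) ?_
    have : freqShift k = 0 := by simp [freqShift, hj, ← two_mul]
    rw [this, hu, hj]
    push_cast
    ring
  · obtain ⟨j, hj⟩ := hko
    obtain ⟨u, hu⟩ := hpar ⟨j, hj⟩
    have hto : Odd t := by
      rw [← Int.not_even_iff_odd]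
      rintro ⟨v, hv⟩
      rw [hu, hv] at ht
      have : (2 : ℤ) * (h * u - k * v) = -1 := by linarith
      omega
    obtain ⟨v, hv⟩ := hto
    refine cexp_eq_of_sub (j * h * s + h * s - t * h * s ^ 2 - r * t * s + v * s) ?_
    have : freqShift k = 1 / 2 := by
      rw [freqShift, hj]
      norm_num [Nat.add_mod]
    rw [this, hv, hj]
    push_cast
    ring

lemma cexp_freqShift (j : ℤ) : cexp (2 * π * I * freqShift k * j) = (-1) ^ ((k : ℤ) * j) := by
  rw [neg_one_zpow_eq_cexp]
  rcases Nat.even_or_odd k with ⟨u, hu⟩ | ⟨u, hu⟩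
  · refine cexp_eq_of_sub (-(u * j)) ?_
    simp only [freqShift, hu, ← two_mul, Nat.mul_mod_right]
    push_cast
    ring
  · refine cexp_eq_of_sub (-(u * j)) ?_
    have : freqShift k = 1 / 2 := by
      rw [freqShift, hu]
      norm_num [Nat.add_mod]
    rw [this, hu]
    push_cast
    ring

/-- The cotangent sum `∑ (-1)^n q^{n²} cot π(α - n z)`, whose product with
`tan (π α) / ∑ (-1)^n q^{n²}` is the rank generating function. -/
def cotTerm (α : ℝ) (z : ℂ) (n : ℤ) : ℂ :=
  (-1) ^ n * qpow z ((n : ℂ) ^ 2) * Complex.cot (π * (α - n * z))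

lemma cotTerm_residue (hk : 0 < k) {z : ℂ} (hz : z = (h + I * w) / k) (j s : ℤ) :
    cotTerm α z (k * j + s) = (-1) ^ s * cexp (2 * π * I * h * s ^ 2 / k) *
      (cexp (2 * π * I * freqShift k * j) * cotGauss α k w ((h * s : ℤ) : ℝ) 0 (k * j + (s : ℝ))) := by
  have hk' : (k : ℂ) ≠ 0 := by exact_mod_cast hk.ne'
  unfold cotTerm cotGauss qpow
  rw [cexp_freqShift, zpow_add₀ (by norm_num)]
  have e1 : Complex.cot (π * (α - ((k * j + s : ℤ) : ℂ) * z)) =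
      Complex.cot (π * (α - (((h * s : ℤ) : ℝ) + I * w * (k * j + (s : ℝ))) / k)) := by
    rw [← cot_add_int_mul_pi _ (h * j), hz]
    congr 1
    push_cast
    field_simp
    ring
  have e2 : cexp (2 * π * I * ((k * j + s : ℤ) : ℂ) ^ 2 * z) =
      cexp (2 * π * I * h * s ^ 2 / k) * cexp (-(2 * π * w / k * (k * j + (s : ℝ)) ^ 2) +
        -(2 * π * I * (0 : ℝ) / k) * (k * j + (s : ℝ))) := by
    rw [← Complex.exp_add]
    refine cexp_eq_of_sub (h * (k * j ^ 2 + 2 * j * s)) ?_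
    rw [hz]
    push_cast
    field_simp
    ring_nf
    rw [I_sq]
    ring
  rw [e1, e2]
  ring

lemma cotPos_ne (hα : ∀ n : ℤ, k * α ≠ n) (ν m : ℤ) : k * (α + m) - (ν : ℝ) ≠ 0 := by
  intro h0
  apply hα (ν - k * m)
  push_cast
  linarith

lemma summable_cotTerm (hk : 0 < k) (hw : 0 < w.re) (hα : ∀ n : ℤ, k * α ≠ n) {z : ℂ}
    (hz : z = (h + I * w) / k) : Summable (cotTerm α z) := by
  have : NeZero k := ⟨hk.ne'⟩
  have hkr : (0 : ℝ) < k := by exact_mod_cast hk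
  have h1 : ∀ s : ℕ, Summable fun j : ℤ => cotTerm α z (k * j + s) := by
    intro s
    have e := fun j : ℤ => cotTerm_residue (α := α) hk hz j s
    push_cast at e
    simp_rw [e]
    refine Summable.mul_left _ ?_
    obtain ⟨B, hB⟩ := cotGauss_decay (μ := ((h * s : ℤ) : ℝ)) (ρ := 0) hk hw
      (fun m => cotPos_ne hα (h * s) m)
    have hB0 : 0 ≤ B := by
      have := (norm_nonneg _).trans (hB 0)
      simpa using this
    have hsum : Summable fun n : ℤ => B / (1 + (n : ℝ) ^ 2) := by
      refine Summable.of_norm_bounded_eventually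
        ((Real.summable_one_div_int_pow (p := 2)).2 one_lt_two |>.mul_left B) ?_
      filter_upwards [(Set.finite_singleton (0 : ℤ)).compl_mem_cofinite] with n hn
      have hn' : (n : ℝ) ≠ 0 := by exact_mod_cast hn
      have : 0 < (n : ℝ) ^ 2 := by positivity
      rw [Real.norm_of_nonneg (by positivity), mul_one_div]
      gcongr
      linarith
    have hsum2 := summable_residue hk hsum s
    refine Summable.of_norm_bounded hsum2 fun j => ?_
    have n1 : ‖cexp (2 * π * I * freqShift k * j)‖ = 1 := by
      rw [cexp_freqShift]
      simp
    rw [norm_mul, n1, one_mul]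
    have := hB (k * j + s)
    push_cast at this ⊢
    exact this
  have e : ∀ p : ℤ × Fin k, cotTerm α z ((Int.divModEquiv k).symm p) =
      cotTerm α z (k * p.1 + (p.2 : ℕ)) := by
    rintro ⟨j, s⟩
    rw [Int.divModEquiv_symm_apply]
    congr 1
    simp
    ring
  refine (Int.divModEquiv k).symm.summable_iff.1 ?_
  refine (Equiv.prodComm (Fin k) ℤ).summable_iff.1 ?_
  refine summable_norm_iff.1 ?_
  refine (summable_prod_of_nonneg fun _ => norm_nonneg _).2 ⟨fun s => ?_, ?_⟩
  · have := (h1 (s : ℕ)).norm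
    refine this.congr fun j => ?_
    simp only [Function.comp, Equiv.prodComm_apply, Prod.swap, e]
  · exact (hasSum_fintype _).summable

/-- The contribution of the class `ν` and the frequency `r - κ` in the Poisson summation formula. -/
def freqTerm (α : ℝ) (k : ℕ) (h' : ℤ) (w : ℂ) (ν r : ℤ) : ℂ :=
  gaussWeight k h' ν * linPhase k h' (r - freqShift k) ν *
    ∫ x : ℝ, cotGauss α k w ν (r - freqShift k) x

lemma summable_resTerm_class (hk : 0 < k) (hw : 0 < w.re) (hα : ∀ n : ℤ, k * α ≠ n) (ν : ℤ) :
    Summable fun p : ℤ × ℤ => resTerm α k h' w (ν - k * p.2) p.1 := by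
  have hinj : Function.Injective fun p : ℤ × ℤ => ((ν - k * p.2, p.1) : ℤ × ℤ) := by
    have hkz : (k : ℤ) ≠ 0 := by exact_mod_cast hk.ne'
    rintro ⟨a, b⟩ ⟨c, d⟩ h0
    have h1 : ν - k * b = ν - k * d := congrArg Prod.fst h0
    have h2 : a = c := congrArg Prod.snd h0
    rw [h2, mul_left_cancel₀ hkz (sub_right_injective h1)]
  have h1 := Summable.comp_injective (f := fun p : ℤ × ℤ => resTerm α k h' w p.1 p.2)
    (summable_resTerm hk hw hα) hinj
  simpa only [Function.comp_def] using h1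

lemma freqTerm_eq (hk : 0 < k) (hw : 0 < w.re) (hpar : Odd k → Even h')
    (hα : ∀ n : ℤ, k * α ≠ n) (hα2 : ∀ n : ℤ, 2 * (k * α) + freqShift k ≠ n) (ν r : ℤ) :
    freqTerm α k h' w ν r = saddleTerm α k h' w ν r +
      2 * k / w * ∑' m : ℤ, resTerm α k h' w (ν - k * m) r := by
  unfold freqTerm saddleTerm
  rw [integral_cotGauss_eq hk hw (cotPos_ne hα ν), mul_add]
  · congr 1
    rw [mul_left_comm, ← tsum_mul_left]
    congr 1
    refine tsum_congr fun m => ?_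
    unfold resTerm
    have g1 : gaussWeight k h' (ν - k * m) = gaussWeight k h' ν := by
      rw [mul_comm]
      exact (gaussWeight_periodic (h' := h') hk).sub_int_mul_eq (x := ν) m
    have g2 : linPhase k h' (r - freqShift k) (ν - k * m) = linPhase k h' (r - freqShift k) ν := by
      rw [mul_comm]
      exact (linPhase_periodic hk hpar r).sub_int_mul_eq (x := ν) m
    rw [g1, g2]
    have : k * (α + m) - (ν : ℝ) = k * α - ((ν - k * m : ℤ) : ℝ) := by push_cast; ring
    rw [this]
  · intro m h0
    apply hα2 (2 * ν + r - 2 * k * m)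
    push_cast
    linarith

lemma summable_freqTerm (hk : 0 < k) (hw : 0 < w.re) (hpar : Odd k → Even h')
    (hα : ∀ n : ℤ, k * α ≠ n) (hα2 : ∀ n : ℤ, 2 * (k * α) + freqShift k ≠ n) (ν : ℤ) :
    Summable (freqTerm α k h' w ν) := by
  have := (summable_saddleTerm (h' := h') hk hw hα2 ν).add
    (((summable_resTerm_class (h' := h') hk hw hα ν).prod).mul_left (2 * k / w))
  refine this.congr fun r => ?_
  rw [freqTerm_eq hk hw hpar hα hα2]

lemma freqTerm_periodic (hk : 0 < k) (hpar : Odd k → Even h') (r : ℤ) :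
    Function.Periodic (fun ν => freqTerm α k h' w ν r) (k : ℤ) := by
  intro ν
  unfold freqTerm
  simp only
  rw [gaussWeight_periodic hk, linPhase_periodic hk hpar r]
  congr 2
  ext x
  have : ((ν + k : ℤ) : ℝ) = (ν : ℝ) + k := by push_cast; ring
  rw [this, cotGauss_add_k hk]

lemma freqTerm_mul (hk : 0 < k) (hh : h * h' ≡ -1 [ZMOD k]) (hpar : Odd k → Even h') (s r : ℤ) :
    freqTerm α k h' w (h * s) r = (-1) ^ s * cexp (2 * π * I * h * s ^ 2 / k) *
      (cexp (2 * π * I * (r - freqShift k : ℝ) * (s : ℝ) / k) *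
        ∫ x : ℝ, cotGauss α k w ((h * s : ℤ) : ℝ) (r - freqShift k) x) := by
  unfold freqTerm
  rw [weight_mul hk hh hpar s r, mul_assoc _ _ (∫ _, _)]
  push_cast
  rfl

lemma tsum_cotTerm_class (hk : 0 < k) (hw : 0 < w.re) (hh : h * h' ≡ -1 [ZMOD k])
    (hpar : Odd k → Even h') (hα : ∀ n : ℤ, k * α ≠ n)
    (hα2 : ∀ n : ℤ, 2 * (k * α) + freqShift k ≠ n) {z : ℂ} (hz : z = (h + I * w) / k) (s : ℤ) :
    ∑' j : ℤ, cotTerm α z (k * j + s) = 1 / k * ∑' r : ℤ, freqTerm α k h' w (h * s) r := by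
  simp_rw [cotTerm_residue (α := α) hk hz]
  have hc0 : ((-1) ^ s * cexp (2 * π * I * h * s ^ 2 / k) : ℂ) ≠ 0 :=
    mul_ne_zero (zpow_ne_zero _ (by norm_num)) (Complex.exp_ne_zero _)
  have hsum' : Summable fun r : ℤ => cexp (2 * π * I * (r - freqShift k : ℝ) * (s : ℝ) / k) *
      ∫ x : ℝ, cotGauss α k w ((h * s : ℤ) : ℝ) (r - freqShift k) x := by
    refine (summable_mul_left_iff hc0).1
      ((summable_freqTerm (h' := h') hk hw hpar hα hα2 (h * s)).congr fun r => ?_)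
    rw [freqTerm_mul hk hh hpar]
  rw [tsum_mul_left, tsum_cotGauss_eq (α := α) hk hw (cotPos_ne hα (h * s)) (freqShift k) (s : ℝ)
    hsum']
  simp_rw [freqTerm_mul hk hh hpar]
  rw [tsum_mul_left, mul_left_comm]

lemma tsum_freqTerm (hk : 0 < k) (hw : 0 < w.re) (hpar : Odd k → Even h')
    (hα : ∀ n : ℤ, k * α ≠ n) (hα2 : ∀ n : ℤ, 2 * (k * α) + freqShift k ≠ n) (ν : ℤ) :
    ∑' r : ℤ, freqTerm α k h' w ν r = (∑' r : ℤ, saddleTerm α k h' w ν r) +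
      2 * k / w * ∑' j : ℤ, ∑' r : ℤ, resTerm α k h' w (k * j + ν) r := by
  have hs := summable_resTerm_class (h' := h') hk hw hα ν
  simp_rw [freqTerm_eq hk hw hpar hα hα2]
  rw [Summable.tsum_add (summable_saddleTerm (h' := h') hk hw hα2 ν)
    (hs.prod.mul_left (2 * k / w)), tsum_mul_left]
  congr 2
  rw [← (Equiv.neg ℤ).tsum_eq (fun j : ℤ => ∑' r : ℤ, resTerm α k h' w (k * j + ν) r)]
  have hcomm := hs.tsum_comm (f := fun r m => resTerm α k h' w (ν - k * m) r)
  rw [← hcomm]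
  refine tsum_congr fun m => tsum_congr fun r => ?_
  have : ν - k * m = k * (Equiv.neg ℤ) m + ν := by
    simp only [Equiv.neg_apply]
    ring
  rw [this]

/-- The cotangent sum as a sum of saddle point integrals and residues, for `α` in general
position. -/
theorem tsum_cotTerm_eq (hk : 0 < k) (hw : 0 < w.re) (hh : h * h' ≡ -1 [ZMOD k])
    (hpar : Odd k → Even h') (hα : ∀ n : ℤ, k * α ≠ n)
    (hα2 : ∀ n : ℤ, 2 * (k * α) + freqShift k ≠ n) {z : ℂ} (hz : z = (h + I * w) / k) :
    ∑' n : ℤ, cotTerm α z n =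
      1 / k * (∑ ν ∈ Finset.range k, ∑' r : ℤ, saddleTerm α k h' w ν r) +
        2 / w * ∑' n : ℤ, ∑' r : ℤ, resTerm α k h' w n r := by
  have hk' : (k : ℂ) ≠ 0 := by exact_mod_cast hk.ne'
  have hEper : Function.Periodic (fun ν : ℤ => ∑' r : ℤ, freqTerm α k h' w ν r) (k : ℤ) :=
    fun ν => tsum_congr fun r => freqTerm_periodic hk hpar r ν
  rw [tsum_eq_sum_range_tsum hk (summable_cotTerm hk hw hα hz),
    Finset.sum_congr rfl fun (s : ℕ) _ => tsum_cotTerm_class hk hw hh hpar hα hα2 hz (s : ℤ),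
    ← Finset.mul_sum, sum_range_mul hk hEper hh,
    Finset.sum_congr rfl fun (s : ℕ) _ => tsum_freqTerm (h' := h') hk hw hpar hα hα2 (s : ℤ),
    Finset.sum_add_distrib, mul_add, ← Finset.mul_sum,
    tsum_eq_sum_range_tsum hk ((summable_resTerm (h' := h') hk hw hα).prod)]
  congr 1
  rw [← mul_assoc]
  congr 1
  field_simp

end

/-! ### Summing the residues and the saddle point terms -/

/-- The logarithm of the ratio of the geometric series formed by the residues at the pole in
position `k α - n`. -/
def resRatioLog (α : ℝ) (k : ℕ) (h' : ℤ) (w : ℂ) (n : ℤ) : ℂ :=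
  -(2 * π * I * h' * n / k) - 2 * π * (k * α - n : ℝ) / (w * k)

/-- The sum of the residues at the pole in position `k α - n`, where `R - κ` is the least admissible
frequency greater than `2 k α`. -/
def resSum (α : ℝ) (k : ℕ) (h' : ℤ) (w : ℂ) (R n : ℤ) : ℂ :=
  gaussWeight k h' n * cexp (2 * π * (k * α - n : ℝ) ^ 2 / (w * k) +
    (R - 2 * n - freqShift k : ℝ) * resRatioLog α k h' w n) / (1 - cexp (resRatioLog α k h' w n))

section
variable {α : ℝ} {k : ℕ} {w : ℂ} {h h' : ℤ}

lemma norm_cexp_resRatioLog (n : ℤ) :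
    ‖cexp (resRatioLog α k h' w n)‖ = Real.exp (-(2 * π * (w⁻¹).re / k * (k * α - n))) := by
  have : resRatioLog α k h' w n = ((-(2 * π * h' * n / k) : ℝ) : ℂ) * I +
      ((-(2 * π / k * (k * α - n)) : ℝ) : ℂ) * w⁻¹ := by
    unfold resRatioLog
    push_cast
    rw [div_eq_mul_inv (2 * (π : ℂ) * (k * α - n)), mul_inv]
    ring
  rw [norm_exp, this, add_re, re_ofReal_mul, re_ofReal_mul, I_re, mul_zero, zero_add]
  congr 1
  ring

lemma linPhase_mul_poleGauss (ρ : ℝ) (n : ℤ) :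
    linPhase k h' ρ n * poleGauss k w ρ (k * α - n) =
      cexp (2 * π * (k * α - n : ℝ) ^ 2 / (w * k) + ρ * resRatioLog α k h' w n) := by
  unfold linPhase poleGauss resRatioLog
  rw [← Complex.exp_add]
  congr 1
  push_cast
  ring

lemma tsum_resTerm (hk : 0 < k) (hw : 0 < w.re) (hα : ∀ n : ℤ, k * α ≠ n) {R : ℤ}
    (hR1 : R - 1 < 2 * (k * α) + freqShift k) (hR2 : 2 * (k * α) + freqShift k < R) (n : ℤ) :
    ∑' r : ℤ, resTerm α k h' w n r = resSum α k h' w R n := by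
  have hkr : (0 : ℝ) < k := by exact_mod_cast hk
  have hP := inv_re_pos hw
  set ξ := resRatioLog α k h' w n with hξ
  set d : ℝ := k * α - n with hd
  have hd0 : d ≠ 0 := sub_ne_zero.2 (hα n)
  set G : ℂ := 2 * π * (d : ℂ) ^ 2 / (w * k) with hG
  have hterm : ∀ r : ℤ, resTerm α k h' w n r = gaussWeight k h' n *
      (stepSign (r - freqShift k) d * cexp (G + (r - freqShift k : ℝ) * ξ)) := by
    intro r
    unfold resTerm
    rw [mul_assoc, mul_left_comm (linPhase _ _ _ _), linPhase_mul_poleGauss]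
  have hnorm : ‖cexp ξ‖ = Real.exp (-(2 * π * (w⁻¹).re / k * d)) := norm_cexp_resRatioLog n
  simp_rw [hterm]
  rw [tsum_mul_left, resSum, ← hξ, ← hd, ← hG, mul_div_assoc]
  congr 1
  have hne : ∀ {x : ℂ}, ‖x‖ < 1 → 1 - x ≠ 0 := by
    intro x hx h0
    rw [sub_eq_zero] at h0
    rw [← h0, norm_one] at hx
    exact lt_irrefl _ hx
  rcases lt_or_gt_of_ne hd0 with hneg | hpos
  · have hlt : ‖cexp (-ξ)‖ < 1 := by
      rw [Complex.exp_neg, norm_inv, hnorm, ← Real.exp_neg, Real.exp_lt_one_iff, neg_neg]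
      exact mul_neg_of_pos_of_neg (by positivity) hneg
    have hinj : Function.Injective fun j : ℕ => R - 2 * n - 1 - (j : ℤ) := by
      intro a b hab
      have : (a : ℤ) = b := sub_right_injective hab
      exact_mod_cast this
    rw [← hinj.tsum_eq]
    · have e : ∀ j : ℕ, stepSign ((R - 2 * n - 1 - (j : ℤ) : ℤ) - freqShift k) d *
          cexp (G + (((R - 2 * n - 1 - (j : ℤ) : ℤ) : ℝ) - freqShift k : ℝ) * ξ) =
          -(cexp (G + (R - 2 * n - freqShift k : ℝ) * ξ) * cexp (-ξ)) * cexp (-ξ) ^ j := by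
        intro j
        have hs : stepSign ((R - 2 * n - 1 - (j : ℤ) : ℤ) - freqShift k) d = -1 := by
          rw [stepSign, if_neg (by rintro ⟨g1, g2⟩; linarith), if_pos]
          refine ⟨?_, hneg⟩
          push_cast
          rw [hd]
          have : (0 : ℝ) ≤ j := Nat.cast_nonneg j
          linarith
        rw [hs, ← Complex.exp_nat_mul, neg_mul, neg_mul, one_mul, ← Complex.exp_add,
          ← Complex.exp_add]
        congr 2
        push_cast
        ring
      simp only [e]
      rw [tsum_mul_left, tsum_geometric_of_norm_lt_one hlt]
      have h1 := hne hlt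
      have h2 : 1 - cexp ξ ≠ 0 := by
        intro h0
        apply h1
        rw [Complex.exp_neg, ← sub_eq_zero.1 h0, inv_one, sub_self]
      have h3 : cexp ξ * cexp (-ξ) = 1 := by rw [← Complex.exp_add, add_neg_cancel, Complex.exp_zero]
      field_simp
      linear_combination h3
    · intro r hr
      by_contra hcon
      apply hr
      have hr2 : R - 2 * n ≤ r := by
        by_contra hlt'
        refine hcon ⟨(R - 2 * n - 1 - r).toNat, ?_⟩
        simp only
        omega
      have hr3 : ((R - 2 * n : ℤ) : ℝ) ≤ r := by exact_mod_cast hr2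
      push_cast at hr3
      simp only
      rw [stepSign, if_neg (by rintro ⟨g1, g2⟩; linarith), if_neg, zero_mul]
      rintro ⟨g1, g2⟩
      rw [hd] at g1
      linarith
  · have hlt : ‖cexp ξ‖ < 1 := by
      rw [hnorm, Real.exp_lt_one_iff, neg_lt_zero]
      positivity
    have hinj : Function.Injective fun j : ℕ => R - 2 * n + (j : ℤ) := by
      intro a b hab
      have : (a : ℤ) = b := add_right_injective _ hab
      exact_mod_cast this
    rw [← hinj.tsum_eq]
    · have e : ∀ j : ℕ, stepSign ((R - 2 * n + (j : ℤ) : ℤ) - freqShift k) d *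
          cexp (G + (((R - 2 * n + (j : ℤ) : ℤ) : ℝ) - freqShift k : ℝ) * ξ) =
          cexp (G + (R - 2 * n - freqShift k : ℝ) * ξ) * cexp ξ ^ j := by
        intro j
        have hs : stepSign ((R - 2 * n + (j : ℤ) : ℤ) - freqShift k) d = 1 := by
          rw [stepSign, if_pos]
          refine ⟨hpos, ?_⟩
          push_cast
          rw [hd]
          have : (0 : ℝ) ≤ j := Nat.cast_nonneg j
          linarith
        rw [hs, ← Complex.exp_nat_mul, one_mul, ← Complex.exp_add]
        congr 1
        push_cast
        ring
      simp only [e]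
      rw [tsum_mul_left, tsum_geometric_of_norm_lt_one hlt, div_eq_mul_inv]
    · intro r hr
      by_contra hcon
      apply hr
      have hr2 : r ≤ R - 2 * n - 1 := by
        by_contra hlt'
        refine hcon ⟨(r - (R - 2 * n)).toNat, ?_⟩
        simp only
        omega
      have hr3 : (r : ℝ) ≤ ((R - 2 * n - 1 : ℤ) : ℝ) := by exact_mod_cast hr2
      push_cast at hr3
      simp only
      rw [stepSign, if_neg, if_neg (by rintro ⟨g1, g2⟩; linarith), zero_mul]
      rintro ⟨g1, g2⟩
      rw [hd] at g2
      linarith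

/-- The terms of the theta series that multiplies the saddle point integrals. -/
def thetaTerm (k : ℕ) (h' : ℤ) (w : ℂ) (σ : ℝ) (n : ℤ) : ℂ :=
  (-1) ^ (((k : ℤ) + 1) * n) * cexp (2 * π * I * h' * (n ^ 2 + σ * n) / k -
    2 * π * (n + σ / 2) ^ 2 / (w * k))

/-- The combination of saddle point integrals attached to the frequencies congruent to `σ` modulo
two. -/
def saddleSum (α : ℝ) (k : ℕ) (h' : ℤ) (w : ℂ) (σ : ℝ) : ℂ :=
  ∑ μ ∈ Finset.range k, gaussWeight k h' μ * linPhase k h' σ μ *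
    ∫ x : ℝ, cotGauss α k w (μ + σ / 2) 0 x

lemma saddleTerm_eq (hk : 0 < k) (n s ν : ℤ) :
    saddleTerm α k h' w ν (2 * n + s) = thetaTerm k h' w (s - freqShift k) n *
      (fun μ : ℤ => gaussWeight k h' μ * linPhase k h' (s - freqShift k) μ *
        ∫ x : ℝ, cotGauss α k w (μ + (s - freqShift k) / 2) 0 x) (ν + n) := by
  have hk' : (k : ℂ) ≠ 0 := by exact_mod_cast hk.ne'
  have hJ : (ν : ℝ) + (((2 * n + s : ℤ) : ℝ) - freqShift k) / 2 =
      ((ν + n : ℤ) : ℝ) + (s - freqShift k) / 2 := by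
    push_cast
    ring
  unfold saddleTerm
  rw [hJ]
  simp only
  rw [← mul_assoc, ← mul_assoc]
  congr 1
  unfold gaussWeight linPhase thetaTerm
  have hs : (-1 : ℂ) ^ (((k : ℤ) + 1) * ν) = (-1) ^ (((k : ℤ) + 1) * n) *
      (-1) ^ (((k : ℤ) + 1) * (ν + n)) := by
    rw [← zpow_add₀ (by norm_num)]
    rw [show ((k : ℤ) + 1) * n + (k + 1) * (ν + n) = (k + 1) * ν + 2 * ((k + 1) * n) by ring,
      zpow_add₀ (by norm_num), zpow_mul (-1 : ℂ) 2]
    norm_num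
  rw [hs]
  have e : ∀ A B x1 x2 x3 y1 y2 y3 : ℂ, x1 + x2 + x3 = y1 + y2 + y3 →
      A * B * cexp x1 * cexp x2 * cexp x3 = A * cexp y1 * (B * cexp y2) * cexp y3 := by
    intro A B x1 x2 x3 y1 y2 y3 hxy
    have : cexp x1 * cexp x2 * cexp x3 = cexp y1 * cexp y2 * cexp y3 := by
      rw [← Complex.exp_add, ← Complex.exp_add, hxy, Complex.exp_add, Complex.exp_add]
    linear_combination (A * B) * this
  rw [← mul_assoc]
  apply e
  push_cast
  rcases eq_or_ne w 0 with hw | hw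
  · subst hw
    simp only [mul_zero, zero_mul, div_zero]
    field_simp
    ring
  · field_simp
    ring

/-- The saddle point integrals depend only on the class `ν + r / 2`. Sorting the frequencies by
parity therefore splits off a theta series. -/
theorem sum_saddleTerm (hk : 0 < k) (hw : 0 < w.re) (hpar : Odd k → Even h')
    (hα2 : ∀ n : ℤ, 2 * (k * α) + freqShift k ≠ n) :
    ∑ ν ∈ Finset.range k, ∑' r : ℤ, saddleTerm α k h' w ν r =
      ∑ s ∈ Finset.range 2, (∑' n : ℤ, thetaTerm k h' w (s - freqShift k) n) *
        saddleSum α k h' w (s - freqShift k) := by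
  have hsum := summable_saddleTerm (h' := h') hk hw hα2
  have e1 : ∀ ν : ℤ, ∑' r : ℤ, saddleTerm α k h' w ν r =
      ∑ s ∈ Finset.range 2, ∑' n : ℤ, saddleTerm α k h' w ν ((2 : ℕ) * n + s) :=
    fun ν => tsum_eq_sum_range_tsum two_pos (hsum ν)
  simp_rw [e1]
  rw [Finset.sum_comm]
  refine Finset.sum_congr rfl fun s _ => ?_
  have e3 := Summable.tsum_finsetSum (s := Finset.range k)
    (f := fun (ν : ℕ) (n : ℤ) => saddleTerm α k h' w ν ((2 : ℕ) * n + s))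
    fun ν _ => summable_residue two_pos (hsum ν) s
  rw [← e3, ← tsum_mul_right]
  refine tsum_congr fun n => ?_
  set g : ℤ → ℂ := fun μ : ℤ => gaussWeight k h' μ * linPhase k h' ((s : ℤ) - freqShift k) μ *
        ∫ x : ℝ, cotGauss α k w (μ + ((s : ℤ) - freqShift k) / 2) 0 x with hg
  have hgper : Function.Periodic g (k : ℤ) := by
    intro μ
    simp only [hg]
    rw [gaussWeight_periodic hk, linPhase_periodic hk hpar s]
    congr 2
    ext x
    rw [← cotGauss_add_k hk (μ + ((s : ℤ) - freqShift k) / 2)]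
    congr 1
    push_cast
    ring
  have e2 : ∀ ν : ℤ, saddleTerm α k h' w ν ((2 : ℕ) * n + s) =
      thetaTerm k h' w ((s : ℤ) - freqShift k) n * g (ν + n) :=
    fun ν => saddleTerm_eq hk n s ν
  simp_rw [e2]
  rw [← Finset.mul_sum, sum_range_add hk hgper]
  simp [hg, saddleSum]

/-- The transformation of the cotangent sum for `α` in general position. -/
theorem tsum_cotTerm_generic (hk : 0 < k) (hw : 0 < w.re) (hh : h * h' ≡ -1 [ZMOD k])
    (hpar : Odd k → Even h') (hα : ∀ n : ℤ, k * α ≠ n) {R : ℤ}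
    (hR1 : R - 1 < 2 * (k * α) + freqShift k) (hR2 : 2 * (k * α) + freqShift k < R)
    {z : ℂ} (hz : z = (h + I * w) / k) :
    ∑' n : ℤ, cotTerm α z n =
      1 / k * (∑ s ∈ Finset.range 2, (∑' n : ℤ, thetaTerm k h' w (s - freqShift k) n) *
        saddleSum α k h' w (s - freqShift k)) + 2 / w * ∑' n : ℤ, resSum α k h' w R n := by
  have hα2 : ∀ n : ℤ, 2 * (k * α) + freqShift k ≠ n := by
    intro n hn
    rw [hn] at hR1 hR2
    have h1 : R - 1 < n := by exact_mod_cast hR1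
    have h2 : n < R := by exact_mod_cast hR2
    omega
  rw [tsum_cotTerm_eq hk hw hh hpar hα hα2 hz, sum_saddleTerm hk hw hpar hα2]
  simp_rw [tsum_resTerm hk hw hα hR1 hR2]

end

/-! ### Continuity in `α` and one-sided limits -/

/-- Dominated convergence for series, where finitely many terms need not be dominated. -/
lemma tendsto_tsum_of_dominated_off_finset {ι β : Type*} [DecidableEq β] {l : Filter ι}
    {f : ι → β → ℂ} {g : β → ℂ} {b : β → ℝ} (S : Finset β) (hb : Summable b)
    (hfg : ∀ n, Tendsto (fun a => f a n) l (𝓝 (g n)))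
    (hbound : ∀ᶠ a in l, ∀ n ∉ S, ‖f a n‖ ≤ b n) :
    Tendsto (fun a => ∑' n, f a n) l (𝓝 (∑' n, g n)) := by
  have hS : Summable fun n => if n ∈ S then ‖g n‖ + 1 else b n := by
    refine hb.congr_cofinite ?_
    filter_upwards [S.finite_toSet.compl_mem_cofinite] with n hn
    rw [if_neg (by simpa using hn)]
  refine tendsto_tsum_of_dominated_convergence hS hfg ?_
  have h1 : ∀ᶠ a in l, ∀ n ∈ S, ‖f a n‖ ≤ ‖g n‖ + 1 := by
    rw [Filter.eventually_all_finset]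
    intro n _
    exact (hfg n).norm.eventually_le_const (lt_add_one _)
  filter_upwards [hbound, h1] with a ha1 ha2 n
  split_ifs with hn
  · exact ha2 n hn
  · exact ha1 n hn

section
variable {α α₀ : ℝ} {k : ℕ} {w : ℂ} {h h' : ℤ}

lemma norm_qpow_ofReal (z : ℂ) (r : ℝ) : ‖qpow z r‖ = Real.exp (-(2 * π * z.im * r)) := by
  rw [qpow, norm_exp, show 2 * π * I * (r : ℂ) * z = ((2 * π * r : ℝ) : ℂ) * (I * z) by
    push_cast; ring, re_ofReal_mul, I_mul_re]
  congr 1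
  ring

lemma continuousAt_cot {z : ℂ} (hz : Complex.sin z ≠ 0) : ContinuousAt Complex.cot z := by
  have : Complex.cot = fun z => Complex.cos z / Complex.sin z := by
    ext z; exact Complex.cot_eq_cos_div_sin z
  rw [this]
  exact Complex.continuous_cos.continuousAt.div Complex.continuous_sin.continuousAt hz

lemma tendsto_tsum_cotTerm {z : ℂ} (hz : 0 < z.im) (hα : ∀ n : ℤ, α₀ ≠ n) :
    Tendsto (fun α : ℝ => ∑' n : ℤ, cotTerm α z n) (𝓝 α₀) (𝓝 (∑' n : ℤ, cotTerm α₀ z n)) := by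
  have hsum : Summable fun n : ℤ => Real.exp (-(2 * π * z.im * |(n : ℝ) - 0|)) *
      (2 / (1 - Real.exp (-2 * (π * z.im)))) :=
    (summable_exp_neg_abs_int (by positivity) 0).mul_right _
  refine tendsto_tsum_of_dominated_off_finset {0} hsum (fun n => ?_) (Eventually.of_forall ?_)
  · unfold cotTerm
    refine Tendsto.const_mul _ ?_
    have hsin : Complex.sin (π * ((α₀ : ℝ) - n * z)) ≠ 0 := by
      intro h0
      obtain ⟨m, hm⟩ := sin_pi_mul_eq_zero h0
      rcases eq_or_ne n 0 with rfl | hn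
      · apply hα m
        have : (α₀ : ℂ) = m := by simpa using hm
        exact_mod_cast this
      · have := congrArg Complex.im hm
        simp at this
        rcases this with h1 | h1
        · exact hn h1
        · exact hz.ne' h1
    exact ContinuousAt.comp (f := fun α : ℝ => (π : ℂ) * (α - n * z)) (continuousAt_cot hsin)
      (by fun_prop)
  · intro α n hn
    have hn0 : n ≠ 0 := by simpa using hn
    have hn1 : (1 : ℝ) ≤ |(n : ℝ)| := by exact_mod_cast Int.one_le_abs hn0
    unfold cotTerm
    rw [norm_mul, norm_mul, norm_zpow, norm_neg, norm_one, one_zpow, one_mul]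
    have e : (n : ℂ) ^ 2 = ((n ^ 2 : ℝ) : ℂ) := by push_cast; ring
    rw [e, norm_qpow_ofReal]
    refine mul_le_mul ?_ (norm_cot_le (by positivity) ?_) (norm_nonneg _) (Real.exp_pos _).le
    · rw [Real.exp_le_exp, sub_zero, neg_le_neg_iff]
      refine mul_le_mul_of_nonneg_left ?_ (by positivity)
      rw [← sq_abs]
      nlinarith
    · have : (π * ((α : ℝ) - n * z) : ℂ).im = -(π * (n * z.im)) := by simp
      rw [this, abs_neg, abs_mul, abs_mul, abs_of_pos Real.pi_pos, abs_of_pos hz]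
      refine mul_le_mul_of_nonneg_left ?_ Real.pi_pos.le
      nlinarith

lemma one_sub_cexp_resRatioLog_ne_zero (hk : 0 < k) (hw : 0 < w.re) {n : ℤ} (hα : k * α ≠ n) :
    1 - cexp (resRatioLog α k h' w n) ≠ 0 := by
  intro h0
  have h1 := norm_cexp_resRatioLog (α := α) (k := k) (h' := h') (w := w) n
  rw [← sub_eq_zero.1 h0, norm_one] at h1
  have h2 := (Real.exp_eq_one_iff _).1 h1.symm
  have hkr : (0 : ℝ) < k := by exact_mod_cast hk
  have hP := inv_re_pos hw
  rw [neg_eq_zero] at h2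
  rcases mul_eq_zero.1 h2 with h3 | h3
  · have : 0 < 2 * π * (w⁻¹).re / k := by positivity
    exact this.ne' h3
  · exact hα (sub_eq_zero.1 h3)

lemma norm_resSum (R n : ℤ) :
    ‖resSum α k h' w R n‖ = Real.exp (2 * π * (w⁻¹).re / k * ((k * α - n) *
      (2 * n + freqShift k - R + (k * α - n)))) / ‖1 - cexp (resRatioLog α k h' w n)‖ := by
  unfold resSum
  rw [norm_div, norm_mul, norm_gaussWeight, one_mul, Complex.exp_add, norm_mul]
  congr 1
  have e1 : cexp (((R - 2 * n - freqShift k : ℝ) : ℂ) * resRatioLog α k h' w n) =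
      cexp (((-(2 * π * (R - 2 * n - freqShift k) * h' * n / k) : ℝ) : ℂ) * I +
       ((-(2 * π * (R - 2 * n - freqShift k) * (k * α - n) / k) : ℝ) : ℂ) * w⁻¹) := by
    congr 1
    unfold resRatioLog
    push_cast
    rw [div_eq_mul_inv (2 * (π : ℂ) * (k * α - n)), mul_inv]
    ring
  have e2 : cexp (2 * π * (k * α - n : ℝ) ^ 2 / (w * k)) =
      cexp (((2 * π * (k * α - n) ^ 2 / k : ℝ) : ℂ) * w⁻¹) := by
    congr 1
    push_cast
    rw [div_eq_mul_inv, mul_inv]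
    ring
  rw [e1, e2, norm_exp, norm_exp, add_re, re_ofReal_mul, re_ofReal_mul, re_ofReal_mul, I_re,
    mul_zero, zero_add, ← Real.exp_add]
  congr 1
  ring

/-- Exponential decay of the residues away from the point `k α₀`, uniformly for `α` near `α₀`. -/
lemma norm_resSum_le (hk : 0 < k) (hw : 0 < w.re) {R : ℤ} (hα : |α - α₀| < 1 / (2 * k))
    (hR1 : R - 1 ≤ 2 * (k * α₀) + freqShift k) (hR2 : 2 * (k * α₀) + freqShift k ≤ R) {n : ℤ}
    (hn : n ∉ Finset.Icc (⌊k * α₀⌋ - 1) (⌊k * α₀⌋ + 2)) :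
    ‖resSum α k h' w R n‖ ≤ Real.exp (2 * π * (w⁻¹).re / k * (13 / 4)) /
      (1 - Real.exp (-(2 * π * (w⁻¹).re / k / 2))) *
        Real.exp (-(2 * π * (w⁻¹).re / k * |(n : ℝ) - k * α₀|)) := by
  have hkr : (0 : ℝ) < k := by exact_mod_cast hk
  have hP := inv_re_pos hw
  set K := 2 * π * (w⁻¹).re / k with hK
  have hK0 : 0 < K := by positivity
  have hden : 0 < 1 - Real.exp (-(K / 2)) := by
    rw [sub_pos, Real.exp_lt_one_iff]
    linarith
  have hα' : |k * α - k * α₀| < 1 / 2 := by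
    rw [← mul_sub, abs_mul, abs_of_pos hkr]
    calc (k : ℝ) * |α - α₀| < k * (1 / (2 * k)) := by gcongr
      _ = 1 / 2 := by field_simp
  have hd0 : 1 ≤ |(n : ℝ) - k * α₀| := by
    by_contra hcon
    rw [not_le, abs_lt] at hcon
    apply hn
    have f1 := Int.floor_le (k * α₀)
    have f2 := Int.lt_floor_add_one (k * α₀)
    rw [Finset.mem_Icc]
    constructor
    · have : ((⌊k * α₀⌋ : ℤ) : ℝ) - 1 < n + 1 := by linarith
      have : (⌊k * α₀⌋ : ℤ) - 1 < n + 1 := by exact_mod_cast this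
      omega
    · have : (n : ℝ) < (⌊k * α₀⌋ : ℤ) + 2 := by linarith
      have : n < ⌊k * α₀⌋ + 2 := by exact_mod_cast this
      omega
  set d := k * α - n with hd
  have hdd : |(n : ℝ) - k * α₀| - 1 / 2 ≤ |d| := by
    have h1 : |(n : ℝ) - k * α₀| ≤ |d| + |k * α - k * α₀| := by
      rw [show (n : ℝ) - k * α₀ = -d + (k * α - k * α₀) by rw [hd]; ring]
      refine (abs_add_le _ _).trans ?_
      rw [abs_neg]
    linarith
  have hd2 : 1 / 2 ≤ |d| := by linarith
  rw [norm_resSum, ← hK, ← hd, div_mul_eq_mul_div (Real.exp (K * (13 / 4))),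
    ← Real.exp_add]
  refine div_le_div₀ (Real.exp_pos _).le ?_ hden ?_
  · rw [Real.exp_le_exp, ← mul_neg, ← mul_add]
    refine mul_le_mul_of_nonneg_left ?_ hK0.le
    set e := 2 * n + freqShift k - R + d with he
    have he2 : |e + d| ≤ 2 := by
      have : e + d = (2 * (k * α₀) + freqShift k - R) + 2 * (k * α - k * α₀) := by
        rw [he, hd]; ring
      rw [this]
      refine (abs_add_le _ _).trans ?_
      rw [abs_mul, abs_two]
      have : |2 * (k * α₀) + freqShift k - R| ≤ 1 := by
        rw [abs_le]; constructor <;> linarith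
      linarith
    have h3 : d * e ≤ 2 * |d| - |d| ^ 2 := by
      have : d * (e + d) ≤ |d| * 2 := by
        refine (le_abs_self _).trans ?_
        rw [abs_mul]
        gcongr
      rw [sq_abs]
      nlinarith
    nlinarith [sq_nonneg (|d| - 3 / 2)]
  · have h4 := norm_cexp_resRatioLog (α := α) (k := k) (h' := h') (w := w) n
    rw [← hK, ← hd] at h4
    rcases le_total 0 d with hpos | hneg
    · rw [abs_of_nonneg hpos] at hd2
      have : Real.exp (-(K * d)) ≤ Real.exp (-(K / 2)) := by
        rw [Real.exp_le_exp]; nlinarith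
      have h5 := norm_sub_norm_le 1 (cexp (resRatioLog α k h' w n))
      rw [norm_one, h4] at h5
      linarith
    · rw [abs_of_nonpos hneg] at hd2
      have h6 : 1 + K / 2 ≤ Real.exp (-(K * d)) := by
        have := Real.add_one_le_exp (-(K * d))
        nlinarith
      have h7 := Real.add_one_le_exp (-(K / 2))
      have h5 := norm_sub_norm_le (cexp (resRatioLog α k h' w n)) 1
      rw [norm_one, h4, norm_sub_rev] at h5
      linarith

lemma summable_resSum (hk : 0 < k) (hw : 0 < w.re) {R : ℤ}
    (hR1 : R - 1 ≤ 2 * (k * α) + freqShift k) (hR2 : 2 * (k * α) + freqShift k ≤ R) :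
    Summable (resSum α k h' w R) := by
  have hkr : (0 : ℝ) < k := by exact_mod_cast hk
  have hP := inv_re_pos hw
  refine Summable.of_norm_bounded_eventually ((summable_exp_neg_abs_int
    (c := 2 * π * (w⁻¹).re / k) (by positivity) (k * α)).mul_left
      (Real.exp (2 * π * (w⁻¹).re / k * (13 / 4)) /
        (1 - Real.exp (-(2 * π * (w⁻¹).re / k / 2))))) ?_
  filter_upwards [(Finset.Icc (⌊k * α⌋ - 1) (⌊k * α⌋ + 2)).finite_toSet.compl_mem_cofinite] with n hn
  exact norm_resSum_le hk hw (by simpa using hkr) hR1 hR2 (by simpa using hn)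

lemma tendsto_tsum_resSum (hk : 0 < k) (hw : 0 < w.re)
    (hne : ∀ n : ℤ, k * α₀ = n → 1 - cexp (resRatioLog α₀ k h' w n) ≠ 0) {R : ℤ}
    (hR1 : R - 1 ≤ 2 * (k * α₀) + freqShift k) (hR2 : 2 * (k * α₀) + freqShift k ≤ R) :
    Tendsto (fun α : ℝ => ∑' n : ℤ, resSum α k h' w R n) (𝓝 α₀)
      (𝓝 (∑' n : ℤ, resSum α₀ k h' w R n)) := by
  have hkr : (0 : ℝ) < k := by exact_mod_cast hk
  have hkc : (k : ℂ) ≠ 0 := by exact_mod_cast hk.ne'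
  have hP := inv_re_pos hw
  have hw0 := ne_zero_of_re_pos hw
  set K := 2 * π * (w⁻¹).re / k with hK
  have hK0 : 0 < K := by positivity
  have hsum := (summable_exp_neg_abs_int hK0 (k * α₀)).mul_left
    (Real.exp (K * (13 / 4)) / (1 - Real.exp (-(K / 2))))
  refine tendsto_tsum_of_dominated_off_finset (Finset.Icc (⌊k * α₀⌋ - 1) (⌊k * α₀⌋ + 2)) hsum
    (fun n => ?_) ?_
  · have hne' : 1 - cexp (resRatioLog α₀ k h' w n) ≠ 0 := by
      by_cases hn : k * α₀ = n
      · exact hne n hn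
      · exact one_sub_cexp_resRatioLog_ne_zero hk hw hn
    have hwk : w * k ≠ 0 := mul_ne_zero hw0 hkc
    unfold resSum
    refine Tendsto.div (Continuous.tendsto ?_ α₀) (Continuous.tendsto ?_ α₀) hne'
    · unfold resRatioLog
      fun_prop
    · unfold resRatioLog
      fun_prop
  · have hnear : ∀ᶠ α in 𝓝 α₀, |α - α₀| < 1 / (2 * k) := by
      have := Metric.ball_mem_nhds α₀ (show (0 : ℝ) < 1 / (2 * k) by positivity)
      filter_upwards [this] with α hα
      simpa [Real.dist_eq] using hα
    filter_upwards [hnear] with α hα n hn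
    exact norm_resSum_le hk hw hα hR1 hR2 hn

lemma cotGauss_neg (μ ρ : ℝ) (x : ℂ) :
    cotGauss (-α) k w (-μ) ρ (-x) = -cotGauss α k w μ (-ρ) x := by
  unfold cotGauss
  rw [← mul_neg (cexp _) (Complex.cot _), ← cot_neg']
  congr 2
  · push_cast
    ring
  · push_cast
    ring

lemma exists_pole_gap (α : ℝ) (hk : 0 < k) (μ : ℝ) :
    ∃ g : ℝ, 0 < g ∧ ∀ m : ℤ, k * (α + m) - μ = 0 ∨ g ≤ |k * (α + m) - μ| := by
  have hkr : (0 : ℝ) < k := by exact_mod_cast hk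
  have e : ∀ m : ℤ, k * (α + m) - μ = k * ((α - μ / k) - ((-m : ℤ) : ℝ)) := by
    intro m
    push_cast
    field_simp
    ring
  by_cases hint : ∃ n : ℤ, α - μ / k = n
  · obtain ⟨n, hn⟩ := hint
    refine ⟨k, hkr, fun m => ?_⟩
    rw [e, hn]
    rcases eq_or_ne n (-m) with h1 | h1
    · left
      rw [h1, sub_self, mul_zero]
    · right
      rw [abs_mul, abs_of_pos hkr]
      have : (1 : ℝ) ≤ |((n - -m : ℤ) : ℝ)| := by exact_mod_cast Int.one_le_abs (sub_ne_zero.2 h1)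
      push_cast at this ⊢
      nlinarith
  · push Not at hint
    obtain ⟨d, hd, hd'⟩ := exists_dist_int hint
    refine ⟨k * d, by positivity, fun m => Or.inr ?_⟩
    rw [e, abs_mul, abs_of_pos hkr]
    exact mul_le_mul_of_nonneg_left (hd' _) hkr.le

/-- When `α` decreases to `α₀`, a pole that reaches the line of integration comes from below, so that
in the limit the line passes above it. -/
lemma tendsto_integral_cotGauss_right (α₀ : ℝ) (hk : 0 < k) (hw : 0 < w.re) (μ : ℝ) :
    ∀ᶠ δ : ℝ in 𝓝[>] 0, Tendsto (fun α : ℝ => ∫ x : ℝ, cotGauss α k w μ 0 x) (𝓝[>] α₀)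
      (𝓝 (∫ x : ℝ, cotGauss α₀ k w μ 0 (x + δ * I))) := by
  have hkr : (0 : ℝ) < k := by exact_mod_cast hk
  have hkc : (k : ℂ) ≠ 0 := by exact_mod_cast hk.ne'
  have hw0 := ne_zero_of_re_pos hw
  set P := (w⁻¹).re with hP
  have hP0 : 0 < P := inv_re_pos hw
  obtain ⟨g, hg0, hg⟩ := exists_pole_gap α₀ hk μ
  have hδ1 : ∀ᶠ δ : ℝ in 𝓝[>] 0, δ < P * (g / 4) :=
    (eventually_lt_nhds (by positivity)).filter_mono nhdsWithin_le_nhds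
  filter_upwards [hδ1, self_mem_nhdsWithin] with δ hδ1 (hδ0 : 0 < δ)
  set v := δ / P with hv
  have hv0 : 0 < v := by positivity
  have hv1 : v < g / 4 := by rw [hv, div_lt_iff₀ hP0]; linarith
  have hδv : δ = v * P := by rw [hv]; field_simp
  -- the poles stay away from the strip `0 ≤ im z ≤ δ`
  have hgap : ∀ ε : ℝ, 0 ≤ ε → k * ε < g / 4 → ∀ m : ℤ, ∀ t : ℝ, 0 ≤ t → t ≤ v →
      (0 < ε ∨ 0 < t) → k * (α₀ + ε + m) - μ + t ≠ 0 ∧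
        (t = v → v ≤ |k * (α₀ + ε + m) - μ + t|) := by
    intro ε hε0 hε1 m t ht0 ht1 hor
    have e : k * (α₀ + ε + m) - μ = (k * (α₀ + m) - μ) + k * ε := by ring
    have hkε : 0 ≤ k * ε := by positivity
    rw [e]
    rcases hg m with h0 | h0
    · rw [h0, zero_add]
      constructor
      · rcases hor with h1 | h1
        · have : 0 < k * ε := by positivity
          linarith
        · linarith
      · rintro rfl
        rw [abs_of_nonneg (by linarith)]
        linarith
    · rcases le_abs.1 h0 with h1 | h1
      · refine ⟨by linarith, fun _ => ?_⟩
        rw [abs_of_nonneg (by linarith)]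
        linarith
      · refine ⟨by linarith, fun _ => ?_⟩
        rw [abs_of_nonpos (by linarith)]
        linarith
  -- on the line `im z = δ` the cotangent is uniformly bounded
  have hvw : 0 < (w / k).re := by
    rw [div_natCast_re]
    positivity
  have hgk : v ≤ k / 2 := by
    by_contra hcon
    rw [not_le] at hcon
    obtain ⟨m, hm⟩ : ∃ m : ℤ, |k * (α₀ + 0 + m) - μ + v| ≤ k / 2 := by
      refine ⟨-round (α₀ + 0 - μ / k + v / k), ?_⟩
      have h1 := abs_sub_round (α₀ + 0 - μ / k + v / k)
      have h2 : k * (α₀ + 0 + ((-round (α₀ + 0 - μ / k + v / k) : ℤ) : ℝ)) - μ + v =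
          k * (α₀ + 0 - μ / k + v / k - round (α₀ + 0 - μ / k + v / k)) := by
        push_cast
        field_simp
        ring
      rw [h2, abs_mul, abs_of_pos hkr]
      nlinarith
    have := (hgap 0 le_rfl (by linarith) m v hv0.le le_rfl (Or.inr hv0)).2 rfl
    linarith
  obtain ⟨M, hM0, hM⟩ := exists_cot_bound hvw (η := v / k) (by positivity)
  have hcotb : ∀ ε : ℝ, 0 ≤ ε → k * ε < g / 4 → ∀ x : ℝ,
      ‖Complex.cot (π * (((α₀ + ε : ℝ) : ℂ) - (μ + I * w * (x + δ * I)) / k))‖ ≤ M := by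
    intro ε hε0 hε1 x
    set T := (k * (α₀ + ε) - μ + v) / k with hT
    obtain ⟨J, hJ⟩ : ∃ J : ℝ, (P : ℂ) = w⁻¹ - J * I :=
      ⟨(w⁻¹).im, by rw [eq_sub_iff_add_eq]; exact re_add_im _⟩
    have e : (((α₀ + ε : ℝ) : ℂ) - (μ + I * w * (x + δ * I)) / k) =
        (T : ℂ) - I * (w / k) * ((x + v * J : ℝ) : ℂ) := by
      rw [hδv, hT]
      push_cast
      rw [hJ]
      field_simp
      linear_combination (-((v : ℂ) * (1 - w * J * I))) * I_sq
    rw [e]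
    refine hM _ _ ⟨⌊T⌋, ?_, ?_⟩
    · have h1 := (hgap ε hε0 hε1 (-⌊T⌋) v hv0.le le_rfl (Or.inr hv0)).2 rfl
      have h2 : k * (α₀ + ε + ((-⌊T⌋ : ℤ) : ℝ)) - μ + v = k * (T - ⌊T⌋) := by
        rw [hT]; push_cast; field_simp; ring
      rw [h2, abs_mul, abs_of_pos hkr, abs_of_nonneg (sub_nonneg.2 (Int.floor_le T))] at h1
      have : v / k ≤ T - ⌊T⌋ := by rw [div_le_iff₀ hkr]; linarith
      linarith
    · have h1 := (hgap ε hε0 hε1 (-(⌊T⌋ + 1)) v hv0.le le_rfl (Or.inr hv0)).2 rfl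
      have h2 : k * (α₀ + ε + ((-(⌊T⌋ + 1) : ℤ) : ℝ)) - μ + v = k * (T - (⌊T⌋ + 1)) := by
        rw [hT]; push_cast; field_simp; ring
      have h3 := Int.lt_floor_add_one T
      rw [h2, abs_mul, abs_of_pos hkr, abs_of_neg (by linarith)] at h1
      have : v / k ≤ -(T - (⌊T⌋ + 1)) := by rw [div_le_iff₀ hkr]; linarith
      linarith
  have hnear : ∀ᶠ α in 𝓝[>] α₀, α < α₀ + g / (4 * k) :=
    (eventually_lt_nhds (by
      have : 0 < g / (4 * k) := by positivity
      linarith)).filter_mono nhdsWithin_le_nhds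
  have hshift : ∀ᶠ α in 𝓝[>] α₀, ∫ x : ℝ, cotGauss α k w μ 0 (x + δ * I) =
      ∫ x : ℝ, cotGauss α k w μ 0 x := by
    filter_upwards [hnear, self_mem_nhdsWithin] with α hα1 (hα0 : α₀ < α)
    have hε1 : k * (α - α₀) < g / 4 := by
      calc k * (α - α₀) < k * (g / (4 * k)) := by
            refine mul_lt_mul_of_pos_left ?_ hkr
            linarith
        _ = g / 4 := by field_simp
    have := integral_line_eq_of_differentiable (f := cotGauss α k w μ 0) (a := 0) (b := δ) hδ0.le
      (fun z hz0 hz1 => differentiableAt_cotGauss hk hw0 fun m hm => ?_)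
      (stripDecay_cotGauss hk hw 0 δ)
    · simpa using this.symm
    · have hz := cotPole_im (α := α) (k := k) (w := w) (μ := μ) m
      rw [← hm, ← hP] at hz
      have h1 := (hgap (α - α₀) (by linarith) hε1 m (z.im / P) (by positivity)
        (by rw [div_le_iff₀ hP0, ← hδv]; exact hz1) (Or.inl (by linarith))).1
      apply h1
      rw [hz]
      field_simp
      ring
  refine Tendsto.congr' hshift ?_
  have hβ : 0 < (2 * π * w / k).re := by
    rw [show 2 * π * w / k = ((2 * π : ℝ) : ℂ) * (w / k) by push_cast; ring, re_ofReal_mul]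
    positivity
  obtain ⟨B, hB0, hB⟩ := exists_gaussian_strip_bound (β := 2 * π * w / k)
    (γ := -(2 * π * I * (0 : ℝ) / k)) hβ δ
  refine tendsto_integral_filter_of_dominated_convergence (fun x => B * (1 + x ^ 2)⁻¹ * M) ?_ ?_
    ((integrable_inv_one_add_sq.const_mul B).mul_const M) ?_
  · filter_upwards [hnear, self_mem_nhdsWithin] with α hα1 (hα0 : α₀ < α)
    have hε1 : k * (α - α₀) < g / 4 := by
      calc k * (α - α₀) < k * (g / (4 * k)) := by
            refine mul_lt_mul_of_pos_left ?_ hkr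
            linarith
        _ = g / 4 := by field_simp
    refine (integrable_line (f := cotGauss α k w μ 0) (a := δ) (b := δ) le_rfl le_rfl
      (fun z hz => differentiableAt_cotGauss hk hw0 fun m hm => ?_)
      (stripDecay_cotGauss hk hw δ δ)).aestronglyMeasurable
    have hz' := cotPole_im (α := α) (k := k) (w := w) (μ := μ) m
    rw [← hm, ← hP, hz, hδv] at hz'
    have h1 := (hgap (α - α₀) (by linarith) hε1 m v hv0.le le_rfl (Or.inr hv0)).1
    apply h1
    have h2 : v * P = -(k * (α + m) - μ) * P := by rw [hz']; ring
    have h3 := mul_right_cancel₀ hP0.ne' h2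
    rw [h3]
    ring
  · filter_upwards [hnear, self_mem_nhdsWithin] with α hα1 (hα0 : α₀ < α)
    have hε1 : k * (α - α₀) < g / 4 := by
      calc k * (α - α₀) < k * (g / (4 * k)) := by
            refine mul_lt_mul_of_pos_left ?_ hkr
            linarith
        _ = g / 4 := by field_simp
    refine Eventually.of_forall fun x => ?_
    unfold cotGauss
    rw [norm_mul]
    have h1 := hB (x + δ * I) (by simp [abs_of_pos hδ0])
    have h2 := hcotb (α - α₀) (by linarith) hε1 x
    rw [add_sub_cancel] at h2
    refine mul_le_mul (h1.trans_eq ?_) h2 (norm_nonneg _) (by positivity)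
    simp [div_eq_mul_inv]
  · refine Eventually.of_forall fun x => ?_
    unfold cotGauss
    refine Tendsto.const_mul _ ?_
    have hsin : Complex.sin (π * ((α₀ : ℝ) - (μ + I * w * (x + δ * I)) / k)) ≠ 0 := by
      intro h0
      obtain ⟨m, hm⟩ := sin_pi_mul_eq_zero h0
      have hz : (x : ℂ) + δ * I = cotPole α₀ k w μ (-m) := by
        rw [cotPole]
        field_simp at hm ⊢
        push_cast
        linear_combination I * hm + (w * (x + I * δ)) * I_sq
      have hz' := cotPole_im (α := α₀) (k := k) (w := w) (μ := μ) (-m)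
      rw [← hz, ← hP] at hz'
      have h1 := (hgap 0 le_rfl (by linarith) (-m) v hv0.le le_rfl (Or.inr hv0)).1
      apply h1
      have h2 : v * P = -(k * (α₀ + (-m : ℤ)) - μ) * P := by
        rw [← hδv, neg_mul, ← hz']
        simp
      have h3 := mul_right_cancel₀ hP0.ne' h2
      rw [h3]
      ring
    exact (ContinuousAt.comp (f := fun α : ℝ => (π : ℂ) * (α - (μ + I * w * (x + δ * I)) / k))
      (continuousAt_cot hsin) (by fun_prop)).mono_left nhdsWithin_le_nhds

lemma integral_cotGauss_neg (α μ : ℝ) (δ : ℝ) :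
    ∫ x : ℝ, cotGauss (-α) k w (-μ) 0 (x + δ * I) = -∫ x : ℝ, cotGauss α k w μ 0 (x + (-δ : ℝ) * I) := by
  rw [← integral_neg, ← integral_neg_eq_self]
  congr 1
  ext x
  rw [← neg_zero, ← cotGauss_neg, neg_zero]
  congr 1
  push_cast
  ring

lemma tendsto_integral_cotGauss_left (α₀ : ℝ) (hk : 0 < k) (hw : 0 < w.re) (μ : ℝ) :
    ∀ᶠ δ : ℝ in 𝓝[>] 0, Tendsto (fun α : ℝ => ∫ x : ℝ, cotGauss α k w μ 0 x) (𝓝[<] α₀)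
      (𝓝 (∫ x : ℝ, cotGauss α₀ k w μ 0 (x + (-δ : ℝ) * I))) := by
  filter_upwards [tendsto_integral_cotGauss_right (-α₀) hk hw (-μ)] with δ hδ
  have h1 : Tendsto (fun α : ℝ => -α) (𝓝[<] α₀) (𝓝[>] (-α₀)) := tendsto_neg_nhdsLT
  have h2 := (hδ.comp h1).neg
  rw [integral_cotGauss_neg, neg_neg] at h2
  refine h2.congr fun α => ?_
  have := integral_cotGauss_neg (k := k) (w := w) α μ 0
  simp only [Function.comp]
  simpa [neg_eq_iff_eq_neg] using this

end

/-! ### The transformation of the cotangent sum at an arbitrary point -/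

/-- The integral of the saddle point integrand over the line `im z = δ`. -/
def cotLine (α : ℝ) (k : ℕ) (w : ℂ) (μ δ : ℝ) : ℂ := ∫ x : ℝ, cotGauss α k w μ 0 (x + δ * I)

/-- The combination `saddleSum` with the line of integration displaced to `im z = δ`. -/
def saddleLineSum (α : ℝ) (k : ℕ) (h' : ℤ) (w : ℂ) (σ δ : ℝ) : ℂ :=
  ∑ μ ∈ Finset.range k, gaussWeight k h' μ * linPhase k h' σ μ * cotLine α k w (μ + σ / 2) δ

section
variable {α α₀ : ℝ} {k : ℕ} {w : ℂ} {h h' : ℤ}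

lemma tendsto_saddleSum (hk : 0 < k) (hw : 0 < w.re) (σ : ℝ) :
    ∀ᶠ δ : ℝ in 𝓝[>] 0,
      Tendsto (fun α : ℝ => saddleSum α k h' w σ) (𝓝[>] α₀) (𝓝 (saddleLineSum α₀ k h' w σ δ)) ∧
      Tendsto (fun α : ℝ => saddleSum α k h' w σ) (𝓝[<] α₀)
        (𝓝 (saddleLineSum α₀ k h' w σ (-δ))) := by
  have h1 := (Filter.eventually_all_finset (Finset.range k)).2 fun μ _ =>
    tendsto_integral_cotGauss_right (k := k) α₀ hk hw ((μ : ℝ) + σ / 2)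
  have h2 := (Filter.eventually_all_finset (Finset.range k)).2 fun μ _ =>
    tendsto_integral_cotGauss_left (k := k) α₀ hk hw ((μ : ℝ) + σ / 2)
  filter_upwards [h1, h2] with δ hδ1 hδ2
  exact ⟨tendsto_finsetSum _ fun μ hμ => (hδ1 μ hμ).const_mul _,
    tendsto_finsetSum _ fun μ hμ => (hδ2 μ hμ).const_mul _⟩

lemma eventually_mul_ne_int (hk : 0 < k) (α₀ : ℝ) :
    ∀ᶠ α : ℝ in 𝓝[≠] α₀, ∀ n : ℤ, k * α ≠ n := by
  have hkr : (0 : ℝ) < k := by exact_mod_cast hk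
  obtain ⟨g, hg0, hg⟩ : ∃ g : ℝ, 0 < g ∧ ∀ n : ℤ, k * α₀ = n ∨ g ≤ |k * α₀ - n| := by
    obtain ⟨g, hg0, hg⟩ := exists_pole_gap (k := 1) (k * α₀) one_pos 0
    refine ⟨g, hg0, fun n => ?_⟩
    have := hg (-n)
    simp only [Nat.cast_one, one_mul, Int.cast_neg, sub_zero, ← sub_eq_add_neg] at this
    simpa [sub_eq_zero] using this
  have h1 : ∀ᶠ α in 𝓝[≠] α₀, |α - α₀| < min g 1 / k := by
    have := Metric.ball_mem_nhds α₀ (show (0 : ℝ) < min g 1 / k by positivity)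
    filter_upwards [nhdsWithin_le_nhds this] with α hα
    simpa [Real.dist_eq] using hα
  filter_upwards [h1, self_mem_nhdsWithin] with α hα1 hα2 n hn
  have hα3 : α - α₀ ≠ 0 := sub_ne_zero.2 hα2
  have hα4 : |k * α - k * α₀| < min g 1 := by
    rw [← mul_sub, abs_mul, abs_of_pos hkr]
    rw [lt_div_iff₀ hkr] at hα1
    linarith
  rcases hg n with h2 | h2
  · apply hα3
    have : k * α = k * α₀ := by rw [hn, h2]
    rw [mul_left_cancel₀ hkr.ne' this, sub_self]
  · rw [hn, abs_sub_comm] at hα4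
    exact absurd (hα4.trans_le (min_le_left _ _)) (not_lt.2 h2)

/-- The transformation of the cotangent sum: the mean of the two one-sided limits of
`tsum_cotTerm_generic`. The thresholds `R` and `R'` of the limits from the right and from the left
differ exactly if `2 k α₀ + κ` is an integer. -/
theorem tsum_cotTerm_eq_mean (hk : 0 < k) (hw : 0 < w.re) (hh : h * h' ≡ -1 [ZMOD k])
    (hpar : Odd k → Even h') (hα : ∀ n : ℤ, α₀ ≠ n)
    (hne : ∀ n : ℤ, k * α₀ = n → 1 - cexp (resRatioLog α₀ k h' w n) ≠ 0) {R R' : ℤ}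
    (hR1 : R - 1 ≤ 2 * (k * α₀) + freqShift k) (hR2 : 2 * (k * α₀) + freqShift k < R)
    (hR1' : R' - 1 < 2 * (k * α₀) + freqShift k) (hR2' : 2 * (k * α₀) + freqShift k ≤ R')
    {z : ℂ} (hz : z = (h + I * w) / k) :
    ∀ᶠ δ : ℝ in 𝓝[>] 0, ∑' n : ℤ, cotTerm α₀ z n =
      1 / k * (∑ s ∈ Finset.range 2, (∑' n : ℤ, thetaTerm k h' w (s - freqShift k) n) *
        ((saddleLineSum α₀ k h' w (s - freqShift k) δ +
          saddleLineSum α₀ k h' w (s - freqShift k) (-δ)) / 2)) +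
      1 / w * (∑' n : ℤ, resSum α₀ k h' w R n + ∑' n : ℤ, resSum α₀ k h' w R' n) := by
  have hkr : (0 : ℝ) < k := by exact_mod_cast hk
  have hzim : 0 < z.im := by
    rw [hz, div_natCast_im]
    have : ((h : ℂ) + I * w).im = w.re := by simp
    rw [this]
    positivity
  have hS := (Filter.eventually_all_finset (Finset.range 2)).2 fun s _ =>
    tendsto_saddleSum (h' := h') (α₀ := α₀) hk hw ((s : ℝ) - freqShift k)
  filter_upwards [hS] with δ hδ
  have hC := tendsto_tsum_cotTerm hzim hα
  have hcont : Continuous fun α : ℝ => 2 * (k * α) + freqShift k := by fun_prop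
  have e1 : ∑' n : ℤ, cotTerm α₀ z n =
      1 / k * (∑ s ∈ Finset.range 2, (∑' n : ℤ, thetaTerm k h' w (s - freqShift k) n) *
        saddleLineSum α₀ k h' w (s - freqShift k) δ) + 2 / w * ∑' n : ℤ, resSum α₀ k h' w R n := by
    refine tendsto_nhds_unique (hC.mono_left (nhdsWithin_le_nhds (s := Set.Ioi α₀))) ?_
    have h1 : Tendsto (fun α : ℝ => 1 / k * (∑ s ∈ Finset.range 2,
        (∑' n : ℤ, thetaTerm k h' w (s - freqShift k) n) * saddleSum α k h' w (s - freqShift k)) +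
          2 / w * ∑' n : ℤ, resSum α k h' w R n) (𝓝[>] α₀) (𝓝 (1 / k * (∑ s ∈ Finset.range 2,
        (∑' n : ℤ, thetaTerm k h' w (s - freqShift k) n) *
          saddleLineSum α₀ k h' w (s - freqShift k) δ) + 2 / w * ∑' n : ℤ, resSum α₀ k h' w R n)) :=
      ((tendsto_finsetSum _ fun s hs => (hδ s hs).1.const_mul _).const_mul _).add
        (((tendsto_tsum_resSum hk hw hne hR1 hR2.le).mono_left nhdsWithin_le_nhds).const_mul _)
    refine h1.congr' ?_
    have h2 : ∀ᶠ α in 𝓝[>] α₀, 2 * (k * α) + freqShift k < R :=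
      (hcont.continuousAt.eventually_lt_const hR2).filter_mono nhdsWithin_le_nhds
    filter_upwards [h2, self_mem_nhdsWithin,
      (eventually_mul_ne_int hk α₀).filter_mono (nhdsWithin_mono _ fun x hx => ne_of_gt hx)]
      with α hα2 (hα1 : α₀ < α) hα3
    refine (tsum_cotTerm_generic hk hw hh hpar hα3 ?_ hα2 hz).symm
    nlinarith
  have e2 : ∑' n : ℤ, cotTerm α₀ z n =
      1 / k * (∑ s ∈ Finset.range 2, (∑' n : ℤ, thetaTerm k h' w (s - freqShift k) n) *
        saddleLineSum α₀ k h' w (s - freqShift k) (-δ)) +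
          2 / w * ∑' n : ℤ, resSum α₀ k h' w R' n := by
    refine tendsto_nhds_unique (hC.mono_left (nhdsWithin_le_nhds (s := Set.Iio α₀))) ?_
    have h1 : Tendsto (fun α : ℝ => 1 / k * (∑ s ∈ Finset.range 2,
        (∑' n : ℤ, thetaTerm k h' w (s - freqShift k) n) * saddleSum α k h' w (s - freqShift k)) +
          2 / w * ∑' n : ℤ, resSum α k h' w R' n) (𝓝[<] α₀) (𝓝 (1 / k * (∑ s ∈ Finset.range 2,
        (∑' n : ℤ, thetaTerm k h' w (s - freqShift k) n) *
          saddleLineSum α₀ k h' w (s - freqShift k) (-δ)) +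
            2 / w * ∑' n : ℤ, resSum α₀ k h' w R' n)) :=
      ((tendsto_finsetSum _ fun s hs => (hδ s hs).2.const_mul _).const_mul _).add
        (((tendsto_tsum_resSum hk hw hne hR1'.le hR2').mono_left nhdsWithin_le_nhds).const_mul _)
    refine h1.congr' ?_
    have h2 : ∀ᶠ α in 𝓝[<] α₀, (R' : ℝ) - 1 < 2 * (k * α) + freqShift k :=
      (hcont.continuousAt.eventually_const_lt hR1').filter_mono nhdsWithin_le_nhds
    filter_upwards [h2, self_mem_nhdsWithin,
      (eventually_mul_ne_int hk α₀).filter_mono (nhdsWithin_mono _ fun x hx => ne_of_lt hx)]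
      with α hα2 (hα1 : α < α₀) hα3
    refine (tsum_cotTerm_generic hk hw hh hpar hα3 hα2 ?_ hz).symm
    nlinarith
  rw [show ∑' n : ℤ, cotTerm α₀ z n =
    (∑' n : ℤ, cotTerm α₀ z n + ∑' n : ℤ, cotTerm α₀ z n) / 2 by ring]
  nth_rewrite 1 [e1]
  rw [e2]
  simp only [Finset.sum_range_succ, Finset.sum_range_zero]
  ring

end

/-! ### The Mordell type integrals -/

section
variable {α : ℝ} {k : ℕ} {w : ℂ} {μ : ℝ}

lemma four_sin_mul_eq_cot_add_cot {α y : ℂ} (h1 : Complex.sin (π * (α - y)) ≠ 0)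
    (h2 : Complex.sin (π * (α + y)) ≠ 0) :
    4 * Complex.sin (2 * π * α) * (cexp (2 * π * I * y) /
      (1 - 2 * Complex.cos (2 * π * α) * cexp (2 * π * I * y) + cexp (2 * (2 * π * I * y)))) =
    Complex.cot (π * (α - y)) + Complex.cot (π * (α + y)) := by
  set E := cexp (2 * π * I * y) with hE
  have hE0 : E ≠ 0 := Complex.exp_ne_zero _
  have e1 : cexp (2 * (2 * π * I * y)) = E ^ 2 := by
    rw [hE, ← Complex.exp_nat_mul]; norm_num
  have e2 : 2 * Complex.cos (2 * π * y) = E + E⁻¹ := by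
    rw [Complex.two_cos, hE, ← Complex.exp_neg]
    congr 2 <;> ring
  have e3 : 1 - 2 * Complex.cos (2 * π * α) * E + E ^ 2 =
      E * (2 * Complex.cos (2 * π * y) - 2 * Complex.cos (2 * π * α)) := by
    rw [e2]; field_simp; ring
  have e4 : 2 * Complex.cos (2 * π * y) - 2 * Complex.cos (2 * π * α) =
      4 * Complex.sin (π * (α - y)) * Complex.sin (π * (α + y)) := by
    have g1 : 2 * π * y = π * (α + y) - π * (α - y) := by ring
    have g2 : 2 * π * α = π * (α + y) + π * (α - y) := by ring
    rw [g1, g2, Complex.cos_sub, Complex.cos_add]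
    ring
  have e5 : Complex.sin (2 * π * α) = Complex.sin (π * (α + y)) * Complex.cos (π * (α - y)) +
      Complex.cos (π * (α + y)) * Complex.sin (π * (α - y)) := by
    rw [← Complex.sin_add]; congr 1; ring
  rw [e1, e3, e4, e5, Complex.cot_eq_cos_div_sin, Complex.cot_eq_cos_div_sin]
  field_simp

lemma exists_tendsto_mul_cotGauss (hk : 0 < k) (hw : 0 < w.re) (α μ : ℝ) :
    ∃ c, Tendsto (fun z => z * cotGauss α k w μ 0 z) (𝓝[≠] 0) (𝓝 c) := by
  have hw0 := ne_zero_of_re_pos hw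
  by_cases hm : ∃ m : ℤ, k * (α + m) - μ = 0
  · obtain ⟨m, hm⟩ := hm
    have hp : cotPole α k w μ m = 0 := by simp [cotPole, hm]
    have := tendsto_cotGauss_pole (α := α) (μ := μ) (ρ := 0) hk hw0 m
    rw [hp] at this
    simp only [sub_zero] at this
    exact ⟨_, this⟩
  · push Not at hm
    refine ⟨0 * cotGauss α k w μ 0 0, ?_⟩
    have h1 : ContinuousAt (cotGauss α k w μ 0) 0 :=
      (differentiableAt_cotGauss hk hw0 fun m => by
        simpa using cotPole_ne_ofReal hw (hm m) 0).continuousAt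
    exact (continuousAt_id.mul h1).tendsto.mono_left nhdsWithin_le_nhds

lemma eventually_differentiableAt_cotGauss (hk : 0 < k) (hw : 0 < w.re) (α μ : ℝ) :
    ∀ᶠ δ : ℝ in 𝓝[>] 0, ∀ z : ℂ, |z.im| ≤ δ → z ≠ 0 → DifferentiableAt ℂ (cotGauss α k w μ 0) z := by
  obtain ⟨g, hg0, hg⟩ := exists_pole_gap α hk μ
  have hP := inv_re_pos hw
  have hδ1 : ∀ᶠ δ : ℝ in 𝓝[>] 0, δ < g * (w⁻¹).re :=
    (eventually_lt_nhds (by positivity)).filter_mono nhdsWithin_le_nhds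
  filter_upwards [hδ1] with δ hδ z hz hz0
  refine differentiableAt_cotGauss hk (ne_zero_of_re_pos hw) fun m hm => ?_
  rcases hg m with h1 | h1
  · apply hz0
    rw [hm, cotPole, h1]
    simp
  · rw [hm, cotPole_im, abs_neg, abs_mul, abs_of_pos hP] at hz
    nlinarith

/-- The function `H` is a difference of two cotangents, so that the integrand of the Mordell type
integral is a combination of two functions `cotGauss`. -/
lemma mordellIntegrand_eq {a c : ℕ} (hk : 0 < k) (hw : 0 < w.re)
    (hsin : Complex.sin (2 * π * (a / c : ℝ)) ≠ 0) (ν : ℤ) {x : ℝ} (hx : x ≠ 0) :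
    mordellIntegrand a c k ν w x = 1 / (4 * Complex.sin (2 * π * (a / c : ℝ))) *
      (cotGauss (a / c) k w (ν - ((k % 2 : ℕ) : ℝ) / 4) 0 x +
        (-1) * cotGauss (-(a / c)) k w (ν - ((k % 2 : ℕ) : ℝ) / 4) 0 x) := by
  have hkc : (k : ℂ) ≠ 0 := by exact_mod_cast hk.ne'
  have hw0 := ne_zero_of_re_pos hw
  have hxc : (x : ℂ) ≠ 0 := by exact_mod_cast hx
  set μ : ℝ := ν - ((k % 2 : ℕ) : ℝ) / 4 with hμ
  set α : ℝ := a / c with hα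
  set y : ℂ := (μ + I * w * x) / k with hy
  have hsin' : ∀ β : ℝ, Complex.sin (π * (β - y)) ≠ 0 := by
    intro β h0
    obtain ⟨m, hm⟩ := sin_pi_mul_eq_zero h0
    have h1 : I * w * x = (((β - m) * k - μ : ℝ) : ℂ) := by
      rw [hy] at hm
      field_simp at hm
      push_cast
      linear_combination (-1) * hm
    have h2 : (x : ℂ) = -I * (((β - m) * k - μ : ℝ) : ℂ) * w⁻¹ := by
      rw [← h1]
      field_simp
      rw [I_sq]
      ring
    have h3 := congrArg Complex.im h2
    rw [mul_assoc, neg_mul, neg_im, I_mul_im, re_ofReal_mul, ofReal_im, eq_comm, neg_eq_zero] at h3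
    rcases mul_eq_zero.1 h3 with h4 | h4
    · rw [h4] at h2
      apply hxc
      rw [h2]
      simp
    · exact (inv_re_pos hw).ne' h4
  have key := four_sin_mul_eq_cot_add_cot (α := (α : ℂ)) (y := y) (hsin' α) (by
    have := hsin' (-α)
    rw [show (π : ℂ) * (((-α : ℝ) : ℂ) - y) = -(π * (α + y)) by push_cast; ring, Complex.sin_neg,
      neg_ne_zero] at this
    exact this)
  have hX : (2 * π * I * ν / k - 2 * π * w * x / k - ((k % 2 : ℕ) : ℂ) * π * I / (2 * k) : ℂ) =
      2 * π * I * y := by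
    rw [hy, hμ]
    push_cast
    field_simp
    linear_combination (-(16 * w * x)) * I_sq
  have hcos : (2 * π * a / c : ℂ) = 2 * π * (α : ℂ) := by rw [hα]; push_cast; ring
  unfold mordellIntegrand fnH
  rw [hX, hcos]
  have e1 : cotGauss (-α) k w μ 0 x = -(cexp (-(2 * π * w * (x : ℂ) ^ 2 / k)) *
      Complex.cot (π * (α + y))) := by
    unfold cotGauss
    rw [← mul_neg (cexp _) (Complex.cot _), ← cot_neg', hy]
    congr 2
    · push_cast; ring
    · push_cast; ring
  have e2 : cotGauss α k w μ 0 x = cexp (-(2 * π * w * (x : ℂ) ^ 2 / k)) *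
      Complex.cot (π * (α - y)) := by
    unfold cotGauss
    rw [hy]
    congr 2
    push_cast; ring
  rw [e1, e2, neg_one_mul, neg_neg, ← mul_add, ← key]
  field_simp

lemma cotLine_neg (α μ δ : ℝ) : cotLine (-α) k w μ δ = -cotLine α k w (-μ) (-δ) := by
  have := integral_cotGauss_neg (k := k) (w := w) α (-μ) δ
  rw [neg_neg] at this
  exact this

/-- The principal values exist, and can be computed from the integrals over two parallel lines. -/
theorem mordellI_eq {a c : ℕ} (hk : 0 < k) (hw : 0 < w.re)
    (hsin : Complex.sin (2 * π * (a / c : ℝ)) ≠ 0) (ν : ℤ) :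
    ∀ᶠ δ : ℝ in 𝓝[>] 0,
      ((∀ ε : ℝ, 0 < ε → IntegrableOn (mordellIntegrand a c k ν w) {x : ℝ | ε < |x|}) ∧
        Tendsto (fun ε : ℝ => ∫ x in {x : ℝ | ε < |x|}, mordellIntegrand a c k ν w x)
          (𝓝[>] 0) (𝓝 (mordellI a c k ν w))) ∧
      8 * Complex.sin (2 * π * (a / c : ℝ)) * mordellI a c k ν w =
        cotLine (a / c) k w (ν - ((k % 2 : ℕ) : ℝ) / 4) δ +
        cotLine (a / c) k w (ν - ((k % 2 : ℕ) : ℝ) / 4) (-δ) +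
        cotLine (a / c) k w (-(ν - ((k % 2 : ℕ) : ℝ) / 4)) δ +
        cotLine (a / c) k w (-(ν - ((k % 2 : ℕ) : ℝ) / 4)) (-δ) := by
  set μ : ℝ := ν - ((k % 2 : ℕ) : ℝ) / 4 with hμ
  set α : ℝ := a / c with hα
  set S := Complex.sin (2 * π * (α : ℝ)) with hS
  have hδ1 : ∀ᶠ δ : ℝ in 𝓝[>] 0, δ < 1 :=
    (eventually_lt_nhds one_pos).filter_mono nhdsWithin_le_nhds
  filter_upwards [hδ1, self_mem_nhdsWithin, eventually_differentiableAt_cotGauss hk hw α μ,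
    eventually_differentiableAt_cotGauss hk hw (-α) μ] with δ hδ1 (hδ0 : 0 < δ) hd1 hd2
  set G : ℂ → ℂ := fun z => 1 / (4 * S) * (cotGauss α k w μ 0 z + (-1) * cotGauss (-α) k w μ 0 z)
    with hG
  obtain ⟨c₁, hc₁⟩ := exists_tendsto_mul_cotGauss hk hw α μ
  obtain ⟨c₂, hc₂⟩ := exists_tendsto_mul_cotGauss hk hw (-α) μ
  have hres : Tendsto (fun z => z * G z) (𝓝[≠] 0) (𝓝 (1 / (4 * S) * (c₁ + (-1) * c₂))) := by
    refine ((hc₁.add (hc₂.const_mul (-1))).const_mul (1 / (4 * S))).congr fun z => ?_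
    simp only [hG]
    ring
  have hdecay : StripDecay G (-δ) δ :=
    ((stripDecay_cotGauss hk hw _ _).add ((stripDecay_cotGauss hk hw _ _).const_mul _)).const_mul _
  have hdiff : ∀ z : ℂ, |z.im| ≤ δ → z ≠ 0 → DifferentiableAt ℂ G z := fun z h1 h2 =>
    ((hd1 z h1 h2).add ((hd2 z h1 h2).const_mul _)).const_mul _
  obtain ⟨hint, hlim⟩ := tendsto_principalValue hδ0 hδ1 hdiff hres hdecay
  have heq : ∀ ε : ℝ, 0 < ε → Set.EqOn (fun x : ℝ => G x) (mordellIntegrand a c k ν w)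
      {x : ℝ | ε < |x|} := by
    intro ε hε x hx
    have hx0 : x ≠ 0 := by
      rintro rfl
      rw [Set.mem_ofPred_eq, abs_zero] at hx
      linarith
    exact (mordellIntegrand_eq hk hw hsin ν hx0).symm
  have hmeas : ∀ ε : ℝ, MeasurableSet {x : ℝ | ε < |x|} := fun ε =>
    measurableSet_lt measurable_const (by fun_prop)
  have hlim' : Tendsto (fun ε : ℝ => ∫ x in {x : ℝ | ε < |x|}, mordellIntegrand a c k ν w x)
      (𝓝[>] 0) (𝓝 (((∫ x : ℝ, G (x + δ * I)) + ∫ x : ℝ, G (x + (-δ : ℝ) * I)) / 2)) := by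
    refine hlim.congr' ?_
    filter_upwards [self_mem_nhdsWithin] with ε (hε : 0 < ε)
    exact setIntegral_congr_fun (hmeas ε) (heq ε hε)
  have hval : mordellI a c k ν w =
      ((∫ x : ℝ, G (x + δ * I)) + ∫ x : ℝ, G (x + (-δ : ℝ) * I)) / 2 := hlim'.limUnder_eq
  refine ⟨⟨fun ε hε => (hint ε hε).congr_fun (heq ε hε) (hmeas ε), by rw [hval]; exact hlim'⟩, ?_⟩
  have hline : ∀ y : ℝ, |y| ≤ δ → y ≠ 0 → ∫ x : ℝ, G (x + y * I) =
      1 / (4 * S) * (cotLine α k w μ y + cotLine α k w (-μ) (-y)) := by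
    intro y hy hy0
    have hne : ∀ z : ℂ, z.im = y → z ≠ 0 := by
      rintro z hz rfl
      exact hy0 hz.symm
    have i1 : Integrable fun x : ℝ => cotGauss α k w μ 0 (x + y * I) :=
      integrable_line le_rfl le_rfl (fun z hz => hd1 z (by rwa [hz]) (hne z hz))
        (stripDecay_cotGauss hk hw y y)
    have i2 : Integrable fun x : ℝ => cotGauss (-α) k w μ 0 (x + y * I) :=
      integrable_line le_rfl le_rfl (fun z hz => hd2 z (by rwa [hz]) (hne z hz))
        (stripDecay_cotGauss hk hw y y)
    simp only [hG]
    rw [integral_const_mul, integral_add i1 (i2.const_mul _), integral_const_mul]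
    change _ * (cotLine α k w μ y + -1 * cotLine (-α) k w μ y) = _
    rw [cotLine_neg, neg_one_mul, neg_neg]
  rw [hval, hline δ (by rw [abs_of_pos hδ0]) hδ0.ne', hline (-δ) (by rw [abs_neg, abs_of_pos hδ0])
    (neg_ne_zero.2 hδ0.ne'), neg_neg]
  field_simp
  ring

end

/-! ### The transformation of the cotangent sum at a rational point -/

section
variable {α : ℝ} {k : ℕ} {w : ℂ} {h h' : ℤ}

lemma cotLine_add_k (hk : 0 < k) (μ δ : ℝ) : cotLine α k w (μ + k) δ = cotLine α k w μ δ := by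
  unfold cotLine
  simp_rw [cotGauss_add_k hk]

lemma sum_range_neg (hk : 0 < k) {g : ℤ → ℂ} (hg : Function.Periodic g (k : ℤ)) :
    ∑ s ∈ Finset.range k, g (-s) = ∑ s ∈ Finset.range k, g s := by
  have := sum_range_mul (h := -1) (h' := 1) hk hg (by norm_num)
  simpa using this

lemma gaussWeight_neg (n : ℤ) : gaussWeight k h' (-n) = gaussWeight k h' n := by
  unfold gaussWeight
  push_cast
  rw [mul_neg, neg_sq, zpow_neg, ← inv_zpow, inv_neg_one]

lemma linPhase_neg (ρ : ℝ) (n : ℤ) : linPhase k h' ρ (-n) = linPhase k h' (-ρ) n := by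
  unfold linPhase
  congr 1
  push_cast
  ring

lemma thetaTerm_neg (σ : ℝ) (n : ℤ) : thetaTerm k h' w (-σ) (-n) = thetaTerm k h' w σ n := by
  unfold thetaTerm
  push_cast
  rw [mul_neg, zpow_neg, ← inv_zpow, inv_neg_one]
  congr 2
  ring

lemma tsum_thetaTerm_neg (σ : ℝ) :
    ∑' n : ℤ, thetaTerm k h' w (-σ) n = ∑' n : ℤ, thetaTerm k h' w σ n := by
  rw [← (Equiv.neg ℤ).tsum_eq]
  exact tsum_congr fun n => thetaTerm_neg σ n

/-- For even `k` the terms of the theta series with `σ = 1` cancel in pairs. -/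
lemma tsum_thetaTerm_one (hev : Even k) : ∑' n : ℤ, thetaTerm k h' w 1 n = 0 := by
  have h1 : ∑' n : ℤ, thetaTerm k h' w 1 n = -∑' n : ℤ, thetaTerm k h' w 1 n := by
    conv_lhs => rw [← (Equiv.subLeft (-1 : ℤ)).tsum_eq]
    rw [← tsum_neg]
    refine tsum_congr fun n => ?_
    simp only [Equiv.subLeft_apply, thetaTerm]
    have hodd : Odd ((k : ℤ) + 1) := (by exact_mod_cast hev : Even (k : ℤ)).add_one
    have e : (-1 : ℂ) ^ (((k : ℤ) + 1) * (-1 - n)) = -(-1) ^ (((k : ℤ) + 1) * n) := by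
      rw [zpow_mul, zpow_mul, hodd.neg_one_zpow, zpow_sub₀ (by norm_num), zpow_neg, zpow_one,
        inv_neg_one, div_eq_mul_inv, ← inv_zpow, inv_neg_one, neg_one_mul]
    rw [e, neg_mul]
    congr 3
    push_cast
    ring
  have h2 := self_eq_neg.1 h1
  exact h2

lemma sum_weight_mul_cotLine_neg (hk : 0 < k) (hpar : Odd k → Even h') (r : ℤ) (δ : ℝ) :
    saddleLineSum α k h' w (-(r - freqShift k)) δ =
      ∑ μ ∈ Finset.range k, gaussWeight k h' μ * linPhase k h' (r - freqShift k) μ *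
        cotLine α k w (-(μ + (r - freqShift k) / 2)) δ := by
  set g : ℤ → ℂ := fun μ => gaussWeight k h' μ * linPhase k h' (r - freqShift k) μ *
    cotLine α k w (-(μ + (r - freqShift k) / 2)) δ with hg
  have hgper : Function.Periodic g (k : ℤ) := by
    intro μ
    simp only [hg]
    rw [gaussWeight_periodic hk, linPhase_periodic hk hpar r]
    congr 1
    rw [← cotLine_add_k hk]
    congr 1
    push_cast
    ring
  have := sum_range_neg hk hgper
  simp only [hg] at this
  unfold saddleLineSum
  simp only [Int.cast_natCast] at this
  rw [← this]
  refine Finset.sum_congr rfl fun μ _ => ?_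
  rw [gaussWeight_neg, linPhase_neg]
  congr 2
  push_cast
  ring

/-- For even `k` the frequencies are the integers. The theta series of the odd ones vanishes, and the
integrals that remain are the Mordell type integrals. -/
theorem tsum_cotTerm_even {a c : ℕ} (hk : 0 < k) (hw : 0 < w.re) (hh : h * h' ≡ -1 [ZMOD k])
    (hev : Even k) (hsin : Complex.sin (2 * π * (a / c : ℝ)) ≠ 0) (hα : ∀ n : ℤ, (a / c : ℝ) ≠ n)
    (hne : ∀ n : ℤ, k * (a / c : ℝ) = n → 1 - cexp (resRatioLog (a / c) k h' w n) ≠ 0) {R R' : ℤ}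
    (hR1 : R - 1 ≤ 2 * (k * (a / c : ℝ))) (hR2 : 2 * (k * (a / c : ℝ)) < R)
    (hR1' : R' - 1 < 2 * (k * (a / c : ℝ))) (hR2' : 2 * (k * (a / c : ℝ)) ≤ R')
    {z : ℂ} (hz : z = (h + I * w) / k) :
    ∑' n : ℤ, cotTerm (a / c) z n =
      (∑' n : ℤ, thetaTerm k h' w 0 n) * (2 * Complex.sin (2 * π * (a / c : ℝ)) / k) *
        (∑ ν ∈ Finset.range k, (-1 : ℂ) ^ ν * cexp (-(2 * π * I * h' * ν ^ 2 / k)) *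
          mordellI a c k ν w) +
      1 / w * (∑' n : ℤ, resSum (a / c) k h' w R n + ∑' n : ℤ, resSum (a / c) k h' w R' n) := by
  have hpar : Odd k → Even h' := fun ho => absurd hev (Nat.not_even_iff_odd.2 ho)
  have hk2 : k % 2 = 0 := Nat.even_iff.1 hev
  have hκ : freqShift k = 0 := by simp [freqShift, hk2]
  have hmain := tsum_cotTerm_eq_mean (R := R) (R' := R') hk hw hh hpar hα hne
    (by simpa [hκ] using hR1) (by simpa [hκ] using hR2) (by simpa [hκ] using hR1')
    (by simpa [hκ] using hR2') hz
  have hI := (Filter.eventually_all_finset (Finset.range k)).2 fun ν _ =>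
    mordellI_eq (a := a) (c := c) hk hw hsin (ν : ℤ)
  obtain ⟨δ, hδ, hδI⟩ := (hmain.and hI).exists
  rw [hδ]
  congr 1
  simp only [Finset.sum_range_succ, Finset.sum_range_zero, hκ, sub_zero, Nat.cast_zero, Nat.cast_one,
    zero_add]
  rw [tsum_thetaTerm_one hev, zero_mul, add_zero]
  -- the reflection `μ ↦ -μ` pairs the lines on the two sides of a possible pole
  have hrefl : ∀ δ : ℝ, saddleLineSum (a / c) k h' w 0 δ = ∑ μ ∈ Finset.range k,
      gaussWeight k h' μ * linPhase k h' 0 μ * cotLine (a / c) k w (-μ) δ := by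
    intro δ
    have := sum_weight_mul_cotLine_neg (α := a / c) (w := w) hk hpar 0 δ
    simpa [hκ] using this
  have h1 : (saddleLineSum (a / c) k h' w 0 δ + saddleLineSum (a / c) k h' w 0 (-δ)) / 2 =
      2 * Complex.sin (2 * π * (a / c : ℝ)) * ∑ ν ∈ Finset.range k,
        (-1 : ℂ) ^ ν * cexp (-(2 * π * I * h' * ν ^ 2 / k)) * mordellI a c k ν w := by
    have h2 : 2 * (saddleLineSum (a / c) k h' w 0 δ + saddleLineSum (a / c) k h' w 0 (-δ)) =
        8 * Complex.sin (2 * π * (a / c : ℝ)) * ∑ ν ∈ Finset.range k,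
        (-1 : ℂ) ^ ν * cexp (-(2 * π * I * h' * ν ^ 2 / k)) * mordellI a c k ν w := by
      rw [two_mul]
      nth_rewrite 3 [hrefl]
      nth_rewrite 3 [hrefl]
      unfold saddleLineSum
      rw [← Finset.sum_add_distrib, ← Finset.sum_add_distrib, ← Finset.sum_add_distrib,
        Finset.mul_sum]
      refine Finset.sum_congr rfl fun ν hν => ?_
      have h3 := (hδI ν hν).2
      have h4 : gaussWeight k h' ν * linPhase k h' 0 ν =
          (-1 : ℂ) ^ ν * cexp (-(2 * π * I * h' * ν ^ 2 / k)) := by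
        have hodd : Odd ((k : ℤ) + 1) := (by exact_mod_cast hev : Even (k : ℤ)).add_one
        unfold gaussWeight linPhase
        rw [zpow_mul, hodd.neg_one_zpow, zpow_natCast]
        simp
      simp only [hk2, Nat.cast_zero, zero_div, sub_zero, Int.cast_natCast] at h3 ⊢
      rw [h4]
      simp only [add_zero]
      linear_combination (-((-1 : ℂ) ^ ν * cexp (-(2 * π * I * h' * ν ^ 2 / k)))) * h3
    linear_combination h2 / 4
  rw [h1]
  ring

/-- For odd `k` the two classes of frequencies, represented by `-1/2` and `1/2`, carry the same theta
series; together they give the Mordell type integrals. -/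
theorem tsum_cotTerm_odd {a c : ℕ} (hk : 0 < k) (hw : 0 < w.re) (hh : h * h' ≡ -1 [ZMOD k])
    (hodd : Odd k) (hpar : Odd k → Even h') (hsin : Complex.sin (2 * π * (a / c : ℝ)) ≠ 0)
    (hα : ∀ n : ℤ, (a / c : ℝ) ≠ n)
    (hne : ∀ n : ℤ, k * (a / c : ℝ) = n → 1 - cexp (resRatioLog (a / c) k h' w n) ≠ 0) {R R' : ℤ}
    (hR1 : R - 1 ≤ 2 * (k * (a / c : ℝ)) + 1 / 2) (hR2 : 2 * (k * (a / c : ℝ)) + 1 / 2 < R)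
    (hR1' : R' - 1 < 2 * (k * (a / c : ℝ)) + 1 / 2) (hR2' : 2 * (k * (a / c : ℝ)) + 1 / 2 ≤ R')
    {z : ℂ} (hz : z = (h + I * w) / k) :
    ∑' n : ℤ, cotTerm (a / c) z n =
      (∑' n : ℤ, thetaTerm k h' w (1 / 2) n) * (4 * Complex.sin (2 * π * (a / c : ℝ)) / k) *
        (∑ ν ∈ Finset.range k, cexp (-(π * I * h' / k * (2 * ν ^ 2 - ν))) *
          mordellI a c k ν w) +
      1 / w * (∑' n : ℤ, resSum (a / c) k h' w R n + ∑' n : ℤ, resSum (a / c) k h' w R' n) := by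
  have hk2 : k % 2 = 1 := Nat.odd_iff.1 hodd
  have hκ : freqShift k = 1 / 2 := by simp [freqShift, hk2]
  have hmain := tsum_cotTerm_eq_mean (R := R) (R' := R') hk hw hh hpar hα hne
    (by simpa [hκ] using hR1) (by simpa [hκ] using hR2) (by simpa [hκ] using hR1')
    (by simpa [hκ] using hR2') hz
  have hI := (Filter.eventually_all_finset (Finset.range k)).2 fun ν _ =>
    mordellI_eq (a := a) (c := c) hk hw hsin (ν : ℤ)
  obtain ⟨δ, hδ, hδI⟩ := (hmain.and hI).exists
  rw [hδ]
  congr 1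
  simp only [Finset.sum_range_succ, Finset.sum_range_zero, hκ, Nat.cast_zero, Nat.cast_one,
    zero_add, zero_sub]
  rw [tsum_thetaTerm_neg, show (1 : ℝ) - 1 / 2 = 1 / 2 by norm_num]
  -- the reflection `μ ↦ -μ` exchanges the two classes of frequencies
  have hrefl : ∀ δ : ℝ, saddleLineSum (a / c) k h' w (1 / 2) δ = ∑ μ ∈ Finset.range k,
      gaussWeight k h' μ * linPhase k h' (-(1 / 2)) μ *
        cotLine (a / c) k w (-(μ + -(1 / 2) / 2)) δ := by
    intro δ
    have := sum_weight_mul_cotLine_neg (α := a / c) (w := w) hk hpar 0 δ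
    simpa [hκ] using this
  have h2 : saddleLineSum (a / c) k h' w (-(1 / 2)) δ + saddleLineSum (a / c) k h' w (-(1 / 2)) (-δ) +
      saddleLineSum (a / c) k h' w (1 / 2) δ + saddleLineSum (a / c) k h' w (1 / 2) (-δ) =
        8 * Complex.sin (2 * π * (a / c : ℝ)) * ∑ ν ∈ Finset.range k,
        cexp (-(π * I * h' / k * (2 * ν ^ 2 - ν))) * mordellI a c k ν w := by
    rw [hrefl, hrefl]
    unfold saddleLineSum
    rw [← Finset.sum_add_distrib, ← Finset.sum_add_distrib, ← Finset.sum_add_distrib,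
      Finset.mul_sum]
    refine Finset.sum_congr rfl fun ν hν => ?_
    have h3 := (hδI ν hν).2
    have h4 : gaussWeight k h' ν * linPhase k h' (-(1 / 2)) ν =
        cexp (-(π * I * h' / k * (2 * ν ^ 2 - ν))) := by
      have hev : Even ((k : ℤ) + 1) := (by exact_mod_cast hodd : Odd (k : ℤ)).add_one
      unfold gaussWeight linPhase
      rw [zpow_mul, hev.neg_one_zpow, one_zpow, one_mul, ← Complex.exp_add]
      congr 1
      push_cast
      ring
    have h5 : (ν : ℝ) + -(1 / 2) / 2 = ν - 1 / 4 := by ring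
    simp only [hk2, Nat.cast_one, Int.cast_natCast] at h3
    rw [h4, h5]
    linear_combination (-(cexp (-(π * I * h' / k * (2 * ν ^ 2 - ν))))) * h3
  linear_combination ((∑' n : ℤ, thetaTerm k h' w (1 / 2) n) / (2 * k)) * h2

end

/-! ### The generating function of the ranks of overpartitions -/

/-- An overpartition as a partition together with a subset of its set of part sizes. -/
def overpartitionEquiv (n : ℕ) :
    Overpartition n ≃ Σ p : n.Partition, {S : Finset ℕ // S ∈ p.parts.toFinset.powerset} where
  toFun p := ⟨p.toPartition, p.overlined, Finset.mem_powerset.2 p.overlined_subset⟩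
  invFun x := ⟨x.1, x.2.1, Finset.mem_powerset.1 x.2.2⟩
  left_inv _ := rfl
  right_inv _ := rfl

instance (n : ℕ) : Fintype (Overpartition n) := Fintype.ofEquiv _ (overpartitionEquiv n).symm

/-- The weight `2 ^ d v ^ ℓ` of a partition with `ℓ` parts of `d` different sizes. -/
def partWeight (v : ℂ) {n : ℕ} (p : n.Partition) : ℂ :=
  2 ^ p.parts.toFinset.card * v ^ Multiset.card p.parts

lemma finsum_overN {u : ℂ} (hu : u ≠ 0) (n : ℕ) :
    ∑ᶠ m : ℤ, (overN m n : ℂ) * u ^ m =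
      ∑ p : n.Partition, u ^ p.parts.sup * partWeight u⁻¹ p := by
  classical
  have hcard : ∀ m : ℤ, overN m n =
      (Finset.univ.filter fun p : Overpartition n => p.rank = m).card := by
    intro m
    rw [overN, Nat.card_eq_fintype_card, Fintype.card_subtype]
  have h1 : ∑ᶠ m : ℤ, (overN m n : ℂ) * u ^ m = ∑ p : Overpartition n, u ^ p.rank := by
    rw [finsum_eq_sum_of_support_subset (s := Finset.univ.image Overpartition.rank)]
    · rw [Finset.sum_comp (fun m : ℤ => u ^ m) Overpartition.rank]
      refine Finset.sum_congr rfl fun m _ => ?_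
      rw [hcard, nsmul_eq_mul]
    · intro m hm
      rw [Function.mem_support] at hm
      have h2 := left_ne_zero_of_mul hm
      rw [hcard, Nat.cast_ne_zero, Finset.card_ne_zero] at h2
      obtain ⟨p, hp⟩ := h2
      simp only [Finset.coe_image, Finset.coe_univ, Set.image_univ, Set.mem_range]
      exact ⟨p, (Finset.mem_filter.1 hp).2⟩
  rw [h1, ← (overpartitionEquiv n).symm.sum_comp, Fintype.sum_sigma]
  refine Finset.sum_congr rfl fun p _ => ?_
  have h3 : ∀ S : {S : Finset ℕ // S ∈ p.parts.toFinset.powerset},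
      u ^ ((overpartitionEquiv n).symm ⟨p, S⟩).rank =
        u ^ p.parts.sup * u⁻¹ ^ Multiset.card p.parts := by
    intro S
    have : ((overpartitionEquiv n).symm ⟨p, S⟩).rank =
      (p.parts.sup : ℤ) - (Multiset.card p.parts : ℤ) := rfl
    rw [this, zpow_sub₀ hu, zpow_natCast, zpow_natCast, inv_pow, div_eq_mul_inv]
  simp_rw [h3]
  rw [Finset.sum_const, Finset.card_univ, Fintype.card_coe, Finset.card_powerset, partWeight,
    nsmul_eq_mul]
  push_cast
  ring

open PowerSeries in
/-- The power series `A` converges absolutely at `q`, with value `s`. -/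
def HasNormEval (A : PowerSeries ℂ) (q s : ℂ) : Prop :=
  (Summable fun n => ‖coeff n A * q ^ n‖) ∧ HasSum (fun n => coeff n A * q ^ n) s

section
variable {A B : PowerSeries ℂ} {q s t : ℂ}

lemma HasNormEval.mul (hA : HasNormEval A q s) (hB : HasNormEval B q t) :
    HasNormEval (A * B) q (s * t) := by
  have e : ∀ n : ℕ, PowerSeries.coeff n (A * B) * q ^ n = ∑ x ∈ Finset.HasAntidiagonal.antidiagonal n,
      (PowerSeries.coeff x.1 A * q ^ x.1) * (PowerSeries.coeff x.2 B * q ^ x.2) := by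
    intro n
    rw [PowerSeries.coeff_mul, Finset.sum_mul]
    refine Finset.sum_congr rfl fun x hx => ?_
    rw [← Finset.HasAntidiagonal.mem_antidiagonal.1 hx, pow_add]
    ring
  have h1 := summable_norm_sum_mul_antidiagonal_of_summable_norm hA.1 hB.1
  have h2 := tsum_mul_tsum_eq_tsum_sum_antidiagonal_of_summable_norm hA.1 hB.1
  rw [hA.2.tsum_eq, hB.2.tsum_eq] at h2
  unfold HasNormEval
  simp_rw [e]
  exact ⟨h1, h2 ▸ h1.of_norm.hasSum⟩

lemma hasNormEval_one (q : ℂ) : HasNormEval 1 q 1 := by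
  have e : ∀ n : ℕ, PowerSeries.coeff n (1 : PowerSeries ℂ) * q ^ n = if n = 0 then 1 else 0 := by
    intro n
    rw [PowerSeries.coeff_one]
    split_ifs with h
    · simp [h]
    · simp
  unfold HasNormEval
  simp_rw [e]
  refine ⟨?_, hasSum_ite_eq 0 1⟩
  exact summable_of_ne_finset_zero (s := {0}) fun n hn => by simp at hn; simp [hn]

lemma HasNormEval.sub (hA : HasNormEval A q s) (hB : HasNormEval B q t) :
    HasNormEval (A - B) q (s - t) := by
  unfold HasNormEval
  simp_rw [map_sub, sub_mul]
  exact ⟨(hA.1.add hB.1).of_nonneg_of_le (fun n => norm_nonneg _) fun n => norm_sub_le _ _,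
    hA.2.sub hB.2⟩

lemma HasNormEval.prod {ι : Type*} (S : Finset ι) {G : ι → PowerSeries ℂ} {g : ι → ℂ}
    (h : ∀ i ∈ S, HasNormEval (G i) q (g i)) : HasNormEval (∏ i ∈ S, G i) q (∏ i ∈ S, g i) := by
  classical
  induction S using Finset.induction_on with
  | empty => simpa using hasNormEval_one q
  | insert i S hi ih =>
    rw [Finset.prod_insert hi, Finset.prod_insert hi]
    exact (h i (Finset.mem_insert_self i S)).mul
      (ih fun j hj => h j (Finset.mem_insert_of_mem hj))

end

/-- The character of the generating function of the partitions with weight `partWeight v` and parts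
at most `L`. -/
def boundedChar (v : ℂ) (L i j : ℕ) : ℂ := if i ≤ L then 2 * v ^ j else 0

open scoped PowerSeries.WithPiTopology in
/-- The factor of the generating function that belongs to the parts of size `i`. -/
def partFactor (v : ℂ) (i : ℕ) : PowerSeries ℂ :=
  1 + ∑' j : ℕ, (2 * v ^ (j + 1)) • PowerSeries.X ^ (i * (j + 1))

open scoped PowerSeries.WithPiTopology in
lemma genFun_boundedChar (v : ℂ) (L : ℕ) :
    Nat.Partition.genFun (boundedChar v L) = ∏ i ∈ Finset.range L, partFactor v (i + 1) := by
  rw [Nat.Partition.genFun_eq_tprod, tprod_eq_prod (s := Finset.range L)]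
  · refine Finset.prod_congr rfl fun i hi => ?_
    have : i + 1 ≤ L := Finset.mem_range.1 hi
    simp [partFactor, boundedChar, this]
  · intro i hi
    have : ¬ i + 1 ≤ L := by simpa using hi
    simp [boundedChar, this]

open scoped PowerSeries.WithPiTopology in
lemma coeff_partFactor (v : ℂ) {i : ℕ} (hi : i ≠ 0) (n : ℕ) :
    PowerSeries.coeff n (partFactor v i) =
      (if n = 0 then 1 else 0) + ∑' j : ℕ, if n = i * (j + 1) then 2 * v ^ (j + 1) else 0 := by
  have hs := Nat.Partition.summable_genFun_term' (fun _ j => 2 * v ^ j) hi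
  rw [partFactor, map_add, PowerSeries.coeff_one,
    hs.map_tsum _ (PowerSeries.WithPiTopology.continuous_coeff _ _)]
  congr 1
  refine tsum_congr fun j => ?_
  rw [map_smul, PowerSeries.coeff_X_pow, smul_eq_mul, mul_ite, mul_one, mul_zero]

lemma hasNormEval_partFactor {v q : ℂ} {i : ℕ} (hi : i ≠ 0) (hx : ‖q ^ i * v‖ < 1) :
    HasNormEval (partFactor v i) q ((1 + q ^ i * v) / (1 - q ^ i * v)) := by
  set x := q ^ i * v with hx'
  have hinj : Function.Injective fun j : ℕ => i * j := fun a b h => Nat.eq_of_mul_eq_mul_left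
    (Nat.pos_of_ne_zero hi) h
  have h0 : ∀ n ∉ Set.range fun j : ℕ => i * j, PowerSeries.coeff n (partFactor v i) * q ^ n = 0 := by
    intro n hn
    rw [coeff_partFactor v hi, if_neg, zero_add]
    · have : ∀ j : ℕ, (if n = i * (j + 1) then 2 * v ^ (j + 1) else 0) = 0 := fun j =>
        if_neg fun h => hn ⟨j + 1, h.symm⟩
      simp [this]
    · rintro rfl
      exact hn ⟨0, by simp⟩
  have h1 : ∀ j : ℕ, PowerSeries.coeff (i * j) (partFactor v i) * q ^ (i * j) =
      2 * x ^ j - if j = 0 then 1 else 0 := by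
    intro j
    rw [coeff_partFactor v hi]
    rcases Nat.eq_zero_or_pos j with rfl | hj
    · have : ∀ j : ℕ, ¬ (i * 0 = i * (j + 1)) := by
        intro j h
        have := hinj h
        omega
      simp [hi]
      norm_num
    · rw [if_neg (by simp [hi]; omega), zero_add, tsum_eq_single (j - 1), if_pos, if_neg (by omega),
        sub_zero, hx', mul_pow, ← pow_mul]
      · rw [Nat.sub_add_cancel hj]; ring
      · rw [Nat.sub_add_cancel hj]
      · intro b hb
        rw [if_neg]
        intro h
        have := hinj h
        omega
  have hne : 1 - x ≠ 0 := by
    intro h0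
    rw [← sub_eq_zero.1 h0, norm_one] at hx
    exact lt_irrefl _ hx
  have hgeo : Summable fun j : ℕ => ‖x ^ j‖ := by
    simp_rw [norm_pow]
    exact summable_geometric_of_lt_one (norm_nonneg _) hx
  constructor
  · refine (hinj.summable_iff ?_).1 ?_
    · intro n hn
      rw [h0 n hn, norm_zero]
    · simp only [Function.comp_def, h1]
      have h2 : Summable fun j : ℕ => 2 * ‖x ^ j‖ + if j = 0 then (1 : ℝ) else 0 :=
        (hgeo.mul_left 2).add (hasSum_ite_eq 0 (1 : ℝ)).summable
      refine h2.of_nonneg_of_le (fun _ => norm_nonneg _) fun j => ?_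
      refine (norm_sub_le _ _).trans (add_le_add (by simp) ?_)
      split_ifs <;> simp
  · refine (hinj.hasSum_iff h0).1 ?_
    simp only [Function.comp_def, h1]
    have h2 := ((hasSum_geometric_of_norm_lt_one hx).mul_left 2).sub (hasSum_ite_eq 0 (1 : ℂ))
    have h3 : (1 + x) / (1 - x) = 2 * (1 - x)⁻¹ - 1 := by
      field_simp
      ring
    rw [h3]
    exact h2

section
variable {n : ℕ}

lemma prod_boundedChar (v : ℂ) (L : ℕ) (p : n.Partition) :
    p.parts.toFinsupp.prod (boundedChar v L) = if p.parts.sup ≤ L then partWeight v p else 0 := by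
  rw [Finsupp.prod, Multiset.toFinsupp_support]
  split_ifs with h
  · have h1 : ∀ i ∈ p.parts.toFinset, boundedChar v L i (p.parts.toFinsupp i) =
        2 * v ^ p.parts.count i := by
      intro i hi
      rw [boundedChar, if_pos, Multiset.toFinsupp_apply]
      exact (Multiset.le_sup (Multiset.mem_toFinset.1 hi)).trans h
    rw [Finset.prod_congr rfl h1, Finset.prod_mul_distrib, Finset.prod_const, partWeight,
      Finset.prod_pow_eq_pow_sum, Multiset.toFinset_sum_count_eq]
  · have : ∃ i ∈ p.parts, L < i := by
      by_contra hcon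
      push Not at hcon
      exact h (Multiset.sup_le.2 hcon)
    obtain ⟨i, hi, hiL⟩ := this
    refine Finset.prod_eq_zero (Multiset.mem_toFinset.2 hi) ?_
    rw [boundedChar, if_neg (by omega)]

/-- The partitions with largest part `L + 1`. -/
lemma coeff_prod_mul_partFactor_sub_one (v : ℂ) (L n : ℕ) :
    PowerSeries.coeff n ((∏ i ∈ Finset.range L, partFactor v (i + 1)) * (partFactor v (L + 1) - 1)) =
      ∑ p : n.Partition, if p.parts.sup = L + 1 then partWeight v p else 0 := by
  rw [mul_sub, mul_one, ← Finset.prod_range_succ (fun i => partFactor v (i + 1)),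
    ← genFun_boundedChar, ← genFun_boundedChar,
    map_sub, Nat.Partition.coeff_genFun, Nat.Partition.coeff_genFun, ← Finset.sum_sub_distrib]
  refine Finset.sum_congr rfl fun p _ => ?_
  rw [prod_boundedChar, prod_boundedChar]
  by_cases h1 : p.parts.sup = L + 1
  · rw [if_pos h1.le, if_neg (by omega), if_pos h1, sub_zero]
  · rw [if_neg h1]
    by_cases h2 : p.parts.sup ≤ L
    · rw [if_pos (by omega), if_pos h2, sub_self]
    · rw [if_neg (by omega), if_neg h2, sub_self]

lemma norm_partWeight {v : ℂ} (hv : ‖v‖ = 1) (p : n.Partition) :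
    ‖partWeight v p‖ = ‖partWeight 1 p‖ := by
  simp [partWeight, hv]

end

/-- The term of the generating function that belongs to the overpartitions with largest part
`L + 1`. -/
def largestPartTerm (v q : ℂ) (L : ℕ) : ℂ :=
  (∏ i ∈ Finset.range L, (1 + q ^ (i + 1) * v) / (1 - q ^ (i + 1) * v)) *
    (2 * (q ^ (L + 1) * v) / (1 - q ^ (L + 1) * v))

lemma norm_pow_succ_mul_lt_one {v q : ℂ} (hv : ‖v‖ = 1) (hq : ‖q‖ < 1) (i : ℕ) :
    ‖q ^ (i + 1) * v‖ < 1 := by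
  rw [norm_mul, hv, mul_one, norm_pow]
  exact pow_lt_one₀ (norm_nonneg _) hq (Nat.succ_ne_zero i)

lemma one_sub_ne_zero_of_norm_lt_one {x : ℂ} (hx : ‖x‖ < 1) : 1 - x ≠ 0 := by
  intro h0
  rw [← sub_eq_zero.1 h0, norm_one] at hx
  exact lt_irrefl _ hx

lemma hasNormEval_largestPartTerm {v q : ℂ} (hv : ‖v‖ = 1) (hq : ‖q‖ < 1) (L : ℕ) :
    HasNormEval ((∏ i ∈ Finset.range L, partFactor v (i + 1)) * (partFactor v (L + 1) - 1)) q
      (largestPartTerm v q L) := by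
  have h := fun i => norm_pow_succ_mul_lt_one hv hq i
  have h1 := (hasNormEval_partFactor L.succ_ne_zero (h L)).sub (hasNormEval_one q)
  have h2 := (HasNormEval.prod (Finset.range L) fun i _ =>
    hasNormEval_partFactor i.succ_ne_zero (h i)).mul h1
  convert h2 using 1
  rw [largestPartTerm]
  congr 1
  have := one_sub_ne_zero_of_norm_lt_one (h L)
  simp only [Nat.succ_eq_add_one]
  field_simp
  ring

lemma summable_largestPartTerm_one {y : ℝ} (hy0 : 0 ≤ y) (hy : y < 1) :
    Summable fun L => ‖largestPartTerm 1 y L‖ := by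
  rcases hy0.eq_or_lt with rfl | hy0
  · refine summable_zero.congr fun L => ?_
    simp [largestPartTerm]
  have hp : ∀ i : ℕ, y ^ (i + 1) < 1 := fun i => pow_lt_one₀ hy0.le hy i.succ_ne_zero
  have hterm : ∀ L : ℕ, largestPartTerm 1 y L = (((∏ i ∈ Finset.range L,
      (1 + y ^ (i + 1)) / (1 - y ^ (i + 1))) * (2 * y ^ (L + 1) / (1 - y ^ (L + 1))) : ℝ) : ℂ) := by
    intro L
    rw [largestPartTerm]
    push_cast
    simp
  have hpos : ∀ L : ℕ, 0 < (∏ i ∈ Finset.range L,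
      (1 + y ^ (i + 1)) / (1 - y ^ (i + 1))) * (2 * y ^ (L + 1) / (1 - y ^ (L + 1))) := by
    intro L
    refine mul_pos (Finset.prod_pos fun i _ => ?_) ?_
    · exact div_pos (by positivity) (sub_pos.2 (hp i))
    · exact div_pos (by positivity) (sub_pos.2 (hp L))
  simp_rw [hterm, norm_real]
  have hratio : Tendsto (fun L : ℕ => y * (1 + y ^ (L + 1)) / (1 - y ^ (L + 2))) atTop (𝓝 y) := by
    have h1 : Tendsto (fun L : ℕ => y ^ (L + 1)) atTop (𝓝 0) :=
      (tendsto_pow_atTop_nhds_zero_of_lt_one hy0.le hy).comp (tendsto_add_atTop_nat 1)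
    have h2 : Tendsto (fun L : ℕ => y ^ (L + 2)) atTop (𝓝 0) :=
      (tendsto_pow_atTop_nhds_zero_of_lt_one hy0.le hy).comp (tendsto_add_atTop_nat 2)
    have h3 : Tendsto (fun L : ℕ => y * (1 + y ^ (L + 1)) / (1 - y ^ (L + 2))) atTop
        (𝓝 (y * (1 + 0) / (1 - 0))) :=
      ((h1.const_add 1).const_mul y).div (h2.const_sub 1) (by norm_num)
    rwa [add_zero, mul_one, sub_zero, div_one] at h3
  refine Summable.of_norm (E := ℝ) ?_
  simp_rw [norm_norm]
  refine (summable_of_ratio_test_tendsto_lt_one hy (Eventually.of_forall fun L => (hpos L).ne')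
    (hratio.congr fun L => ?_)).norm
  rw [Real.norm_of_nonneg (hpos _).le, Real.norm_of_nonneg (hpos _).le, Finset.prod_range_succ]
  have e1 : (1 : ℝ) - y ^ (L + 1) ≠ 0 := (sub_pos.2 (hp L)).ne'
  have e2 : (1 : ℝ) - y ^ (L + 2) ≠ 0 := (sub_pos.2 (hp (L + 1))).ne'
  have e3 : (∏ i ∈ Finset.range L, (1 + y ^ (i + 1)) / (1 - y ^ (i + 1))) ≠ 0 :=
    Finset.prod_ne_zero_iff.2 fun i _ => (div_pos (by positivity) (sub_pos.2 (hp i))).ne'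
  rw [show L + 1 + 1 = L + 2 by ring]
  field_simp
  ring

/-- The weighted number of the partitions of `n` with largest part `L + 1`. -/
def largestPartCoeff (v : ℂ) (L n : ℕ) : ℂ :=
  ∑ p : n.Partition, if p.parts.sup = L + 1 then partWeight v p else 0

lemma summable_largestPartCoeff {v q : ℂ} (hv : ‖v‖ = 1) (hq : ‖q‖ < 1) (L : ℕ) :
    (Summable fun n => ‖largestPartCoeff v L n * q ^ n‖) ∧
      HasSum (fun n => largestPartCoeff v L n * q ^ n) (largestPartTerm v q L) := by
  have := hasNormEval_largestPartTerm hv hq L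
  unfold HasNormEval at this
  simp_rw [coeff_prod_mul_partFactor_sub_one] at this
  exact this

lemma largestPartCoeff_one (L n : ℕ) : largestPartCoeff 1 L n = ((∑ p : n.Partition,
    if p.parts.sup = L + 1 then (2 : ℝ) ^ p.parts.toFinset.card else 0 : ℝ) : ℂ) := by
  simp only [largestPartCoeff, partWeight]
  push_cast
  refine Finset.sum_congr rfl fun p _ => ?_
  split_ifs <;> simp

lemma norm_largestPartCoeff_le {v : ℂ} (hv : ‖v‖ = 1) (L n : ℕ) :
    ‖largestPartCoeff v L n‖ ≤ ‖largestPartCoeff 1 L n‖ := by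
  rw [largestPartCoeff_one, norm_real]
  refine ((norm_sum_le _ _).trans (Finset.sum_le_sum fun p _ => ?_)).trans (le_abs_self _)
  split_ifs
  · rw [norm_partWeight hv]
    simp [partWeight]
  · simp

lemma summable_largestPartCoeff_mul {v q : ℂ} (hv : ‖v‖ = 1) (hq : ‖q‖ < 1) :
    Summable fun x : ℕ × ℕ => ‖largestPartCoeff v x.1 x.2 * q ^ x.2‖ := by
  have hy : ‖((‖q‖ : ℝ) : ℂ)‖ < 1 := by simpa using hq
  have h0 : ∀ L n, 0 ≤ ‖largestPartCoeff 1 L n * ((‖q‖ : ℝ) : ℂ) ^ n‖ := fun _ _ => norm_nonneg _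
  have hdom : Summable fun x : ℕ × ℕ => ‖largestPartCoeff 1 x.1 x.2 * ((‖q‖ : ℝ) : ℂ) ^ x.2‖ := by
    rw [summable_prod_of_nonneg fun _ => norm_nonneg _]
    refine ⟨fun L => (summable_largestPartCoeff norm_one hy L).1, ?_⟩
    refine (summable_largestPartTerm_one (norm_nonneg q) hq).congr fun L => ?_
    rw [← (summable_largestPartCoeff norm_one hy L).2.tsum_eq]
    have h1 : ∀ n, largestPartCoeff 1 L n * ((‖q‖ : ℝ) : ℂ) ^ n =
        ((‖largestPartCoeff 1 L n * ((‖q‖ : ℝ) : ℂ) ^ n‖ : ℝ) : ℂ) := by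
      intro n
      rw [largestPartCoeff_one, ← ofReal_pow, ← ofReal_mul, norm_real, Real.norm_of_nonneg]
      refine mul_nonneg (Finset.sum_nonneg fun p _ => ?_) (by positivity)
      split_ifs <;> positivity
    rw [tsum_congr h1, ← ofReal_tsum, norm_real, Real.norm_of_nonneg (tsum_nonneg (h0 L))]
  refine hdom.of_nonneg_of_le (fun _ => norm_nonneg _) fun x => ?_
  rw [norm_mul, norm_mul, norm_pow, norm_pow, norm_real, norm_norm]
  exact mul_le_mul_of_nonneg_right (norm_largestPartCoeff_le hv _ _) (by positivity)

lemma parts_sup_ne_zero {n : ℕ} (p : (n + 1).Partition) : p.parts.sup ≠ 0 := by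
  intro hp
  have hne : p.parts ≠ 0 := by
    intro h0
    have := p.parts_sum
    rw [h0] at this
    simp at this
  obtain ⟨i, hi⟩ := Multiset.exists_mem_of_ne_zero hne
  have h1 := p.parts_pos hi
  have h2 := Multiset.le_sup hi
  omega

lemma largestPartCoeff_zero (v : ℂ) (L : ℕ) : largestPartCoeff v L 0 = 0 := by
  refine Finset.sum_eq_zero fun p _ => if_neg ?_
  rw [Nat.Partition.partition_zero_parts]
  simp

lemma finsum_overN_mul {u q : ℂ} (hu : u ≠ 0) (n : ℕ) :
    (∑ᶠ m : ℤ, (overN m (n + 1) : ℂ) * u ^ m) * q ^ (n + 1) =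
      ∑' L, u ^ (L + 1) * (largestPartCoeff u⁻¹ L (n + 1) * q ^ (n + 1)) := by
  rw [finsum_overN hu, Finset.sum_mul]
  have hexp : ∀ L, u ^ (L + 1) * (largestPartCoeff u⁻¹ L (n + 1) * q ^ (n + 1)) =
      ∑ p : (n + 1).Partition, if L = p.parts.sup - 1 then
        u ^ p.parts.sup * partWeight u⁻¹ p * q ^ (n + 1) else 0 := by
    intro L
    rw [largestPartCoeff, Finset.sum_mul, Finset.mul_sum]
    refine Finset.sum_congr rfl fun p _ => ?_
    have := parts_sup_ne_zero p
    by_cases h1 : p.parts.sup = L + 1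
    · rw [if_pos h1, if_pos (by omega), h1]
      ring
    · rw [if_neg h1, if_neg (by omega)]
      ring
  rw [tsum_congr hexp, Summable.tsum_finsetSum fun p _ => (hasSum_ite_eq _ _).summable]
  refine Finset.sum_congr rfl fun p _ => ?_
  rw [tsum_ite_eq]

/-- Classifying the overpartitions by their largest part. -/
theorem rankGen_eq {u q : ℂ} (hu : ‖u‖ = 1) (hq : ‖q‖ < 1) :
    Summable (fun L : ℕ => u ^ (L + 1) * largestPartTerm u⁻¹ q L) ∧
    rankGen u q = 1 + ∑' L : ℕ, u ^ (L + 1) * largestPartTerm u⁻¹ q L := by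
  have hu0 : u ≠ 0 := by
    rintro rfl
    simp at hu
  have hv : ‖u⁻¹‖ = 1 := by rw [norm_inv, hu, inv_one]
  set F : ℕ → ℕ → ℂ := fun L n => u ^ (L + 1) * (largestPartCoeff u⁻¹ L n * q ^ n) with hF
  have hsum : Summable (Function.uncurry F) := by
    refine Summable.of_norm_bounded (summable_largestPartCoeff_mul hv hq) fun x => ?_
    rw [Function.uncurry, hF]
    simp only
    rw [norm_mul, norm_pow, hu, one_pow, one_mul]
  have hL : ∀ L, ∑' n, F L n = u ^ (L + 1) * largestPartTerm u⁻¹ q L := by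
    intro L
    rw [tsum_mul_left, (summable_largestPartCoeff hv hq L).2.tsum_eq]
  have h1 : Summable fun L => ∑' n, F L n := hsum.prod
  have h2 : Summable fun n => ∑' L, F L n := hsum.prod_symm.prod
  refine ⟨h1.congr hL, ?_⟩
  have hzero : ∑' L, F L 0 = 0 := by
    simp [hF, largestPartCoeff_zero]
  have h3 : ∑' L, ∑' n, F L n = ∑' n, ∑' L, F L n := (Summable.tsum_comm hsum).symm
  have h4 : ∀ n, (∑ᶠ m : ℤ, (overN m (n + 1) : ℂ) * u ^ m) * q ^ (n + 1) = ∑' L, F L (n + 1) :=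
    fun n => finsum_overN_mul hu0 n
  rw [rankGen, ← tsum_congr hL, h3, h2.tsum_eq_zero_add, hzero, zero_add, tsum_congr h4]

/-! ### A Rogers–Fine identity -/

/-- The coefficient `(-A; q)_n / (A q; q)_n`. -/
def fineCoeff (q A : ℂ) (n : ℕ) : ℂ := ∏ i ∈ Finset.range n, (1 + A * q ^ i) / (1 - A * q ^ (i + 1))

/-- The basic hypergeometric series `∑ (-A; q)_n t ^ n / (A q; q)_n`. -/
def fineSum (q A t : ℂ) : ℂ := ∑' n : ℕ, fineCoeff q A n * t ^ n

/-- The product of the factors that appear when the recurrence `one_sub_mul_fineSum` is iterated. -/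
def finePre (q A t : ℂ) (n : ℕ) : ℂ := ∏ i ∈ Finset.range n,
  (1 + A * q ^ i) * (A * q ^ i) * (1 + t * q ^ i) * (t * q ^ (i + 1)) /
    ((1 - A * q ^ (i + 1)) * (1 - t * q ^ i))

/-- A bound for the finite products that occur in the basic hypergeometric series. -/
def prodBound (q : ℂ) : ℝ := Real.exp (2 / (1 - ‖q‖) ^ 2)

section
variable {q A t : ℂ}

lemma prodBound_pos (q : ℂ) : 0 < prodBound q := Real.exp_pos _

lemma norm_mul_pow_le {a : ℂ} (ha : ‖a‖ ≤ 1) (i : ℕ) : ‖a * q ^ i‖ ≤ ‖q‖ ^ i := by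
  rw [norm_mul, norm_pow]
  exact mul_le_of_le_one_left (by positivity) ha

lemma norm_mul_pow_le_succ {a : ℂ} (ha : ‖a‖ ≤ ‖q‖) (i : ℕ) : ‖a * q ^ i‖ ≤ ‖q‖ ^ (i + 1) := by
  rw [norm_mul, norm_pow, pow_succ']
  exact mul_le_mul_of_nonneg_right ha (by positivity)

lemma norm_prod_le_prodBound (hq : ‖q‖ < 1) (n : ℕ) {a b : ℕ → ℂ} (ha : ∀ i, ‖a i‖ ≤ ‖q‖ ^ i)
    (hb : ∀ i, ‖b i‖ ≤ ‖q‖ ^ (i + 1)) :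
    ‖∏ i ∈ Finset.range n, (1 + a i) / (1 - b i)‖ ≤ prodBound q := by
  set r := ‖q‖ with hr
  have hr0 : 0 ≤ r := norm_nonneg _
  have hr1 : 0 < 1 - r := by linarith
  rw [norm_prod]
  have h1 : ∀ i ∈ Finset.range n, ‖(1 + a i) / (1 - b i)‖ ≤ Real.exp (2 / (1 - r) * r ^ i) := by
    intro i _
    have hri : r ^ (i + 1) ≤ r := pow_le_of_le_one hr0 hq.le i.succ_ne_zero
    have hden : 1 - r ≤ ‖1 - b i‖ := by
      have := norm_sub_norm_le 1 (b i)
      rw [norm_one] at this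
      linarith [hb i]
    have hden' : 1 - r ^ (i + 1) ≤ ‖1 - b i‖ := by
      have := norm_sub_norm_le 1 (b i)
      rw [norm_one] at this
      linarith [hb i]
    have hpos : 0 < 1 - r ^ (i + 1) := by linarith
    have hnum : ‖1 + a i‖ ≤ 1 + r ^ i := (norm_add_le _ _).trans (by rw [norm_one]; linarith [ha i])
    have h0 : 0 ≤ r ^ i := by positivity
    rw [norm_div]
    calc ‖1 + a i‖ / ‖1 - b i‖ ≤ (1 + r ^ i) / (1 - r ^ (i + 1)) := by gcongr
      _ ≤ 2 / (1 - r) * r ^ i + 1 := by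
          rw [div_le_iff₀ hpos]
          have e1 : r ^ (i + 1) = r * r ^ i := pow_succ' _ _
          have e2 : 2 / (1 - r) * r ^ i * (1 - r) = 2 * r ^ i := by field_simp
          have e3 : 2 / (1 - r) * r ^ i * (1 - r) ≤ 2 / (1 - r) * r ^ i * (1 - r ^ (i + 1)) := by
            refine mul_le_mul_of_nonneg_left (by linarith) (by positivity)
          have e4 : r * r ^ i ≤ r ^ i := mul_le_of_le_one_left h0 hq.le
          nlinarith
      _ ≤ _ := Real.add_one_le_exp _
  refine (Finset.prod_le_prod (fun i _ => norm_nonneg _) h1).trans ?_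
  rw [← Real.exp_sum, prodBound, Real.exp_le_exp, ← Finset.mul_sum, sq, ← div_div,
    div_eq_mul_inv (2 / (1 - r))]
  refine mul_le_mul_of_nonneg_left ?_ (by positivity)
  rw [← tsum_geometric_of_lt_one hr0 hq]
  exact (summable_geometric_of_lt_one hr0 hq).sum_le_tsum _ fun i _ => by positivity

lemma norm_fineCoeff_le (hq : ‖q‖ < 1) (hA : ‖A‖ ≤ 1) (n : ℕ) : ‖fineCoeff q A n‖ ≤ prodBound q :=
  norm_prod_le_prodBound hq n (fun i => norm_mul_pow_le hA i) fun i => norm_mul_pow_le hA (i + 1)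

lemma summable_fineSum (hq : ‖q‖ < 1) (hA : ‖A‖ ≤ 1) (ht : ‖t‖ < 1) :
    Summable fun n => fineCoeff q A n * t ^ n := by
  refine Summable.of_norm_bounded (g := fun n => prodBound q * ‖t‖ ^ n)
    ((summable_geometric_of_lt_one (norm_nonneg _) ht).mul_left _) fun n => ?_
  rw [norm_mul, norm_pow]
  exact mul_le_mul_of_nonneg_right (norm_fineCoeff_le hq hA n) (by positivity)

lemma norm_fineSum_le (hq : ‖q‖ < 1) (hA : ‖A‖ ≤ 1) (ht : ‖t‖ < 1) :
    ‖fineSum q A t‖ ≤ prodBound q / (1 - ‖t‖) := by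
  have h1 : HasSum (fun n => prodBound q * ‖t‖ ^ n) (prodBound q * (1 - ‖t‖)⁻¹) :=
    (hasSum_geometric_of_lt_one (norm_nonneg _) ht).mul_left _
  rw [div_eq_mul_inv]
  refine tsum_of_norm_bounded h1 fun n => ?_
  rw [norm_mul, norm_pow]
  exact mul_le_mul_of_nonneg_right (norm_fineCoeff_le hq hA n) (by positivity)

lemma one_sub_mul_pow_ne_zero (hq : ‖q‖ < 1) (hA : ‖A‖ ≤ 1) (i : ℕ) : 1 - A * q ^ (i + 1) ≠ 0 :=
  one_sub_ne_zero_of_norm_lt_one ((norm_mul_pow_le hA (i + 1)).trans_lt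
    (pow_lt_one₀ (norm_nonneg _) hq i.succ_ne_zero))

lemma fineCoeff_succ' (q A : ℂ) (n : ℕ) :
    fineCoeff q A (n + 1) = (1 + A) / (1 - A * q) * fineCoeff q (A * q) n := by
  rw [fineCoeff, Finset.prod_range_succ', mul_comm, fineCoeff]
  congr 1
  · simp
  · refine Finset.prod_congr rfl fun i _ => ?_
    rw [mul_assoc, mul_assoc, ← pow_succ', ← pow_succ']

/-- The recurrence before the shift of the index of summation. -/
lemma one_sub_mul_fineSum_aux (hq : ‖q‖ < 1) (hA : ‖A‖ ≤ 1) (ht : ‖t‖ < 1) :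
    (1 - t) * fineSum q A t = 1 + A * t + A * (1 + t) * (fineSum q A (t * q) - 1) := by
  have htq : ‖t * q‖ < 1 := by
    rw [norm_mul]
    exact mul_lt_one_of_nonneg_of_lt_one_left (norm_nonneg _) ht hq.le
  have s1 := summable_fineSum hq hA ht
  have s2 := summable_fineSum hq hA htq
  have hrec : ∀ n, fineCoeff q A (n + 1) * t ^ (n + 1) - t * (fineCoeff q A n * t ^ n) =
      A * (fineCoeff q A (n + 1) * (t * q) ^ (n + 1)) + A * t * (fineCoeff q A n * (t * q) ^ n) := by
    intro n
    have hne := one_sub_mul_pow_ne_zero hq hA n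
    rw [fineCoeff, Finset.prod_range_succ]
    change fineCoeff q A n * _ * _ - _ = A * (fineCoeff q A n * _ * _) + _
    rw [mul_pow, mul_pow]
    field_simp
    ring
  have e1 : fineSum q A t = 1 + ∑' n, fineCoeff q A (n + 1) * t ^ (n + 1) := by
    rw [fineSum, s1.tsum_eq_zero_add]
    simp [fineCoeff]
  have e2 : fineSum q A (t * q) = 1 + ∑' n, fineCoeff q A (n + 1) * (t * q) ^ (n + 1) := by
    rw [fineSum, s2.tsum_eq_zero_add]
    simp [fineCoeff]
  have s1' := (summable_nat_add_iff 1).2 s1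
  have s2' := (summable_nat_add_iff 1).2 s2
  have h1 : (∑' n, fineCoeff q A (n + 1) * t ^ (n + 1)) - t * fineSum q A t =
      A * (∑' n, fineCoeff q A (n + 1) * (t * q) ^ (n + 1)) + A * t * fineSum q A (t * q) := by
    rw [fineSum, fineSum, ← tsum_mul_left, ← tsum_mul_left, ← tsum_mul_left,
      ← s1'.tsum_sub (s1.mul_left t), ← (s2'.mul_left A).tsum_add (s2.mul_left (A * t))]
    exact tsum_congr hrec
  linear_combination e1 + h1 - A * e2

/-- The recurrence behind the Rogers–Fine identity. -/
lemma one_sub_mul_fineSum (hq : ‖q‖ < 1) (hA : ‖A‖ ≤ 1) (ht : ‖t‖ < 1) :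
    (1 - t) * fineSum q A t = 1 + A * t +
      (1 + A) * A * (1 + t) * (t * q) / (1 - A * q) * fineSum q (A * q) (t * q) := by
  rw [one_sub_mul_fineSum_aux hq hA ht]
  have htq : ‖t * q‖ < 1 := by
    rw [norm_mul]
    exact mul_lt_one_of_nonneg_of_lt_one_left (norm_nonneg _) ht hq.le
  have e : fineSum q A (t * q) - 1 = (1 + A) / (1 - A * q) * (t * q) * fineSum q (A * q) (t * q) := by
    rw [fineSum, (summable_fineSum hq hA htq).tsum_eq_zero_add, fineSum, ← tsum_mul_left]
    have : fineCoeff q A 0 * (t * q) ^ 0 = 1 := by simp [fineCoeff]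
    rw [this, add_sub_cancel_left]
    refine tsum_congr fun n => ?_
    rw [fineCoeff_succ', pow_succ]
    ring
  rw [e]
  ring

/-- The `q`-binomial theorem, as a functional equation. -/
lemma fineSum_one_eq (hq : ‖q‖ < 1) (ht : ‖t‖ < 1) :
    fineSum q 1 t = (1 + t) / (1 - t) * fineSum q 1 (t * q) := by
  have h := one_sub_mul_fineSum_aux (A := 1) hq norm_one.le ht
  have hne := one_sub_ne_zero_of_norm_lt_one ht
  field_simp
  linear_combination h

lemma fineSum_one_eq_prod (hq : ‖q‖ < 1) (ht : ‖t‖ < 1) (n : ℕ) :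
    fineSum q 1 t = (∏ i ∈ Finset.range n, (1 + t * q ^ i) / (1 - t * q ^ i)) *
      fineSum q 1 (t * q ^ n) := by
  induction n with
  | zero => simp
  | succ n ih =>
    have h1 : ‖t * q ^ n‖ < 1 := by
      rw [norm_mul, norm_pow]
      exact mul_lt_one_of_nonneg_of_lt_one_left (norm_nonneg _) ht (pow_le_one₀ (norm_nonneg _) hq.le)
    rw [ih, fineSum_one_eq hq h1, Finset.prod_range_succ]
    ring_nf

lemma tendsto_fineSum_zero (hq : ‖q‖ < 1) : Tendsto (fineSum q 1) (𝓝 0) (𝓝 1) := by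
  have h1 : Tendsto (fun t => t * ((1 + 1) / (1 - 1 * q) * (prodBound q / (1 - 1 / 2) : ℝ)))
      (𝓝 (0 : ℂ)) (𝓝 0) := by
    have : Continuous fun t : ℂ => t * ((1 + 1) / (1 - 1 * q) * (prodBound q / (1 - 1 / 2) : ℝ)) := by
      fun_prop
    simpa using this.tendsto 0
  rw [tendsto_iff_norm_sub_tendsto_zero]
  have h2 := h1.norm
  rw [norm_zero] at h2
  refine tendsto_of_tendsto_of_tendsto_of_le_of_le' tendsto_const_nhds h2
    (Eventually.of_forall fun _ => norm_nonneg _) ?_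
  filter_upwards [Metric.ball_mem_nhds (0 : ℂ) (show (0 : ℝ) < 1 / 2 by norm_num)] with t ht
  have ht' : ‖t‖ < 1 / 2 := by simpa using ht
  have ht1 : ‖t‖ < 1 := by linarith
  have e : fineSum q 1 t - 1 = t * ((1 + 1) / (1 - 1 * q) * fineSum q (1 * q) t) := by
    rw [fineSum, (summable_fineSum hq norm_one.le ht1).tsum_eq_zero_add, fineSum, ← tsum_mul_left,
      ← tsum_mul_left]
    have : fineCoeff q 1 0 * t ^ 0 = 1 := by simp [fineCoeff]
    rw [this, add_sub_cancel_left]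
    refine tsum_congr fun n => ?_
    rw [fineCoeff_succ', pow_succ]
    ring
  rw [e, norm_mul, norm_mul, norm_mul, norm_mul, norm_real]
  have hF := norm_fineSum_le (A := 1 * q) hq (by simpa using hq.le) ht1
  have : prodBound q / (1 - ‖t‖) ≤ ‖prodBound q / (1 - 1 / 2)‖ := by
    rw [Real.norm_of_nonneg (by have := prodBound_pos q; positivity)]
    exact div_le_div_of_nonneg_left (prodBound_pos q).le (by norm_num) (by linarith)
  gcongr
  exact hF.trans this

lemma norm_finePre_le (hq : ‖q‖ < 1) (hA : ‖A‖ ≤ 1) (ht : ‖t‖ ≤ ‖q‖) (n : ℕ) :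
    ‖finePre q A t n‖ ≤ prodBound q ^ 2 * ‖q‖ ^ n := by
  have e : finePre q A t n = (∏ i ∈ Finset.range n, (1 + A * q ^ i) / (1 - A * q ^ (i + 1))) *
      (∏ i ∈ Finset.range n, (1 + t * q ^ i) / (1 - t * q ^ i)) *
      ∏ i ∈ Finset.range n, (A * q ^ i) * (t * q ^ (i + 1)) := by
    rw [← Finset.prod_mul_distrib, ← Finset.prod_mul_distrib, finePre]
    refine Finset.prod_congr rfl fun i _ => ?_
    rw [div_mul_div_comm, div_mul_eq_mul_div]
    ring_nf
  have h1 := norm_fineCoeff_le hq hA n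
  have h2 : ‖∏ i ∈ Finset.range n, (1 + t * q ^ i) / (1 - t * q ^ i)‖ ≤ prodBound q :=
    norm_prod_le_prodBound hq n (fun i => norm_mul_pow_le (ht.trans hq.le) i)
      fun i => norm_mul_pow_le_succ ht i
  have h3 : ‖∏ i ∈ Finset.range n, (A * q ^ i) * (t * q ^ (i + 1))‖ ≤ ‖q‖ ^ n := by
    rw [norm_prod, ← Finset.card_range n, ← Finset.prod_const, Finset.card_range]
    refine Finset.prod_le_prod (fun i _ => norm_nonneg _) fun i _ => ?_
    rw [norm_mul]
    have g1 : ‖A * q ^ i‖ ≤ 1 := (norm_mul_pow_le hA i).trans (pow_le_one₀ (norm_nonneg _) hq.le)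
    have g2 : ‖t * q ^ (i + 1)‖ ≤ ‖q‖ :=
      (norm_mul_pow_le (ht.trans hq.le) (i + 1)).trans
        (pow_le_of_le_one (norm_nonneg _) hq.le i.succ_ne_zero)
    nlinarith [norm_nonneg (A * q ^ i), norm_nonneg (t * q ^ (i + 1))]
  rw [e, norm_mul, norm_mul, sq]
  have := prodBound_pos q
  unfold fineCoeff at h1
  gcongr

lemma fineSum_eq_partial (hq : ‖q‖ < 1) (hA : ‖A‖ ≤ 1) (ht : ‖t‖ < 1) (m : ℕ) :
    fineSum q A t = ∑ n ∈ Finset.range m,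
      finePre q A t n * ((1 + A * t * q ^ (2 * n)) / (1 - t * q ^ n)) +
      finePre q A t m * fineSum q (A * q ^ m) (t * q ^ m) := by
  induction m with
  | zero => simp [finePre]
  | succ m ih =>
    have hA' : ‖A * q ^ m‖ ≤ 1 := (norm_mul_pow_le hA m).trans (pow_le_one₀ (norm_nonneg _) hq.le)
    have ht' : ‖t * q ^ m‖ < 1 := by
      rw [norm_mul, norm_pow]
      exact mul_lt_one_of_nonneg_of_lt_one_left (norm_nonneg _) ht (pow_le_one₀ (norm_nonneg _) hq.le)
    have h1 := one_sub_mul_fineSum hq hA' ht'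
    have hne := one_sub_ne_zero_of_norm_lt_one ht'
    have hne2 := one_sub_mul_pow_ne_zero hq hA m
    have hpre : finePre q A t (m + 1) = finePre q A t m * ((1 + A * q ^ m) * (A * q ^ m) *
        (1 + t * q ^ m) * (t * q ^ (m + 1)) / ((1 - A * q ^ (m + 1)) * (1 - t * q ^ m))) :=
      Finset.prod_range_succ _ _
    have e1 : A * q ^ m * q = A * q ^ (m + 1) := by ring
    have e2 : t * q ^ m * q = t * q ^ (m + 1) := by ring
    have e3 : A * q ^ m * (t * q ^ m) = A * t * q ^ (2 * m) := by ring
    rw [e1, e2, e3] at h1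
    have h2 : fineSum q (A * q ^ m) (t * q ^ m) = (1 + A * t * q ^ (2 * m)) / (1 - t * q ^ m) +
      (1 + A * q ^ m) * (A * q ^ m) * (1 + t * q ^ m) * (t * q ^ (m + 1)) /
        ((1 - A * q ^ (m + 1)) * (1 - t * q ^ m)) *
        fineSum q (A * q ^ (m + 1)) (t * q ^ (m + 1)) := by
      field_simp at h1 ⊢
      linear_combination h1
    rw [Finset.sum_range_succ, ih, hpre, h2]
    ring

/-- The Rogers–Fine identity (the case needed here). -/
theorem hasSum_finePre (hq : ‖q‖ < 1) (hA : ‖A‖ ≤ 1) (ht : ‖t‖ ≤ ‖q‖) :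
    HasSum (fun n => finePre q A t n * ((1 + A * t * q ^ (2 * n)) / (1 - t * q ^ n)))
      (fineSum q A t) := by
  have ht1 : ‖t‖ < 1 := ht.trans_lt hq
  have hr : 0 < 1 - ‖q‖ := by linarith
  have hbd : ∀ n : ℕ, ‖t * q ^ n‖ ≤ ‖q‖ := fun n => (norm_mul_pow_le_succ ht n).trans
    (pow_le_of_le_one (norm_nonneg _) hq.le n.succ_ne_zero)
  have hden : ∀ n : ℕ, 1 - ‖q‖ ≤ ‖1 - t * q ^ n‖ := by
    intro n
    have := norm_sub_norm_le 1 (t * q ^ n)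
    rw [norm_one] at this
    linarith [hbd n]
  have hsum : Summable fun n => finePre q A t n * ((1 + A * t * q ^ (2 * n)) / (1 - t * q ^ n)) := by
    refine Summable.of_norm_bounded (g := fun n => prodBound q ^ 2 * ‖q‖ ^ n * (2 / (1 - ‖q‖)))
      (((summable_geometric_of_lt_one (norm_nonneg _) hq).mul_left _).mul_right _) fun n => ?_
    rw [norm_mul, norm_div]
    refine mul_le_mul (norm_finePre_le hq hA ht n) ?_ (by positivity) (by positivity)
    refine div_le_div₀ (by norm_num) ?_ hr (hden n)
    refine (norm_add_le _ _).trans ?_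
    rw [norm_one, norm_mul, norm_mul, norm_pow]
    have : ‖A‖ * ‖t‖ * ‖q‖ ^ (2 * n) ≤ 1 := by
      have g1 : ‖A‖ * ‖t‖ ≤ 1 := mul_le_one₀ hA (norm_nonneg _) ht1.le
      exact mul_le_one₀ g1 (by positivity) (pow_le_one₀ (norm_nonneg _) hq.le)
    linarith
  have h1 := hsum.hasSum.tendsto_sum_nat
  have h2 : Tendsto (fun m => finePre q A t m * fineSum q (A * q ^ m) (t * q ^ m)) atTop (𝓝 0) := by
    refine squeeze_zero_norm (a := fun m => prodBound q ^ 2 * ‖q‖ ^ m * (prodBound q / (1 - ‖q‖)))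
      (fun m => ?_) ?_
    · rw [norm_mul]
      have hA' : ‖A * q ^ m‖ ≤ 1 := (norm_mul_pow_le hA m).trans (pow_le_one₀ (norm_nonneg _) hq.le)
      refine mul_le_mul (norm_finePre_le hq hA ht m) ?_ (norm_nonneg _) (by positivity)
      refine (norm_fineSum_le hq hA' ((hbd m).trans_lt hq)).trans ?_
      exact div_le_div_of_nonneg_left (prodBound_pos q).le hr (by linarith [hbd m])
    · have := ((tendsto_pow_atTop_nhds_zero_of_lt_one (norm_nonneg _) hq).const_mul
        (prodBound q ^ 2)).mul_const (prodBound q / (1 - ‖q‖))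
      simpa using this
  have h3 := h1.add h2
  rw [add_zero] at h3
  have h4 := tendsto_nhds_unique
    (h3.congr fun m => (fineSum_eq_partial hq hA ht1 m).symm) tendsto_const_nhds
  rw [← h4]
  exact hsum.hasSum

end

/-! ### Partial fractions for the rank generating function -/

/-- The coefficient of `1 / ((1 - u q ^ (j + 1)) (1 - u⁻¹ q ^ (j + 1)))` in the partial fraction
decomposition of the `m`-th term of the Rogers–Fine series. -/
def pfCoeff (q : ℂ) (m j : ℕ) : ℂ :=
  (∏ i ∈ Finset.range m, (1 + q ^ (i + 1) * q ^ (j + 1)) * (1 + q ^ (i + 1) / q ^ (j + 1))) /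
    ∏ i ∈ Finset.range (m + 1), if i = j then 1 else
      (1 - q ^ (i + 1) * q ^ (j + 1)) * (1 - q ^ (i + 1) / q ^ (j + 1))

/-- The quadratic factor `(1 - u q ^ (j + 1)) (1 - u⁻¹ q ^ (j + 1))`. -/
def quadFactor (u q : ℂ) (j : ℕ) : ℂ := (1 - u * q ^ (j + 1)) * (1 - u⁻¹ * q ^ (j + 1))

section
variable {u q : ℂ}

lemma pow_succ_injective (hq0 : q ≠ 0) (hq : ‖q‖ < 1) {i j : ℕ} (h : q ^ (i + 1) = q ^ (j + 1)) :
    i = j := by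
  have h1 := congrArg norm h
  rw [norm_pow, norm_pow] at h1
  have h2 := (pow_right_strictAnti₀ (norm_pos_iff.2 hq0) hq).injective h1
  omega

/-- Partial fractions in the variable `u + u⁻¹`. -/
lemma prod_div_prod_quadFactor (hq0 : q ≠ 0) (hq : ‖q‖ < 1) (hu : u ≠ 0)
    (hD : ∀ j, quadFactor u q j ≠ 0) (m : ℕ) :
    (∏ i ∈ Finset.range m, (1 + u * q ^ (i + 1)) * (1 + u⁻¹ * q ^ (i + 1))) /
      ∏ i ∈ Finset.range (m + 1), quadFactor u q i =
    ∑ j ∈ Finset.range (m + 1), pfCoeff q m j / quadFactor u q j := by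
  set y : ℕ → ℂ := fun i => q ^ (i + 1) with hy
  have hy0 : ∀ i, y i ≠ 0 := fun i => pow_ne_zero _ hq0
  have hy1 : ∀ i, ‖y i‖ < 1 := fun i => by
    rw [hy, norm_pow]
    exact pow_lt_one₀ (norm_nonneg _) hq i.succ_ne_zero
  set v : ℕ → ℂ := fun i => y i + (y i)⁻¹ with hv
  set x := u + u⁻¹ with hx
  have hinj : Set.InjOn v (Finset.range (m + 1)) := by
    intro i _ j _ hij
    have h1 : (y i - y j) * (1 - y i * y j) = 0 := by
      simp only [hv] at hij
      have := hy0 i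
      have := hy0 j
      field_simp at hij
      linear_combination -hij
    rcases mul_eq_zero.1 h1 with h2 | h2
    · exact pow_succ_injective hq0 hq (sub_eq_zero.1 h2)
    · have h3 : ‖y i * y j‖ < 1 := by
        rw [norm_mul]
        exact mul_lt_one_of_nonneg_of_lt_one_left (norm_nonneg _) (hy1 i) (hy1 j).le
      exact absurd h2 (one_sub_ne_zero_of_norm_lt_one h3)
  set Q : Polynomial ℂ := ∏ i ∈ Finset.range m,
    (Polynomial.C (1 + y i ^ 2) + Polynomial.C (y i) * Polynomial.X) with hQ
  have hdeg : Q.degree < (Finset.range (m + 1)).card := by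
    rw [Finset.card_range]
    refine lt_of_le_of_lt (Polynomial.degree_prod_le _ _) ?_
    refine lt_of_le_of_lt (Finset.sum_le_sum (g := fun _ => (1 : WithBot ℕ)) fun i _ => ?_) ?_
    · refine (Polynomial.degree_add_le _ _).trans (max_le ?_ ?_)
      · exact Polynomial.degree_C_le.trans zero_le_one
      · exact Polynomial.degree_C_mul_X_le _
    · rw [Finset.sum_const, Finset.card_range, nsmul_eq_mul, mul_one]
      exact_mod_cast Nat.lt_succ_self m
  have hQeval : ∀ b : ℂ, b ≠ 0 → Q.eval (b + b⁻¹) =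
      ∏ i ∈ Finset.range m, (1 + b * y i) * (1 + b⁻¹ * y i) := by
    intro b hb
    rw [hQ, Polynomial.eval_prod]
    refine Finset.prod_congr rfl fun i _ => ?_
    simp only [Polynomial.eval_add, Polynomial.eval_mul, Polynomial.eval_C, Polynomial.eval_X]
    field_simp
    ring
  have hquad : ∀ b : ℂ, b ≠ 0 → ∀ i, (1 - b * y i) * (1 - b⁻¹ * y i) = -y i * (b + b⁻¹ - v i) := by
    intro b hb i
    have := hy0 i
    simp only [hv]
    field_simp
    ring
  have hxv : ∀ i ∈ Finset.range (m + 1), x ≠ v i := by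
    intro i _ h
    apply hD i
    have := hquad u hu i
    rw [← hx, h, sub_self, mul_zero] at this
    exact this
  have h1 := Lagrange.eval_interpolate_not_at_node (r := fun i => Q.eval (v i)) hxv
  rw [← Lagrange.eq_interpolate hinj hdeg, Lagrange.eval_nodal, hQeval u hu] at h1
  change (∏ i ∈ Finset.range m, (1 + u * y i) * (1 + u⁻¹ * y i)) / _ = _
  rw [h1]
  have h2 : ∏ i ∈ Finset.range (m + 1), quadFactor u q i =
      (∏ i ∈ Finset.range (m + 1), -y i) * ∏ i ∈ Finset.range (m + 1), (x - v i) := by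
    rw [← Finset.prod_mul_distrib]
    exact Finset.prod_congr rfl fun i _ => hquad u hu i
  have h3 : ∏ i ∈ Finset.range (m + 1), (x - v i) ≠ 0 :=
    Finset.prod_ne_zero_iff.2 fun i hi => sub_ne_zero.2 (hxv i hi)
  have h4 : ∏ i ∈ Finset.range (m + 1), -y i ≠ 0 :=
    Finset.prod_ne_zero_iff.2 fun i hi => neg_ne_zero.2 (hy0 i)
  rw [h2, mul_comm (∏ i ∈ Finset.range (m + 1), -y i), mul_div_mul_left _ _ h3, Finset.sum_div]
  refine Finset.sum_congr rfl fun j hj => ?_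
  have h5 : ∏ i ∈ Finset.range (m + 1), (if i = j then (1 : ℂ) else
      (1 - q ^ (i + 1) * q ^ (j + 1)) * (1 - q ^ (i + 1) / q ^ (j + 1))) =
      (∏ i ∈ (Finset.range (m + 1)).erase j, -y i) *
        ∏ i ∈ (Finset.range (m + 1)).erase j, (v j - v i) := by
    have h8 := Finset.prod_erase (Finset.range (m + 1)) (a := j) (f := fun i => if i = j then (1 : ℂ)
      else (1 - q ^ (i + 1) * q ^ (j + 1)) * (1 - q ^ (i + 1) / q ^ (j + 1))) (if_pos rfl)
    rw [← h8, ← Finset.prod_mul_distrib]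
    refine Finset.prod_congr rfl fun i hi => ?_
    rw [if_neg (Finset.ne_of_mem_erase hi)]
    have := hquad (y j) (hy0 j) i
    change _ = -y i * (y j + (y j)⁻¹ - v i)
    rw [← this]
    simp only [hy]
    ring
  have h6 : quadFactor u q j = -y j * (x - v j) := hquad u hu j
  have h7 : ∏ i ∈ Finset.range m, (1 + q ^ (i + 1) * q ^ (j + 1)) * (1 + q ^ (i + 1) / q ^ (j + 1)) =
      Q.eval (v j) := by
    simp only [hv]
    rw [hQeval _ (hy0 j)]
    refine Finset.prod_congr rfl fun i _ => ?_
    simp only [hy]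
    ring
  rw [pfCoeff, h5, h6, h7, Lagrange.nodalWeight, ← Finset.mul_prod_erase _ _ hj, Finset.prod_inv_distrib,
    div_div]
  rw [div_eq_mul_inv, div_eq_mul_inv, mul_inv, mul_inv, mul_inv, mul_inv]
  ring

lemma one_add_pow_ne_zero (hq : ‖q‖ < 1) (i : ℕ) : 1 + q ^ (i + 1) ≠ 0 := by
  have : ‖-q ^ (i + 1)‖ < 1 := by
    rw [norm_neg, norm_pow]
    exact pow_lt_one₀ (norm_nonneg _) hq i.succ_ne_zero
  simpa using one_sub_ne_zero_of_norm_lt_one this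

lemma one_sub_pow_ne_zero (hq : ‖q‖ < 1) (i : ℕ) : 1 - q ^ (i + 1) ≠ 0 := by
  have : ‖q ^ (i + 1)‖ < 1 := by
    rw [norm_pow]
    exact pow_lt_one₀ (norm_nonneg _) hq i.succ_ne_zero
  exact one_sub_ne_zero_of_norm_lt_one this

lemma pfCoeff_self (hq0 : q ≠ 0) (hq : ‖q‖ < 1) (j : ℕ) :
    pfCoeff q j j = (-1) ^ j * (∏ i ∈ Finset.range j, (1 + q ^ (i + 1)) / (1 - q ^ (i + 1))) *
      ∏ i ∈ Finset.range j, (1 + q ^ (i + j + 2)) / (1 - q ^ (i + j + 2)) := by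
  have h1 : ∏ i ∈ Finset.range (j + 1), (if i = j then (1 : ℂ) else
      (1 - q ^ (i + 1) * q ^ (j + 1)) * (1 - q ^ (i + 1) / q ^ (j + 1))) =
      ∏ i ∈ Finset.range j, (1 - q ^ (i + 1) * q ^ (j + 1)) * (1 - q ^ (i + 1) / q ^ (j + 1)) := by
    rw [Finset.prod_range_succ, if_pos rfl, mul_one]
    refine Finset.prod_congr rfl fun i hi => if_neg ?_
    have := Finset.mem_range.1 hi
    omega
  have h2 : ∏ i ∈ Finset.range j, (1 + q ^ (i + 1) / q ^ (j + 1)) / (1 - q ^ (i + 1) / q ^ (j + 1)) =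
      (-1) ^ j * ∏ i ∈ Finset.range j, (1 + q ^ (i + 1)) / (1 - q ^ (i + 1)) := by
    have hc : (-1 : ℂ) ^ j = ∏ _i ∈ Finset.range j, (-1 : ℂ) := by
      rw [Finset.prod_const, Finset.card_range]
    rw [← Finset.prod_range_reflect, hc, ← Finset.prod_mul_distrib]
    refine Finset.prod_congr rfl fun i hi => ?_
    have hij := Finset.mem_range.1 hi
    have e : q ^ (j + 1) = q ^ (j - 1 - i + 1) * q ^ (i + 1) := by
      rw [← pow_add]; congr 1; omega
    have g1 : q ^ (i + 1) ≠ 0 := pow_ne_zero _ hq0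
    have g2 : q ^ (j - 1 - i + 1) ≠ 0 := pow_ne_zero _ hq0
    have g3 := one_sub_pow_ne_zero hq i
    have g4 : q ^ (i + 1) - 1 ≠ 0 := by
      rw [← neg_sub]; exact neg_ne_zero.2 g3
    have e2 : q ^ (j - 1 - i + 1) / (q ^ (j - 1 - i + 1) * q ^ (i + 1)) = (q ^ (i + 1))⁻¹ := by
      field_simp
    rw [e, e2]
    have g5 : 1 - (q ^ (i + 1))⁻¹ ≠ 0 := by
      intro h0
      apply g3
      field_simp at h0
      linear_combination -h0
    rw [neg_one_mul, ← div_neg, div_eq_div_iff g5 (neg_ne_zero.2 g3)]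
    field_simp
    ring
  rw [pfCoeff, h1, ← Finset.prod_div_distrib]
  rw [← h2, mul_comm, ← Finset.prod_mul_distrib]
  refine Finset.prod_congr rfl fun i _ => ?_
  rw [← pow_add, show i + 1 + (j + 1) = i + j + 2 by ring, mul_div_mul_comm]

lemma pfCoeff_self_mul (hq0 : q ≠ 0) (hq : ‖q‖ < 1) (j : ℕ) :
    pfCoeff q j j * (1 - q ^ (2 * (j + 1))) * fineSum q 1 (q ^ (2 * (j + 1))) =
      (-1) ^ j * (1 - q ^ (j + 1)) ^ 2 * fineSum q 1 q := by
  have h1 := fineSum_one_eq_prod hq hq (2 * j + 1)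
  have h2 : ∏ i ∈ Finset.range (2 * j + 1), (1 + q * q ^ i) / (1 - q * q ^ i) =
      (∏ i ∈ Finset.range j, (1 + q ^ (i + 1)) / (1 - q ^ (i + 1))) *
        ((1 + q ^ (j + 1)) / (1 - q ^ (j + 1))) *
        ∏ i ∈ Finset.range j, (1 + q ^ (i + j + 2)) / (1 - q ^ (i + j + 2)) := by
    rw [show 2 * j + 1 = (j + 1) + j by ring, Finset.prod_range_add, Finset.prod_range_succ]
    simp only [← pow_succ']
    congr 1
    refine Finset.prod_congr rfl fun i _ => ?_
    rw [show j + 1 + i + 1 = i + j + 2 by ring]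
  have h3 := one_sub_pow_ne_zero hq j
  have h4 := one_add_pow_ne_zero hq j
  rw [h2, show q * q ^ (2 * j + 1) = q ^ (2 * (j + 1)) by ring] at h1
  rw [pfCoeff_self hq0 hq, h1, show q ^ (2 * (j + 1)) = (q ^ (j + 1)) ^ 2 by rw [← pow_mul]; ring]
  field_simp
  ring

lemma norm_pfCoeff_self_le (hq0 : q ≠ 0) (hq : ‖q‖ < 1) (j : ℕ) :
    ‖pfCoeff q j j‖ ≤ prodBound q ^ 2 := by
  rw [pfCoeff_self hq0 hq, norm_mul, norm_mul, norm_pow, norm_neg, norm_one, one_pow, one_mul, sq]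
  have hle : ∀ a b : ℕ, a ≤ b → ‖q ^ b‖ ≤ ‖q‖ ^ a := fun a b hab => by
    rw [norm_pow]
    exact pow_le_pow_of_le_one (norm_nonneg _) hq.le hab
  have := prodBound_pos q
  refine mul_le_mul ?_ ?_ (norm_nonneg _) this.le
  · exact norm_prod_le_prodBound hq j (fun i => hle _ _ (by omega)) fun i => hle _ _ (by omega)
  · exact norm_prod_le_prodBound hq j (fun i => hle _ _ (by omega)) fun i => hle _ _ (by omega)

lemma pfCoeff_succ (hq0 : q ≠ 0) (j n : ℕ) :
    pfCoeff q (j + n + 1) j = pfCoeff q (j + n) j *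
      ((1 + q ^ (2 * (j + 1)) * q ^ n) * (1 + q ^ n) /
        ((1 - q ^ (2 * (j + 1)) * q ^ (n + 1)) * (1 - q ^ (n + 1)))) := by
  rw [pfCoeff, pfCoeff, Finset.prod_range_succ _ (j + n), Finset.prod_range_succ _ (j + n + 1),
    if_neg (by omega), mul_div_mul_comm]
  congr 2
  · have : q ^ (j + 1) ≠ 0 := pow_ne_zero _ hq0
    congr 2
    · ring
    · rw [div_eq_iff this]; ring
  · have : q ^ (j + 1) ≠ 0 := pow_ne_zero _ hq0
    congr 2
    · ring
    · rw [div_eq_iff this]; ring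

lemma norm_pow_two_mul_le (hq : ‖q‖ < 1) (j : ℕ) : ‖q ^ (2 * (j + 1))‖ ≤ ‖q‖ := by
  rw [norm_pow]
  exact pow_le_of_le_one (norm_nonneg _) hq.le (by omega)

lemma pfCoeff_add (hq0 : q ≠ 0) (hq : ‖q‖ < 1) (j n : ℕ) :
    pfCoeff q (j + n) j * q ^ ((j + n + 1) ^ 2) = pfCoeff q j j * q ^ ((j + 1) ^ 2) *
      (1 - q ^ (2 * (j + 1))) * (finePre q 1 (q ^ (2 * (j + 1))) n / (1 - q ^ (2 * (j + 1)) * q ^ n)) := by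
  have ht : ∀ n : ℕ, 1 - q ^ (2 * (j + 1)) * q ^ n ≠ 0 := by
    intro n
    have := one_sub_pow_ne_zero hq (2 * j + 1 + n)
    rwa [← pow_add, show 2 * (j + 1) + n = 2 * j + 1 + n + 1 by ring]
  induction n with
  | zero =>
    have := ht 0
    rw [pow_zero, mul_one] at this
    simp only [add_zero, finePre, Finset.range_zero, Finset.prod_empty, pow_zero, mul_one]
    field_simp
  | succ n ih =>
    have hpre : finePre q 1 (q ^ (2 * (j + 1))) (n + 1) = finePre q 1 (q ^ (2 * (j + 1))) n *
        ((1 + 1 * q ^ n) * (1 * q ^ n) * (1 + q ^ (2 * (j + 1)) * q ^ n) *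
          (q ^ (2 * (j + 1)) * q ^ (n + 1)) /
            ((1 - 1 * q ^ (n + 1)) * (1 - q ^ (2 * (j + 1)) * q ^ n))) :=
      Finset.prod_range_succ _ _
    have e : q ^ ((j + (n + 1) + 1) ^ 2) = q ^ ((j + n + 1) ^ 2) *
        (q ^ (2 * (j + 1)) * q ^ n * q ^ (n + 1)) := by
      rw [← pow_add, ← pow_add, ← pow_add]
      congr 1
      ring
    rw [← add_assoc, pfCoeff_succ hq0, add_assoc j n 1, e, hpre]
    have h1 := ht n
    have h2 := ht (n + 1)
    have h3 := one_sub_pow_ne_zero hq n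
    set t := q ^ (2 * (j + 1)) with htdef
    have key : ∀ a b c d f g p P x y : ℂ, a * b = c * (p / d) → d ≠ 0 →
        a * (x * y / (f * g)) * (b * P) = c * (p * (y * x * P / (g * d)) / f) := by
      intro a b c d f g p P x y h hd
      have : a * (x * y / (f * g)) * (b * P) = (a * b) * (x * y * P / (f * g)) := by ring
      rw [this, h]
      field_simp
    have := key _ _ _ _ (1 - t * q ^ (n + 1)) (1 - q ^ (n + 1)) _ (t * q ^ n * q ^ (n + 1))
      (1 + t * q ^ n) (1 + q ^ n) ih h1
    rw [this]
    ring

/-- The sum of the coefficients of a fixed partial fraction. -/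
lemma hasSum_pfCoeff (hq0 : q ≠ 0) (hq : ‖q‖ < 1) (j : ℕ) :
    HasSum (fun n => pfCoeff q (j + n) j * q ^ ((j + n + 1) ^ 2) * (1 + q ^ (2 * (j + n + 1))))
      (fineSum q 1 q * ((-1) ^ j * q ^ ((j + 1) ^ 2) * (1 - q ^ (j + 1)) ^ 2)) := by
  have h1 := (hasSum_finePre (A := 1) hq norm_one.le (norm_pow_two_mul_le hq j)).mul_left
    (pfCoeff q j j * q ^ ((j + 1) ^ 2) * (1 - q ^ (2 * (j + 1))))
  have h2 := pfCoeff_self_mul hq0 hq j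
  have e : fineSum q 1 q * ((-1) ^ j * q ^ ((j + 1) ^ 2) * (1 - q ^ (j + 1)) ^ 2) =
      pfCoeff q j j * q ^ ((j + 1) ^ 2) * (1 - q ^ (2 * (j + 1))) *
        fineSum q 1 (q ^ (2 * (j + 1))) := by
    linear_combination (-q ^ ((j + 1) ^ 2)) * h2
  rw [e]
  refine h1.congr_fun fun n => ?_
  rw [pfCoeff_add hq0 hq]
  ring

lemma one_sub_norm_sq_le_quadFactor (hq : ‖q‖ < 1) (hu : ‖u‖ = 1) (j : ℕ) :
    (1 - ‖q‖) ^ 2 ≤ ‖quadFactor u q j‖ := by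
  have h1 : ∀ b : ℂ, ‖b‖ = 1 → 1 - ‖q‖ ≤ ‖1 - b * q ^ (j + 1)‖ := by
    intro b hb
    have := norm_sub_norm_le 1 (b * q ^ (j + 1))
    rw [norm_one, norm_mul, hb, one_mul, norm_pow] at this
    have h2 := pow_le_of_le_one (norm_nonneg q) hq.le j.succ_ne_zero
    simp only [Nat.succ_eq_add_one] at h2
    linarith
  rw [quadFactor, norm_mul, sq]
  exact mul_le_mul (h1 u hu) (h1 u⁻¹ (by rw [norm_inv, hu, inv_one])) (by linarith) (norm_nonneg _)

lemma summable_pfCoeff (hq0 : q ≠ 0) (hq : ‖q‖ < 1) (hu : ‖u‖ = 1) :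
    Summable fun p : ℕ × ℕ => pfCoeff q (p.1 + p.2) p.1 * q ^ ((p.1 + p.2 + 1) ^ 2) *
      (1 + q ^ (2 * (p.1 + p.2 + 1))) / quadFactor u q p.1 := by
  have hr : 0 < 1 - ‖q‖ := by linarith
  have hg := summable_geometric_of_lt_one (norm_nonneg q) hq
  have hbound : Summable fun p : ℕ × ℕ =>
      (prodBound q ^ 2 * 2 * (prodBound q ^ 2 * (1 - ‖q‖)⁻¹) * 2 / (1 - ‖q‖) ^ 2) *
        (‖q‖ ^ p.1 * ‖q‖ ^ p.2) :=
    (hg.mul_of_nonneg hg (fun _ => by positivity) fun _ => by positivity).mul_left _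
  refine Summable.of_norm_bounded hbound fun p => ?_
  obtain ⟨j, n⟩ := p
  simp only
  rw [pfCoeff_add hq0 hq, norm_div, norm_mul, norm_mul, norm_mul, norm_mul, norm_div]
  have h1 := norm_pfCoeff_self_le hq0 hq j
  have h2 : ‖q ^ ((j + 1) ^ 2)‖ ≤ ‖q‖ ^ j := by
    rw [norm_pow]
    exact pow_le_pow_of_le_one (norm_nonneg _) hq.le (by nlinarith)
  have h3 : ‖1 - q ^ (2 * (j + 1))‖ ≤ 2 := by
    refine (norm_sub_le _ _).trans ?_
    rw [norm_one]
    linarith [norm_pow_two_mul_le hq j]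
  have h4 := norm_finePre_le (A := 1) hq norm_one.le (norm_pow_two_mul_le hq j) n
  have h5 : 1 - ‖q‖ ≤ ‖1 - q ^ (2 * (j + 1)) * q ^ n‖ := by
    have := norm_sub_norm_le 1 (q ^ (2 * (j + 1)) * q ^ n)
    rw [norm_one] at this
    have h6 : ‖q ^ (2 * (j + 1)) * q ^ n‖ ≤ ‖q‖ := by
      rw [norm_mul, norm_pow q n]
      exact (mul_le_of_le_one_right (norm_nonneg _) (pow_le_one₀ (norm_nonneg _) hq.le)).trans
        (norm_pow_two_mul_le hq j)
    linarith
  have h7 : ‖1 + q ^ (2 * (j + n + 1))‖ ≤ 2 := by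
    refine (norm_add_le _ _).trans ?_
    rw [norm_one]
    linarith [norm_pow_two_mul_le hq (j + n)]
  have h8 := one_sub_norm_sq_le_quadFactor hq hu j
  have hB := prodBound_pos q
  calc _ ≤ prodBound q ^ 2 * ‖q‖ ^ j * 2 * (prodBound q ^ 2 * ‖q‖ ^ n / (1 - ‖q‖)) * 2 /
        (1 - ‖q‖) ^ 2 := by gcongr
    _ = _ := by ring

lemma finePre_eq (hq : ‖q‖ < 1) (hu : ‖u‖ = 1) (n : ℕ) :
    q / (1 - q * u⁻¹) * (finePre q (q * u⁻¹) (u * q) n *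
        ((1 + q * u⁻¹ * (u * q) * q ^ (2 * n)) / (1 - u * q * q ^ n))) =
      (∏ i ∈ Finset.range n, (1 + u * q ^ (i + 1)) * (1 + u⁻¹ * q ^ (i + 1))) /
        (∏ i ∈ Finset.range (n + 1), quadFactor u q i) * q ^ ((n + 1) ^ 2) *
          (1 + q ^ (2 * (n + 1))) := by
  have hu0 : u ≠ 0 := by
    rintro rfl
    simp at hu
  have hv : ‖u⁻¹‖ = 1 := by rw [norm_inv, hu, inv_one]
  have hA : ∀ b : ℂ, ‖b‖ = 1 → ∀ i : ℕ, 1 - b * q ^ (i + 1) ≠ 0 := fun b hb i =>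
    one_sub_mul_pow_ne_zero hq hb.le i
  have e1 : q * u⁻¹ * (u * q) * q ^ (2 * n) = q ^ (2 * (n + 1)) := by
    field_simp
    ring
  rw [e1]
  have main : q / (1 - q * u⁻¹) * (finePre q (q * u⁻¹) (u * q) n / (1 - u * q * q ^ n)) =
      (∏ i ∈ Finset.range n, (1 + u * q ^ (i + 1)) * (1 + u⁻¹ * q ^ (i + 1))) /
        (∏ i ∈ Finset.range (n + 1), quadFactor u q i) * q ^ ((n + 1) ^ 2) := by
    induction n with
    | zero =>
      have h1 := hA u hu 0
      have h2 := hA _ hv 0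
      simp only [zero_add, pow_one] at h1 h2
      rw [mul_comm] at h2
      simp [finePre, quadFactor]
      field_simp
    | succ n ih =>
      have e1' : q * u⁻¹ * (u * q) * q ^ (2 * n) = q ^ (2 * (n + 1)) := by
        field_simp
        ring
      specialize ih e1'
      have hpre : finePre q (q * u⁻¹) (u * q) (n + 1) = finePre q (q * u⁻¹) (u * q) n *
          ((1 + q * u⁻¹ * q ^ n) * (q * u⁻¹ * q ^ n) * (1 + u * q * q ^ n) *
            (u * q * q ^ (n + 1)) / ((1 - q * u⁻¹ * q ^ (n + 1)) * (1 - u * q * q ^ n))) :=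
        Finset.prod_range_succ _ _
      have g1 : q * u⁻¹ * q ^ n = u⁻¹ * q ^ (n + 1) := by ring
      have g2 : u * q * q ^ n = u * q ^ (n + 1) := by ring
      have g3 : q * u⁻¹ * q ^ (n + 1) = u⁻¹ * q ^ (n + 2) := by ring
      have g4 : u * q * q ^ (n + 1) = u * q ^ (n + 2) := by ring
      rw [g2] at ih
      rw [hpre, g1, g2, g3, g4, Finset.prod_range_succ, Finset.prod_range_succ _ (n + 1)]
      have h1 := hA u hu n
      have h2 := hA u hu (n + 1)
      have h3 := hA _ hv (n + 1)
      have e2 : q ^ ((n + 1 + 1) ^ 2) = q ^ ((n + 1) ^ 2) * ((u⁻¹ * q ^ (n + 1)) * (u * q ^ (n + 2))) := by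
        field_simp
        rw [← pow_add, ← pow_add]
        congr 1
        ring
      rw [e2, quadFactor, show n + 1 + 1 = n + 2 by ring] at *
      have key : ∀ a p d P Q E x y f g r s : ℂ, d ≠ 0 → a * (p / d) = P / Q * E →
          a * (p * (y * r * x * s / (g * d)) / f) = P * (x * y) / (Q * (f * g)) * (E * (r * s)) := by
        intro a p d P Q E x y f g r s hd h
        have : a * (p * (y * r * x * s / (g * d)) / f) = (a * (p / d)) * (y * r * x * s / (g * f)) := by
          field_simp
        rw [this, h]
        ring
      exact key _ _ _ _ _ _ _ _ _ _ _ _ h1 ih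
  rw [← main]
  ring

lemma largestPartTerm_eq (hq : ‖q‖ < 1) (hu : ‖u‖ = 1) (L : ℕ) :
    u ^ (L + 1) * largestPartTerm u⁻¹ q L =
      2 * (q / (1 - q * u⁻¹)) * (fineCoeff q (q * u⁻¹) L * (u * q) ^ L) := by
  have hu0 : u ≠ 0 := by
    rintro rfl
    simp at hu
  have hv : ‖u⁻¹‖ = 1 := by rw [norm_inv, hu, inv_one]
  have hne : ∀ i : ℕ, 1 - q ^ (i + 1) * u⁻¹ ≠ 0 := fun i =>
    one_sub_ne_zero_of_norm_lt_one (norm_pow_succ_mul_lt_one hv hq i)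
  have main : (∏ i ∈ Finset.range L, (1 + q ^ (i + 1) * u⁻¹) / (1 - q ^ (i + 1) * u⁻¹)) /
      (1 - q ^ (L + 1) * u⁻¹) = fineCoeff q (q * u⁻¹) L / (1 - q * u⁻¹) := by
    induction L with
    | zero => simp [fineCoeff]
    | succ L ih =>
      have h1 := hne L
      have h2 := hne (L + 1)
      have hs : fineCoeff q (q * u⁻¹) (L + 1) = fineCoeff q (q * u⁻¹) L *
        ((1 + q * u⁻¹ * q ^ L) / (1 - q * u⁻¹ * q ^ (L + 1))) := Finset.prod_range_succ _ _
      rw [Finset.prod_range_succ, hs, mul_div_right_comm (fineCoeff _ _ _), ← ih]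
      rw [show q * u⁻¹ * q ^ L = q ^ (L + 1) * u⁻¹ by ring,
        show q * u⁻¹ * q ^ (L + 1) = q ^ (L + 1 + 1) * u⁻¹ by ring]
      ring
  rw [largestPartTerm]
  have e : u ^ (L + 1) * ((∏ i ∈ Finset.range L, (1 + q ^ (i + 1) * u⁻¹) / (1 - q ^ (i + 1) * u⁻¹)) *
      (2 * (q ^ (L + 1) * u⁻¹) / (1 - q ^ (L + 1) * u⁻¹))) =
      (2 * u ^ (L + 1) * q ^ (L + 1) * u⁻¹) *
      ((∏ i ∈ Finset.range L, (1 + q ^ (i + 1) * u⁻¹) / (1 - q ^ (i + 1) * u⁻¹)) /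
      (1 - q ^ (L + 1) * u⁻¹)) := by ring
  rw [e, main, pow_succ u L, mul_pow]
  have e2 : 2 * (u ^ L * u) * q ^ (L + 1) * u⁻¹ = 2 * q * (u ^ L * q ^ L) := by
    field_simp
    ring
  rw [e2]
  ring

/-- The expansion of the rank generating function in partial fractions. -/
theorem rankGen_eq_tsum_quadFactor (hq0 : q ≠ 0) (hq : ‖q‖ < 1) (hu : ‖u‖ = 1) :
    (Summable fun j : ℕ => (-1) ^ j * q ^ ((j + 1) ^ 2) * (1 - q ^ (j + 1)) ^ 2 / quadFactor u q j) ∧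
    rankGen u q = 1 + 2 * fineSum q 1 q *
      ∑' j : ℕ, (-1) ^ j * q ^ ((j + 1) ^ 2) * (1 - q ^ (j + 1)) ^ 2 / quadFactor u q j := by
  have hu0 : u ≠ 0 := by
    rintro rfl
    simp at hu
  have hv : ‖u⁻¹‖ = 1 := by rw [norm_inv, hu, inv_one]
  have hD : ∀ j, quadFactor u q j ≠ 0 := by
    intro j h0
    have := one_sub_norm_sq_le_quadFactor hq hu j
    rw [h0, norm_zero] at this
    have hr : 0 < 1 - ‖q‖ := by linarith
    have := pow_pos hr 2
    linarith
  set G : ℕ → ℕ → ℂ := fun j n => pfCoeff q (j + n) j * q ^ ((j + n + 1) ^ 2) *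
    (1 + q ^ (2 * (j + n + 1))) / quadFactor u q j with hG
  have hsum : Summable fun p : ℕ × ℕ => G p.1 p.2 := summable_pfCoeff hq0 hq hu
  have hrow : ∀ j, ∑' n, G j n = fineSum q 1 q *
      ((-1) ^ j * q ^ ((j + 1) ^ 2) * (1 - q ^ (j + 1)) ^ 2 / quadFactor u q j) := by
    intro j
    rw [((hasSum_pfCoeff hq0 hq j).div_const _).tsum_eq, mul_div_assoc]
  have hP : fineSum q 1 q ≠ 0 := by
    have hlim : Tendsto (fun n : ℕ => fineSum q 1 (q * q ^ n)) atTop (𝓝 1) := by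
      refine (tendsto_fineSum_zero hq).comp ?_
      have := (tendsto_pow_atTop_nhds_zero_of_norm_lt_one hq).const_mul q
      simpa using this
    intro h0
    have h1 : ∀ n : ℕ, fineSum q 1 (q * q ^ n) = 0 := by
      intro n
      have h2 := fineSum_one_eq_prod hq hq n
      rw [h0] at h2
      rcases mul_eq_zero.1 h2.symm with h3 | h3
      · exfalso
        refine Finset.prod_ne_zero_iff.2 (fun i _ => ?_) h3
        rw [← pow_succ']
        exact div_ne_zero (one_add_pow_ne_zero hq i) (one_sub_pow_ne_zero hq i)
      · exact h3
    simp_rw [h1] at hlim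
    exact zero_ne_one (tendsto_nhds_unique tendsto_const_nhds hlim)
  have hprod : Summable fun j => ∑' n, G j n := hsum.prod
  have hA : ‖q * u⁻¹‖ ≤ 1 := by rw [norm_mul, hv, mul_one]; exact hq.le
  have ht : ‖u * q‖ ≤ ‖q‖ := by rw [norm_mul, hu, one_mul]
  have hterm : ∀ n : ℕ, q / (1 - q * u⁻¹) * (finePre q (q * u⁻¹) (u * q) n *
        ((1 + q * u⁻¹ * (u * q) * q ^ (2 * n)) / (1 - u * q * q ^ n))) =
      ∑ p ∈ Finset.HasAntidiagonal.antidiagonal n, G p.1 p.2 := by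
    intro n
    rw [finePre_eq hq hu, prod_div_prod_quadFactor hq0 hq hu0 hD,
      Finset.Nat.sum_antidiagonal_eq_sum_range_succ G, Finset.sum_mul, Finset.sum_mul]
    refine Finset.sum_congr rfl fun j hj => ?_
    have : j + (n - j) = n := by
      have := Finset.mem_range.1 hj
      omega
    simp only [hG, this]
    ring
  have h1 := (hasSum_finePre hq hA ht).mul_left (q / (1 - q * u⁻¹))
  simp_rw [hterm] at h1
  have h2 : ∑' n, ∑ p ∈ Finset.HasAntidiagonal.antidiagonal n, G p.1 p.2 = ∑' j, ∑' n, G j n := by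
    have h3 := Summable.tsum_sigma' (fun n => (hasSum_fintype _).summable)
      (Finset.HasAntidiagonal.sigmaAntidiagonalEquivProd.summable_iff.2 hsum)
    have h4 := Finset.HasAntidiagonal.sigmaAntidiagonalEquivProd.tsum_eq fun p : ℕ × ℕ => G p.1 p.2
    rw [← hsum.tsum_prod, ← h4]
    refine Eq.trans ?_ h3.symm
    refine tsum_congr fun n => ?_
    rw [tsum_fintype, Finset.univ_eq_attach]
    exact (Finset.sum_attach _ fun p : ℕ × ℕ => G p.1 p.2).symm
  constructor
  · have := (hprod.congr hrow).mul_left (fineSum q 1 q)⁻¹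
    refine this.congr fun j => ?_
    rw [inv_mul_cancel_left₀ hP]
  · rw [(rankGen_eq hu hq).2]
    congr 1
    rw [tsum_congr (largestPartTerm_eq hq hu), tsum_mul_left, mul_assoc, mul_assoc]
    congr 1
    change _ * fineSum q (q * u⁻¹) (u * q) = _
    rw [← h1.tsum_eq, h2, ← tsum_mul_left]
    exact tsum_congr hrow

end

/-! ### The rank generating function as a cotangent sum -/

/-- The theta series `∑ (-1)^n q^{n²}`. -/
def altTheta (z : ℂ) : ℂ := ∑' n : ℤ, (-1 : ℂ) ^ n * qpow z ((n : ℂ) ^ 2)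

lemma tsum_int_eq_zero_add_tsum {f : ℤ → ℂ} (hf : Summable f) :
    ∑' n : ℤ, f n = f 0 + ∑' j : ℕ, (f (j + 1) + f (-(j + 1))) := by
  have h1 : Summable fun j : ℕ => f (j + 1) :=
    hf.comp_injective (i := fun j : ℕ => (j : ℤ) + 1) fun a b h => by simpa using h
  have h2 : Summable fun j : ℕ => f (-(j + 1)) :=
    hf.comp_injective (i := fun j : ℕ => -((j : ℤ) + 1)) fun a b h => by
      have := neg_injective h
      simpa using this
  rw [tsum_of_add_one_of_neg_add_one h1 h2, h1.tsum_add h2]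
  ring

section
variable {z : ℂ}

lemma norm_cexp_two_pi_mul_lt_one (hz : 0 < z.im) : ‖cexp (2 * π * I * z)‖ < 1 := by
  have := norm_qpow_ofReal z 1
  simp only [qpow, ofReal_one, mul_one] at this
  rw [this, Real.exp_lt_one_iff, neg_lt_zero]
  positivity

lemma norm_qpow_sq_le (hz : 0 < z.im) (n : ℤ) :
    ‖qpow z ((n : ℂ) ^ 2)‖ ≤ Real.exp (-(2 * π * z.im * |(n : ℝ) - 0|)) := by
  have e : (n : ℂ) ^ 2 = ((n ^ 2 : ℝ) : ℂ) := by push_cast; ring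
  rw [e, norm_qpow_ofReal, Real.exp_le_exp, sub_zero, neg_le_neg_iff]
  refine mul_le_mul_of_nonneg_left ?_ (by positivity)
  rw [← sq_abs]
  rcases eq_or_ne n 0 with rfl | hn
  · simp
  · have : (1 : ℝ) ≤ |(n : ℝ)| := by exact_mod_cast Int.one_le_abs hn
    nlinarith

lemma summable_altTheta (hz : 0 < z.im) :
    Summable fun n : ℤ => (-1 : ℂ) ^ n * qpow z ((n : ℂ) ^ 2) := by
  refine Summable.of_norm_bounded (summable_exp_neg_abs_int (c := 2 * π * z.im) (by positivity) 0)
    fun n => ?_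
  rw [norm_mul, norm_zpow, norm_neg, norm_one, one_zpow, one_mul]
  exact norm_qpow_sq_le hz n

lemma summable_cotTerm_of_im_pos (hz : 0 < z.im) (α : ℝ) : Summable (cotTerm α z) := by
  have hsum : Summable fun n : ℤ => Real.exp (-(2 * π * z.im * |(n : ℝ) - 0|)) *
      (2 / (1 - Real.exp (-2 * (π * z.im)))) :=
    (summable_exp_neg_abs_int (by positivity) 0).mul_right _
  refine Summable.of_norm_bounded_eventually hsum ?_
  filter_upwards [(Set.finite_singleton (0 : ℤ)).compl_mem_cofinite] with n hn
  have hn0 : n ≠ 0 := by simpa using hn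
  have hn1 : (1 : ℝ) ≤ |(n : ℝ)| := by exact_mod_cast Int.one_le_abs hn0
  unfold cotTerm
  rw [norm_mul, norm_mul, norm_zpow, norm_neg, norm_one, one_zpow, one_mul]
  refine mul_le_mul (norm_qpow_sq_le hz n) (norm_cot_le (by positivity) ?_) (norm_nonneg _)
    (Real.exp_pos _).le
  have : (π * ((α : ℝ) - n * z) : ℂ).im = -(π * (n * z.im)) := by simp
  rw [this, abs_neg, abs_mul, abs_mul, abs_of_pos Real.pi_pos, abs_of_pos hz]
  refine mul_le_mul_of_nonneg_left ?_ Real.pi_pos.le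
  nlinarith

lemma qpow_natCast (z : ℂ) (m : ℕ) : qpow z m = cexp (2 * π * I * z) ^ m := by
  rw [qpow, ← Complex.exp_nat_mul]
  congr 1
  ring

lemma qpow_succ_sq (z : ℂ) (j : ℕ) :
    qpow z (((j + 1 : ℤ) : ℂ) ^ 2) = cexp (2 * π * I * z) ^ ((j + 1) ^ 2) := by
  rw [← qpow_natCast]
  congr 1
  push_cast
  ring

lemma neg_one_zpow_succ (j : ℕ) : (-1 : ℂ) ^ ((j : ℤ) + 1) = -(-1) ^ j := by
  rw [zpow_add₀ (by norm_num), zpow_natCast]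
  simp

lemma neg_one_zpow_neg_succ (j : ℕ) : (-1 : ℂ) ^ (-((j : ℤ) + 1)) = -(-1) ^ j := by
  rw [zpow_neg, neg_one_zpow_succ]
  rcases neg_one_pow_eq_or ℂ j with h | h <;> rw [h] <;> norm_num

lemma altTheta_eq (hz : 0 < z.im) : altTheta z =
    1 - 2 * ∑' j : ℕ, (-1 : ℂ) ^ j * cexp (2 * π * I * z) ^ ((j + 1) ^ 2) := by
  rw [altTheta, tsum_int_eq_zero_add_tsum (summable_altTheta hz), ← tsum_mul_left, sub_eq_add_neg,
    ← tsum_neg]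
  congr 1
  · simp [qpow]
  · refine tsum_congr fun j => ?_
    rw [neg_one_zpow_succ, neg_one_zpow_neg_succ, qpow_succ_sq, Int.cast_neg, neg_sq, qpow_succ_sq]
    ring

/-- Gauss's identity: the generating function `∏ (1 + q^n) / (1 - q^n)` of overpartitions is the
reciprocal of a theta series. The two sides of the partial fraction formula for the rank
generating function are compared at `u = 1`. -/
theorem fineSum_mul_altTheta (hz : 0 < z.im) :
    fineSum (cexp (2 * π * I * z)) 1 (cexp (2 * π * I * z)) * altTheta z = 1 := by
  set q := cexp (2 * π * I * z) with hqdef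
  have hq : ‖q‖ < 1 := norm_cexp_two_pi_mul_lt_one hz
  have hq0 : q ≠ 0 := Complex.exp_ne_zero _
  -- at `u = 1` the numerators `(1 - q^j)²` of the partial fractions cancel the quadratic factors
  have h1 := (rankGen_eq_tsum_quadFactor (u := 1) hq0 hq norm_one).2
  have h2 := (rankGen_eq (u := 1) norm_one hq).2
  have h3 : ∀ L, (1 : ℂ) ^ (L + 1) * largestPartTerm 1⁻¹ q L = fineCoeff q 1 (L + 1) * q ^ (L + 1) := by
    intro L
    rw [largestPartTerm_eq hq norm_one, fineCoeff_succ']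
    simp only [inv_one, mul_one, one_mul]
    ring
  have h4 : fineSum q 1 q = 1 + ∑' L, fineCoeff q 1 (L + 1) * q ^ (L + 1) := by
    rw [fineSum, (summable_fineSum hq norm_one.le hq).tsum_eq_zero_add]
    simp [fineCoeff]
  rw [tsum_congr h3, ← h4] at h2
  have h5 : ∀ j : ℕ, (-1 : ℂ) ^ j * q ^ ((j + 1) ^ 2) * (1 - q ^ (j + 1)) ^ 2 / quadFactor 1 q j =
      (-1) ^ j * q ^ ((j + 1) ^ 2) := by
    intro j
    have := one_sub_pow_ne_zero hq j
    rw [quadFactor, inv_one, one_mul, ← sq]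
    field_simp
  rw [tsum_congr h5, h2] at h1
  rw [altTheta_eq hz]
  linear_combination h1

lemma sin_pi_sub_int_mul_ne_zero (hz : 0 < z.im) {α : ℝ} {n : ℤ} (hn : n ≠ 0) :
    Complex.sin (π * ((α : ℂ) - n * z)) ≠ 0 := by
  intro h0
  obtain ⟨m, hm⟩ := sin_pi_mul_eq_zero h0
  have := congrArg Complex.im hm
  simp at this
  rcases this with h1 | h1
  · exact hn h1
  · exact hz.ne' h1

/-- The rank generating function at a root of unity, as a cotangent sum. -/
theorem rankO_eq_fineSum_mul (a : ℤ) (c : ℕ) (hz : 0 < z.im) {α : ℝ} (hα : α = a / c)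
    (hsin : Complex.sin (π * α) ≠ 0) (hcos : Complex.cos (π * α) ≠ 0) :
    rankO a c z = fineSum (cexp (2 * π * I * z)) 1 (cexp (2 * π * I * z)) *
      (Complex.tan (π * α) * ∑' n : ℤ, cotTerm α z n) := by
  set q := cexp (2 * π * I * z) with hqdef
  have hq : ‖q‖ < 1 := norm_cexp_two_pi_mul_lt_one hz
  have hq0 : q ≠ 0 := Complex.exp_ne_zero _
  set u := cexp (2 * π * I * α) with hudef
  have hu0 : u ≠ 0 := Complex.exp_ne_zero _
  have hu : ‖u‖ = 1 := by
    rw [hudef, show 2 * π * I * (α : ℂ) = ((2 * π * α : ℝ) : ℂ) * I by push_cast; ring,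
      norm_exp_ofReal_mul_I]
  have hrank : rankO a c z = rankGen u q := by
    rw [rankO, hudef, hα]
    congr 2
    push_cast
    ring
  obtain ⟨hs, h1⟩ := rankGen_eq_tsum_quadFactor hq0 hq hu
  have hG := fineSum_mul_altTheta hz
  rw [altTheta_eq hz, ← hqdef] at hG
  have hs0 : Summable fun j : ℕ => (-1 : ℂ) ^ j * q ^ ((j + 1) ^ 2) := by
    refine Summable.of_norm_bounded (summable_geometric_of_lt_one (norm_nonneg q) hq) fun j => ?_
    rw [norm_mul, norm_pow, norm_neg, norm_one, one_pow, one_mul, norm_pow]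
    exact pow_le_pow_of_le_one (norm_nonneg _) hq.le (by nlinarith)
  suffices hmain : 1 - 2 * ∑' j : ℕ, (-1 : ℂ) ^ j * q ^ ((j + 1) ^ 2) + 2 * ∑' j : ℕ,
      (-1 : ℂ) ^ j * q ^ ((j + 1) ^ 2) * (1 - q ^ (j + 1)) ^ 2 / quadFactor u q j =
      Complex.tan (π * α) * ∑' n : ℤ, cotTerm α z n by
    rw [hrank, h1]
    linear_combination fineSum q 1 q * hmain - hG
  rw [tsum_int_eq_zero_add_tsum (summable_cotTerm_of_im_pos hz α), mul_add, sub_add,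
    ← mul_sub, ← hs0.tsum_sub hs, sub_eq_add_neg, ← mul_neg, ← tsum_neg, ← tsum_mul_left,
    ← tsum_mul_left]
  congr 1
  · simp only [cotTerm, Complex.cot_eq_cos_div_sin, Complex.tan_eq_sin_div_cos, qpow]
    simp only [Int.cast_zero, zero_mul, sub_zero, zpow_zero]
    field_simp
    simp
  · refine tsum_congr fun j => ?_
    have hj : ((j : ℤ) + 1) ≠ 0 := by positivity
    have s1 := sin_pi_sub_int_mul_ne_zero (α := α) hz hj
    have s2 := sin_pi_sub_int_mul_ne_zero (α := α) hz (neg_ne_zero.2 hj)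
    have e2 : (α : ℂ) - ((-((j : ℤ) + 1) : ℤ) : ℂ) * z = α + ((j + 1 : ℤ) : ℂ) * z := by
      push_cast; ring
    rw [e2] at s2
    have hcc := four_sin_mul_eq_cot_add_cot s1 s2
    have eQ : cexp (2 * π * I * (((j + 1 : ℤ) : ℂ) * z)) = q ^ (j + 1) := by
      rw [← qpow_natCast, qpow]
      congr 1
      push_cast
      ring
    have eQ2 : cexp (2 * (2 * π * I * (((j + 1 : ℤ) : ℂ) * z))) = (q ^ (j + 1)) ^ 2 := by
      rw [← eQ, ← Complex.exp_nat_mul]; norm_num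
    have eu : 2 * Complex.cos (2 * π * α) = u + u⁻¹ := by
      rw [Complex.two_cos, hudef, ← Complex.exp_neg]
      congr 2 <;> ring
    have hquad : 1 - 2 * Complex.cos (2 * π * α) * q ^ (j + 1) + (q ^ (j + 1)) ^ 2 =
        quadFactor u q j := by
      rw [eu, quadFactor]
      field_simp
      ring
    rw [eQ, eQ2, hquad] at hcc
    have htan : Complex.tan (π * α) * (4 * Complex.sin (2 * π * α)) = 2 * (2 - u - u⁻¹) := by
      have e3 : Complex.cos (2 * π * α) = 1 - 2 * Complex.sin (π * α) ^ 2 := by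
        rw [mul_assoc, Complex.cos_two_mul, Complex.cos_sq']
        ring
      rw [mul_assoc 2 (π : ℂ), Complex.sin_two_mul]
      linear_combination 8 * Complex.sin (π * α) * Complex.tan_mul_cos hcos + 4 * e3 - 2 * eu
    have hne : quadFactor u q j ≠ 0 := by
      intro h0
      have := one_sub_norm_sq_le_quadFactor hq hu j
      rw [h0, norm_zero] at this
      have : 0 < (1 - ‖q‖) ^ 2 := pow_pos (by linarith) 2
      linarith
    have hquad2 : quadFactor u q j = (1 - q ^ (j + 1)) ^ 2 + q ^ (j + 1) * (2 - u - u⁻¹) := by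
      rw [← hquad, eu]
      ring
    unfold cotTerm
    rw [e2, neg_one_zpow_succ, neg_one_zpow_neg_succ, qpow_succ_sq, Int.cast_neg, neg_sq,
      qpow_succ_sq, ← mul_add, ← hcc, mul_left_comm (Complex.tan _), ← mul_assoc (Complex.tan _), htan]
    rw [← hqdef]
    field_simp
    rw [hquad2]
    linear_combination (q * q ^ j) * mul_inv_cancel₀ hu0

end

/-! ### Eta quotients and theta series -/

lemma mul_cpow_of_arg {x y : ℂ} (hx : x ≠ 0) (hy : y ≠ 0) (h : x.arg + y.arg ∈ Set.Ioc (-π) π)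
    (r : ℂ) : (x * y) ^ r = x ^ r * y ^ r := by
  rw [cpow_def_of_ne_zero (mul_ne_zero hx hy), cpow_def_of_ne_zero hx, cpow_def_of_ne_zero hy,
    (log_mul_eq_add_log_iff hx hy).2 h, add_mul, Complex.exp_add]

lemma abs_arg_lt_of_re_pos {x : ℂ} (hx : 0 < x.re) : |x.arg| < π / 2 :=
  abs_arg_lt_pi_div_two_iff.2 (Or.inl hx)

lemma mul_cpow_of_re_pos {x y : ℂ} (hx : 0 < x.re) (hy : 0 < y.re) (r : ℂ) :
    (x * y) ^ r = x ^ r * y ^ r := by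
  have h1 := abs_lt.1 (abs_arg_lt_of_re_pos hx)
  have h2 := abs_lt.1 (abs_arg_lt_of_re_pos hy)
  exact mul_cpow_of_arg (ne_zero_of_re_pos hx) (ne_zero_of_re_pos hy)
    ⟨by linarith, by linarith⟩ r

lemma cpow_half_sq (x : ℂ) : (x ^ (1 / 2 : ℂ)) ^ 2 = x := by
  simp

/-- The transformation of `η` under `z ↦ -1 / z`. -/
lemma eta_neg_inv {z : ℂ} (hz : 0 < z.im) :
    ModularForm.eta (-1 / z) = (-I * z) ^ (1 / 2 : ℂ) * ModularForm.eta z := by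
  have h1 : ModularForm.eta (-1 / z) = (Complex.sqrt I)⁻¹ * (Complex.sqrt z * ModularForm.eta z) := by
    simpa using ModularForm.eta_comp_eq_csqrt_I_inv (show z ∈ UpperHalfPlane.upperHalfPlaneSet from hz)
  have hre : 0 < (-I * z).re := by simpa
  have h2 := abs_lt.1 (abs_arg_lt_of_re_pos hre)
  have h3 : Complex.sqrt z = I ^ (1 / 2 : ℂ) * (-I * z) ^ (1 / 2 : ℂ) := by
    rw [← mul_cpow_of_arg I_ne_zero (ne_zero_of_re_pos hre) (by
      rw [arg_I]
      constructor <;> linarith [Real.pi_pos]), ← mul_assoc, mul_neg, I_mul_I, neg_neg, one_mul]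
    simp [Complex.sqrt]
  have h4 : Complex.sqrt I = I ^ (1 / 2 : ℂ) := by simp [Complex.sqrt]
  have h5 : I ^ (1 / 2 : ℂ) ≠ 0 := by simp [cpow_eq_zero_iff]
  rw [h1, h3, h4]
  field_simp

lemma eta_add_int (z : ℂ) (n : ℤ) :
    ModularForm.eta (z + n) = cexp (π * I * n / 12) * ModularForm.eta z := by
  have h1 : ∀ m : ℕ, ModularForm.eta_q m (z + n) = ModularForm.eta_q m z := by
    intro m
    rw [ModularForm.eta_q_eq_pow, ModularForm.eta_q_eq_pow]
    congr 1
    exact cexp_eq_of_sub n (by ring)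
  unfold ModularForm.eta
  simp_rw [h1]
  rw [← mul_assoc, Function.Periodic.qParam, Function.Periodic.qParam, ← Complex.exp_add]
  congr 2
  push_cast
  ring

lemma eta_ne_zero' {z : ℂ} (hz : 0 < z.im) : ModularForm.eta z ≠ 0 := ModularForm.eta_ne_zero hz

lemma two_mul_im_pos {z : ℂ} (hz : 0 < z.im) : 0 < (2 * z).im := by simpa using hz

lemma div_two_im_pos {z : ℂ} (hz : 0 < z.im) : 0 < (z / 2).im := by simpa using hz

/-- The generating function `∏ (1 + q^n) / (1 - q^n)` of overpartitions, as an eta quotient. -/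
lemma fineSum_eq_eta {z : ℂ} (hz : 0 < z.im) :
    fineSum (cexp (2 * π * I * z)) 1 (cexp (2 * π * I * z)) =
      ModularForm.eta (2 * z) / ModularForm.eta z ^ 2 := by
  set q := cexp (2 * π * I * z) with hqdef
  have hq : ‖q‖ < 1 := norm_cexp_two_pi_mul_lt_one hz
  have hq2e : cexp (2 * π * I * (2 * z)) = q ^ 2 := by
    rw [hqdef, ← Complex.exp_nat_mul]
    congr 1
    push_cast
    ring
  have hq2 : ‖q ^ 2‖ < 1 := by
    rw [norm_pow]
    exact pow_lt_one₀ (norm_nonneg _) hq two_ne_zero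
  have h1 := (ModularForm.multipliable_one_sub_pow hq).hasProd.tendsto_prod_nat
  have h2 := (ModularForm.multipliable_one_sub_pow hq2).hasProd.tendsto_prod_nat
  have hT : ∏' n : ℕ, (1 - q ^ (n + 1)) ≠ 0 := by
    have := ModularForm.eta_tprod_ne_zero (z := z) hz
    simpa only [ModularForm.eta_q_eq_pow, ← hqdef] using this
  have h3 := h2.div (h1.pow 2) (pow_ne_zero 2 hT)
  have h4 : Tendsto (fun n : ℕ => fineSum q 1 (q * q ^ n)) atTop (𝓝 1) := by
    refine (tendsto_fineSum_zero hq).comp ?_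
    have := (tendsto_pow_atTop_nhds_zero_of_norm_lt_one hq).const_mul q
    simpa using this
  have h5 := h3.mul h4
  rw [mul_one] at h5
  have h6 : ∀ n : ℕ, (∏ i ∈ Finset.range n, (1 - (q ^ 2) ^ (i + 1))) /
      (∏ i ∈ Finset.range n, (1 - q ^ (i + 1))) ^ 2 * fineSum q 1 (q * q ^ n) = fineSum q 1 q := by
    intro n
    rw [fineSum_one_eq_prod hq hq n, ← Finset.prod_pow, ← Finset.prod_div_distrib]
    congr 1
    refine Finset.prod_congr rfl fun i _ => ?_
    have := one_sub_pow_ne_zero hq i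
    rw [← pow_succ', ← pow_mul, mul_comm 2, pow_mul]
    field_simp
    ring
  rw [tendsto_nhds_unique (h5.congr h6) tendsto_const_nhds |>.symm]
  unfold ModularForm.eta
  simp only [ModularForm.eta_q_eq_pow, hq2e, ← hqdef]
  rw [mul_pow, show Function.Periodic.qParam 24 (2 * z) = Function.Periodic.qParam 24 z ^ 2 by
    rw [Function.Periodic.qParam, Function.Periodic.qParam, ← Complex.exp_nat_mul]
    congr 1
    push_cast
    ring, mul_div_mul_left _ _ (pow_ne_zero 2 (Function.Periodic.qParam_ne_zero _))]

lemma altTheta_eq_eta {z : ℂ} (hz : 0 < z.im) :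
    altTheta z = ModularForm.eta z ^ 2 / ModularForm.eta (2 * z) := by
  have h1 := fineSum_mul_altTheta hz
  rw [fineSum_eq_eta hz] at h1
  have h2 := eta_ne_zero' hz
  have h3 := eta_ne_zero' (two_mul_im_pos hz)
  field_simp at h1 ⊢
  linear_combination h1

lemma altTheta_neg_inv {z : ℂ} (hz : 0 < z.im) :
    altTheta (-1 / z) =
      1 / (2 * I / z) ^ (1 / 2 : ℂ) * ∑' n : ℤ, qpow z (((n : ℂ) / 2 - 1 / 4) ^ 2) := by
  have hz0 : z ≠ 0 := by
    rintro rfl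
    simp at hz
  have ha : 0 < (2 * I / z).re := by
    rw [div_eq_mul_inv, show 2 * I * z⁻¹ = ((2 : ℝ) : ℂ) * (I * z⁻¹) by push_cast; ring,
      re_ofReal_mul, I_mul_re, inv_im]
    have := normSq_pos.2 hz0
    rw [neg_div, neg_neg]
    positivity
  have h1 := Complex.tsum_exp_neg_quadratic ha (I / 2)
  refine Eq.trans ?_ (h1.trans ?_)
  · refine tsum_congr fun n => ?_
    rw [neg_one_zpow_eq_cexp, qpow, ← Complex.exp_add]
    congr 1
    field_simp
    ring
  · congr 1
    refine tsum_congr fun n => ?_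
    rw [qpow]
    congr 1
    have e : (n : ℂ) + I * (I / 2) = 2 * ((n : ℂ) / 2 - 1 / 4) := by
      linear_combination I_mul_I / 2
    rw [e]
    field_simp
    linear_combination (2 * (n : ℂ) - 1) ^ 2 * (-4) * I_mul_I

lemma summable_qpow_quarter {z : ℂ} (hz : 0 < z.im) :
    Summable fun n : ℤ => qpow z (((n : ℂ) / 2 - 1 / 4) ^ 2) := by
  refine Summable.of_norm_bounded ((summable_exp_neg_abs_int (c := π * z.im / 4) (by positivity)
    (1 / 2)).mul_left 1) fun n => ?_
  rw [show ((n : ℂ) / 2 - 1 / 4) ^ 2 = ((((n : ℝ) / 2 - 1 / 4) ^ 2 : ℝ) : ℂ) by push_cast; ring,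
    norm_qpow_ofReal, one_mul, Real.exp_le_exp, neg_le_neg_iff]
  have h1 : (1 / 2 : ℝ) ≤ |(n : ℝ) - 1 / 2| := by
    rcases le_or_gt n 0 with h | h
    · have : (n : ℝ) ≤ 0 := by exact_mod_cast h
      rw [abs_of_neg (by linarith)]
      linarith
    · have : (1 : ℝ) ≤ n := by exact_mod_cast h
      rw [abs_of_pos (by linarith)]
      linarith
  have h2 : ((n : ℝ) / 2 - 1 / 4) ^ 2 = |(n : ℝ) - 1 / 2| ^ 2 / 4 := by
    rw [sq_abs]
    ring
  rw [h2]
  have h3 : 0 < π * z.im := by positivity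
  have h4 : |(n : ℝ) - 1 / 2| ≤ 2 * |(n : ℝ) - 1 / 2| ^ 2 := by nlinarith
  nlinarith

/-- Gauss's second identity, in the form `∑ q^{(n + 1/4)²} = η(z)² / η(z / 2)`. -/
theorem tsum_qpow_quarter {z : ℂ} (hz : 0 < z.im) :
    ∑' n : ℤ, qpow z (((n : ℂ) + 1 / 4) ^ 2) = ModularForm.eta z ^ 2 / ModularForm.eta (z / 2) := by
  have hz0 : z ≠ 0 := by
    rintro rfl
    simp at hz
  have h1 := altTheta_neg_inv hz
  have him : 0 < (-1 / z).im := by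
    rw [neg_div, one_div, neg_im, inv_im]
    have := normSq_pos.2 hz0
    rw [neg_div, neg_neg]
    positivity
  rw [altTheta_eq_eta him, show 2 * (-1 / z) = -1 / (z / 2) by field_simp,
    eta_neg_inv hz, eta_neg_inv (div_two_im_pos hz), mul_pow, cpow_half_sq,
    tsum_eq_sum_range_tsum (k := 2) (by norm_num) (summable_qpow_quarter hz)] at h1
  simp only [Finset.sum_range_succ, Finset.sum_range_zero, zero_add] at h1
  have e1 : ∑' j : ℤ, qpow z ((((((2 : ℕ) : ℤ) * j + ((0 : ℕ) : ℤ) : ℤ) : ℂ) / 2 - 1 / 4) ^ 2) =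
      ∑' n : ℤ, qpow z (((n : ℂ) + 1 / 4) ^ 2) := by
    rw [← (Equiv.neg ℤ).tsum_eq]
    refine tsum_congr fun n => ?_
    congr 1
    simp only [Equiv.neg_apply]
    push_cast
    ring
  have e2 : ∑' j : ℤ, qpow z ((((((2 : ℕ) : ℤ) * j + ((1 : ℕ) : ℤ) : ℤ) : ℂ) / 2 - 1 / 4) ^ 2) =
      ∑' n : ℤ, qpow z (((n : ℂ) + 1 / 4) ^ 2) := by
    refine tsum_congr fun n => ?_
    congr 1
    push_cast
    ring
  rw [e1, e2] at h1
  have hre : 0 < (-I * (z / 2)).re := by simpa using hz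
  have hrs : (2 * I / z) ^ (1 / 2 : ℂ) * (-I * (z / 2)) ^ (1 / 2 : ℂ) = 1 := by
    have ha : 0 < (2 * I / z).re := by
      have := inv_re_pos hre
      rwa [show (-I * (z / 2))⁻¹ = 2 * I / z by
        rw [inv_eq_iff_eq_inv, inv_div]
        field_simp
        simp] at this
    rw [← mul_cpow_of_re_pos ha hre, show 2 * I / z * (-I * (z / 2)) = 1 by
      field_simp
      simp, one_cpow]
  have hsq := cpow_half_sq (-I * (z / 2))
  set r := (-I * (z / 2)) ^ (1 / 2 : ℂ) with hr
  set s := (2 * I / z) ^ (1 / 2 : ℂ) with hs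
  have hr0 : r ≠ 0 := right_ne_zero_of_mul (hrs.trans_ne one_ne_zero)
  have hs0 : s ≠ 0 := left_ne_zero_of_mul (hrs.trans_ne one_ne_zero)
  have h2 := eta_ne_zero' (div_two_im_pos hz)
  have hy : -I * z = 2 * r ^ 2 := by rw [hsq]; ring
  have hs' : s = 1 / r := eq_one_div_of_mul_eq_one_left hrs
  rw [hy, hs'] at h1
  generalize ∑' n : ℤ, qpow z (((n : ℂ) + 1 / 4) ^ 2) = Θ at h1 ⊢
  field_simp at h1 ⊢
  linear_combination -h1 / 2

/-! ### Dedekind sums -/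

/-- The Dedekind sum `s(h, k)`. -/
def dedekindSum (h : ℤ) (k : ℕ) : ℝ :=
  ∑ μ ∈ Finset.range k, sawtooth ((μ : ℝ) / k) * sawtooth ((h * μ : ℝ) / k)

lemma omega_eq (h : ℤ) (k : ℕ) : omega h k = cexp (π * I * dedekindSum h k) := rfl

lemma sawtooth_add_int (x : ℝ) (n : ℤ) : sawtooth (x + n) = sawtooth x := by
  unfold sawtooth
  rw [Int.fract_add_intCast, Int.floor_add_intCast]
  push_cast
  split_ifs <;> ring

lemma sawtooth_neg (x : ℝ) : sawtooth (-x) = -sawtooth x := by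
  unfold sawtooth
  by_cases hx : Int.fract x = 0
  · rw [if_pos hx, if_pos (Int.fract_neg_eq_zero.2 hx), neg_zero]
  · rw [if_neg hx, if_neg fun h => hx (Int.fract_neg_eq_zero.1 h)]
    have h1 := Int.fract_neg hx
    have h2 := Int.self_sub_floor x
    have h3 := Int.self_sub_floor (-x)
    linarith

lemma dedekindSum_add_mul (h n : ℤ) {k : ℕ} (hk : 0 < k) :
    dedekindSum (h + k * n) k = dedekindSum h k := by
  refine Finset.sum_congr rfl fun μ _ => ?_
  have hk0 : (k : ℝ) ≠ 0 := by exact_mod_cast hk.ne'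
  congr 1
  rw [← sawtooth_add_int (h * μ / k : ℝ) (n * μ)]
  congr 1
  push_cast
  field_simp

lemma dedekindSum_neg (h : ℤ) (k : ℕ) : dedekindSum (-h) k = -dedekindSum h k := by
  rw [dedekindSum, dedekindSum, ← Finset.sum_neg_distrib]
  refine Finset.sum_congr rfl fun μ _ => ?_
  rw [← mul_neg, ← sawtooth_neg]
  congr 2
  push_cast
  ring

lemma sawtooth_natCast_div (m : ℕ) {k : ℕ} (hk : 0 < k) :
    sawtooth ((m : ℝ) / k) = if k ∣ m then 0 else (m : ℝ) / k - (m / k : ℕ) - 1 / 2 := by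
  have hk0 : (k : ℝ) ≠ 0 := by exact_mod_cast hk.ne'
  have hfl : ⌊(m : ℝ) / k⌋ = ((m / k : ℕ) : ℤ) := by
    rw [← Nat.floor_div_eq_div (K := ℝ), Int.natCast_floor_eq_floor (by positivity)]
  unfold sawtooth
  rw [← Int.self_sub_floor, hfl]
  have : (m : ℝ) / k - ((m / k : ℕ) : ℤ) = 0 ↔ k ∣ m := by
    rw [sub_eq_zero, div_eq_iff hk0]
    push_cast
    norm_cast
    constructor
    · intro h
      exact ⟨m / k, by rw [mul_comm]; exact h⟩
    · intro h
      exact (Nat.div_mul_cancel h).symm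
  simp only [this]
  push_cast
  rfl

section
variable {h k : ℕ}

/-- A double count of the lattice points below the diagonal of the `h × k` rectangle, weighted by
their height. -/
lemma sum_floor_mul_floor_add_one (hk : 0 < k) (hcop : Nat.Coprime h k) :
    ∑ μ ∈ Finset.range k, ((h * μ / k : ℕ) : ℝ) * ((h * μ / k : ℕ) + 1) =
      2 * ∑ j ∈ Finset.range h, (j : ℝ) * (k - 1 - (k * j / h : ℕ)) := by
  have e1 : ∀ μ ∈ Finset.range k, ((h * μ / k : ℕ) : ℝ) * ((h * μ / k : ℕ) + 1) =
      2 * ∑ j ∈ Finset.range h, if k * j ≤ h * μ then (j : ℝ) else 0 := by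
    intro μ hμ
    have hμk := Finset.mem_range.1 hμ
    have e2 : (Finset.range h).filter (fun j => k * j ≤ h * μ) ∪ {0} =
        Finset.range (h * μ / k + 1) := by
      ext j
      simp only [Finset.mem_union, Finset.mem_filter, Finset.mem_range, Finset.mem_singleton,
        Nat.lt_succ_iff, Nat.le_div_iff_mul_le hk, mul_comm j k]
      constructor
      · rintro (h1 | rfl)
        · exact h1.2
        · simp
      · intro h1
        rcases Nat.eq_zero_or_pos j with h0 | h0
        · exact Or.inr h0
        · refine Or.inl ⟨?_, h1⟩
          by_contra h2
          have : k * h ≤ k * j := Nat.mul_le_mul_left k (not_lt.1 h2)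
          have h3 : 0 < h := by
            rcases Nat.eq_zero_or_pos h with h4 | h4
            · subst h4
              have := Nat.mul_pos hk h0
              omega
            · exact h4
          have h5 : h * μ < h * k := Nat.mul_lt_mul_of_pos_left hμk h3
          rw [mul_comm] at h5
          nlinarith
    have e3 : ∑ j ∈ Finset.range (h * μ / k + 1), (j : ℝ) =
        ∑ j ∈ Finset.range h, if k * j ≤ h * μ then (j : ℝ) else 0 := by
      rw [← Finset.sum_filter, ← e2]
      by_cases h0 : 0 ∈ (Finset.range h).filter (fun j => k * j ≤ h * μ)
      · rw [Finset.union_eq_left.2 (Finset.singleton_subset_iff.2 h0)]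
      · rw [Finset.sum_union (Finset.disjoint_singleton_right.2 h0)]
        simp
    rw [← e3]
    have e4 := Finset.sum_range_id_mul_two (h * μ / k + 1)
    have e5 := congrArg (fun n : ℕ => (n : ℝ)) e4
    push_cast [Nat.add_sub_cancel] at e5
    linarith
  rw [Finset.sum_congr rfl e1, ← Finset.mul_sum, Finset.sum_comm]
  congr 1
  refine Finset.sum_congr rfl fun j hj => ?_
  rcases Nat.eq_zero_or_pos j with rfl | h0
  · simp
  have hjh := Finset.mem_range.1 hj
  have hh : 0 < h := h0.trans hjh
  have hlt : k * j / h < k := by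
    rw [Nat.div_lt_iff_lt_mul hh]
    exact Nat.mul_lt_mul_of_pos_left hjh hk
  have hnd : ¬ h ∣ k * j := by
    intro hd
    have := Nat.le_of_dvd h0 (hcop.dvd_of_dvd_mul_left hd)
    omega
  have e6 : (Finset.range k).filter (fun μ => ¬ k * j ≤ h * μ) = Finset.range (k * j / h + 1) := by
    ext μ
    simp only [Finset.mem_filter, Finset.mem_range, not_le, Nat.lt_succ_iff,
      Nat.le_div_iff_mul_le hh]
    constructor
    · rintro ⟨-, h2⟩
      nlinarith
    · intro h2
      have h3 : h * μ ≠ k * j := fun h4 => hnd ⟨μ, h4.symm⟩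
      have h4 : h * μ < k * j := by
        rw [mul_comm] at h2
        omega
      refine ⟨?_, h4⟩
      have : h * μ < h * k := h4.trans (by rw [mul_comm h]; exact Nat.mul_lt_mul_of_pos_left hjh hk)
      exact lt_of_mul_lt_mul_left this (Nat.zero_le _)
  have e7 := Finset.sum_filter_add_sum_filter_not (Finset.range k) (fun μ => k * j ≤ h * μ)
    (fun _ => (j : ℝ))
  rw [e6, Finset.sum_const, Finset.sum_const, Finset.sum_const, Finset.card_range,
    Finset.card_range] at e7
  rw [← Finset.sum_filter, Finset.sum_const]
  simp only [nsmul_eq_mul] at e7 ⊢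
  push_cast at e7 ⊢
  linarith

/-- Multiplication by a unit permutes the residues modulo `k`. -/
lemma sum_mod_eq (hk : 0 < k) (hcop : Nat.Coprime h k) (f : ℕ → ℝ) :
    ∑ μ ∈ Finset.range k, f (h * μ % k) = ∑ μ ∈ Finset.range k, f μ := by
  have hinj : Set.InjOn (fun μ => h * μ % k) (Finset.range k : Set ℕ) := by
    intro a ha b hb hab
    have ha' := Finset.mem_range.1 (Finset.mem_coe.1 ha)
    have hb' := Finset.mem_range.1 (Finset.mem_coe.1 hb)
    have h1 : a ≡ b [MOD k] := Nat.ModEq.cancel_left_of_coprime (by rwa [Nat.gcd_comm]) hab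
    exact Nat.ModEq.eq_of_lt_of_lt h1 ha' hb'
  have himg : (Finset.range k).image (fun μ => h * μ % k) = Finset.range k := by
    refine Finset.eq_of_subset_of_card_le ?_ ?_
    · intro x hx
      obtain ⟨μ, -, rfl⟩ := Finset.mem_image.1 hx
      exact Finset.mem_range.2 (Nat.mod_lt _ hk)
    · rw [Finset.card_image_of_injOn hinj]
  conv_rhs => rw [← himg, Finset.sum_image hinj]

lemma sum_range_real (k : ℕ) : ∑ μ ∈ Finset.range k, (μ : ℝ) = k * (k - 1) / 2 := by
  induction k with
  | zero => simp
  | succ n ih => rw [Finset.sum_range_succ, ih]; push_cast; ring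

lemma sum_range_sq_real (k : ℕ) :
    ∑ μ ∈ Finset.range k, (μ : ℝ) ^ 2 = k * (k - 1) * (2 * k - 1) / 6 := by
  induction k with
  | zero => simp
  | succ n ih => rw [Finset.sum_range_succ, ih]; push_cast; ring

lemma mod_eq_real (k m : ℕ) : ((m % k : ℕ) : ℝ) = m - k * (m / k : ℕ) := by
  have := Nat.div_add_mod m k
  have h2 : ((k * (m / k) + m % k : ℕ) : ℝ) = m := by exact_mod_cast this
  push_cast at h2
  linarith

lemma sum_floor (hk : 0 < k) (hcop : Nat.Coprime h k) :
    ∑ μ ∈ Finset.range k, ((h * μ / k : ℕ) : ℝ) = (h - 1) * (k - 1) / 2 := by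
  have hk0 : (k : ℝ) ≠ 0 := by exact_mod_cast hk.ne'
  have h1 := sum_mod_eq hk hcop fun n => (n : ℝ)
  simp only [mod_eq_real] at h1
  rw [Finset.sum_sub_distrib, ← Finset.mul_sum, sum_range_real] at h1
  push_cast at h1
  rw [← Finset.mul_sum, sum_range_real] at h1
  field_simp
  have h2 : (k : ℝ) * (2 * ∑ μ ∈ Finset.range k, ((h * μ / k : ℕ) : ℝ)) =
      k * ((h - 1) * (k - 1)) := by linarith
  linarith [mul_left_cancel₀ hk0 h2]

/-- The Dedekind sum in terms of the moment `∑ μ ⌊h μ / k⌋`. -/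
lemma dedekindSum_eq (hk : 0 < k) (hcop : Nat.Coprime h k) :
    dedekindSum h k = h * (k - 1) * (2 * k - 1) / (6 * k) - (k - 1) / 4 -
      (∑ μ ∈ Finset.range k, (μ : ℝ) * (h * μ / k : ℕ)) / k := by
  have hk0 : (k : ℝ) ≠ 0 := by exact_mod_cast hk.ne'
  have e1 : ∀ μ ∈ Finset.range k, sawtooth ((μ : ℝ) / k) * sawtooth (((h : ℤ) * μ : ℝ) / k) =
      ((μ : ℝ) / k - 1 / 2) * ((h * μ : ℝ) / k - (h * μ / k : ℕ) - 1 / 2) -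
        if μ = 0 then 1 / 4 else 0 := by
    intro μ hμ
    have hμk := Finset.mem_range.1 hμ
    have c1 : (((h : ℤ) * μ : ℝ) / k) = ((h * μ : ℕ) : ℝ) / k := by push_cast; ring
    rw [c1, sawtooth_natCast_div _ hk, sawtooth_natCast_div _ hk]
    rcases Nat.eq_zero_or_pos μ with rfl | h0
    · simp
      norm_num
    · have n1 : ¬ k ∣ μ := fun hd => by
        have := Nat.le_of_dvd h0 hd
        omega
      have n2 : ¬ k ∣ h * μ := fun hd => n1 (hcop.symm.dvd_of_dvd_mul_left hd)
      rw [if_neg n1, if_neg n2, if_neg h0.ne', Nat.div_eq_of_lt hμk]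
      push_cast
      ring
  rw [dedekindSum, Finset.sum_congr rfl e1, Finset.sum_sub_distrib, Finset.sum_ite_eq',
    if_pos (Finset.mem_range.2 hk)]
  have e2 : ∀ μ ∈ Finset.range k, ((μ : ℝ) / k - 1 / 2) *
      ((h * μ : ℝ) / k - (h * μ / k : ℕ) - 1 / 2) = (h / k ^ 2 : ℝ) * (μ : ℝ) ^ 2 -
        1 / k * ((μ : ℝ) * (h * μ / k : ℕ)) - (1 / (2 * k) + h / (2 * k)) * (μ : ℝ) +
        1 / 2 * ((h * μ / k : ℕ) : ℝ) + 1 / 4 := by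
    intro μ _
    field_simp
    ring
  rw [Finset.sum_congr rfl e2, Finset.sum_add_distrib, Finset.sum_add_distrib,
    Finset.sum_sub_distrib, Finset.sum_sub_distrib, ← Finset.mul_sum, ← Finset.mul_sum,
    ← Finset.mul_sum, ← Finset.mul_sum, sum_floor hk hcop, sum_range_real, sum_range_sq_real,
    Finset.sum_const, Finset.card_range, nsmul_eq_mul]
  field_simp
  ring

/-- Dedekind's reciprocity law. -/
theorem dedekindSum_add_dedekindSum (hh : 0 < h) (hk : 0 < k) (hcop : Nat.Coprime h k) :
    dedekindSum h k + dedekindSum k h =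
      -(1 / 4) + ((h : ℝ) / k + k / h + 1 / (h * k)) / 12 := by
  have hk0 : (k : ℝ) ≠ 0 := by exact_mod_cast hk.ne'
  have hh0 : (h : ℝ) ≠ 0 := by exact_mod_cast hh.ne'
  rw [dedekindSum_eq hk hcop, dedekindSum_eq hh hcop.symm]
  have h1 := sum_floor_mul_floor_add_one hk hcop
  have h2 := sum_mod_eq hk hcop fun n => (n : ℝ) ^ 2
  have h3 := sum_floor hk hcop
  simp only [mod_eq_real] at h2
  have e1 : ∀ μ ∈ Finset.range k, (((h * μ : ℕ) : ℝ) - k * (h * μ / k : ℕ)) ^ 2 =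
      (h : ℝ) ^ 2 * (μ : ℝ) ^ 2 - 2 * h * k * ((μ : ℝ) * (h * μ / k : ℕ)) +
        k ^ 2 * (((h * μ / k : ℕ) : ℝ) * ((h * μ / k : ℕ) + 1)) - k ^ 2 * ((h * μ / k : ℕ) : ℝ) := by
    intro μ _
    push_cast
    ring
  have e2 : ∀ j ∈ Finset.range h, (j : ℝ) * (k - 1 - (k * j / h : ℕ)) =
      (k - 1) * (j : ℝ) - (j : ℝ) * (k * j / h : ℕ) := by
    intro j _
    ring
  rw [Finset.sum_congr rfl e1, Finset.sum_sub_distrib, Finset.sum_add_distrib,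
    Finset.sum_sub_distrib, ← Finset.mul_sum, ← Finset.mul_sum, ← Finset.mul_sum, ← Finset.mul_sum,
    h1, h3, sum_range_sq_real, Finset.sum_congr rfl e2, Finset.sum_sub_distrib, ← Finset.mul_sum,
    sum_range_real] at h2
  set A := ∑ μ ∈ Finset.range k, (μ : ℝ) * (h * μ / k : ℕ)
  set B := ∑ j ∈ Finset.range h, (j : ℝ) * (k * j / h : ℕ)
  have h4 : (k : ℝ) * (12 * h * A + 12 * k * B) = k * ((h ^ 2 * (k - 1) * (2 * k - 1)) +
      6 * k * h * (h - 1) * (k - 1) - 3 * k * (h - 1) * (k - 1) - (k - 1) * (2 * k - 1)) := by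
    linear_combination (-6) * h2
  have h5 := mul_left_cancel₀ hk0 h4
  field_simp
  linear_combination (-24) * h5

end

/-! ### The eta function at an arbitrary cusp -/

/-- The value `η((h + i y) / k)`, normalised so that it depends only on `h` modulo `k`. -/
def etaCusp (h : ℤ) (k : ℕ) (y : ℂ) : ℂ :=
  ModularForm.eta ((h + I * y) / k) * cexp (-(π * I * h / (12 * k)))

section
variable {h h' : ℤ} {k : ℕ} {w : ℂ}

lemma etaCusp_add_mul (hk : 0 < k) (h n : ℤ) (y : ℂ) : etaCusp (h + k * n) k y = etaCusp h k y := by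
  have hk0 : (k : ℂ) ≠ 0 := by exact_mod_cast hk.ne'
  have e : (((h + k * n : ℤ) : ℂ) + I * y) / k = (h + I * y) / k + n := by
    push_cast
    field_simp
    ring
  rw [etaCusp, e, eta_add_int, mul_right_comm, ← Complex.exp_add, mul_comm, etaCusp]
  congr 2
  push_cast
  field_simp
  ring

lemma im_cusp_pos (hk : 0 < k) (hw : 0 < w.re) (h : ℤ) : 0 < (((h : ℂ) + I * w) / k).im := by
  have hkr : (0 : ℝ) < k := by exact_mod_cast hk
  rw [div_natCast_im, add_im, intCast_im, I_mul_im, zero_add]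
  positivity

lemma neg_I_mul_cpow_half (hw : 0 < w.re) :
    (-I * w) ^ (1 / 2 : ℂ) = cexp (-(π * I / 4)) * w ^ (1 / 2 : ℂ) := by
  have h2 := abs_lt.1 (abs_arg_lt_of_re_pos hw)
  rw [mul_cpow_of_arg (neg_ne_zero.2 I_ne_zero) (ne_zero_of_re_pos hw) (by
    rw [arg_neg_I]
    constructor <;> linarith [Real.pi_pos])]
  congr 1
  rw [cpow_def_of_ne_zero (neg_ne_zero.2 I_ne_zero), log_neg_I]
  congr 1
  ring

/-- The transformation of `η` at the cusp `h / k`. The proof descends along the Euclidean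
algorithm: `z ↦ -1 / z` carries `h / k` to `-k / h`, and the multipliers match by the reciprocity
law for Dedekind sums. -/
theorem etaCusp_inv (hk : 0 < k) (hh : h * h' ≡ -1 [ZMOD k]) (hw : 0 < w.re) :
    etaCusp h' k w⁻¹ = omega h k * w ^ (1 / 2 : ℂ) * etaCusp h k w := by
  induction k using Nat.strong_induction_on generalizing h h' w with
  | _ k ih =>
  have hkC : (k : ℂ) ≠ 0 := by exact_mod_cast hk.ne'
  have hw0 := ne_zero_of_re_pos hw
  rcases (Nat.one_le_iff_ne_zero.2 hk.ne').eq_or_lt with rfl | hk1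
  · -- `k = 1` is the inversion formula itself
    have e1 : ∀ (n : ℤ) (y : ℂ), etaCusp n 1 y = ModularForm.eta (I * y) := by
      intro n y
      have := etaCusp_add_mul (k := 1) one_pos 0 n y
      simp only [Nat.cast_one, one_mul, zero_add] at this
      rw [this]
      simp [etaCusp]
    have e2 : omega h 1 = 1 := by simp [omega, sawtooth]
    have e3 : I * w⁻¹ = -1 / (I * w) := by
      field_simp
      simp
    rw [e1, e1, e2, one_mul, e3, eta_neg_inv (by simpa using hw), ← mul_assoc, neg_mul, I_mul_I,
      neg_neg, one_mul]
  · obtain ⟨r, hr⟩ : ∃ r : ℕ, h % k = r := ⟨(h % k).toNat, by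
      rw [Int.toNat_of_nonneg (Int.emod_nonneg _ (by omega))]⟩
    have hrk : r < k := by
      have := Int.emod_lt_of_pos h (show (0 : ℤ) < k by omega)
      omega
    have hdec : h = r + k * (h / k) := by
      rw [← hr]
      exact (Int.emod_add_mul_ediv h k).symm
    have hh2 : (r : ℤ) * h' ≡ -1 [ZMOD k] := by
      have : (r : ℤ) ≡ h [ZMOD k] := by
        rw [← hr]
        exact Int.mod_modEq _ _
      exact (this.mul_right h').trans hh
    obtain ⟨m, hm⟩ : ∃ m : ℤ, (r : ℤ) * h' + 1 = k * m := by
      have := hh2.symm.dvd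
      rwa [sub_neg_eq_add] at this
    have hr0 : 0 < r := by
      rcases Nat.eq_zero_or_pos r with h0 | h0
      · subst h0
        exfalso
        have h1 : (k : ℤ) ∣ 1 := ⟨m, by rw [← hm]; simp⟩
        have := Int.le_of_dvd one_pos h1
        omega
      · exact h0
    have hcop : Nat.Coprime r k := by
      rw [← Nat.isCoprime_iff_coprime]
      exact ⟨-h', m, by linear_combination -hm⟩
    have hrC : (r : ℂ) ≠ 0 := by exact_mod_cast hr0.ne'
    have hmC : (r : ℂ) * h' + 1 = k * m := by exact_mod_cast hm
    have e1 : omega h k = omega r k := by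
      rw [hdec, omega_eq, omega_eq, dedekindSum_add_mul _ _ hk]
    have e2 : etaCusp h k w = etaCusp r k w := by
      rw [hdec, etaCusp_add_mul hk]
    rw [e1, e2]
    have hzim : 0 < (((r : ℤ) + I * w) / k : ℂ).im := im_cusp_pos hk hw r
    rw [Int.cast_natCast] at hzim
    have hd : (r : ℂ) + I * w ≠ 0 := by
      intro h0
      rw [h0] at hzim
      simp at hzim
    have hd' : (r : ℂ) + w * I ≠ 0 := by rwa [mul_comm w]
    -- `-1 / ((r + i w) / k) = (-k + i v) / r`
    obtain ⟨v, hv⟩ : ∃ v : ℂ, v = k * w / (r + I * w) := ⟨_, rfl⟩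
    have hvinv : v⁻¹ = ((r / k : ℝ) : ℂ) * w⁻¹ + I * ((1 / k : ℝ) : ℂ) := by
      rw [hv]
      push_cast
      field_simp
    have hvre : 0 < v.re := by
      have h1 : 0 < (v⁻¹).re := by
        rw [hvinv, add_re, re_ofReal_mul, I_mul_re, ofReal_im, neg_zero, add_zero]
        have := inv_re_pos hw
        positivity
      have := inv_re_pos h1
      rwa [inv_inv] at this
    have hIH := ih r hrk hr0 (h := -k) (h' := m) (by
      refine (Int.modEq_iff_dvd.2 ⟨-h', ?_⟩).symm
      linear_combination hm) hvre
    have a1 : ((m : ℂ) + I * v⁻¹) / r = (h' + I * w⁻¹) / k := by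
      rw [hvinv]
      push_cast
      field_simp
      linear_combination (-w) * hmC + w * I_mul_I
    have a2 : (((-k : ℤ) : ℂ) + I * v) / r = -1 / ((r + I * w) / k) := by
      rw [hv]
      push_cast
      field_simp
      ring
    rw [etaCusp, etaCusp, a1, a2, eta_neg_inv hzim, omega_eq, dedekindSum_neg] at hIH
    have a3 : v ^ (1 / 2 : ℂ) * (-I * ((r + I * w) / k)) ^ (1 / 2 : ℂ) =
        cexp (-(π * I / 4)) * w ^ (1 / 2 : ℂ) := by
      rw [← mul_cpow_of_re_pos hvre (by simpa using hzim), ← neg_I_mul_cpow_half hw]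
      congr 1
      rw [hv]
      field_simp
    have hrec := dedekindSum_add_dedekindSum hr0 hk hcop
    have hrecC : (dedekindSum r k : ℂ) + dedekindSum k r =
        -(1 / 4) + ((r : ℂ) / k + k / r + 1 / (r * k)) / 12 := by
      have := congrArg (fun x : ℝ => (x : ℂ)) hrec
      push_cast at this
      exact this
    rw [etaCusp, etaCusp, omega_eq, Int.cast_natCast]
    set E := ModularForm.eta ((h' + I * w⁻¹) / k)
    set F := ModularForm.eta ((r + I * w) / k)
    have hE : E = cexp (π * I * m / (12 * r)) * (E * cexp (-(π * I * m / (12 * r)))) := by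
      rw [mul_left_comm, ← Complex.exp_add, add_neg_cancel, Complex.exp_zero, mul_one]
    have a4 : cexp (π * I * m / (12 * r)) * cexp (π * I * (-dedekindSum k r : ℝ)) *
        cexp (-(π * I / 4)) * cexp (-(π * I * ((-k : ℤ) : ℂ) / (12 * r))) *
        cexp (-(π * I * h' / (12 * k))) =
        cexp (π * I * dedekindSum r k) * cexp (-(π * I * ((r : ℤ) : ℂ) / (12 * k))) := by
      simp only [← Complex.exp_add]
      congr 1
      have : (dedekindSum r k : ℂ) = -(1 / 4) + ((r : ℂ) / k + k / r + 1 / (r * k)) / 12 -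
          dedekindSum k r := by linear_combination hrecC
      rw [this]
      push_cast
      field_simp
      linear_combination (-4) * hmC
    rw [hE, hIH]
    rw [Int.cast_natCast] at a4
    linear_combination (cexp (π * I * m / (12 * r)) * cexp (π * I * (-dedekindSum k r : ℝ)) *
      cexp (-(π * I * ((-k : ℤ) : ℂ) / (12 * r))) * cexp (-(π * I * h' / (12 * k))) * F) * a3 +
      w ^ (1 / 2 : ℂ) * F * a4

end

/-! ### Multipliers of the theta series -/

section
variable {h h' : ℤ} {k : ℕ} {w z z₁ : ℂ}

lemma modEq_of_dvd_modulus {m : ℕ} (hm : m ∣ k) (hh : h * h' ≡ -1 [ZMOD k]) :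
    h * h' ≡ -1 [ZMOD m] :=
  hh.of_dvd (Int.natCast_dvd_natCast.2 hm)

lemma omega_ne_zero (h : ℤ) (k : ℕ) : omega h k ≠ 0 := Complex.exp_ne_zero _

lemma tsum_thetaTerm_zero (hev : Even k) (hw : 0 < w.re) (hz₁ : z₁ = (h' + I / w) / k) :
    ∑' n : ℤ, thetaTerm k h' w 0 n = altTheta z₁ := by
  have hw0 := ne_zero_of_re_pos hw
  refine tsum_congr fun n => ?_
  have hodd : Odd ((k : ℤ) + 1) := by
    have : Even (k : ℤ) := by exact_mod_cast hev
    exact this.add_one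
  rw [thetaTerm, zpow_mul, hodd.neg_one_zpow, qpow, hz₁]
  congr 2
  rcases eq_or_ne (k : ℂ) 0 with hk0 | hk0
  · simp [hk0]
  · push_cast
    field_simp
    linear_combination (-4) * n ^ 2 * I_mul_I

lemma tsum_thetaTerm_half (hodd : Odd k) (hw : 0 < w.re) (hz₁ : z₁ = (h' + I / w) / k) :
    ∑' n : ℤ, thetaTerm k h' w (1 / 2) n =
      cexp (-(π * I * h' / (8 * k))) * ∑' n : ℤ, qpow z₁ (((n : ℂ) + 1 / 4) ^ 2) := by
  have hw0 := ne_zero_of_re_pos hw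
  rw [← tsum_mul_left]
  refine tsum_congr fun n => ?_
  have hev : Even (((k : ℤ) + 1) * n) := by
    have : Odd (k : ℤ) := by exact_mod_cast hodd
    exact this.add_one.mul_right n
  have hk0 : (k : ℂ) ≠ 0 := by
    exact_mod_cast hodd.pos.ne'
  rw [thetaTerm, hev.neg_one_zpow, one_mul, qpow, hz₁, ← Complex.exp_add]
  congr 1
  push_cast
  field_simp
  linear_combination (-128) * (4 * n + 1) ^ 2 * I_mul_I

lemma eta_cusp (h : ℤ) (k : ℕ) (y : ℂ) : ModularForm.eta ((h + I * y) / k) =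
    etaCusp h k y * cexp (π * I * h / (12 * k)) := by
  rw [etaCusp, mul_assoc, ← Complex.exp_add, neg_add_cancel, Complex.exp_zero, mul_one]

/-- The multiplier of `η(2z) / η(z)²` for even `k`. -/
lemma eta_quotient_even (hk : 0 < k) (hev : Even k) (hh : h * h' ≡ -1 [ZMOD k]) (hw : 0 < w.re)
    (hz : z = (h + I * w) / k) (hz₁ : z₁ = (h' + I / w) / k) :
    ModularForm.eta (2 * z) / ModularForm.eta z ^ 2 =
      omega h k ^ 2 / omega h (k / 2) * w ^ (1 / 2 : ℂ) *
        (ModularForm.eta (2 * z₁) / ModularForm.eta z₁ ^ 2) := by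
  obtain ⟨r, hr⟩ := hev
  have hr2 : k / 2 = r := by omega
  have hr0 : 0 < r := by omega
  have hrk : r ∣ k := ⟨2, by omega⟩
  have hrC : (r : ℂ) ≠ 0 := by exact_mod_cast hr0.ne'
  have hkr : (k : ℂ) = 2 * r := by
    rw [hr]
    push_cast
    ring
  have hT1 := etaCusp_inv hk hh hw
  have hT2 := etaCusp_inv hr0 (modEq_of_dvd_modulus hrk hh) hw
  have e1 : 2 * z = (h + I * w) / r := by
    rw [hz, hkr]
    field_simp
  have e2 : 2 * z₁ = (h' + I * w⁻¹) / r := by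
    rw [hz₁, hkr, div_eq_mul_inv I w]
    field_simp
  have e3 : z₁ = (h' + I * w⁻¹) / k := by rw [hz₁, div_eq_mul_inv I w]
  have hz1ne : etaCusp h k w ≠ 0 :=
    mul_ne_zero (eta_ne_zero' (im_cusp_pos hk hw h)) (Complex.exp_ne_zero _)
  have hz2ne : etaCusp h r w ≠ 0 :=
    mul_ne_zero (eta_ne_zero' (im_cusp_pos hr0 hw h)) (Complex.exp_ne_zero _)
  have hs0 : w ^ (1 / 2 : ℂ) ≠ 0 := by simp [cpow_eq_zero_iff, ne_zero_of_re_pos hw]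
  have e5 : ∀ n : ℤ, cexp (π * I * n / (12 * r)) = cexp (π * I * n / (12 * k)) ^ 2 := by
    intro n
    rw [← Complex.exp_nat_mul, hkr]
    congr 1
    push_cast
    field_simp
  have h1 := omega_ne_zero h k
  have h2 := omega_ne_zero h r
  rw [e1, e2, e3, hz, eta_cusp, eta_cusp, eta_cusp, eta_cusp, hT1, hT2, e5, e5, hr2]
  have g1 := Complex.exp_ne_zero (π * I * h / (12 * k))
  have g2 := Complex.exp_ne_zero (π * I * h' / (12 * k))
  field_simp

/-- The multiplier that relates `η(2z) / η(z)²` to `η(z₁/2) / η(z₁)²` for odd `k`. -/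
lemma eta_quotient_odd (hk : 0 < k) (hpar : Even h') (hh : h * h' ≡ -1 [ZMOD k])
    (hw : 0 < w.re) (hz : z = (h + I * w) / k) (hz₁ : z₁ = (h' + I / w) / k) :
    (√2 : ℝ) * (ModularForm.eta (2 * z) / ModularForm.eta z ^ 2) =
      cexp (π * I * h' / (8 * k)) * (omega h k ^ 2 / omega (2 * h) k) * w ^ (1 / 2 : ℂ) *
        (ModularForm.eta (z₁ / 2) / ModularForm.eta z₁ ^ 2) := by
  obtain ⟨g, hg⟩ := hpar
  have hg2 : (h' : ℂ) = 2 * g := by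
    rw [hg]
    push_cast
    ring
  have hkC : (k : ℂ) ≠ 0 := by exact_mod_cast hk.ne'
  have h2w : 0 < (2 * w).re := by simpa using hw
  have hT1 := etaCusp_inv hk hh hw
  have hT2 := etaCusp_inv hk (h := 2 * h) (h' := g) (by
    have : 2 * h * g = h * h' := by rw [hg]; ring
    rwa [this]) h2w
  have e1 : 2 * z = ((2 * h : ℤ) + I * (2 * w)) / k := by
    rw [hz]
    push_cast
    field_simp
  have e2 : z₁ / 2 = (g + I * (2 * w)⁻¹) / k := by
    rw [hz₁, hg2, div_eq_mul_inv I w, mul_inv]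
    field_simp
  have e3 : z₁ = (h' + I * w⁻¹) / k := by rw [hz₁, div_eq_mul_inv I w]
  have hz1ne : etaCusp h k w ≠ 0 :=
    mul_ne_zero (eta_ne_zero' (im_cusp_pos hk hw h)) (Complex.exp_ne_zero _)
  have hz2ne : etaCusp (2 * h) k (2 * w) ≠ 0 :=
    mul_ne_zero (eta_ne_zero' (im_cusp_pos hk h2w _)) (Complex.exp_ne_zero _)
  have hs0 : w ^ (1 / 2 : ℂ) ≠ 0 := by simp [cpow_eq_zero_iff, ne_zero_of_re_pos hw]
  have hs2 : (2 * w) ^ (1 / 2 : ℂ) = (√2 : ℝ) * w ^ (1 / 2 : ℂ) := by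
    rw [mul_cpow_of_re_pos (by simp) hw]
    congr 1
    rw [Real.sqrt_eq_rpow, ofReal_cpow (by norm_num)]
    norm_num
  have h1 := omega_ne_zero h k
  have h2 := omega_ne_zero (2 * h) k
  rw [e1, e2, e3, hz, eta_cusp, eta_cusp, eta_cusp, eta_cusp, hT1, hT2, hs2]
  have g1 := Complex.exp_ne_zero (π * I * h / (12 * k))
  have g2 := Complex.exp_ne_zero (π * I * h' / (12 * k))
  have g3 : cexp (π * I * ((2 * h : ℤ) : ℂ) / (12 * k)) = cexp (π * I * h / (12 * k)) ^ 2 := by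
    rw [← Complex.exp_nat_mul]
    congr 1
    push_cast
    ring
  have g4 : cexp (π * I * h' / (8 * k)) * cexp (π * I * g / (12 * k)) =
      cexp (π * I * h' / (12 * k)) ^ 2 := by
    rw [← Complex.exp_nat_mul, ← Complex.exp_add, hg2]
    congr 1
    push_cast
    field_simp
    ring
  rw [g3]
  generalize cexp (π * I * h' / (8 * k)) = E₁ at g4 ⊢
  generalize cexp (π * I * g / (12 * k)) = E₂ at g4 ⊢
  generalize cexp (π * I * h' / (12 * k)) = E₃ at g2 g4 ⊢
  field_simp
  linear_combination (-(1 : ℂ)) * g4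

lemma tan_mul_sin_two_mul {x : ℂ} (hx : Complex.cos x ≠ 0) :
    Complex.tan x * Complex.sin (2 * x) = 2 * Complex.sin x ^ 2 := by
  rw [Complex.sin_two_mul]
  linear_combination 2 * Complex.sin x * Complex.tan_mul_cos hx

lemma cpow_half_eq_mul (hw : 0 < w.re) : w ^ (1 / 2 : ℂ) = w * w ^ (-(1 / 2) : ℂ) := by
  have hw0 := ne_zero_of_re_pos hw
  nth_rewrite 2 [← cpow_one w]
  rw [← cpow_add _ _ hw0]
  norm_num

/-- The transformation law for even `k`, before the residues are identified. -/
theorem rankO_eq_resSum_even {a c : ℕ} (hk : 0 < k) (hw : 0 < w.re) (hh : h * h' ≡ -1 [ZMOD k])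
    (hev : Even k) (hsin : Complex.sin (2 * π * (a / c : ℝ)) ≠ 0)
    (hne : ∀ n : ℤ, k * (a / c : ℝ) = n → 1 - cexp (resRatioLog (a / c) k h' w n) ≠ 0) {R R' : ℤ}
    (hR1 : R - 1 ≤ 2 * (k * (a / c : ℝ))) (hR2 : 2 * (k * (a / c : ℝ)) < R)
    (hR1' : R' - 1 < 2 * (k * (a / c : ℝ))) (hR2' : 2 * (k * (a / c : ℝ)) ≤ R')
    (hz : z = (h + I * w) / k) (hz₁ : z₁ = (h' + I / w) / k) :
    rankO a c z = Complex.tan (π * a / c) * (omega h k ^ 2 / omega h (k / 2)) * w ^ (-(1 / 2) : ℂ) *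
        (ModularForm.eta (2 * z₁) / ModularForm.eta z₁ ^ 2 *
          (∑' n : ℤ, resSum (a / c) k h' w R n + ∑' n : ℤ, resSum (a / c) k h' w R' n)) +
      4 * Complex.sin (π * a / c) ^ 2 * omega h k ^ 2 / (omega h (k / 2) * k) *
        w ^ (1 / 2 : ℂ) * ∑ ν ∈ Finset.range k, (-1 : ℂ) ^ ν * cexp (-(2 * π * I * h' * ν ^ 2 / k)) *
          mordellI a c k ν w := by
  have hw0 := ne_zero_of_re_pos hw
  have hzim : 0 < z.im := by rw [hz]; exact im_cusp_pos hk hw h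
  have hz1im : 0 < z₁.im := by
    rw [hz₁, div_eq_mul_inv I w]
    exact im_cusp_pos hk (inv_re_pos hw) h'
  have hsc : Complex.sin (2 * π * (a / c : ℝ)) =
      2 * Complex.sin (π * (a / c : ℝ)) * Complex.cos (π * (a / c : ℝ)) := by
    rw [mul_assoc 2, Complex.sin_two_mul]
  have hcos : Complex.cos (π * (a / c : ℝ)) ≠ 0 := fun h0 => hsin (by rw [hsc, h0, mul_zero])
  have hs : Complex.sin (π * (a / c : ℝ)) ≠ 0 := fun h0 => hsin (by rw [hsc, h0]; ring)
  have hα : ∀ n : ℤ, (a / c : ℝ) ≠ n := by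
    intro n hn
    apply hs
    rw [hn]
    push_cast
    rw [mul_comm]
    exact Complex.sin_int_mul_pi n
  have hang : (π : ℂ) * (a / c : ℝ) = π * a / c := by
    push_cast
    ring
  have h1 := rankO_eq_fineSum_mul (a : ℤ) c hzim (α := (a / c : ℝ)) (by push_cast; rfl) hs hcos
  have h2 := tsum_cotTerm_even hk hw hh hev hsin hα hne hR1 hR2 hR1' hR2' hz
  rw [fineSum_eq_eta hzim, eta_quotient_even hk hev hh hw hz hz₁, h2, tsum_thetaTerm_zero hev hw hz₁,
    altTheta_eq_eta hz1im, mul_assoc 2] at h1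
  have h3 := tan_mul_sin_two_mul hcos
  rw [hang] at h1 h3
  rw [h1]
  have h4 := cpow_half_eq_mul hw
  have n1 := eta_ne_zero' hz1im
  have n2 := eta_ne_zero' (two_mul_im_pos hz1im)
  have n3 := omega_ne_zero h (k / 2)
  have hkC : (k : ℂ) ≠ 0 := by exact_mod_cast hk.ne'
  generalize ∑ ν ∈ Finset.range k, (-1 : ℂ) ^ ν * cexp (-(2 * π * I * h' * ν ^ 2 / k)) *
          mordellI a c k ν w = M
  generalize ∑' n : ℤ, resSum (a / c) k h' w R n + ∑' n : ℤ, resSum (a / c) k h' w R' n = T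
  have e1 : Complex.tan (π * a / c) * (omega h k ^ 2 / omega h (k / 2)) * w ^ (-(1 / 2) : ℂ) *
        (ModularForm.eta (2 * z₁) / ModularForm.eta z₁ ^ 2 * T) =
      Complex.tan (π * a / c) * (omega h k ^ 2 / omega h (k / 2)) * w ^ (1 / 2 : ℂ) *
        (ModularForm.eta (2 * z₁) / ModularForm.eta z₁ ^ 2) * (1 / w * T) := by
    rw [h4]
    field_simp
  rw [e1]
  generalize w ^ (1 / 2 : ℂ) = s
  generalize 1 / w * T = T'
  generalize (π : ℂ) * a / c = x at h3 ⊢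
  field_simp
  linear_combination 2 * M * s * omega h k ^ 2 * ModularForm.eta z₁ ^ 2 * h3

/-- The transformation law for odd `k`, before the residues are identified. -/
theorem rankO_eq_resSum_odd {a c : ℕ} (hk : 0 < k) (hw : 0 < w.re) (hh : h * h' ≡ -1 [ZMOD k])
    (hodd : Odd k) (hpar : Even h') (hsin : Complex.sin (2 * π * (a / c : ℝ)) ≠ 0)
    (hne : ∀ n : ℤ, k * (a / c : ℝ) = n → 1 - cexp (resRatioLog (a / c) k h' w n) ≠ 0) {R R' : ℤ}
    (hR1 : R - 1 ≤ 2 * (k * (a / c : ℝ)) + 1 / 2) (hR2 : 2 * (k * (a / c : ℝ)) + 1 / 2 < R)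
    (hR1' : R' - 1 < 2 * (k * (a / c : ℝ)) + 1 / 2) (hR2' : 2 * (k * (a / c : ℝ)) + 1 / 2 ≤ R')
    (hz : z = (h + I * w) / k) (hz₁ : z₁ = (h' + I / w) / k) :
    rankO a c z = cexp (π * I * h' / (8 * k)) * Complex.tan (π * a / c) *
        (omega h k ^ 2 / ((√2 : ℝ) * omega (2 * h) k)) * w ^ (-(1 / 2) : ℂ) *
        (ModularForm.eta (z₁ / 2) / ModularForm.eta z₁ ^ 2 *
          (∑' n : ℤ, resSum (a / c) k h' w R n + ∑' n : ℤ, resSum (a / c) k h' w R' n)) +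
      4 * (√2 : ℝ) * Complex.sin (π * a / c) ^ 2 * omega h k ^ 2 / (omega (2 * h) k * k) *
        w ^ (1 / 2 : ℂ) * ∑ ν ∈ Finset.range k, cexp (-(π * I * h' / k * (2 * ν ^ 2 - ν))) *
          mordellI a c k ν w := by
  have hw0 := ne_zero_of_re_pos hw
  have hzim : 0 < z.im := by rw [hz]; exact im_cusp_pos hk hw h
  have hz1im : 0 < z₁.im := by
    rw [hz₁, div_eq_mul_inv I w]
    exact im_cusp_pos hk (inv_re_pos hw) h'
  have hsc : Complex.sin (2 * π * (a / c : ℝ)) =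
      2 * Complex.sin (π * (a / c : ℝ)) * Complex.cos (π * (a / c : ℝ)) := by
    rw [mul_assoc 2, Complex.sin_two_mul]
  have hcos : Complex.cos (π * (a / c : ℝ)) ≠ 0 := fun h0 => hsin (by rw [hsc, h0, mul_zero])
  have hs : Complex.sin (π * (a / c : ℝ)) ≠ 0 := fun h0 => hsin (by rw [hsc, h0]; ring)
  have hα : ∀ n : ℤ, (a / c : ℝ) ≠ n := by
    intro n hn
    apply hs
    rw [hn]
    push_cast
    rw [mul_comm]
    exact Complex.sin_int_mul_pi n
  have hang : (π : ℂ) * (a / c : ℝ) = π * a / c := by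
    push_cast
    ring
  have hsq : ((√2 : ℝ) : ℂ) ^ 2 = 2 := by
    rw [← ofReal_pow, Real.sq_sqrt (by norm_num)]
    norm_num
  have hsq0 : ((√2 : ℝ) : ℂ) ≠ 0 := by
    intro h0
    rw [h0] at hsq
    norm_num at hsq
  have h1 := rankO_eq_fineSum_mul (a : ℤ) c hzim (α := (a / c : ℝ)) (by push_cast; rfl) hs hcos
  have h2 := tsum_cotTerm_odd hk hw hh hodd (fun _ => hpar) hsin hα hne hR1 hR2 hR1' hR2' hz
  have hquot := eta_quotient_odd hk hpar hh hw hz hz₁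
  rw [fineSum_eq_eta hzim, h2, tsum_thetaTerm_half hodd hw hz₁,
    tsum_qpow_quarter hz1im, mul_assoc 2] at h1
  have h3 := tan_mul_sin_two_mul hcos
  rw [hang] at h1 h3
  rw [h1]
  have h4 := cpow_half_eq_mul hw
  have n1 := eta_ne_zero' hz1im
  have n2 := eta_ne_zero' (div_two_im_pos hz1im)
  have n3 := omega_ne_zero (2 * h) k
  have hkC : (k : ℂ) ≠ 0 := by exact_mod_cast hk.ne'
  generalize ∑ ν ∈ Finset.range k, cexp (-(π * I * h' / k * (2 * ν ^ 2 - ν))) *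
          mordellI a c k ν w = M
  generalize ∑' n : ℤ, resSum (a / c) k h' w R n + ∑' n : ℤ, resSum (a / c) k h' w R' n = T
  have e2 : ModularForm.eta (2 * z) / ModularForm.eta z ^ 2 = cexp (π * I * h' / (8 * k)) *
      (omega h k ^ 2 / ((√2 : ℝ) * omega (2 * h) k)) * w ^ (1 / 2 : ℂ) *
        (ModularForm.eta (z₁ / 2) / ModularForm.eta z₁ ^ 2) := by
    refine mul_left_cancel₀ hsq0 (hquot.trans ?_)
    field_simp
  rw [e2]
  have e1 : cexp (π * I * h' / (8 * k)) * Complex.tan (π * a / c) *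
        (omega h k ^ 2 / ((√2 : ℝ) * omega (2 * h) k)) * w ^ (-(1 / 2) : ℂ) *
        (ModularForm.eta (z₁ / 2) / ModularForm.eta z₁ ^ 2 * T) =
      cexp (π * I * h' / (8 * k)) * Complex.tan (π * a / c) *
        (omega h k ^ 2 / ((√2 : ℝ) * omega (2 * h) k)) * w ^ (1 / 2 : ℂ) *
        (ModularForm.eta (z₁ / 2) / ModularForm.eta z₁ ^ 2) * (1 / w * T) := by
    rw [h4]
    field_simp
  rw [e1, Complex.exp_neg]
  generalize w ^ (1 / 2 : ℂ) = s
  generalize 1 / w * T = T'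
  generalize (π : ℂ) * a / c = x at h3 ⊢
  have g2 := Complex.exp_ne_zero (π * I * h' / (8 * k))
  generalize cexp (π * I * h' / (8 * k)) = E at g2 ⊢
  generalize ((√2 : ℝ) : ℂ) = y at hsq hsq0 ⊢
  field_simp
  linear_combination 4 * M * s * omega h k ^ 2 * ModularForm.eta z₁ ^ 2 * h3 -
    4 * Complex.sin x ^ 2 * M * s * omega h k ^ 2 * ModularForm.eta z₁ ^ 2 * hsq

end

/-! ### The residues as Appell–Lerch sums -/

section
variable {α r σ : ℝ} {h h' : ℤ} {k : ℕ} {w z₁ : ℂ}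

lemma qpow_add (z r s : ℂ) : qpow z (r + s) = qpow z r * qpow z s := by
  rw [qpow, qpow, qpow, ← Complex.exp_add]
  congr 1
  ring

lemma resRatioLog_sub (hk : 0 < k) (hw : 0 < w.re) (hz₁ : z₁ = (h' + I / w) / k) {N : ℤ}
    (hr : k * α = N + r) (m : ℤ) : resRatioLog α k h' w (N - m) =
      -(2 * π * I * h' * α) + 2 * π * I * (m + r) * z₁ := by
  have hw0 := ne_zero_of_re_pos hw
  have hkC : (k : ℂ) ≠ 0 := by exact_mod_cast hk.ne'
  have hN : (N : ℂ) = k * α - r := by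
    have := congrArg (fun x : ℝ => (x : ℂ)) hr
    push_cast at this
    linear_combination -this
  rw [resRatioLog, hz₁]
  push_cast
  rw [hN]
  field_simp
  linear_combination (-(m : ℂ) - r) * I_mul_I

/-- In terms of the position `N - m` of the pole relative to the integer `N`, the sum of the residues
is a term of an Appell–Lerch sum in `q₁ = e^{2π i z₁}`. -/
lemma resSum_sub (hk : 0 < k) (hw : 0 < w.re) (hz₁ : z₁ = (h' + I / w) / k) {N R : ℤ}
    (hr : k * α = N + r) (hσ : R = 2 * N + freqShift k + σ) (m : ℤ) :
    resSum α k h' w R (N - m) =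
      (-1) ^ (((k : ℤ) + 1) * N) * cexp (2 * π * I * h' * α * (2 * r - k * α - σ)) *
      ((-1) ^ (((k : ℤ) + 1) * m) * qpow z₁ ((m + r) * (m + σ - r)) /
        (1 - cexp (-(2 * π * I * h' * α)) * qpow z₁ (m + r))) := by
  have hw0 := ne_zero_of_re_pos hw
  have hkC : (k : ℂ) ≠ 0 := by exact_mod_cast hk.ne'
  have hN : (N : ℂ) = k * α - r := by
    have := congrArg (fun x : ℝ => (x : ℂ)) hr
    push_cast at this
    linear_combination -this
  have hR : (R : ℂ) = 2 * N + freqShift k + σ := by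
    have := congrArg (fun x : ℝ => (x : ℂ)) hσ
    push_cast at this
    exact this
  have hX : cexp (resRatioLog α k h' w (N - m)) =
      cexp (-(2 * π * I * h' * α)) * qpow z₁ (m + r) := by
    rw [resRatioLog_sub hk hw hz₁ hr, Complex.exp_add, qpow]
  have hsgn : (-1 : ℂ) ^ (((k : ℤ) + 1) * (N - m)) =
      (-1) ^ (((k : ℤ) + 1) * N) * (-1) ^ (((k : ℤ) + 1) * m) := by
    rw [mul_sub, zpow_sub₀ (by norm_num), div_eq_mul_inv, ← inv_zpow]
    norm_num
  have hexp : cexp (-(2 * π * I * h' * ((N - m : ℤ) : ℂ) ^ 2 / k)) *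
      cexp (2 * π * (k * α - (N - m : ℤ) : ℝ) ^ 2 / (w * k) +
        (R - 2 * (N - m : ℤ) - freqShift k : ℝ) * resRatioLog α k h' w (N - m)) =
      cexp (2 * π * I * h' * α * (2 * r - k * α - σ)) * qpow z₁ ((m + r) * (m + σ - r)) := by
    rw [qpow, ← Complex.exp_add, ← Complex.exp_add, resRatioLog_sub hk hw hz₁ hr, hz₁]
    congr 1
    push_cast
    rw [hR, hN]
    field_simp
    linear_combination ((m : ℂ) + r) ^ 2 * I_mul_I
  rw [resSum, hX, gaussWeight, hsgn, mul_assoc ((-1 : ℂ) ^ (((k : ℤ) + 1) * N) *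
    (-1) ^ (((k : ℤ) + 1) * m)), hexp]
  ring

lemma tsum_resSum (hk : 0 < k) (hw : 0 < w.re) (hz₁ : z₁ = (h' + I / w) / k) {N R : ℤ}
    (hr : k * α = N + r) (hσ : R = 2 * N + freqShift k + σ) :
    ∑' n : ℤ, resSum α k h' w R n =
      (-1) ^ (((k : ℤ) + 1) * N) * cexp (2 * π * I * h' * α * (2 * r - k * α - σ)) *
      ∑' m : ℤ, (-1) ^ (((k : ℤ) + 1) * m) * qpow z₁ ((m + r) * (m + σ - r)) /
        (1 - cexp (-(2 * π * I * h' * α)) * qpow z₁ (m + r)) := by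
  rw [← (Equiv.subLeft N).tsum_eq, ← tsum_mul_left]
  exact tsum_congr fun m => resSum_sub hk hw hz₁ hr hσ m

/-- The two one-sided limits differ by the ratio of the geometric series; their sum carries the
factor `(1 + X) / (1 - X)`. -/
lemma tsum_resSum_add (hk : 0 < k) (hw : 0 < w.re) (hz₁ : z₁ = (h' + I / w) / k) {N R : ℤ}
    (hr : k * α = N + r) (hσ : R = 2 * N + freqShift k + σ) (hR : 2 * (k * α) + freqShift k = R) :
    ∑' n : ℤ, resSum α k h' w (R + 1) n + ∑' n : ℤ, resSum α k h' w R n =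
      (-1) ^ (((k : ℤ) + 1) * N) * cexp (2 * π * I * h' * α * (2 * r - k * α - σ)) *
      ∑' m : ℤ, (-1) ^ (((k : ℤ) + 1) * m) * qpow z₁ ((m + r) * (m + σ - r)) *
        (1 + cexp (-(2 * π * I * h' * α)) * qpow z₁ (m + r)) /
        (1 - cexp (-(2 * π * I * h' * α)) * qpow z₁ (m + r)) := by
  have s1 : Summable (resSum α k h' w (R + 1)) :=
    summable_resSum hk hw (by push_cast; linarith) (by push_cast; linarith)
  have s2 : Summable (resSum α k h' w R) := summable_resSum hk hw (by linarith) (by linarith)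
  rw [← s1.tsum_add s2, ← (Equiv.subLeft N).tsum_eq, ← tsum_mul_left]
  refine tsum_congr fun m => ?_
  simp only [Equiv.subLeft_apply]
  rw [resSum_sub hk hw hz₁ hr hσ, resSum_sub (σ := σ + 1) hk hw hz₁ hr (by push_cast; linarith)]
  have e1 : qpow z₁ ((m + r) * (m + ((σ + 1 : ℝ) : ℂ) - r)) =
      qpow z₁ ((m + r) * (m + σ - r)) * qpow z₁ (m + r) := by
    rw [← qpow_add]
    congr 1
    push_cast
    ring
  have e2 : cexp (2 * π * I * h' * α * (2 * r - k * α - ((σ + 1 : ℝ) : ℂ))) =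
      cexp (2 * π * I * h' * α * (2 * r - k * α - σ)) * cexp (-(2 * π * I * h' * α)) := by
    rw [← Complex.exp_add]
    congr 1
    push_cast
    ring
  rw [e1, e2]
  ring

lemma one_add_div_one_sub_eq_cot {y : ℂ} (hy : cexp (2 * π * I * y) ≠ 1) :
    (1 + cexp (2 * π * I * y)) / (1 - cexp (2 * π * I * y)) = I * Complex.cot (π * y) := by
  have h1 : 1 - cexp (2 * π * I * y) ≠ 0 := sub_ne_zero.2 hy.symm
  have h2 : cexp (2 * π * I * y) - 1 ≠ 0 := sub_ne_zero.2 hy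
  rw [Complex.cot_eq_exp_ratio, show 2 * I * (π * y) = 2 * π * I * y by ring]
  have h3 : I * (1 - cexp (2 * π * I * y)) ≠ 0 := mul_ne_zero I_ne_zero h1
  field_simp
  ring

lemma cexp_mul_qpow_ne_one {z : ℂ} (hz : 0 < z.im) {β : ℝ} (hβ : ∀ n : ℤ, β ≠ n) (m : ℤ) :
    cexp (2 * π * I * (m * z - β)) ≠ 1 := by
  intro h0
  obtain ⟨n, hn⟩ := Complex.exp_eq_one_iff.1 h0
  have h1 : m * z - β = n := by
    have : (2 * π * I : ℂ) ≠ 0 := by simp [Real.pi_ne_zero]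
    refine mul_left_cancel₀ this ?_
    rw [hn]
    ring
  have h2 := congrArg Complex.im h1
  simp only [sub_im, mul_im, intCast_re, intCast_im, ofReal_im, zero_mul, sub_zero, add_zero] at h2
  rcases mul_eq_zero.1 h2 with h3 | h3
  · have h4 : m = 0 := by exact_mod_cast h3
    rw [h4, Int.cast_zero, zero_mul, zero_sub] at h1
    apply hβ (-n)
    have h5 : (β : ℂ) = ((-n : ℤ) : ℂ) := by
      push_cast
      linear_combination -h1
    exact_mod_cast h5
  · exact hz.ne' h3

/-- The symmetrised Appell–Lerch sum that occurs when `c` divides the odd modulus `k`. -/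
lemma two_mul_tsum_appell {z : ℂ} (hz : 0 < z.im) {β : ℝ} (hβ : ∀ n : ℤ, β ≠ n)
    (hs : Summable fun m : ℤ => qpow z ((m : ℂ) ^ 2 + m / 2) /
      (1 - cexp (-(2 * π * I * β)) * qpow z m)) :
    cexp (-(π * I * β)) * (2 * ∑' m : ℤ, qpow z ((m : ℂ) ^ 2 + m / 2) /
        (1 - cexp (-(2 * π * I * β)) * qpow z m)) =
      -(2 * I * Complex.sin (π * β) * ∑' n : ℤ, (1 + qpow z n) * qpow z ((n : ℂ) ^ 2 + n / 2) /
        (1 - 2 * qpow z n * Complex.cos (2 * π * β) + qpow z (2 * n))) := by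
  set E := cexp (π * I * β) with hE
  have hE0 : E ≠ 0 := Complex.exp_ne_zero _
  have hE2 : cexp (2 * π * I * β) = E ^ 2 := by
    rw [hE, ← Complex.exp_nat_mul]
    congr 1
    push_cast
    ring
  have hcos : 2 * Complex.cos (2 * π * β) = E ^ 2 + (E ^ 2)⁻¹ := by
    rw [Complex.two_cos, ← hE2, ← Complex.exp_neg]
    congr 2 <;> ring
  have hsin : 2 * I * Complex.sin (π * β) = E - E⁻¹ := by
    rw [Complex.sin, hE, ← Complex.exp_neg, show -(π * β : ℂ) * I = -(π * I * β) by ring,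
      show (π * β : ℂ) * I = π * I * β by ring]
    linear_combination (cexp (-(π * I * β)) - cexp (π * I * β)) * I_mul_I
  have hEn : cexp (-(π * I * β)) = E⁻¹ := Complex.exp_neg _
  have hEn2 : cexp (-(2 * π * I * β)) = (E ^ 2)⁻¹ := by rw [Complex.exp_neg, hE2]
  simp only [hEn2] at hs
  simp only [hEn, hEn2]
  have hpos : ∀ m : ℤ, 1 - (E ^ 2)⁻¹ * qpow z m ≠ 0 := by
    intro m h0
    apply cexp_mul_qpow_ne_one hz hβ m
    rw [mul_sub, Complex.exp_sub, hE2, ← mul_assoc, div_eq_mul_inv, mul_comm]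
    exact (sub_eq_zero.1 h0).symm
  have hneg : ∀ m : ℤ, 1 - E ^ 2 * qpow z m ≠ 0 := by
    intro m h0
    apply cexp_mul_qpow_ne_one hz (β := -β) (fun n hn => hβ (-n) (by push_cast; linarith)) m
    rw [show 2 * π * I * (m * z - ((-β : ℝ) : ℂ)) = 2 * π * I * m * z + 2 * π * I * β by
      push_cast; ring, Complex.exp_add, hE2, mul_comm]
    exact (sub_eq_zero.1 h0).symm
  have hs' : Summable fun m : ℤ => qpow z ((((-m : ℤ) : ℂ)) ^ 2 + ((-m : ℤ) : ℂ) / 2) /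
      (1 - (E ^ 2)⁻¹ * qpow z ((-m : ℤ) : ℂ)) := (Equiv.neg ℤ).summable_iff.2 hs
  have hsymm : ∑' m : ℤ, qpow z ((m : ℂ) ^ 2 + m / 2) / (1 - (E ^ 2)⁻¹ * qpow z m) =
      ∑' m : ℤ, qpow z ((((-m : ℤ) : ℂ)) ^ 2 + ((-m : ℤ) : ℂ) / 2) /
        (1 - (E ^ 2)⁻¹ * qpow z ((-m : ℤ) : ℂ)) := ((Equiv.neg ℤ).tsum_eq _).symm
  -- the terms of index `m` and `-m` are added
  rw [two_mul]
  nth_rewrite 2 [hsymm]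
  rw [← hs.tsum_add hs', ← tsum_mul_left, ← tsum_mul_left, ← tsum_neg]
  refine tsum_congr fun m => ?_
  have hq0 : qpow z m ≠ 0 := Complex.exp_ne_zero _
  have e1 : qpow z (((-m : ℤ) : ℂ)) = (qpow z m)⁻¹ := by
    rw [qpow, qpow, ← Complex.exp_neg]
    congr 1
    push_cast
    ring
  have e2 : qpow z (((-m : ℤ) : ℂ) ^ 2 + ((-m : ℤ) : ℂ) / 2) =
      qpow z ((m : ℂ) ^ 2 + m / 2) * (qpow z m)⁻¹ := by
    rw [← e1, ← qpow_add]
    congr 1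
    push_cast
    ring
  have e3 : qpow z (2 * m) = qpow z m ^ 2 := by
    rw [sq, ← qpow_add]
    congr 1
    ring
  have e4 : 1 - 2 * qpow z m * Complex.cos (2 * π * β) + qpow z (2 * m) =
      (1 - (E ^ 2)⁻¹ * qpow z m) * (1 - E ^ 2 * qpow z m) := by
    rw [e3, show 2 * qpow z m * Complex.cos (2 * π * β) =
      qpow z m * (2 * Complex.cos (2 * π * β)) by ring, hcos]
    field_simp
    ring
  have e5 : 1 - (E ^ 2)⁻¹ * (qpow z m)⁻¹ = -((E ^ 2)⁻¹ * (qpow z m)⁻¹ * (1 - E ^ 2 * qpow z m)) := by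
    field_simp
    ring
  have hp := hpos m
  have hn := hneg m
  rw [e2, e1, e4, e5, hsin]
  generalize qpow z ((m : ℂ) ^ 2 + m / 2) = A
  generalize qpow z (m : ℂ) = Q at *
  have hp' : E ^ 2 - Q ≠ 0 := by
    intro h0
    apply hp
    rw [← sub_eq_zero.1 h0]
    field_simp
    simp
  field_simp
  ring

end

/-! ### Identification with the companions of the rank generating function -/

section
variable {a b c k : ℕ} {h' N R : ℤ} {w z₁ : ℂ} {r : ℝ}

lemma freqShift_of_even (hev : Even k) : freqShift k = 0 := by
  simp [freqShift, Nat.even_iff.1 hev]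

lemma freqShift_of_odd (hodd : Odd k) : freqShift k = 1 / 2 := by
  simp [freqShift, Nat.odd_iff.1 hodd]

lemma neg_one_zpow_of_even (hev : Even k) (n : ℤ) : (-1 : ℂ) ^ (((k : ℤ) + 1) * n) = (-1) ^ n := by
  have hodd : Odd ((k : ℤ) + 1) := by
    have : Even (k : ℤ) := by exact_mod_cast hev
    exact this.add_one
  rw [zpow_mul, hodd.neg_one_zpow]

lemma neg_one_zpow_of_odd (hodd : Odd k) (n : ℤ) : (-1 : ℂ) ^ (((k : ℤ) + 1) * n) = 1 := by
  have : Odd (k : ℤ) := by exact_mod_cast hodd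
  exact (this.add_one.mul_right n).neg_one_zpow

lemma ofReal_natCast_div (b c : ℕ) : ((b / c : ℝ) : ℂ) = (b : ℂ) / c := by push_cast; rfl

/-- Even `k`, no pole at a threshold: the residues form `𝒪(a h', b, c; q₁)`. -/
lemma compOabc_eq_tsum_resSum (hk : 0 < k) (hw : 0 < w.re) (hz₁ : z₁ = (h' + I / w) / k)
    (hev : Even k) (hr : k * (a / c : ℝ) = N + (b / c : ℝ))
    (hR : (R : ℝ) = 2 * N + (tIdx b c + 1) / 2) :
    ModularForm.eta (2 * z₁) / ModularForm.eta z₁ ^ 2 * ∑' n : ℤ, resSum (a / c) k h' w R n =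
      (-1) ^ N * cexp (-(2 * π * I * h' * (a / c) * (k * (a / c)))) *
        compOabc (a * h') b c z₁ := by
  rw [tsum_resSum hk hw hz₁ hr (σ := (tIdx b c + 1) / 2) (by rw [freqShift_of_even hev, hR]; ring),
    compOabc, neg_one_zpow_of_even hev, ofReal_natCast_div, ofReal_natCast_div]
  have e1 : ∀ m : ℤ, (-1 : ℂ) ^ (((k : ℤ) + 1) * m) *
      qpow z₁ ((m + (b : ℂ) / c) * (m + (((tIdx b c + 1) / 2 : ℝ) : ℂ) - (b : ℂ) / c)) /
        (1 - cexp (-(2 * π * I * h' * ((a : ℂ) / c))) * qpow z₁ (m + (b : ℂ) / c)) =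
      qpow z₁ (tIdx b c * b / (2 * c) + b / (2 * c) - (b : ℂ) ^ 2 / (c : ℂ) ^ 2) *
        ((-1 : ℂ) ^ m * qpow z₁ ((m : ℂ) / 2 * (2 * m + 1) + m * tIdx b c / 2) /
          (1 - cexp (-(2 * π * I * ((a * h' : ℤ) : ℂ) / c)) * qpow z₁ (m + b / c))) := by
    intro m
    rw [neg_one_zpow_of_even hev, ← mul_div_assoc (qpow z₁ _), mul_left_comm (qpow z₁ _), ← qpow_add]
    congr 2
    · congr 2
      push_cast
      ring
    · congr 3
      push_cast
      ring
  have e2 : cexp (2 * π * I * h' * ((a : ℂ) / c) *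
      (2 * ((b : ℂ) / c) - k * ((a : ℂ) / c) - (((tIdx b c + 1) / 2 : ℝ) : ℂ))) =
      cexp (-(2 * π * I * h' * (a / c) * (k * (a / c)))) *
        cexp (π * I * ((a * h' : ℤ) : ℂ) / c * (4 * b / c - 1 - tIdx b c)) := by
    rw [← Complex.exp_add]
    congr 1
    push_cast
    ring
  rw [tsum_congr e1, tsum_mul_left, e2]
  ring

/-- Odd `k`, no pole at a threshold: the residues form `𝒰(a h', b, c; q₁)`. -/
lemma compUabc_eq_tsum_resSum (hk : 0 < k) (hw : 0 < w.re) (hz₁ : z₁ = (h' + I / w) / k)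
    (hodd : Odd k) (hr : k * (a / c : ℝ) = N + (b / c : ℝ)) (hR : R = 2 * N + sIdx b c + 1) :
    ModularForm.eta (z₁ / 2) / ModularForm.eta z₁ ^ 2 * ∑' n : ℤ, resSum (a / c) k h' w R n =
      cexp (-(2 * π * I * h' * (a / c) * (k * (a / c)))) * compUabc (a * h') b c z₁ := by
  rw [tsum_resSum hk hw hz₁ hr (σ := sIdx b c + 1 / 2)
      (by rw [freqShift_of_odd hodd, hR]; push_cast; ring),
    compUabc, neg_one_zpow_of_odd hodd, ofReal_natCast_div, ofReal_natCast_div]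
  have e1 : ∀ m : ℤ, (-1 : ℂ) ^ (((k : ℤ) + 1) * m) *
      qpow z₁ ((m + (b : ℂ) / c) * (m + ((sIdx b c + 1 / 2 : ℝ) : ℂ) - (b : ℂ) / c)) /
        (1 - cexp (-(2 * π * I * h' * ((a : ℂ) / c))) * qpow z₁ (m + (b : ℂ) / c)) =
      qpow z₁ (sIdx b c * b / c + b / (2 * c) - (b : ℂ) ^ 2 / (c : ℂ) ^ 2) *
        (qpow z₁ ((m : ℂ) / 2 * (2 * m + 1) + m * sIdx b c) /
          (1 - cexp (-(2 * π * I * ((a * h' : ℤ) : ℂ) / c)) * qpow z₁ (m + b / c))) := by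
    intro m
    rw [neg_one_zpow_of_odd hodd, ← mul_div_assoc (qpow z₁ _), one_mul, ← qpow_add]
    congr 2
    · push_cast
      ring
    · congr 3
      push_cast
      ring
  have e2 : cexp (2 * π * I * h' * ((a : ℂ) / c) *
      (2 * ((b : ℂ) / c) - k * ((a : ℂ) / c) - ((sIdx b c + 1 / 2 : ℝ) : ℂ))) =
      cexp (-(2 * π * I * h' * (a / c) * (k * (a / c)))) *
        cexp (π * I * ((a * h' : ℤ) : ℂ) / c * (4 * b / c - 1 - 2 * sIdx b c)) := by
    rw [← Complex.exp_add]
    congr 1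
    push_cast
    ring
  rw [tsum_congr e1, tsum_mul_left, e2]
  ring

/-- Odd `k`, with `2 k a / c + 1 / 2` integral: the two one-sided limits form `𝒱(a h', b, c; q₁)`. -/
lemma compVabc_eq_tsum_resSum (hk : 0 < k) (hw : 0 < w.re) (hz₁ : z₁ = (h' + I / w) / k)
    (hodd : Odd k) (hr : k * (a / c : ℝ) = N + (b / c : ℝ)) (hR : R = 2 * N + sIdx b c + 1)
    (hkR : 2 * (k * (a / c : ℝ)) + 1 / 2 = R) :
    ModularForm.eta (z₁ / 2) / ModularForm.eta z₁ ^ 2 *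
        (∑' n : ℤ, resSum (a / c) k h' w (R + 1) n + ∑' n : ℤ, resSum (a / c) k h' w R n) =
      cexp (-(2 * π * I * h' * (a / c) * (k * (a / c)))) * compVabc (a * h') b c z₁ := by
  rw [tsum_resSum_add hk hw hz₁ hr (σ := sIdx b c + 1 / 2)
      (by rw [freqShift_of_odd hodd, hR]; push_cast; ring) (by rw [freqShift_of_odd hodd, hkR]),
    compVabc, neg_one_zpow_of_odd hodd, ofReal_natCast_div, ofReal_natCast_div]
  have e0 : ∀ m : ℤ, cexp (-(2 * π * I * h' * ((a : ℂ) / c))) * qpow z₁ (m + (b : ℂ) / c) =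
      cexp (-(2 * π * I * ((a * h' : ℤ) : ℂ) / c)) * qpow z₁ (m + b / c) := by
    intro m
    congr 2
    push_cast
    ring
  have e1 : ∀ m : ℤ, (-1 : ℂ) ^ (((k : ℤ) + 1) * m) *
      qpow z₁ ((m + (b : ℂ) / c) * (m + ((sIdx b c + 1 / 2 : ℝ) : ℂ) - (b : ℂ) / c)) *
        (1 + cexp (-(2 * π * I * h' * ((a : ℂ) / c))) * qpow z₁ (m + (b : ℂ) / c)) /
        (1 - cexp (-(2 * π * I * h' * ((a : ℂ) / c))) * qpow z₁ (m + (b : ℂ) / c)) =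
      qpow z₁ (sIdx b c * b / c + b / (2 * c) - (b : ℂ) ^ 2 / (c : ℂ) ^ 2) *
        (qpow z₁ ((m : ℂ) / 2 * (2 * m + 1) + m * sIdx b c) *
          (1 + cexp (-(2 * π * I * ((a * h' : ℤ) : ℂ) / c)) * qpow z₁ (m + b / c)) /
          (1 - cexp (-(2 * π * I * ((a * h' : ℤ) : ℂ) / c)) * qpow z₁ (m + b / c))) := by
    intro m
    rw [neg_one_zpow_of_odd hodd, e0, ← mul_div_assoc, one_mul, ← mul_assoc, ← qpow_add]
    congr 3
    push_cast
    ring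
  have e2 : cexp (2 * π * I * h' * ((a : ℂ) / c) *
      (2 * ((b : ℂ) / c) - k * ((a : ℂ) / c) - ((sIdx b c + 1 / 2 : ℝ) : ℂ))) =
      cexp (-(2 * π * I * h' * (a / c) * (k * (a / c)))) *
        cexp (π * I * ((a * h' : ℤ) : ℂ) / c * (4 * b / c - 1 - 2 * sIdx b c)) := by
    rw [← Complex.exp_add]
    congr 1
    push_cast
    ring
  rw [tsum_congr e1, tsum_mul_left, e2]
  ring

/-- Even `k`, with `k a / c` half an odd integer: the two one-sided limits form `𝒱(a h' / c; q₁)`. -/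
lemma compV_eq_tsum_resSum (hk : 0 < k) (hw : 0 < w.re) (hz₁ : z₁ = (h' + I / w) / k)
    (hev : Even k) (hr : k * (a / c : ℝ) = N + 1 / 2) (hR : R = 2 * N + 1) :
    ModularForm.eta (2 * z₁) / ModularForm.eta z₁ ^ 2 *
        (∑' n : ℤ, resSum (a / c) k h' w (R + 1) n + ∑' n : ℤ, resSum (a / c) k h' w R n) =
      (-1) ^ N * cexp (-(2 * π * I * h' * (a / c) * (k * (a / c)))) * compV (a * h') c z₁ := by
  rw [tsum_resSum_add hk hw hz₁ hr (σ := 1) (by rw [freqShift_of_even hev, hR]; push_cast; ring)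
      (by rw [freqShift_of_even hev, hR, hr]; push_cast; ring),
    compV, neg_one_zpow_of_even hev, ofReal_natCast_div]
  have e0 : ∀ m : ℤ, cexp (-(2 * π * I * h' * ((a : ℂ) / c))) * qpow z₁ (m + ((1 / 2 : ℝ) : ℂ)) =
      cexp (-(2 * π * I * ((a * h' : ℤ) : ℂ) / c)) * qpow z₁ (m + 1 / 2) := by
    intro m
    congr 2
    · push_cast
      ring
    · push_cast
      ring
  have e1 : ∀ m : ℤ, (-1 : ℂ) ^ (((k : ℤ) + 1) * m) *
      qpow z₁ ((m + ((1 / 2 : ℝ) : ℂ)) * (m + ((1 : ℝ) : ℂ) - ((1 / 2 : ℝ) : ℂ))) *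
        (1 + cexp (-(2 * π * I * h' * ((a : ℂ) / c))) * qpow z₁ (m + ((1 / 2 : ℝ) : ℂ))) /
        (1 - cexp (-(2 * π * I * h' * ((a : ℂ) / c))) * qpow z₁ (m + ((1 / 2 : ℝ) : ℂ))) =
      qpow z₁ (1 / 4) * ((-1 : ℂ) ^ m * qpow z₁ ((m : ℂ) ^ 2 + m) *
        (1 + cexp (-(2 * π * I * ((a * h' : ℤ) : ℂ) / c)) * qpow z₁ (m + 1 / 2)) /
        (1 - cexp (-(2 * π * I * ((a * h' : ℤ) : ℂ) / c)) * qpow z₁ (m + 1 / 2))) := by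
    intro m
    rw [neg_one_zpow_of_even hev, e0, ← mul_div_assoc, ← mul_assoc, mul_left_comm, ← qpow_add]
    congr 4
    push_cast
    ring
  have e2 : cexp (2 * π * I * h' * ((a : ℂ) / c) *
      (2 * ((1 / 2 : ℝ) : ℂ) - k * ((a : ℂ) / c) - ((1 : ℝ) : ℂ))) =
      cexp (-(2 * π * I * h' * (a / c) * (k * (a / c)))) := by
    congr 1
    push_cast
    ring
  rw [tsum_congr e1, tsum_mul_left, e2]
  ring

lemma im_dual_pos (hk : 0 < k) (hw : 0 < w.re) (hz₁ : z₁ = (h' + I / w) / k) : 0 < z₁.im := by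
  rw [hz₁, div_eq_mul_inv I w]
  exact im_cusp_pos hk (inv_re_pos hw) h'

/-- Even `k` and integral `k a / c`: the two one-sided limits form a cotangent sum in `z₁`, that is
the rank generating function again. -/
lemma rankO_eq_tsum_resSum (hk : 0 < k) (hw : 0 < w.re) (hz₁ : z₁ = (h' + I / w) / k)
    (hev : Even k) (hr : k * (a / c : ℝ) = N) (hR : R = 2 * N)
    (hsin : Complex.sin (π * (h' * (a / c) : ℝ)) ≠ 0)
    (hcos : Complex.cos (π * (h' * (a / c) : ℝ)) ≠ 0) :
    ModularForm.eta (2 * z₁) / ModularForm.eta z₁ ^ 2 *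
        (∑' n : ℤ, resSum (a / c) k h' w (R + 1) n + ∑' n : ℤ, resSum (a / c) k h' w R n) =
      -((-1) ^ N * I * cexp (-(2 * π * I * h' * (a / c) * (k * (a / c)))) *
        Complex.cot (π * a * h' / c) * rankO (a * h') c z₁) := by
  have hz1im := im_dual_pos hk hw hz₁
  set β : ℝ := h' * (a / c) with hβ
  have hβn : ∀ n : ℤ, β ≠ n := by
    intro n hn
    apply hsin
    rw [hn, ofReal_intCast, mul_comm]
    exact Complex.sin_int_mul_pi n
  have hang : (π : ℂ) * a * h' / c = π * β := by
    rw [hβ]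
    push_cast
    ring
  rw [tsum_resSum_add (r := 0) (σ := 0) hk hw hz₁ (by rw [hr, add_zero])
      (by rw [freqShift_of_even hev, hR]; push_cast; ring)
      (by rw [freqShift_of_even hev, hR, hr]; push_cast; ring), neg_one_zpow_of_even hev,
    rankO_eq_fineSum_mul (a * h') c hz1im (α := β) (by rw [hβ]; push_cast; ring) hsin hcos,
    fineSum_eq_eta hz1im, hang]
  have e1 : ∀ m : ℤ, (-1 : ℂ) ^ (((k : ℤ) + 1) * m) *
      qpow z₁ ((m + ((0 : ℝ) : ℂ)) * (m + ((0 : ℝ) : ℂ) - ((0 : ℝ) : ℂ))) *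
        (1 + cexp (-(2 * π * I * h' * ((a / c : ℝ) : ℂ))) * qpow z₁ (m + ((0 : ℝ) : ℂ))) /
        (1 - cexp (-(2 * π * I * h' * ((a / c : ℝ) : ℂ))) * qpow z₁ (m + ((0 : ℝ) : ℂ))) =
      -I * cotTerm β z₁ m := by
    intro m
    have e0 : cexp (-(2 * π * I * h' * ((a / c : ℝ) : ℂ))) * qpow z₁ (m + ((0 : ℝ) : ℂ)) =
        cexp (2 * π * I * (m * z₁ - β)) := by
      rw [qpow, ← Complex.exp_add, hβ]
      congr 1
      push_cast
      ring
    rw [e0, neg_one_zpow_of_even hev, mul_div_assoc,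
      one_add_div_one_sub_eq_cot (cexp_mul_qpow_ne_one hz1im hβn m), cotTerm,
      show (π : ℂ) * (m * z₁ - β) = -(π * (β - m * z₁)) by ring, cot_neg', ofReal_zero, add_zero,
      sub_zero, sq]
    ring
  have e2 : cexp (2 * π * I * h' * ((a / c : ℝ) : ℂ) *
      (2 * ((0 : ℝ) : ℂ) - k * ((a / c : ℝ) : ℂ) - ((0 : ℝ) : ℂ))) =
      cexp (-(2 * π * I * h' * (a / c) * (k * (a / c)))) := by
    congr 1
    push_cast
    ring
  have e3 : Complex.cot (π * β) * Complex.tan (π * β) = 1 := by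
    rw [Complex.cot_eq_cos_div_sin, Complex.tan_eq_sin_div_cos]
    field_simp
  rw [tsum_congr e1, tsum_mul_left, e2]
  linear_combination (-1 : ℂ) ^ N * (-I) * cexp (-(2 * π * I * h' * (a / c) * (k * (a / c)))) *
    (ModularForm.eta (2 * z₁) / ModularForm.eta z₁ ^ 2) * (∑' m : ℤ, cotTerm β z₁ m) * (-e3)

/-- Odd `k` and integral `k a / c`: the residues form `𝒰(a h' / c; q₁)`. -/
lemma compU_eq_tsum_resSum (hk : 0 < k) (hw : 0 < w.re) (hz₁ : z₁ = (h' + I / w) / k)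
    (hodd : Odd k) (hr : k * (a / c : ℝ) = N) (hR : R = 2 * N + 1)
    (hβ : ∀ n : ℤ, (h' * (a / c) : ℝ) ≠ n) :
    ModularForm.eta (z₁ / 2) / ModularForm.eta z₁ ^ 2 * (2 * ∑' n : ℤ, resSum (a / c) k h' w R n) =
      -(2 * I * cexp (-(2 * π * I * h' * (a / c) * (k * (a / c)))) * compU (a * h') c z₁) := by
  have hz1im := im_dual_pos hk hw hz₁
  have hsum : Summable (resSum (a / c) k h' w R) := by
    refine summable_resSum hk hw ?_ ?_ <;> rw [freqShift_of_odd hodd, hR, hr] <;> push_cast <;>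
      linarith
  have e0 : ∀ m : ℤ, resSum (a / c) k h' w R (N - m) =
      cexp (-(2 * π * I * h' * (a / c) * (k * (a / c)))) *
        cexp (-(π * I * ((h' * (a / c) : ℝ) : ℂ))) * (qpow z₁ ((m : ℂ) ^ 2 + m / 2) /
        (1 - cexp (-(2 * π * I * ((h' * (a / c) : ℝ) : ℂ))) * qpow z₁ m)) := by
    intro m
    rw [resSum_sub hk hw hz₁ (r := 0) (σ := 1 / 2) (by rw [hr, add_zero])
      (by rw [freqShift_of_odd hodd, hR]; push_cast; ring), neg_one_zpow_of_odd hodd,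
      neg_one_zpow_of_odd hodd, one_mul, one_mul, ← Complex.exp_add]
    congr 2
    · push_cast
      ring
    · congr 1
      push_cast
      ring
    · congr 3
      · push_cast
        ring
      · push_cast
        ring
  have hs := (Equiv.subLeft N).summable_iff.2 hsum
  have hs' := (hs.congr fun m => (e0 m)).mul_left
    (cexp (-(2 * π * I * h' * (a / c) * (k * (a / c)))) *
        cexp (-(π * I * ((h' * (a / c) : ℝ) : ℂ))))⁻¹
  have hne : cexp (-(2 * π * I * h' * (a / c) * (k * (a / c)))) *
        cexp (-(π * I * ((h' * (a / c) : ℝ) : ℂ))) ≠ 0 :=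
    mul_ne_zero (Complex.exp_ne_zero _) (Complex.exp_ne_zero _)
  simp only [inv_mul_cancel_left₀ hne] at hs'
  have h1 := two_mul_tsum_appell hz1im hβ hs'
  rw [← (Equiv.subLeft N).tsum_eq]
  simp only [Equiv.subLeft_apply, e0]
  rw [tsum_mul_left, compU]
  have e1 : (π : ℂ) * ((a * h' : ℤ) : ℂ) / c = π * ((h' * (a / c) : ℝ) : ℂ) := by
    push_cast
    ring
  have e2 : 2 * (π : ℂ) * ((a * h' : ℤ) : ℂ) / c = 2 * π * ((h' * (a / c) : ℝ) : ℂ) := by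
    push_cast
    ring
  rw [e1, e2]
  linear_combination ModularForm.eta (z₁ / 2) / ModularForm.eta z₁ ^ 2 *
    cexp (-(2 * π * I * h' * (a / c) * (k * (a / c)))) * h1

end

/-! ### Arithmetic of the cusp -/

lemma two_mul_div_ne_int {n : ℤ} {c : ℕ} (hc : 2 < c) (hn : IsCoprime n (c : ℤ)) (m : ℤ) :
    (2 * (n / c) : ℝ) ≠ m := by
  intro h0
  have hc0 : (c : ℝ) ≠ 0 := by
    have : c ≠ 0 := by omega
    exact_mod_cast this
  rw [← mul_div_assoc, div_eq_iff hc0] at h0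
  have h1 : 2 * n = m * c := by exact_mod_cast h0
  have h2 : (c : ℤ) ∣ 2 := hn.symm.dvd_of_dvd_mul_right ⟨m, by rw [h1, mul_comm]⟩
  have := Int.le_of_dvd (by norm_num) h2
  omega

lemma div_ne_int {n : ℤ} {c : ℕ} (hc : 2 < c) (hn : IsCoprime n (c : ℤ)) (m : ℤ) :
    (n / c : ℝ) ≠ m := by
  intro h0
  apply two_mul_div_ne_int hc hn (2 * m)
  rw [h0]
  push_cast
  ring

lemma sin_two_mul_ne_zero {n : ℤ} {c : ℕ} (hc : 2 < c) (hn : IsCoprime n (c : ℤ)) :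
    Complex.sin (2 * π * (n / c : ℝ)) ≠ 0 := by
  intro h0
  rw [mul_assoc, mul_left_comm] at h0
  obtain ⟨m, hm⟩ := sin_pi_mul_eq_zero h0
  apply two_mul_div_ne_int hc hn m
  exact_mod_cast hm

section
variable {a c k : ℕ} {h h' : ℤ} {w : ℂ}

lemma isCoprime_mul_inverse (hcop : Nat.Coprime a c) (hck : c ∣ k) (hh : h * h' ≡ -1 [ZMOD k]) :
    IsCoprime (a * h') (c : ℤ) := by
  refine IsCoprime.mul_left (Nat.isCoprime_iff_coprime.2 hcop) ?_
  obtain ⟨m, hm⟩ := (modEq_of_dvd_modulus hck hh).dvd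
  exact ⟨-h, -m, by linear_combination hm⟩

/-- If `k a / c` is an integer then `c` divides `k`, and the ratio of the geometric series is
`e^{-2π i a h' / c}` at the pole that lies on the real line. It is not `1`, as `a h'` is prime to `c`. -/
lemma one_sub_cexp_resRatioLog_ne_zero_of_coprime (hk : 0 < k) (hc : 2 < c)
    (hcop : Nat.Coprime a c) (hh : h * h' ≡ -1 [ZMOD k]) {n : ℤ} (hn : k * (a / c : ℝ) = n) :
    1 - cexp (resRatioLog (a / c) k h' w n) ≠ 0 := by
  have hc0 : (c : ℝ) ≠ 0 := by
    have : c ≠ 0 := by omega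
    exact_mod_cast this
  have hkC : (k : ℂ) ≠ 0 := by exact_mod_cast hk.ne'
  have hck : c ∣ k := by
    have h1 : (k * a : ℝ) = n * c := by
      rw [← hn]
      field_simp
    have h2 : (k * a : ℤ) = n * c := by exact_mod_cast h1
    have h3 : (c : ℤ) ∣ ((k * a : ℕ) : ℤ) := ⟨n, by push_cast; rw [h2, mul_comm]⟩
    exact hcop.symm.dvd_of_dvd_mul_right (Int.natCast_dvd_natCast.1 h3)
  intro h0
  obtain ⟨m, hm⟩ := Complex.exp_eq_one_iff.1 (sub_eq_zero.1 h0).symm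
  have hnC : (n : ℂ) = k * (a / c) := by
    have := congrArg (fun x : ℝ => (x : ℂ)) hn
    push_cast at this
    exact this.symm
  rw [resRatioLog, hn, sub_self, ofReal_zero, mul_zero, zero_div, sub_zero, hnC] at hm
  have h2 : (2 * π * I : ℂ) ≠ 0 := by simp [Real.pi_ne_zero]
  have h3 : (h' : ℂ) * (a / c) = -m := by
    refine mul_left_cancel₀ h2 ?_
    have : 2 * π * I * (h' * ((a : ℂ) / c)) = 2 * π * I * h' * (k * (a / c)) / k := by
      field_simp
    rw [this]
    linear_combination -hm
  apply div_ne_int hc (isCoprime_mul_inverse hcop hck hh) (-m)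
  have h4 : ((((a * h' : ℤ) : ℝ) / c : ℝ) : ℂ) = ((-m : ℤ) : ℂ) := by
    push_cast
    rw [← h3]
    ring
  exact_mod_cast h4

end

/-! ### The shifts `s(b, c)` and `t(b, c)` -/

/-- `t(b, c) = 2T - 1` where `T` is the least integer above `2b/c`. -/
lemma exists_tIdx_eq {b c : ℕ} (hb0 : 0 < b) (hbc : b < c) (hne : 2 * b ≠ c) :
    ∃ T : ℤ, (tIdx b c : ℝ) = 2 * T - 1 ∧ T - 1 < 2 * (b / c : ℝ) ∧ 2 * (b / c : ℝ) < T := by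
  have hb : (0 : ℝ) < b := by exact_mod_cast hb0
  have hc : (b : ℝ) < c := by exact_mod_cast hbc
  have hc0 : (0 : ℝ) < c := hb.trans hc
  unfold tIdx
  split_ifs with h2
  · have h3 : (2 * b : ℝ) < c := by exact_mod_cast h2
    refine ⟨1, by norm_num, ?_, ?_⟩
    · push_cast
      rw [sub_self]
      positivity
    · rw [← mul_div_assoc, div_lt_iff₀ hc0]
      push_cast
      linarith
  · have h3 : (c : ℝ) < 2 * b := by
      have : c < 2 * b := by omega
      exact_mod_cast this
    refine ⟨2, by norm_num, ?_, ?_⟩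
    · rw [← mul_div_assoc, lt_div_iff₀ hc0]
      push_cast
      linarith
    · rw [← mul_div_assoc, div_lt_iff₀ hc0]
      push_cast
      linarith

/-- Off its jumps, `s(b, c)` is the integer part of `2b/c + 1/2`. -/
lemma sIdx_lt {b c : ℕ} (hb0 : 0 < b) (hbc : b < c) (hne1 : 4 * b ≠ c) (hne3 : 4 * b ≠ 3 * c) :
    (sIdx b c : ℝ) < 2 * (b / c : ℝ) + 1 / 2 ∧ 2 * (b / c : ℝ) + 1 / 2 < sIdx b c + 1 := by
  have hb : (0 : ℝ) < b := by exact_mod_cast hb0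
  have hc : (b : ℝ) < c := by exact_mod_cast hbc
  have hc0 : (0 : ℝ) < c := hb.trans hc
  have hx : (b / c : ℝ) * c = b := div_mul_cancel₀ _ hc0.ne'
  unfold sIdx
  split_ifs with h4 h5
  · have h6 : (4 * b : ℝ) < c := by exact_mod_cast lt_of_le_of_ne h4 hne1
    constructor <;> push_cast <;> nlinarith
  · have h6 : (4 * b : ℝ) < 3 * c := by exact_mod_cast lt_of_le_of_ne h5 hne3
    have h7 : (c : ℝ) < 4 * b := by exact_mod_cast not_le.1 h4
    constructor <;> push_cast <;> nlinarith
  · have h6 : (3 * c : ℝ) < 4 * b := by exact_mod_cast not_le.1 h5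
    constructor <;> push_cast <;> nlinarith

/-- At a jump, `s(b, c)` is the lower of the two neighbouring values. -/
lemma sIdx_eq_of_jump {b c : ℕ} (hc : 0 < c) (h : 4 * b = c ∨ 4 * b = 3 * c) :
    (sIdx b c : ℝ) = 2 * (b / c : ℝ) - 1 / 2 := by
  have hc0 : (0 : ℝ) < c := by exact_mod_cast hc
  unfold sIdx
  rcases h with h | h
  · rw [if_pos h.le]
    have : (4 * b : ℝ) = c := by exact_mod_cast h
    field_simp
    push_cast
    linarith
  · rw [if_neg (by omega), if_pos h.le]
    have : (4 * b : ℝ) = 3 * c := by exact_mod_cast h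
    field_simp
    push_cast
    linarith

end OverpartitionRank

end

/-! ### The transformation law -/

open OverpartitionRank in
theorem theorem2p1 (a c k : ℕ) (h h' : ℤ) (w : ℂ) (k₁ c₁ l : ℕ) (z z₁ : ℂ)
    (hc : 2 < c) (ha : 0 < a) (hac : a < c) (hcop : Nat.Coprime a c) (hk : 0 < k)
    (hh' : h * h' ≡ -1 [ZMOD k]) (hpar : Odd k → Even h')
    (hw : 0 < w.re)
    (hk₁ : k₁ = k / Nat.gcd k c) (hc₁ : c₁ = c / Nat.gcd c k)
    (hl : l < c₁) (hlc : l ≡ a * k₁ [MOD c₁])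
    (hz : z = (h + I * w) / k) (hz₁ : z₁ = (h' + I / w) / k) :
    -- the principal values defining the Mordell type integrals exist
    (∀ ν : ℤ,
      (∀ ε : ℝ, 0 < ε → IntegrableOn (mordellIntegrand a c k ν w) {x : ℝ | ε < |x|}) ∧
      Tendsto (fun ε : ℝ => ∫ x in {x : ℝ | ε < |x|}, mordellIntegrand a c k ν w x)
        (𝓝[>] 0) (𝓝 (mordellI a c k ν w))) ∧
    -- the transformation law
    (c ∣ k → Even k →
      rankO a c z =
        -((-1 : ℂ) ^ k₁ * I * cexp (-(2 * π * I * a ^ 2 * h' * k₁ / c)) *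
            Complex.tan (π * a / c) * Complex.cot (π * a * h' / c) *
            (omega h k ^ 2 / omega h (k / 2)) * w ^ (-(1 / 2) : ℂ) * rankO (a * h') c z₁)
        + 4 * Complex.sin (π * a / c) ^ 2 * omega h k ^ 2 / (omega h (k / 2) * k) *
            w ^ (1 / 2 : ℂ) *
            ∑ ν ∈ Finset.range k, (-1 : ℂ) ^ ν * cexp (-(2 * π * I * h' * ν ^ 2 / k)) *
              mordellI a c k ν w) ∧
    (c ∣ k → Odd k →
      rankO a c z =
        -((√2 : ℝ) * I * cexp (π * I * h' / (8 * k) - 2 * π * I * a ^ 2 * h' * k₁ / c) *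
            Complex.tan (π * a / c) *
            (omega h k ^ 2 / omega (2 * h) k) * w ^ (-(1 / 2) : ℂ) * compU (a * h') c z₁)
        + 4 * (√2 : ℝ) * Complex.sin (π * a / c) ^ 2 * omega h k ^ 2 / (omega (2 * h) k * k) *
            w ^ (1 / 2 : ℂ) *
            ∑ ν ∈ Finset.range k, cexp (-(π * I * h' / k * (2 * ν ^ 2 - ν))) *
              mordellI a c k ν w) ∧
    (¬ c ∣ k → Even k → c₁ ≠ 2 →
      rankO a c z =
        2 * cexp (-(2 * π * I * a ^ 2 * h' * k₁ / (c₁ * c))) *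
            Complex.tan (π * a / c) *
            (omega h k ^ 2 / omega h (k / 2)) * w ^ (-(1 / 2) : ℂ) *
            (-1 : ℂ) ^ (((l : ℤ) - a * k₁) / c₁) * compOabc (a * h') (l * c / c₁) c z₁
        + 4 * Complex.sin (π * a / c) ^ 2 * omega h k ^ 2 / (omega h (k / 2) * k) *
            w ^ (1 / 2 : ℂ) *
            ∑ ν ∈ Finset.range k, (-1 : ℂ) ^ ν * cexp (-(2 * π * I * h' * ν ^ 2 / k)) *
              mordellI a c k ν w) ∧
    (¬ c ∣ k → Even k → c₁ = 2 →
      rankO a c z =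
        cexp (-(π * I * a ^ 2 * h' * k₁ / c)) *
            Complex.tan (π * a / c) *
            (omega h k ^ 2 / omega h (k / 2)) * w ^ (-(1 / 2) : ℂ) *
            (-1 : ℂ) ^ (((l : ℤ) - a * k₁) / c₁) * compV (a * h') c z₁
        + 4 * Complex.sin (π * a / c) ^ 2 * omega h k ^ 2 / (omega h (k / 2) * k) *
            w ^ (1 / 2 : ℂ) *
            ∑ ν ∈ Finset.range k, (-1 : ℂ) ^ ν * cexp (-(2 * π * I * h' * ν ^ 2 / k)) *
              mordellI a c k ν w) ∧
    (¬ c ∣ k → Odd k → c₁ ≠ 4 →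
      rankO a c z =
        (√2 : ℝ) * cexp (π * I * h' / (8 * k) - 2 * π * I * h' * a ^ 2 * k₁ / (c * c₁)) *
            Complex.tan (π * a / c) *
            (omega h k ^ 2 / omega (2 * h) k) * w ^ (-(1 / 2) : ℂ) *
            compUabc (a * h') (l * c / c₁) c z₁
        + 4 * (√2 : ℝ) * Complex.sin (π * a / c) ^ 2 * omega h k ^ 2 / (omega (2 * h) k * k) *
            w ^ (1 / 2 : ℂ) *
            ∑ ν ∈ Finset.range k, cexp (-(π * I * h' / k * (2 * ν ^ 2 - ν))) *
              mordellI a c k ν w) ∧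
    (¬ c ∣ k → Odd k → c₁ = 4 →
      rankO a c z =
        cexp (π * I * h' / (8 * k) - 2 * π * I * h' * a ^ 2 * k₁ / (c * c₁)) *
            Complex.tan (π * a / c) *
            (omega h k ^ 2 / ((√2 : ℝ) * omega (2 * h) k)) * w ^ (-(1 / 2) : ℂ) *
            compVabc (a * h') (l * c / c₁) c z₁
        + 4 * (√2 : ℝ) * Complex.sin (π * a / c) ^ 2 * omega h k ^ 2 / (omega (2 * h) k * k) *
            w ^ (1 / 2 : ℂ) *
            ∑ ν ∈ Finset.range k, cexp (-(π * I * h' / k * (2 * ν ^ 2 - ν))) *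
              mordellI a c k ν w) := by
  have hc0 : (c : ℝ) ≠ 0 := by
    have : c ≠ 0 := by omega
    exact_mod_cast this
  have hacI : IsCoprime (a : ℤ) (c : ℤ) := Nat.isCoprime_iff_coprime.2 hcop
  have hsin : Complex.sin (2 * π * (a / c : ℝ)) ≠ 0 := by
    simpa using sin_two_mul_ne_zero hc hacI
  -- no geometric series of residues has ratio `1`
  have hne : ∀ n : ℤ, k * (a / c : ℝ) = n → 1 - cexp (resRatioLog (a / c) k h' w n) ≠ 0 :=
    fun n hn => one_sub_cexp_resRatioLog_ne_zero_of_coprime hk hc hcop hh' hn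
  obtain ⟨g, hg⟩ : ∃ g, g = Nat.gcd k c := ⟨_, rfl⟩
  have hg0 : 0 < g := hg ▸ Nat.gcd_pos_of_pos_left c hk
  have hkg : k = k₁ * g := by
    rw [hk₁, hg]
    exact (Nat.div_mul_cancel (Nat.gcd_dvd_left k c)).symm
  have hcg : c = c₁ * g := by
    rw [hc₁, hg, Nat.gcd_comm k c]
    exact (Nat.div_mul_cancel (Nat.gcd_dvd_left c k)).symm
  have hkc : Nat.Coprime k₁ c₁ := by
    rw [hk₁, hc₁, Nat.gcd_comm c k]
    exact Nat.coprime_div_gcd_div_gcd (Nat.gcd_pos_of_pos_left c hk)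
  have hc1 : 0 < c₁ := by omega
  have hgR : (g : ℝ) ≠ 0 := by exact_mod_cast hg0.ne'
  have hc1R : (c₁ : ℝ) ≠ 0 := by exact_mod_cast hc1.ne'
  have hc1R' : (0 : ℝ) < c₁ := by exact_mod_cast hc1
  have hc1C : (c₁ : ℂ) ≠ 0 := by exact_mod_cast hc1.ne'
  have hgC : (g : ℂ) ≠ 0 := by exact_mod_cast hg0.ne'
  obtain ⟨N, hN⟩ : ∃ N : ℤ, (a * k₁ : ℤ) - l = c₁ * N := by
    have := Nat.modEq_iff_dvd.1 hlc
    push_cast at this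
    exact this
  have hNR : (a * k₁ : ℝ) - l = c₁ * N := by exact_mod_cast hN
  have hcR : (c : ℝ) = c₁ * g := by exact_mod_cast hcg
  have hcC : (c : ℂ) = c₁ * g := by exact_mod_cast hcg
  have hkR : (k : ℝ) = k₁ * g := by exact_mod_cast hkg
  have hkC : (k : ℂ) = k₁ * g := by exact_mod_cast hkg
  have hb : l * c / c₁ = l * g := by
    rw [hcg, mul_left_comm, Nat.mul_div_cancel_left _ hc1]
  have hblt : l * c / c₁ < c := by
    rw [hb]
    conv_rhs => rw [hcg]
    exact Nat.mul_lt_mul_of_pos_right hl hg0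
  have hcancel : ∀ {m n : ℕ}, m ≠ n → m * g ≠ n * g :=
    fun hmn h0 => hmn (Nat.eq_of_mul_eq_mul_right hg0 h0)
  have hbc : ((l * c / c₁ : ℕ) / c : ℝ) = l / c₁ := by
    rw [hb, hcR]
    push_cast
    field_simp
  have hr0 : k * (a / c : ℝ) = N + l / c₁ := by
    rw [hkR, hcR]
    field_simp
    linarith
  have hr : k * (a / c : ℝ) = N + ((l * c / c₁ : ℕ) / c : ℝ) := by rw [hbc, hr0]
  have hsgn : (-1 : ℂ) ^ (((l : ℤ) - a * k₁) / c₁) = (-1) ^ N := by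
    have h1 : ((l : ℤ) - a * k₁) / c₁ = -N := by
      rw [show (l : ℤ) - a * k₁ = c₁ * -N by linear_combination -hN]
      exact Int.mul_ediv_cancel_left _ (by omega)
    rw [h1, zpow_neg, ← inv_zpow]
    norm_num
  have hphase : 2 * π * I * h' * ((a : ℂ) / c) * (k * (a / c)) =
      2 * π * I * h' * a ^ 2 * k₁ / (c * c₁) := by
    rw [hkC, hcC]
    field_simp
  have hdvd : c ∣ k → c₁ = 1 ∧ l = 0 := by
    intro hd
    have : c₁ = 1 := by
      rw [hc₁, Nat.gcd_eq_left hd, Nat.div_self (by omega)]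
    omega
  have hcopl : Nat.Coprime l c₁ := by
    have h1 : Nat.Coprime (a * k₁) c₁ :=
      Nat.Coprime.mul_left (hcop.coprime_dvd_right ⟨g, hcg⟩) hkc
    rw [Nat.coprime_iff_gcd_eq_one, hlc.gcd_eq]
    exact h1
  have hndvd : ¬ c ∣ k → c₁ ≠ 1 ∧ 0 < l := by
    intro hd
    have h1 : c₁ ≠ 1 := by
      rintro rfl
      apply hd
      rw [hcg, one_mul]
      exact ⟨k₁, by rw [mul_comm]; exact hkg⟩
    refine ⟨h1, Nat.pos_of_ne_zero ?_⟩
    rintro rfl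
    exact h1 (by simpa using hcopl)
  have hsq : ((√2 : ℝ) : ℂ) ^ 2 = 2 := by
    rw [← ofReal_pow, Real.sq_sqrt (by norm_num)]
    norm_num
  have hsq0 : ((√2 : ℝ) : ℂ) ≠ 0 := by
    intro h0
    rw [h0] at hsq
    norm_num at hsq
  refine ⟨fun ν => ?_, ?_, ?_, ?_, ?_, ?_, ?_⟩
  · obtain ⟨δ, hδ⟩ := (mordellI_eq hk hw hsin ν).exists
    exact hδ.1
  · intro hd hev
    obtain ⟨hc1', hl0⟩ := hdvd hd
    -- `k a / c` is an integer, hence a threshold: the limits from the right and from the left differ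
    have hN' : N = a * k₁ := by
      rw [hc1', hl0] at hN
      simpa using hN.symm
    have hrN : k * (a / c : ℝ) = N := by rw [hr0, hl0]; simp
    have hcopI := isCoprime_mul_inverse hcop hd hh'
    have hs2 := sin_two_mul_ne_zero hc hcopI
    have hβ : (((a * h' : ℤ) : ℝ) / c : ℝ) = h' * (a / c) := by
      push_cast
      ring
    rw [hβ, mul_assoc, Complex.sin_two_mul] at hs2
    have hs : Complex.sin (π * (h' * (a / c) : ℝ)) ≠ 0 := fun h0 => hs2 (by rw [h0]; ring)
    have hcs : Complex.cos (π * (h' * (a / c) : ℝ)) ≠ 0 := fun h0 => hs2 (by rw [h0]; ring)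
    have hpow : (-1 : ℂ) ^ N = (-1) ^ k₁ := by
      rw [hN', mul_comm, zpow_mul, zpow_natCast]
      rcases Nat.even_or_odd k₁ with he | ho
      · rw [zpow_natCast, he.neg_one_pow, one_pow]
      · rw [zpow_natCast, ho.neg_one_pow]
        refine Odd.neg_one_pow ?_
        -- `c` is even because `k = k₁ g` is even and `k₁` is odd; so `a`, which is prime to `c`, is odd
        have h2 : 2 ∣ c := by
          have h3 : 2 ∣ k₁ * g := by
            rw [← hkg]
            exact hev.two_dvd
          rcases (Nat.Prime.dvd_mul Nat.prime_two).1 h3 with h4 | h4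
          · exact absurd (even_iff_two_dvd.2 h4) (Nat.not_even_iff_odd.2 ho)
          · rw [hcg]
            exact h4.mul_left _
        rw [← Nat.not_even_iff_odd]
        intro hea
        have := Nat.dvd_gcd hea.two_dvd h2
        rw [hcop] at this
        omega
    rw [rankO_eq_resSum_even (R := 2 * N + 1) (R' := 2 * N) hk hw hh' hev hsin hne
      (by rw [hrN]; push_cast; linarith) (by rw [hrN]; push_cast; linarith)
      (by rw [hrN]; push_cast; linarith) (by rw [hrN]; push_cast; linarith) hz hz₁,
      rankO_eq_tsum_resSum hk hw hz₁ hev hrN rfl hs hcs, hphase, hpow, hc1']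
    congr 1
    rw [show 2 * π * I * h' * a ^ 2 * k₁ / (c * ((1 : ℕ) : ℂ)) =
      2 * π * I * a ^ 2 * h' * k₁ / c by push_cast; ring]
    ring
  · intro hd hodd
    obtain ⟨hc1', hl0⟩ := hdvd hd
    have hrN : k * (a / c : ℝ) = N := by rw [hr0, hl0]; simp
    have hcopI := isCoprime_mul_inverse hcop hd hh'
    have hβ : ∀ n : ℤ, (h' * (a / c) : ℝ) ≠ n := by
      intro n hn
      apply div_ne_int hc hcopI n
      rw [← hn]
      push_cast
      ring
    rw [rankO_eq_resSum_odd (R := 2 * N + 1) (R' := 2 * N + 1) hk hw hh' hodd (hpar hodd) hsin hne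
      (by rw [hrN]; push_cast; linarith) (by rw [hrN]; push_cast; linarith)
      (by rw [hrN]; push_cast; linarith) (by rw [hrN]; push_cast; linarith) hz hz₁,
      ← two_mul, compU_eq_tsum_resSum hk hw hz₁ hodd hrN rfl hβ, hphase, hc1']
    congr 1
    rw [show π * I * h' / (8 * k) - 2 * π * I * a ^ 2 * h' * k₁ / c =
      π * I * h' / (8 * k) + -(2 * π * I * h' * a ^ 2 * k₁ / (c * ((1 : ℕ) : ℂ))) by
        push_cast; ring, Complex.exp_add]
    generalize ((√2 : ℝ) : ℂ) = y at hsq hsq0 ⊢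
    have h2 : y⁻¹ = y / 2 := by
      field_simp
      exact hsq.symm
    rw [show omega h k ^ 2 / (y * omega (2 * h) k) = y / 2 * (omega h k ^ 2 / omega (2 * h) k) by
      rw [← h2, inv_mul_eq_div, div_div, mul_comm y]]
    ring
  · intro hd hev hc2
    obtain ⟨hc1', hl0⟩ := hndvd hd
    have hne2 : 2 * l ≠ c₁ := by
      intro h0
      have h1 := Nat.dvd_gcd (dvd_refl l) (⟨2, by rw [← h0, mul_comm]⟩ : l ∣ c₁)
      rw [hcopl] at h1
      have := Nat.le_of_dvd one_pos h1
      omega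
    obtain ⟨T, hT, hT1, hT2⟩ := exists_tIdx_eq (b := l * c / c₁) (c := c)
      (by rw [hb]; positivity) hblt (by rw [hb, hcg, ← mul_assoc]; exact hcancel hne2)
    rw [hbc] at hT1 hT2
    rw [rankO_eq_resSum_even (R := 2 * N + T) (R' := 2 * N + T) hk hw hh' hev hsin hne
      (by rw [hr0]; push_cast; linarith) (by rw [hr0]; push_cast; linarith)
      (by rw [hr0]; push_cast; linarith) (by rw [hr0]; push_cast; linarith) hz hz₁,
      ← two_mul, mul_left_comm _ (2 : ℂ), compOabc_eq_tsum_resSum hk hw hz₁ hev hr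
        (by rw [hT]; push_cast; ring), hphase, hsgn]
    congr 1
    rw [show 2 * π * I * h' * a ^ 2 * k₁ / (c * c₁) =
      2 * π * I * a ^ 2 * h' * k₁ / (c₁ * c) by ring]
    ring
  · intro hd hev hc2
    obtain ⟨hc1', hl0⟩ := hndvd hd
    -- `2 k a / c` is an odd integer, hence a threshold
    have hl1 : l = 1 := by omega
    have hrN : k * (a / c : ℝ) = N + 1 / 2 := by
      rw [hr0, hl1, hc2]
      norm_num
    rw [rankO_eq_resSum_even (R := 2 * N + 1 + 1) (R' := 2 * N + 1) hk hw hh' hev hsin hne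
      (by rw [hrN]; push_cast; linarith) (by rw [hrN]; push_cast; linarith)
      (by rw [hrN]; push_cast; linarith) (by rw [hrN]; push_cast; linarith) hz hz₁,
      compV_eq_tsum_resSum hk hw hz₁ hev hrN rfl, hphase, hsgn, hc2]
    congr 1
    rw [show 2 * π * I * h' * a ^ 2 * k₁ / (c * ((2 : ℕ) : ℂ)) =
      π * I * a ^ 2 * h' * k₁ / c by push_cast; ring]
    ring
  · intro hd hodd hc4
    obtain ⟨hc1', hl0⟩ := hndvd hd
    have hne1 : 4 * l ≠ c₁ := by
      intro h0
      have h1 := Nat.dvd_gcd (dvd_refl l) (⟨4, by rw [← h0, mul_comm]⟩ : l ∣ c₁)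
      rw [hcopl] at h1
      have := Nat.le_of_dvd one_pos h1
      omega
    have hne3 : 4 * l ≠ 3 * c₁ := by
      intro h0
      have h1 : c₁ ∣ 4 := hcopl.symm.dvd_of_dvd_mul_right ⟨3, by rw [h0, mul_comm]⟩
      have h2 := Nat.le_of_dvd (by norm_num) h1
      interval_cases c₁ <;> omega
    obtain ⟨hS1, hS2⟩ := sIdx_lt (b := l * c / c₁) (c := c) (by rw [hb]; positivity) hblt
      (by rw [hb, hcg, ← mul_assoc]; exact hcancel hne1)
      (by rw [hb, hcg, ← mul_assoc, ← mul_assoc]; exact hcancel hne3)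
    rw [hbc] at hS1 hS2
    rw [rankO_eq_resSum_odd (R := 2 * N + sIdx (l * c / c₁) c + 1)
      (R' := 2 * N + sIdx (l * c / c₁) c + 1) hk hw hh' hodd (hpar hodd) hsin hne
      (by rw [hr0]; push_cast; linarith) (by rw [hr0]; push_cast; linarith)
      (by rw [hr0]; push_cast; linarith) (by rw [hr0]; push_cast; linarith) hz hz₁,
      ← two_mul, mul_left_comm _ (2 : ℂ), compUabc_eq_tsum_resSum hk hw hz₁ hodd hr rfl, hphase]
    congr 1
    rw [sub_eq_add_neg, Complex.exp_add]
    generalize ((√2 : ℝ) : ℂ) = y at hsq hsq0 ⊢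
    have h2 : y⁻¹ = y / 2 := by
      field_simp
      exact hsq.symm
    rw [show omega h k ^ 2 / (y * omega (2 * h) k) = y / 2 * (omega h k ^ 2 / omega (2 * h) k) by
      rw [← h2, inv_mul_eq_div, div_div, mul_comm y]]
    ring
  · intro hd hodd hc4
    obtain ⟨hc1', hl0⟩ := hndvd hd
    -- `2 k a / c + 1 / 2` is an integer, hence a threshold
    have hl13 : l = 1 ∨ l = 3 := by
      have hl2 : l ≠ 2 := by
        rintro rfl
        rw [hc4] at hcopl
        norm_num at hcopl
      omega
    have hS := sIdx_eq_of_jump (b := l * c / c₁) (c := c) (by omega)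
      (by rw [hb, hcg, hc4]; rcases hl13 with rfl | rfl <;> omega)
    rw [hbc] at hS
    set S : ℕ := sIdx (l * c / c₁) c with hSdef
    rw [rankO_eq_resSum_odd (R := 2 * N + S + 1 + 1) (R' := 2 * N + S + 1) hk hw hh' hodd
      (hpar hodd) hsin hne
      (by rw [hr0]; push_cast; linarith) (by rw [hr0]; push_cast; linarith)
      (by rw [hr0]; push_cast; linarith) (by rw [hr0]; push_cast; linarith) hz hz₁,
      compVabc_eq_tsum_resSum hk hw hz₁ hodd hr rfl (by rw [hr0]; push_cast; linarith), hphase]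
    congr 1
    rw [sub_eq_add_neg, Complex.exp_add]
    ring
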